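/- Let $K$ be a finite extension of $\mathbb{Q}_p$ with ring of integers $\mathcal{O}_K$, uniformiser $\pi$, residue field $k$ and normalised valuation $v$; a tilde denotes reduction mod $\pi$, and $v(f)$ is the minimal valuation of a coefficient of a polynomial $f$. A genus one model $\Phi$ over $\mathcal{O}_K$ of degree $n\in\{2,3,4\}$ is: for $n=2$ an equation $y^2+P(x_1,x_2)y=Q(x_1,x_2)$ with forms $P,Q$ of degrees $2,4$; for $n=3$ a ternary cubic form $U$; for $n=4$ a pair of quadratic forms $(Q_1,Q_2)$ in four variables. It is non-singular if it defines a smooth curve of genus one over $K$ (in $\mathbb{P}(1,1,2)$, $\mathbb{P}^2$, $\mathbb{P}^3$). Its discriminant $\Delta(\Phi)=(c_4^3-c_6^2)/1728$ is scaled so that $y^2+x_1x_2y=0$, $x_1x_2x_3=0$, $x_1x_2=x_3x_4=0$ have $c_4=1$, $c_6=-1$; its level $\ell$ is defined by $v(\Delta(\Phi))=v(\Delta_E)+12\ell$, where $\Delta_E$ is the minimal discriminant of the Jacobian $E$. Since $E$ is the same for all $K$-equivalent models, the level changes exactly when $v(\Delta)$ does. **Local solubility tests.** The input is the affine polynomial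 data obtained from $\Phi$ by setting the last $x_i$ equal to $1$. One call proceeds as follows; $\Gamma$ denotes the reduction mod $\pi$ (an affine curve over $k$) after Step (i). * *Step (i), $n=2$* ($y^2+h(x)y=g(x)$): substitute $y\leftarrow y+r_0x^2+r_1x+r_2$ with $r_i\in\mathcal{O}_K$ so that, if possible, $v(h)\ge1$ and $v(g)\ge1$; if now $v(h)\ge1$ and $v(g)\ge2$, replace $(h,g)$ by $(\pi^{-1}h,\pi^{-2}g)$ and repeat Step (i). *$n=3$* ($g(x,y)=0$): divide $g$ by $\pi^{v(g)}$. *$n=4$* ($g_1=g_2=0$ in $x,y,z$): replace $g_1,g_2$ by $K$-linear combinations, integral with $\widetilde g_1,\widetilde g_2$ linearly independent over $k$; if $\widetilde g_1,\widetilde g_2$ have a common linear factor, make an affine change of coordinates over $\mathcal{O}_K$ so that it is $x$, replace $g_i(x,y,z)$ by $\pi^{-1}g_i(\pi x,y,z)$ and repeat Step (i). * *Step (ii)*: if $\Gamma$ has a smooth $k$-point, return TRUE. * *Steps (iii)–(v)*: find the non-regular $k$-points of $\Gamma$. For $n=2,3$ these are the singular points at whose lifts the equation vanishes mod $\pi^2$;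 for $n=4$, the points of $\Gamma$ that are singular on $\widetilde g=0$ for some $g=\lambda g_1+\mu g_2$ ($\lambda,\mu\in\mathcal{O}_K$ not both divisible by $\pi$) that vanishes mod $\pi^2$ at their lifts. For each of them lift its coordinates other than $y$ in the case $n=2$ (all its coordinates if $n=3,4$) to $u$, and call the procedure on the polynomials obtained by substituting $u+\pi\mathbf{x}$ for these coordinates; return TRUE if one of these calls does, and FALSE otherwise. An *iteration* is a recursive call together with the Step (i) (with its repetitions) that begins it. **Tamagawa distance algorithms.** The input is a model $\Phi$ over $\mathcal{O}_K$ and a boolean Affine; $\Gamma$ is the reduction of $\Phi$ (if Affine is FALSE) or its affine piece where the last $x_i$ is $1$ (if Affine is TRUE). Non-regular points are defined as above. For $n=3$ the line subalgorithm below is run on each $k$-rational line that is a component of multiplicity one of $\Gamma$, after moving it to $\{x=0\}$ by $\mathrm{GL}_3(\mathcal{O}_K)$; for $n=4$ the line and conic subalgorithms are run on each $k$-rational line and conic that is a component of multiplicity one, after moving the line to $\{x_1=x_2=0\}$ or the conic into the plane $\{x_1=0\}$ by $\mathrm{GL}_4(\mathcal{O}_K)$. Moreover each non-regular $k$-point of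 $\Gamma$ is moved to $(0:1:0)$, $(0:0:1)$ or $(0:0:0:1)$ by an $\mathcal{O}_K$-equivalence, for $n=4$ such that the partial derivatives of $Q_1$ at $(0,0,0,1)$ are $0$ mod $\pi$ and $Q_1(0,0,0,1)\equiv0\pmod{\pi^2}$, and the algorithm is called with Affine $=$ TRUE on $(\pi^{-1}P(\pi x_1,x_2),\pi^{-2}Q(\pi x_1,x_2))$, on $\pi^{-2}U(\pi x,\pi y,z)$, or on $(\pi^{-2}Q_1,\pi^{-1}Q_2)$ evaluated at $(\pi x_1,\pi x_2,\pi x_3,x_4)$. * *Line, $n=3$*: (ii) replace $U$ by $\pi^{-1}U(\pi x,y,z)$. (iii) Write $U=f_0x^3+f_1x^2+f_2x+f_3$ with forms $f_i(y,z)$. If $f_3\equiv(ay+bz)f_2\pmod\pi$ for some $a,b\in\mathcal{O}_K$, substitute $x\leftarrow x-ay-bz$ and go to (ii); otherwise return. * *Conic, $n=4$*: (ii) make a $\mathrm{GL}_2(\mathcal{O}_K)$-transformation so that $\widetilde Q_1$ vanishes on $\{x_1=0\}$, and replace $(Q_1,Q_2)$ by $(\pi^{-1}Q_1(\pi x_1,x_2,x_3,x_4),Q_2(\pi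 x_1,x_2,x_3,x_4))$. (iii) Write $Q_i=\lambda_ix_1^2+\ell_ix_1+q_i$ with $\ell_i,q_i$ forms in $x_2,x_3,x_4$. If $q_1\equiv(a_2x_2+a_3x_3+a_4x_4)\ell_1+bq_2\pmod\pi$ for some $a_i,b\in\mathcal{O}_K$, substitute $x_1\leftarrow x_1-a_2x_2-a_3x_3-a_4x_4$ and go to (ii); otherwise return. * *Line, $n=4$*: (ii) replace each $Q_i$ by $\pi^{-1}Q_i(\pi x_1,\pi x_2,x_3,x_4)$. (iii) With $Q_1=\sum_{i\le j}a_{ij}x_ix_j$ and $Q_2=\sum_{i\le j}b_{ij}x_ix_j$ let $L(s,t)=\begin{pmatrix}a_{13}s+a_{14}t&a_{23}s+a_{24}t\\b_{13}s+b_{14}t&b_{23}s+b_{24}t\end{pmatrix}$ mod $\pi$, $g=\det L$ and $(f_1,f_2)^T=\operatorname{adj}(L)\,(\widetilde Q_1(0,0,s,t),\widetilde Q_2(0,0,s,t))^T$. (iv) If $f_i=(\widetilde\lambda_is+\widetilde\mu_it)g$ for $i=1,2$, substitute $x_i\leftarrow x_i-\lambda_ix_3-\mu_ix_4$ for $i=1,2$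 and go to (ii). (v) Otherwise, if $f_1,f_2,g$ have a common linear factor, take a linear form $\ell$ over $\mathcal{O}_K$, non-zero mod $\pi$, with $\widetilde\ell(-f_1,-f_2,gs,gt)=0$, make a $\mathrm{GL}_4(\mathcal{O}_K)$-transformation so that $\ell=x_1$, and run the conic subalgorithm. (vi) Return. **Statement.** For every $n\in\{2,3,4\}$ and every non-singular genus one model $\Phi$ over $\mathcal{O}_K$ of degree $n$, whatever choices are made in the steps above: 1. The local solubility test with input $\Phi$ terminates. No iteration increases the level, and once the level has stabilised the number of iterations is at most $\tfrac12v(\Delta)$: if $\Psi_0,\dots,\Psi_m$ are models that are reached at the start of Step (ii) in a run with input $\Phi$, each $\Psi_{i+1}$ being obtained from $\Psi_i$ by one iteration, and all $\Psi_i$ have the same level, then $m\le\tfrac12v(\Delta(\Psi_0))$. 2. The Tamagawa distance algorithm with input $\Phi$ and either value of Affine terminates. So do the three subalgorithms, whenever the reduction of $\Phi$ contains as a component of multiplicity one the line $\{x=0\}$ ($n=3$), the line $\{x_1=x_2=0\}$ ($n=4$), or a $k$-rational conic in the plane $\{x_1=0\}$ ($n=4$), respectively. -/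

import Mathlib

open MvPolynomial

namespace GenusOne

/-! ## Nondeterministic recursive procedures

A procedure is given by a relation `body : σ → List σ → Prop` on its program states: `body s calls`
means that, for some admissible choice of the auxiliary data that the description of the procedure
leaves open (lifts, changes of coordinates, order of enumeration, ...), the segment of code that
starts in the state `s` ends by passing to the finite list `calls` of states. A state is a recursive
call, or the target of a jump ("go to Step ..."); an empty list means that the procedure returns.
Returned values do not affect the control flow, so they are not recorded, except that a recursive
call that returns `TRUE` may cut short the enumeration in the local solubility tests; here all the
listed calls have to be finished. -/

/-- The procedure terminates from the state `s`, whatever choices are made: it is never stuck, and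
its tree of calls is well-founded (it is finitely branching, since the lists of calls are finite). -/
inductive Halts {σ : Type*} (body : σ → List σ → Prop) : σ → Prop
  | intro (s : σ) (step : ∃ calls, body s calls)
      (rec_halts : ∀ calls, body s calls → ∀ t ∈ calls, Halts body t) : Halts body s

/-- From the state `s` the procedure can pass to the state `t`. -/
def Calls {σ : Type*} (body : σ → List σ → Prop) (s t : σ) : Prop :=
  ∃ calls, body s calls ∧ t ∈ calls

/-- The list `calls` arises from a loop over the elements of the (finite) set `S`, in some order,
with one call for each element. -/
def ForEach {ι σ : Type*} (S : Set ι) (call : ι → σ → Prop) (calls : List σ) : Prop :=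
  ∃ L : List ι, L.Nodup ∧ (∀ p, p ∈ L ↔ p ∈ S) ∧ List.Forall₂ call L calls

/-- The states of the local solubility tests. -/
inductive Stage (M : Type*)
  /-- At the start of Step (i) (this is also how the procedure is called). -/
  | normalise (Φ : M)
  /-- At the start of Step (ii). -/
  | search (Φ : M)

/-- One iteration of a local solubility test, from the start of Step (ii) to the next time that
Step (ii) is started: a recursive call, followed by Step (i) with all its repetitions. -/
def Iteration {M : Type*} (body : Stage M → List (Stage M) → Prop) (Φ Ψ : M) : Prop :=
  ∃ Φ₁ Φ₂ : M, Calls body (.search Φ) (.normalise Φ₁) ∧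
    Relation.ReflTransGen (fun A B => Calls body (.normalise A) (.normalise B)) Φ₁ Φ₂ ∧
    Calls body (.normalise Φ₂) (.search Ψ)

/-- The model `Ψ` can occur at the start of Step (ii) in a run with input `Φ`. -/
def Occurs {M : Type*} (body : Stage M → List (Stage M) → Prop) (Φ Ψ : M) : Prop :=
  Relation.ReflTransGen (Calls body) (.normalise Φ) (.search Ψ)

/-- In runs with input `Φ` no iteration increases `v`. -/
def NeverIncreases {M : Type*} (body : Stage M → List (Stage M) → Prop) (v : M → ℕ∞) (Φ : M) :
    Prop :=
  ∀ Ψ Ψ' : M, Occurs body Φ Ψ → Iteration body Ψ Ψ' → v Ψ' ≤ v Ψ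

/-- In runs with input `Φ`, any number `m` of consecutive (nested) iterations during which `v` is
constant satisfies `m ≤ v / 2`. -/
def StableIterationsBounded {M : Type*} (body : Stage M → List (Stage M) → Prop) (v : M → ℕ∞)
    (Φ : M) : Prop :=
  ∀ (m : ℕ) (Ψ : ℕ → M), Occurs body Φ (Ψ 0) → (∀ i < m, Iteration body (Ψ i) (Ψ (i + 1))) →
    (∀ i ≤ m, v (Ψ i) = v (Ψ 0)) → 2 * (m : ℕ∞) ≤ v (Ψ 0)

/-! ## Polynomials, points and substitutions -/

/-- The gradient of `f` at `p`. -/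
noncomputable def grad {n : ℕ} {A : Type*} [CommRing A] (f : MvPolynomial (Fin n) A)
    (p : Fin n → A) : Fin n → A :=
  fun i => eval p (pderiv i f)

/-- The substitution `x_j ← ∑ i, N i j * x_i`. -/
noncomputable def linSubst {n : ℕ} {R : Type*} [CommRing R] (N : Matrix (Fin n) (Fin n) R) :
    Fin n → MvPolynomial (Fin n) R :=
  fun j => ∑ i, C (N i j) * X i

/-- The linear form with coefficients `ℓ`. -/
noncomputable def linForm {n : ℕ} {A : Type*} [CommRing A] (ℓ : Fin n → A) :
    MvPolynomial (Fin n) A :=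
  ∑ j, C (ℓ j) * X j

/-- The last nonzero coordinate is `1`. Each point of projective space has exactly one
representative of this kind. -/
def IsNormalised {n : ℕ} {F : Type*} [Field F] (p : Fin n → F) : Prop :=
  ∃ i, p i = 1 ∧ ∀ j, i < j → p j = 0

/-- `q` is a lift of `p` from the residue field. -/
def IsLift {n : ℕ} {R : Type*} [CommRing R] [IsLocalRing R] (q : Fin n → R)
    (p : Fin n → IsLocalRing.ResidueField R) : Prop :=
  ∀ i, algebraMap R (IsLocalRing.ResidueField R) (q i) = p i

/-! ## Genus one models of degree 2 -/

/-- The generalised binary quartic `y² + P(x₁, x₂) y = Q(x₁, x₂)` with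
`P = l x₁² + m x₁x₂ + n x₂²` and `Q = a x₁⁴ + b x₁³x₂ + c x₁²x₂² + d x₁x₂³ + e x₂⁴`. It also
stands for the affine equation `y² + h(x) y = g(x)` with `h(x) = P(x, 1)` and `g(x) = Q(x, 1)`. -/
structure Quartic (R : Type*) where
  (l m n a b c d e : R)

namespace Quartic

variable {R : Type*} [CommRing R]

/-- The value of the form `P` at a point of an `R`-algebra. -/
def P (Φ : Quartic R) {A : Type*} [CommRing A] [Algebra R A] (x : Fin 2 → A) : A :=
  Φ.l • x 0 ^ 2 + Φ.m • (x 0 * x 1) + Φ.n • x 1 ^ 2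

/-- The value of the form `Q` at a point of an `R`-algebra. -/
def Q (Φ : Quartic R) {A : Type*} [CommRing A] [Algebra R A] (x : Fin 2 → A) : A :=
  Φ.a • x 0 ^ 4 + Φ.b • (x 0 ^ 3 * x 1) + Φ.c • (x 0 ^ 2 * x 1 ^ 2) + Φ.d • (x 0 * x 1 ^ 3)
    + Φ.e • x 1 ^ 4

/-- The value of `y² + P(x₁, x₂) y - Q(x₁, x₂)` at `p = (x₁, x₂, y)`. -/
def form (Φ : Quartic R) {A : Type*} [CommRing A] [Algebra R A] (p : Fin 3 → A) : A :=
  p 2 ^ 2 + Φ.P ![p 0, p 1] * p 2 - Φ.Q ![p 0, p 1]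

/-- `p` is a smooth point on the curve `y² + P(x₁, x₂) y = Q(x₁, x₂)` in `ℙ(1,1,2)` over `F`. -/
def IsSmoothAt (Φ : Quartic R) {F : Type*} [Field F] [Algebra R F] (p : Fin 3 → F) : Prop :=
  Φ.form p = 0 ∧ grad (Φ.form (X : Fin 3 → MvPolynomial (Fin 3) F)) p ≠ 0

/-- The curve in `ℙ(1,1,2)` over the field `F` is smooth (hence a smooth curve of genus one). -/
def Nonsingular (Φ : Quartic R) (F : Type*) [Field F] [Algebra R F] : Prop :=
  ∀ p : Fin 3 → AlgebraicClosure F, p ≠ 0 → Φ.form p = 0 → Φ.IsSmoothAt p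

/-- The Weierstrass equation of the Jacobian, given by the `a`-invariants. -/
def jacobian (Φ : Quartic R) : WeierstrassCurve R where
  a₁ := Φ.m
  a₂ := -(Φ.l * Φ.n) + Φ.c
  a₃ := Φ.l * Φ.d + Φ.n * Φ.b
  a₄ := -(Φ.l ^ 2 * Φ.e) - Φ.l * Φ.n * Φ.c - Φ.n ^ 2 * Φ.a - 4 * Φ.a * Φ.e + Φ.b * Φ.d
  a₆ := -(Φ.l ^ 2 * Φ.c * Φ.e) + Φ.l * Φ.m * Φ.b * Φ.e - Φ.l * Φ.n * Φ.b * Φ.d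
      - Φ.m ^ 2 * Φ.a * Φ.e + Φ.m * Φ.n * Φ.a * Φ.d - Φ.n ^ 2 * Φ.a * Φ.c - 4 * Φ.a * Φ.c * Φ.e
      + Φ.a * Φ.d ^ 2 + Φ.b ^ 2 * Φ.e

/-- The discriminant. -/
def disc (Φ : Quartic R) : R := Φ.jacobian.Δ

/-- `Φ' = [μ, r, N] Φ`: substitute `y ← μ⁻¹ y + r₀ x₁² + r₁ x₁x₂ + r₂ x₂²`, then
`x_j ← ∑ i, N i j * x_i`, and multiply the equation by `μ²`. -/
def IsTransform (μ : R) (r : Fin 3 → R) (N : Matrix (Fin 2) (Fin 2) R) (Φ Φ' : Quartic R) : Prop :=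
  let x := linSubst N
  let ρ := C (r 0) * x 0 ^ 2 + C (r 1) * (x 0 * x 1) + C (r 2) * x 1 ^ 2
  Φ'.P (X : Fin 2 → MvPolynomial (Fin 2) R) = C μ * (Φ.P x + 2 * ρ) ∧
    Φ'.Q (X : Fin 2 → MvPolynomial (Fin 2) R) = C (μ ^ 2) * (Φ.Q x - ρ * Φ.P x - ρ ^ 2)

variable [IsLocalRing R]

/-- The non-regular `k`-points on the reduction `Γ`, or on its affine piece `x₂ = 1`. -/
def nonRegular (π : R) (Φ : Quartic R) (affine : Bool) :
    Set (Fin 3 → IsLocalRing.ResidueField R) :=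
  {p | IsNormalised ![p 0, p 1] ∧ (affine = true → p 1 ≠ 0) ∧
    Φ.form p = 0 ∧ ¬ Φ.IsSmoothAt p ∧ ∃ q : Fin 3 → R, IsLift q p ∧ π ^ 2 ∣ Φ.form q}

/-- The procedure `IsLocallySoluble(h, g)`. -/
def isLocallySoluble (π : R) : Stage (Quartic R) → List (Stage (Quartic R)) → Prop
  | .normalise Φ, calls =>
      ∃ (r : Fin 3 → R) (Ψ : Quartic R), IsTransform 1 r 1 Φ Ψ ∧
        ((∃ (r' : Fin 3 → R) (Ψ' : Quartic R), IsTransform 1 r' 1 Φ Ψ' ∧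
            C π ∣ Ψ'.P (X : Fin 2 → MvPolynomial (Fin 2) R) ∧
            C π ∣ Ψ'.Q (X : Fin 2 → MvPolynomial (Fin 2) R)) →
          C π ∣ Ψ.P (X : Fin 2 → MvPolynomial (Fin 2) R) ∧
          C π ∣ Ψ.Q (X : Fin 2 → MvPolynomial (Fin 2) R)) ∧
        ((∃ Ψ₁ : Quartic R,
            C π * Ψ₁.P (X : Fin 2 → MvPolynomial (Fin 2) R) = Ψ.P X ∧
            C (π ^ 2) * Ψ₁.Q (X : Fin 2 → MvPolynomial (Fin 2) R) = Ψ.Q X ∧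
            calls = [.normalise Ψ₁]) ∨
          (¬ (C π ∣ Ψ.P (X : Fin 2 → MvPolynomial (Fin 2) R) ∧
              C (π ^ 2) ∣ Ψ.Q (X : Fin 2 → MvPolynomial (Fin 2) R)) ∧
            calls = [.search Ψ]))
  | .search Φ, calls =>
      ((∃ p : Fin 3 → IsLocalRing.ResidueField R, p 1 = 1 ∧ Φ.IsSmoothAt p) ∧ calls = []) ∨
      ((¬ ∃ p : Fin 3 → IsLocalRing.ResidueField R, p 1 = 1 ∧ Φ.IsSmoothAt p) ∧
        ForEach (Φ.nonRegular π true)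
          (fun p t => ∃ (u : R) (Φ₁ : Quartic R),
            algebraMap R (IsLocalRing.ResidueField R) u = p 0 ∧
            Φ₁.P (X : Fin 2 → MvPolynomial (Fin 2) R) = Φ.P ![C u * X 1 + C π * X 0, X 1] ∧
            Φ₁.Q (X : Fin 2 → MvPolynomial (Fin 2) R) = Φ.Q ![C u * X 1 + C π * X 0, X 1] ∧
            t = .normalise Φ₁)
          calls)

/-- The procedure `TamagawaDistances(P, Q, Affine)`. -/
def tamagawaDistances (π : R) : Quartic R × Bool → List (Quartic R × Bool) → Prop
  | (Φ, affine), calls =>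
      ForEach (Φ.nonRegular π affine)
        (fun p t => ∃ (μ : R) (r : Fin 3 → R) (N : Matrix (Fin 2) (Fin 2) R) (Φ' Φ₁ : Quartic R)
            (c : IsLocalRing.ResidueField R),
          IsUnit μ ∧ IsUnit N.det ∧ IsTransform μ r N Φ Φ' ∧
          -- the transformation moves `p` to `(0 : 1 : 0)`
          c ≠ 0 ∧ algebraMap R _ (N 1 0) = c * p 0 ∧ algebraMap R _ (N 1 1) = c * p 1 ∧
          algebraMap R _ (r 0 * N 1 0 ^ 2 + r 1 * (N 1 0 * N 1 1) + r 2 * N 1 1 ^ 2)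
            = c ^ 2 * p 2 ∧
          C π * Φ₁.P (X : Fin 2 → MvPolynomial (Fin 2) R) = Φ'.P ![C π * X 0, X 1] ∧
          C (π ^ 2) * Φ₁.Q (X : Fin 2 → MvPolynomial (Fin 2) R) = Φ'.Q ![C π * X 0, X 1] ∧
          t = (Φ₁, true))
        calls

end Quartic

/-! ## Genus one models of degree 3 -/

/-- The ternary cubic
`a x³ + b y³ + c z³ + f y²z + g z²x + h x²y + i yz² + j zx² + k xy² + m xyz`. It also stands for
the polynomial of total degree at most `3` that is obtained by putting `z = 1`. -/
structure Cubic (R : Type*) where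
  (a b c f g h i j k m : R)

namespace Cubic

variable {R : Type*} [CommRing R]

/-- The value of the cubic at a point of an `R`-algebra. -/
def form (U : Cubic R) {A : Type*} [CommRing A] [Algebra R A] (p : Fin 3 → A) : A :=
  U.a • p 0 ^ 3 + U.b • p 1 ^ 3 + U.c • p 2 ^ 3 + U.f • (p 1 ^ 2 * p 2) + U.g • (p 2 ^ 2 * p 0)
    + U.h • (p 0 ^ 2 * p 1) + U.i • (p 1 * p 2 ^ 2) + U.j • (p 2 * p 0 ^ 2)
    + U.k • (p 0 * p 1 ^ 2) + U.m • (p 0 * p 1 * p 2)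

/-- `p` is a smooth point on the curve `U = 0` in `ℙ²` over `F`. -/
def IsSmoothAt (U : Cubic R) {F : Type*} [Field F] [Algebra R F] (p : Fin 3 → F) : Prop :=
  U.form p = 0 ∧ grad (U.form (X : Fin 3 → MvPolynomial (Fin 3) F)) p ≠ 0

/-- The curve in `ℙ²` over the field `F` is smooth (hence a smooth curve of genus one). -/
def Nonsingular (U : Cubic R) (F : Type*) [Field F] [Algebra R F] : Prop :=
  ∀ p : Fin 3 → AlgebraicClosure F, p ≠ 0 → U.form p = 0 → U.IsSmoothAt p

/-- The Weierstrass equation of the Jacobian, given by the `a`-invariants. -/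
def jacobian (U : Cubic R) : WeierstrassCurve R where
  a₁ := U.m
  a₂ := -(U.f * U.j + U.g * U.k + U.h * U.i)
  a₃ := 9 * U.a * U.b * U.c - U.a * U.f * U.i - U.b * U.g * U.j - U.c * U.h * U.k
      - U.f * U.g * U.h - U.i * U.j * U.k
  a₄ := -3 * (U.a * U.b * U.g * U.i + U.a * U.c * U.f * U.k + U.b * U.c * U.h * U.j)
      + U.a * U.f ^ 2 * U.g + U.a * U.i ^ 2 * U.k + U.b * U.g ^ 2 * U.h + U.b * U.i * U.j ^ 2
      + U.c * U.f * U.h ^ 2 + U.c * U.j * U.k ^ 2 + U.f * U.g * U.j * U.k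
      + U.f * U.h * U.i * U.j + U.g * U.h * U.i * U.k
  a₆ :=
      3 * U.a * U.b * U.c * U.f * U.g * U.h - 3 * U.a * U.b * U.c * U.f * U.j * U.m - 3 *
      U.a * U.b * U.c * U.g * U.k * U.m - 3 * U.a * U.b * U.c * U.h * U.i * U.m + 3 * U.a *
      U.b * U.c * U.i * U.j * U.k + U.a * U.b * U.c * U.m^3 + 9 * U.a * U.b * U.c^2 * U.h *
      U.k - U.a * U.b * U.f * U.g * U.i * U.j + U.a * U.b * U.f * U.g^2 * U.m + 2 * U.a *
      U.b * U.g * U.h * U.i^2 - U.a * U.b * U.g * U.i * U.m^2 + 2 * U.a * U.b * U.g^2 * U.i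
      * U.k + U.a * U.b * U.i^2 * U.j * U.m + 9 * U.a * U.b^2 * U.c * U.g * U.j - U.a *
      U.b^2 * U.g^3 + 2 * U.a * U.c * U.f * U.g * U.k^2 - U.a * U.c * U.f * U.h * U.i * U.k
      - U.a * U.c * U.f * U.k * U.m^2 + U.a * U.c * U.f^2 * U.h * U.m + 2 * U.a * U.c *
      U.f^2 * U.j * U.k + U.a * U.c * U.i * U.k^2 * U.m - U.a * U.c^2 * U.k^3 + U.a * U.f *
      U.g * U.i * U.k * U.m - U.a * U.f * U.i^2 * U.j * U.k - U.a * U.f^2 * U.g * U.h * U.i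
      - U.a * U.f^2 * U.g^2 * U.k - U.a * U.g * U.i^2 * U.k^2 + 9 * U.a^2 * U.b * U.c * U.f
      * U.i - U.a^2 * U.b * U.i^3 - 27 * U.a^2 * U.b^2 * U.c^2 - U.a^2 * U.c * U.f^3 + 2 *
      U.b * U.c * U.f * U.h * U.j^2 - U.b * U.c * U.g * U.h * U.j * U.k + U.b * U.c * U.g *
      U.h^2 * U.m - U.b * U.c * U.h * U.j * U.m^2 + 2 * U.b * U.c * U.h^2 * U.i * U.j + U.b
      * U.c * U.j^2 * U.k * U.m - U.b * U.c^2 * U.h^3 - U.b * U.f * U.g^2 * U.h * U.j + U.b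
      * U.g * U.h * U.i * U.j * U.m - U.b * U.g * U.i * U.j^2 * U.k - U.b * U.g^2 * U.h^2 *
      U.i - U.b * U.h * U.i^2 * U.j^2 - U.b^2 * U.c * U.j^3 - U.c * U.f * U.g * U.h^2 * U.k
      + U.c * U.f * U.h * U.j * U.k * U.m - U.c * U.f * U.j^2 * U.k^2 - U.c * U.f^2 * U.h^2
      * U.j - U.c * U.h * U.i * U.j * U.k^2 - U.f * U.g * U.h * U.i * U.j * U.k

/-- The discriminant. -/
def disc (U : Cubic R) : R := U.jacobian.Δ

/-- `U' = [1, N] U`: substitute `x_j ← ∑ i, N i j * x_i`. -/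
def IsTransform (N : Matrix (Fin 3) (Fin 3) R) (U U' : Cubic R) : Prop :=
  U'.form (X : Fin 3 → MvPolynomial (Fin 3) R) = U.form (linSubst N)

/-- The form `f₂` in `U = f₀ x³ + f₁(y,z) x² + f₂(y,z) x + f₃(y,z)`. -/
def f₂ (U : Cubic R) {A : Type*} [CommRing A] [Algebra R A] (y z : A) : A :=
  U.k • y ^ 2 + U.m • (y * z) + U.g • z ^ 2

/-- The form `f₃` in `U = f₀ x³ + f₁(y,z) x² + f₂(y,z) x + f₃(y,z)`. -/
def f₃ (U : Cubic R) {A : Type*} [CommRing A] [Algebra R A] (y z : A) : A :=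
  U.b • y ^ 3 + U.f • (y ^ 2 * z) + U.i • (y * z ^ 2) + U.c • z ^ 3

variable [IsLocalRing R]

/-- The non-regular `k`-points on the reduction `Γ`, or on its affine piece `z = 1`. -/
def nonRegular (π : R) (U : Cubic R) (affine : Bool) :
    Set (Fin 3 → IsLocalRing.ResidueField R) :=
  {p | IsNormalised p ∧ (affine = true → p 2 ≠ 0) ∧
    U.form p = 0 ∧ ¬ U.IsSmoothAt p ∧ ∃ q : Fin 3 → R, IsLift q p ∧ π ^ 2 ∣ U.form q}

/-- The procedure `IsLocallySoluble(g)`. -/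
def isLocallySoluble (π : R) : Stage (Cubic R) → List (Stage (Cubic R)) → Prop
  | .normalise U, calls =>
      ∃ (r : ℕ) (V : Cubic R),
        C (π ^ r) * V.form (X : Fin 3 → MvPolynomial (Fin 3) R) = U.form X ∧
        ¬ C π ∣ V.form (X : Fin 3 → MvPolynomial (Fin 3) R) ∧ calls = [.search V]
  | .search U, calls =>
      ((∃ p : Fin 3 → IsLocalRing.ResidueField R, p 2 = 1 ∧ U.IsSmoothAt p) ∧ calls = []) ∨
      ((¬ ∃ p : Fin 3 → IsLocalRing.ResidueField R, p 2 = 1 ∧ U.IsSmoothAt p) ∧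
        ForEach (U.nonRegular π true)
          (fun p t => ∃ (u : Fin 2 → R) (U₁ : Cubic R), IsLift u ![p 0, p 1] ∧
            U₁.form (X : Fin 3 → MvPolynomial (Fin 3) R)
              = U.form ![C (u 0) * X 2 + C π * X 0, C (u 1) * X 2 + C π * X 1, X 2] ∧
            t = .normalise U₁)
          calls)

/-- The `k`-rational lines (given by their normalised equations) that are components of
multiplicity one of the reduction `Γ`, or of its affine piece `z = 1`. -/
def lineComponents (U : Cubic R) (affine : Bool) : Set (Fin 3 → IsLocalRing.ResidueField R) :=
  {ℓ | IsNormalised ℓ ∧ (affine = true → ¬ (ℓ 0 = 0 ∧ ℓ 1 = 0)) ∧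
    linForm ℓ ∣ U.form X ∧ ¬ linForm ℓ ^ 2 ∣ U.form X}

/-- The states of the procedure for the Tamagawa distances in degree 3. -/
inductive Task (R : Type*)
  /-- `TamagawaDistances(U, Affine)` is called. -/
  | distances (U : Cubic R) (affine : Bool)
  /-- The subalgorithm for the contribution of the line `x = 0` is at the start of Step (ii). -/
  | line (U : Cubic R)

/-- The procedure `TamagawaDistances(U, Affine)` and its subalgorithm. -/
def tamagawaDistances (π : R) : Task R → List (Task R) → Prop
  | .distances U affine, calls =>
      ∃ calls₁ calls₂ : List (Task R), calls = calls₁ ++ calls₂ ∧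
        ForEach (U.lineComponents affine)
          (fun ℓ t => ∃ (N : Matrix (Fin 3) (Fin 3) R) (U' : Cubic R),
            IsUnit N.det ∧ IsTransform N U U' ∧
            -- the transformation moves the line to `x = 0`
            (∀ i, i ≠ 0 → ∑ j, algebraMap R _ (N i j) * ℓ j = 0) ∧
            t = .line U')
          calls₁ ∧
        ForEach (U.nonRegular π affine)
          (fun p t => ∃ (N : Matrix (Fin 3) (Fin 3) R) (U' U₁ : Cubic R)
              (c : IsLocalRing.ResidueField R),
            IsUnit N.det ∧ IsTransform N U U' ∧
            -- the transformation moves `p` to `(0 : 0 : 1)`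
            (∀ j, algebraMap R _ (N 2 j) = c * p j) ∧
            C (π ^ 2) * U₁.form (X : Fin 3 → MvPolynomial (Fin 3) R)
              = U'.form ![C π * X 0, C π * X 1, X 2] ∧
            t = .distances U₁ true)
          calls₂
  | .line U, calls =>
      ∃ V : Cubic R,
        C π * V.form (X : Fin 3 → MvPolynomial (Fin 3) R) = U.form ![C π * X 0, X 1, X 2] ∧
        let divides (a b : R) : Prop :=
          V.f₃ (X 0) (X 1) = (a • X 0 + b • X 1) *
            V.f₂ (X 0 : MvPolynomial (Fin 2) (IsLocalRing.ResidueField R)) (X 1)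
        ((∃ (a b : R) (V₁ : Cubic R), divides a b ∧
            V₁.form (X : Fin 3 → MvPolynomial (Fin 3) R)
              = V.form ![X 0 - C a * X 1 - C b * X 2, X 1, X 2] ∧
            calls = [.line V₁]) ∨
          ((¬ ∃ a b : R, divides a b) ∧ calls = []))

end Cubic

/-! ## Genus one models of degree 4 -/

/-- The quadratic form `∑ i ≤ j, c_ij x_i x_j` in four variables. -/
structure Quadric (R : Type*) where
  (c11 c12 c13 c14 c22 c23 c24 c33 c34 c44 : R)

namespace Quadric

variable {R : Type*} [CommRing R]

/-- The value of the quadratic form at a point of an `R`-algebra. -/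
def form (q : Quadric R) {A : Type*} [CommRing A] [Algebra R A] (x : Fin 4 → A) : A :=
  q.c11 • x 0 ^ 2 + q.c12 • (x 0 * x 1) + q.c13 • (x 0 * x 2) + q.c14 • (x 0 * x 3)
    + q.c22 • x 1 ^ 2 + q.c23 • (x 1 * x 2) + q.c24 • (x 1 * x 3)
    + q.c33 • x 2 ^ 2 + q.c34 • (x 2 * x 3) + q.c44 • x 3 ^ 2

/-- `pf`; the matrix of second partial derivatives of `q` has determinant `pf ^ 2 + 4 * rd`. -/
def pf (q : Quadric R) : R := q.c12 * q.c34 + q.c13 * q.c24 + q.c14 * q.c23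

/-- `rd`; the matrix of second partial derivatives of `q` has determinant `pf ^ 2 + 4 * rd`. -/
def rd (q : Quadric R) : R :=
      4 * q.c11 * q.c22 * q.c33 * q.c44 - q.c11 * q.c22 * q.c34^2 + q.c11 * q.c23 * q.c24 *
      q.c34 - q.c11 * q.c23^2 * q.c44 - q.c11 * q.c24^2 * q.c33 + q.c12 * q.c13 * q.c23 *
      q.c44 - q.c12 * q.c13 * q.c24 * q.c34 - q.c12 * q.c14 * q.c23 * q.c34 + q.c12 * q.c14
      * q.c24 * q.c33 - q.c12^2 * q.c33 * q.c44 + q.c13 * q.c14 * q.c22 * q.c34 - q.c13 *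
      q.c14 * q.c23 * q.c24 - q.c13^2 * q.c22 * q.c44 - q.c14^2 * q.c22 * q.c33

theorem det_hessian (q : Quadric R) :
    Matrix.det !![2 * q.c11, q.c12, q.c13, q.c14; q.c12, 2 * q.c22, q.c23, q.c24;
      q.c13, q.c23, 2 * q.c33, q.c34; q.c14, q.c24, q.c34, 2 * q.c44]
      = q.pf ^ 2 + 4 * q.rd := by
  simp [Matrix.det_succ_row_zero, Fin.sum_univ_succ, Fin.succAbove, pf, rd]
  ring

/-- The quadratic form `t q₁ + q₂` over the polynomial ring `R[t]`. -/
noncomputable def pencil (q₁ q₂ : Quadric R) : Quadric (Polynomial R) where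
  c11 := Polynomial.C q₁.c11 * Polynomial.X + Polynomial.C q₂.c11
  c12 := Polynomial.C q₁.c12 * Polynomial.X + Polynomial.C q₂.c12
  c13 := Polynomial.C q₁.c13 * Polynomial.X + Polynomial.C q₂.c13
  c14 := Polynomial.C q₁.c14 * Polynomial.X + Polynomial.C q₂.c14
  c22 := Polynomial.C q₁.c22 * Polynomial.X + Polynomial.C q₂.c22
  c23 := Polynomial.C q₁.c23 * Polynomial.X + Polynomial.C q₂.c23
  c24 := Polynomial.C q₁.c24 * Polynomial.X + Polynomial.C q₂.c24
  c33 := Polynomial.C q₁.c33 * Polynomial.X + Polynomial.C q₂.c33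
  c34 := Polynomial.C q₁.c34 * Polynomial.X + Polynomial.C q₂.c34
  c44 := Polynomial.C q₁.c44 * Polynomial.X + Polynomial.C q₂.c44

end Quadric

/-- A quadric intersection `Q₁ = Q₂ = 0`; here `Q₁ = Q 0` and `Q₂ = Q 1`. It also stands for the
pair of polynomials of total degree at most `2` that is obtained by putting `x₄ = 1`. -/
structure QuadricPair (R : Type*) where
  Q : Fin 2 → Quadric R

namespace QuadricPair

variable {R : Type*} [CommRing R]

/-- `p` is a smooth point on the curve `Q₁ = Q₂ = 0` in `ℙ³` over `F`. -/
def IsSmoothAt (Φ : QuadricPair R) {F : Type*} [Field F] [Algebra R F] (p : Fin 4 → F) : Prop :=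
  (∀ i, (Φ.Q i).form p = 0) ∧
    LinearIndependent F fun i => grad ((Φ.Q i).form (X : Fin 4 → MvPolynomial (Fin 4) F)) p

/-- The scheme `Q₁ = Q₂ = 0` in `ℙ³` over the field `F` is a smooth curve (hence a smooth curve of
genus one). -/
def Nonsingular (Φ : QuadricPair R) (F : Type*) [Field F] [Algebra R F] : Prop :=
  ∀ p : Fin 4 → AlgebraicClosure F, p ≠ 0 → (∀ i, (Φ.Q i).form p = 0) → Φ.IsSmoothAt p

/-- The generalised binary quartic `y² + pf(x Q₁ + z Q₂) y = rd(x Q₁ + z Q₂)`. -/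
noncomputable def doubling (Φ : QuadricPair R) : Quartic R where
  l := (Quadric.pencil (Φ.Q 0) (Φ.Q 1)).pf.coeff 2
  m := (Quadric.pencil (Φ.Q 0) (Φ.Q 1)).pf.coeff 1
  n := (Quadric.pencil (Φ.Q 0) (Φ.Q 1)).pf.coeff 0
  a := (Quadric.pencil (Φ.Q 0) (Φ.Q 1)).rd.coeff 4
  b := (Quadric.pencil (Φ.Q 0) (Φ.Q 1)).rd.coeff 3
  c := (Quadric.pencil (Φ.Q 0) (Φ.Q 1)).rd.coeff 2
  d := (Quadric.pencil (Φ.Q 0) (Φ.Q 1)).rd.coeff 1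
  e := (Quadric.pencil (Φ.Q 0) (Φ.Q 1)).rd.coeff 0

/-- The discriminant. -/
noncomputable def disc (Φ : QuadricPair R) : R := Φ.doubling.disc

/-- `Φ' = [M, N] Φ`: replace `Q_i` by `∑ j, M i j * Q_j`, then substitute
`x_j ← ∑ i, N i j * x_i`. -/
def IsTransform (M : Matrix (Fin 2) (Fin 2) R) (N : Matrix (Fin 4) (Fin 4) R)
    (Φ Φ' : QuadricPair R) : Prop :=
  ∀ i, (Φ'.Q i).form (X : Fin 4 → MvPolynomial (Fin 4) R)
    = ∑ j, C (M i j) * (Φ.Q j).form (linSubst N)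

/-- The form `q` in `Q = λ x₁² + ℓ(x₂,x₃,x₄) x₁ + q(x₂,x₃,x₄)`, for `Q = Q_i`. -/
def conicPart (Φ : QuadricPair R) (i : Fin 2) {A : Type*} [CommRing A] [Algebra R A]
    (x : Fin 3 → A) : A :=
  (Φ.Q i).form ![0, x 0, x 1, x 2]

/-- The form `ℓ` in `Q = λ x₁² + ℓ(x₂,x₃,x₄) x₁ + q(x₂,x₃,x₄)`, for `Q = Q_i`. -/
def linearPart (Φ : QuadricPair R) (i : Fin 2) {A : Type*} [CommRing A] [Algebra R A]
    (x : Fin 3 → A) : A :=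
  (Φ.Q i).c12 • x 0 + (Φ.Q i).c13 • x 1 + (Φ.Q i).c14 • x 2

/-- The matrix `s C + t D`, where `C` has rows `(a₁₃, a₂₃)`, `(b₁₃, b₂₃)` and `D` has rows
`(a₁₄, a₂₄)`, `(b₁₄, b₂₄)`, the coefficients of `Q₁` and `Q₂` being `a_ij` and `b_ij`. -/
def lineMatrix (Φ : QuadricPair R) {A : Type*} [CommRing A] [Algebra R A] (s t : A) :
    Matrix (Fin 2) (Fin 2) A :=
  !![(Φ.Q 0).c13 • s + (Φ.Q 0).c14 • t, (Φ.Q 0).c23 • s + (Φ.Q 0).c24 • t;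
     (Φ.Q 1).c13 • s + (Φ.Q 1).c14 • t, (Φ.Q 1).c23 • s + (Φ.Q 1).c24 • t]

variable [IsLocalRing R]

/-- The form `g(s, t) = det (s C + t D)` over the residue field. -/
noncomputable def lineG (Φ : QuadricPair R) : MvPolynomial (Fin 2) (IsLocalRing.ResidueField R) :=
  (Φ.lineMatrix (X 0 : MvPolynomial (Fin 2) (IsLocalRing.ResidueField R)) (X 1)).det

/-- The forms `(f₁, f₂) = adj (s C + t D) (Q₁(0,0,s,t), Q₂(0,0,s,t))` over the residue field. -/
noncomputable def lineF (Φ : QuadricPair R) :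
    Fin 2 → MvPolynomial (Fin 2) (IsLocalRing.ResidueField R) :=
  (Φ.lineMatrix (X 0 : MvPolynomial (Fin 2) (IsLocalRing.ResidueField R)) (X 1)).adjugate.mulVec
    fun i => (Φ.Q i).form ![0, 0, X 0, X 1]

/-- The non-regular `k`-points on the reduction `Γ`, or on its affine piece `x₄ = 1`: the points
on `Γ` that are singular on `g = 0` for some `g = c₀ Q₁ + c₁ Q₂`, with `c₀, c₁` not both divisible
by `π`, such that `g` vanishes mod `π²` at some lift. -/
def nonRegular (π : R) (Φ : QuadricPair R) (affine : Bool) :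
    Set (Fin 4 → IsLocalRing.ResidueField R) :=
  {p | IsNormalised p ∧ (affine = true → p 3 ≠ 0) ∧ (∀ i, (Φ.Q i).form p = 0) ∧
    ∃ c : Fin 2 → R, (¬ ∀ i, π ∣ c i) ∧
      ∑ i, c i • grad ((Φ.Q i).form
        (X : Fin 4 → MvPolynomial (Fin 4) (IsLocalRing.ResidueField R))) p = 0 ∧
      ∃ q : Fin 4 → R, IsLift q p ∧ π ^ 2 ∣ ∑ i, c i * (Φ.Q i).form q}

/-- The reductions of the polynomials `Q_i(x, y, z, 1)` have a common linear factor. -/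
def HasCommonFactor (Φ : QuadricPair R) : Prop :=
  ∃ ℓ : Fin 4 → IsLocalRing.ResidueField R, (∃ j, j ≠ 3 ∧ ℓ j ≠ 0) ∧
    ∀ i, linForm ℓ ∣ (Φ.Q i).form X

/-- The procedure `IsLocallySoluble(g₁, g₂)`. In Step (i), `Ψ` is given by `K`-linear combinations
of the equations in `Φ`; as the equations in `Ψ` are independent mod `π`, this means that
conversely `Φ` is given by combinations of the equations in `Ψ` with integral coefficients. -/
def isLocallySoluble (π : R) : Stage (QuadricPair R) → List (Stage (QuadricPair R)) → Prop
  | .normalise Φ, calls =>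
      ∃ (A : Matrix (Fin 2) (Fin 2) R) (Ψ : QuadricPair R), A.det ≠ 0 ∧ IsTransform A 1 Ψ Φ ∧
        LinearIndependent (IsLocalRing.ResidueField R)
          (fun i => (Ψ.Q i).form
            (X : Fin 4 → MvPolynomial (Fin 4) (IsLocalRing.ResidueField R))) ∧
        ((¬ Ψ.HasCommonFactor ∧ calls = [.search Ψ]) ∨
          (Ψ.HasCommonFactor ∧
            ∃ (N : Matrix (Fin 4) (Fin 4) R) (Ψ' Ψ₁ : QuadricPair R),
              -- a change of the affine coordinates that turns the common factor into `x`
              IsUnit N.det ∧ (∀ i, N i 3 = if i = 3 then 1 else 0) ∧ IsTransform 1 N Ψ Ψ' ∧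
              (∀ i, (X 0 : MvPolynomial (Fin 4) (IsLocalRing.ResidueField R))
                ∣ (Ψ'.Q i).form X) ∧
              (∀ i, C π * (Ψ₁.Q i).form (X : Fin 4 → MvPolynomial (Fin 4) R)
                = (Ψ'.Q i).form ![C π * X 0, X 1, X 2, X 3]) ∧
              calls = [.normalise Ψ₁]))
  | .search Φ, calls =>
      ((∃ p : Fin 4 → IsLocalRing.ResidueField R, p 3 = 1 ∧ Φ.IsSmoothAt p) ∧ calls = []) ∨
      ((¬ ∃ p : Fin 4 → IsLocalRing.ResidueField R, p 3 = 1 ∧ Φ.IsSmoothAt p) ∧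
        ForEach (Φ.nonRegular π true)
          (fun p t => ∃ (u : Fin 3 → R) (Φ₁ : QuadricPair R), IsLift u ![p 0, p 1, p 2] ∧
            (∀ i, (Φ₁.Q i).form (X : Fin 4 → MvPolynomial (Fin 4) R)
              = (Φ.Q i).form ![C (u 0) * X 3 + C π * X 0, C (u 1) * X 3 + C π * X 1,
                  C (u 2) * X 3 + C π * X 2, X 3]) ∧
            t = .normalise Φ₁)
          calls)

/-- The reduction contains the line `x₁ = x₂ = 0` as a component of multiplicity one: it contains
this line, and some point of the line over the algebraic closure is smooth (equivalently, all but
finitely many are). -/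
def HasLine (Φ : QuadricPair R) : Prop :=
  (∀ p : Fin 4 → AlgebraicClosure (IsLocalRing.ResidueField R), p 0 = 0 → p 1 = 0 →
    ∀ i, (Φ.Q i).form p = 0) ∧
  ∃ p : Fin 4 → AlgebraicClosure (IsLocalRing.ResidueField R), p 0 = 0 ∧ p 1 = 0 ∧
    Φ.IsSmoothAt p

/-- The reduction contains a `k`-rational conic in the plane `x₁ = 0` as a component of
multiplicity one: it contains `x₁ = q(x₂,x₃,x₄) = 0` for some absolutely irreducible form `q` of
degree 2, and some point of this conic over the algebraic closure is smooth (equivalently, all but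
finitely many are). -/
def HasConic (Φ : QuadricPair R) : Prop :=
  ∃ q : MvPolynomial (Fin 3) (IsLocalRing.ResidueField R), q.IsHomogeneous 2 ∧
    Irreducible (map (algebraMap _ (AlgebraicClosure (IsLocalRing.ResidueField R))) q) ∧
    (∀ i, q ∣ Φ.conicPart i X) ∧
    ∃ p : Fin 4 → AlgebraicClosure (IsLocalRing.ResidueField R), p 0 = 0 ∧
      aeval ![p 1, p 2, p 3] q = 0 ∧ Φ.IsSmoothAt p

/-- The `k`-rational lines (given as planes in `k⁴`) that are components of multiplicity one of the
reduction `Γ`, or of its affine piece `x₄ = 1`. -/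
def lineComponents (Φ : QuadricPair R) (affine : Bool) :
    Set (Submodule (IsLocalRing.ResidueField R) (Fin 4 → IsLocalRing.ResidueField R)) :=
  {W | Module.finrank (IsLocalRing.ResidueField R) W = 2 ∧
    (affine = true → ∃ w ∈ W, w 3 ≠ 0) ∧
    ∃ (N : Matrix (Fin 4) (Fin 4) R) (Φ' : QuadricPair R), IsUnit N.det ∧ IsTransform 1 N Φ Φ' ∧
      (fun j => algebraMap R _ (N 2 j)) ∈ W ∧ (fun j => algebraMap R _ (N 3 j)) ∈ W ∧
      Φ'.HasLine}

/-- The planes (given by their normalised equations) that contain a `k`-rational conic that is a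
component of multiplicity one of the reduction `Γ`, or of its affine piece `x₄ = 1`. A plane
contains at most one such conic, and a conic spans a unique plane. -/
def conicComponents (Φ : QuadricPair R) (affine : Bool) :
    Set (Fin 4 → IsLocalRing.ResidueField R) :=
  {ℓ | IsNormalised ℓ ∧ (affine = true → ¬ (ℓ 0 = 0 ∧ ℓ 1 = 0 ∧ ℓ 2 = 0)) ∧
    ∃ (N : Matrix (Fin 4) (Fin 4) R) (Φ' : QuadricPair R), IsUnit N.det ∧ IsTransform 1 N Φ Φ' ∧
      (∀ i, i ≠ 0 → ∑ j, algebraMap R _ (N i j) * ℓ j = 0) ∧ Φ'.HasConic}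

/-- The states of the procedure for the Tamagawa distances in degree 4. -/
inductive Task (R : Type*)
  /-- `TamagawaDistances(Q₁, Q₂, Affine)` is called. -/
  | distances (Φ : QuadricPair R) (affine : Bool)
  /-- The subalgorithm for the contribution of the line `x₁ = x₂ = 0` is at the start of
  Step (ii). -/
  | line (Φ : QuadricPair R)
  /-- The subalgorithm for the contribution of a conic in the plane `x₁ = 0` is at the start of
  Step (ii). -/
  | conic (Φ : QuadricPair R)

/-- The procedure `TamagawaDistances(Q₁, Q₂, Affine)` and its two subalgorithms. -/
def tamagawaDistances (π : R) : Task R → List (Task R) → Prop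
  | .distances Φ affine, calls =>
      ∃ calls₁ calls₂ calls₃ : List (Task R), calls = calls₁ ++ calls₂ ++ calls₃ ∧
        ForEach (Φ.lineComponents affine)
          (fun W t => ∃ (N : Matrix (Fin 4) (Fin 4) R) (Φ' : QuadricPair R),
            IsUnit N.det ∧ IsTransform 1 N Φ Φ' ∧
            -- the transformation moves the line to `x₁ = x₂ = 0`
            (fun j => algebraMap R _ (N 2 j)) ∈ W ∧ (fun j => algebraMap R _ (N 3 j)) ∈ W ∧
            t = .line Φ')
          calls₁ ∧
        ForEach (Φ.conicComponents affine)
          (fun ℓ t => ∃ (N : Matrix (Fin 4) (Fin 4) R) (Φ' : QuadricPair R),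
            IsUnit N.det ∧ IsTransform 1 N Φ Φ' ∧
            -- the transformation moves the plane of the conic to `x₁ = 0`
            (∀ i, i ≠ 0 → ∑ j, algebraMap R _ (N i j) * ℓ j = 0) ∧
            t = .conic Φ')
          calls₂ ∧
        ForEach (Φ.nonRegular π affine)
          (fun p t => ∃ (M : Matrix (Fin 2) (Fin 2) R) (N : Matrix (Fin 4) (Fin 4) R)
              (Φ' Φ₁ : QuadricPair R) (c : IsLocalRing.ResidueField R),
            IsUnit M.det ∧ IsUnit N.det ∧ IsTransform M N Φ Φ' ∧
            -- the transformation moves `p` to `(0 : 0 : 0 : 1)`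
            (∀ j, algebraMap R _ (N 3 j) = c * p j) ∧
            grad ((Φ'.Q 0).form
              (X : Fin 4 → MvPolynomial (Fin 4) (IsLocalRing.ResidueField R)))
              ![0, 0, 0, 1] = 0 ∧
            π ^ 2 ∣ (Φ'.Q 0).form (![0, 0, 0, 1] : Fin 4 → R) ∧
            C (π ^ 2) * (Φ₁.Q 0).form (X : Fin 4 → MvPolynomial (Fin 4) R)
              = (Φ'.Q 0).form ![C π * X 0, C π * X 1, C π * X 2, X 3] ∧
            C π * (Φ₁.Q 1).form (X : Fin 4 → MvPolynomial (Fin 4) R)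
              = (Φ'.Q 1).form ![C π * X 0, C π * X 1, C π * X 2, X 3] ∧
            t = .distances Φ₁ true)
          calls₃
  | .line Φ, calls =>
      ∃ Ψ : QuadricPair R,
        (∀ i, C π * (Ψ.Q i).form (X : Fin 4 → MvPolynomial (Fin 4) R)
          = (Φ.Q i).form ![C π * X 0, C π * X 1, X 2, X 3]) ∧
        let divides (a b : Fin 2 → R) : Prop :=
          ∀ i, Ψ.lineF i = (a i • X 0 + b i • X 1) * Ψ.lineG
        let haveFactor : Prop :=
          ∃ h : Fin 2 → IsLocalRing.ResidueField R, h ≠ 0 ∧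
            linForm h ∣ Ψ.lineG ∧ ∀ i, linForm h ∣ Ψ.lineF i
        -- Step (iv): the curve is a line, which is moved to `x₁ = x₂ = 0`
        ((∃ (a b : Fin 2 → R) (Ψ₁ : QuadricPair R), divides a b ∧
            (∀ i, (Ψ₁.Q i).form (X : Fin 4 → MvPolynomial (Fin 4) R)
              = (Ψ.Q i).form ![X 0 - C (a 0) * X 2 - C (b 0) * X 3,
                  X 1 - C (a 1) * X 2 - C (b 1) * X 3, X 2, X 3]) ∧
            calls = [.line Ψ₁]) ∨
          -- Step (v): the curve is a conic, whose plane is moved to `x₁ = 0`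
          ((¬ ∃ a b : Fin 2 → R, divides a b) ∧ haveFactor ∧
            ∃ (ℓ : Fin 4 → R) (N : Matrix (Fin 4) (Fin 4) R) (Ψ₁ : QuadricPair R),
              -(ℓ 0 • Ψ.lineF 0) - ℓ 1 • Ψ.lineF 1 + ℓ 2 • (Ψ.lineG * X 0)
                + ℓ 3 • (Ψ.lineG * X 1) = 0 ∧
              IsUnit N.det ∧ N.mulVec ℓ = ![1, 0, 0, 0] ∧ IsTransform 1 N Ψ Ψ₁ ∧
              calls = [.conic Ψ₁]) ∨
          ((¬ ∃ a b : Fin 2 → R, divides a b) ∧ ¬ haveFactor ∧ calls = []))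
  | .conic Φ, calls =>
      ∃ (M : Matrix (Fin 2) (Fin 2) R) (Φ' Ψ : QuadricPair R),
        IsUnit M.det ∧ IsTransform M 1 Φ Φ' ∧
        Φ'.conicPart 0 (X : Fin 3 → MvPolynomial (Fin 3) (IsLocalRing.ResidueField R)) = 0 ∧
        C π * (Ψ.Q 0).form (X : Fin 4 → MvPolynomial (Fin 4) R)
          = (Φ'.Q 0).form ![C π * X 0, X 1, X 2, X 3] ∧
        (Ψ.Q 1).form (X : Fin 4 → MvPolynomial (Fin 4) R)
          = (Φ'.Q 1).form ![C π * X 0, X 1, X 2, X 3] ∧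
        let inIdeal (a : Fin 3 → R) (b : R) : Prop :=
          Ψ.conicPart 0 (X : Fin 3 → MvPolynomial (Fin 3) (IsLocalRing.ResidueField R))
            = (∑ j, a j • X j) * Ψ.linearPart 0 X + b • Ψ.conicPart 1 X
        ((∃ (a : Fin 3 → R) (b : R) (Ψ₁ : QuadricPair R), inIdeal a b ∧
            (∀ i, (Ψ₁.Q i).form (X : Fin 4 → MvPolynomial (Fin 4) R)
              = (Ψ.Q i).form ![X 0 - C (a 0) * X 1 - C (a 1) * X 2 - C (a 2) * X 3,
                  X 1, X 2, X 3]) ∧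
            calls = [.conic Ψ₁]) ∨
          ((¬ ∃ (a : Fin 3 → R) (b : R), inIdeal a b) ∧ calls = []))

end QuadricPair

end GenusOne

/-! The whole argument measures how singular a model is. Call q a singular point modulo π^m of f = 0
if π^(2m) divides f(q) and π^m divides the gradient at q (`SingMod`). A non-regular point is
singular modulo π at each of its lifts (`singMod_one_of_lift`). Zooming in on it and dividing out
the available powers of π turns a singular point modulo π^m of the new model into a singular point
modulo π^(m+1) of the old one. Hence m nested iterations force a singular point modulo π^m on the
model they start from. When this point is moved to a coordinate point, the Jacobian gets π^m ∣ a₃,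
a₄ and π^(2m) ∣ a₆, so π^(2m) ∣ Δ (`sq_dvd_delta`), which is the bound m ≤ v(Δ)/2. That the level
does not rise is a count of exponents: the substitution multiplies Δ by a power of π that the
subsequent division always recovers.

In degree 4 a point is singular modulo π^m if there is a 2×2 matrix B with π^m ∣ det B such that the
values of the two forms lie in π^m B R² and their partial derivatives in B R²
(`QuadricPair.SingMod`). An iteration multiplies B by a matrix of determinant divisible by π. A weak
elementary divisor statement for B (`exists_isUnit_pow_dvd_vecMul`), together with the passage to
the binary quartic of the pencil (`QuadricPair.doubling`), again gives π^(2m) ∣ Δ. This needs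
iterations in which Step (i) is not repeated. A repetition lowers v(Δ) by at least 12, so it does
not occur while the level is constant (`iteration_cases`).

Termination needs a bound for the m that occur. In degrees 2 and 4 it is v(Δ), where Δ ≠ 0 follows
from smoothness: if Δ = 0, then the binary quartic P² + 4Q has a double root, and this produces a
singular point on the curve. In degree 3 compactness of the ring of integers is used instead:
singular points modulo all powers of π would give a genuine one (`exists_eq_zero_of_pow_dvd`). The
least m without a singular point modulo π^m is then a decreasing measure (`sInf_lt_sInf_of_imp`).

The subalgorithms are treated in the same way, with lines and conics modulo π^m (`LineMod`,
`ConicMod`) in place of points. In degree 3 lines modulo all powers would give a line on the cubic,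
which is singular where this line meets the residual conic. In degree 4 a line or a conic modulo π^m
makes Δ divisible by π^m. The procedures must also never be stuck, which means that the divisions by
π in Step (ii) remain possible. The invariants for this are `ContainsLine` and `DependentOnPlane`.
The delicate transition is the one from a line to a conic in Step (v), which rests on
`dependent_or_divides`. -/

namespace GenusOne

/-! ### Procedures: termination from well-founded call trees. -/

section Procedures

variable {σ : Type*} {body : σ → List σ → Prop}

/-- A procedure that is never stuck and has bounded paths from each reachable state halts. -/
theorem halts_of_acc (Inv : σ → Prop) (hex : ∀ s, Inv s → ∃ calls, body s calls)
    (hpres : ∀ s t, Inv s → Calls body s t → Inv t) {s : σ}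
    (hacc : Acc (fun t s => Calls body s t) s) (hs : Inv s) : Halts body s := by
  induction hacc with
  | intro s _ ih =>
    exact ⟨s, hex s hs, fun calls hc t ht => ih t ⟨calls, hc, ht⟩ (hpres s t hs ⟨calls, hc, ht⟩)⟩

/-- A point is accessible if the lengths of the paths that start from it are bounded. -/
theorem acc_of_bounded_paths {r : σ → σ → Prop} (e : ℕ) (s : σ)
    (h : ∀ (m : ℕ) (f : ℕ → σ), f 0 = s → (∀ i < m, r (f i) (f (i + 1))) → m ≤ e) :
    Acc (fun t s => r s t) s := by
  induction e generalizing s with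
  | zero =>
    refine ⟨s, fun t ht => ?_⟩
    have := h 1 (fun i => if i = 0 then s else t) (by simp) (by simpa using ht)
    omega
  | succ e ih =>
    refine ⟨s, fun t ht => ih t fun m f hf hr => ?_⟩
    -- A path of length `m` from the successor `t` extends to a path of length `m + 1` from `s`, so
    -- `e` bounds the paths from `t`.
    have := h (m + 1) (fun i => if i = 0 then s else f (i - 1)) (by simp) ?_
    · omega
    · rintro (_ | i) hi
      · simpa [hf] using ht
      · simpa using hr i (by omega)

theorem ForEach.exists_of_mem {ι : Type*} {S : Set ι} {call : ι → σ → Prop} {calls : List σ}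
    (h : ForEach S call calls) {t : σ} (ht : t ∈ calls) : ∃ p ∈ S, call p t := by
  obtain ⟨L, -, hL, h2⟩ := h
  obtain ⟨n, hn, rfl⟩ := List.getElem_of_mem ht
  have hn' : n < L.length := by rw [h2.length_eq]; exact hn
  exact ⟨L[n], (hL _).1 (List.getElem_mem hn'), h2.get hn' hn⟩

/-- Needed for the half of `Halts` that says a procedure is never stuck. In the applications the set
is finite because the residue field is. -/
theorem ForEach.exists {ι : Type*} {S : Set ι} (hS : S.Finite) {call : ι → σ → Prop}
    (h : ∀ p ∈ S, ∃ t, call p t) : ∃ calls, ForEach S call calls := by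
  classical
  choose g hg using h
  refine ⟨hS.toFinset.toList.attach.map fun p => g p.1 (by simpa using p.2),
    hS.toFinset.toList, Finset.nodup_toList _, by simp, ?_⟩
  rw [List.forall₂_map_right_iff]
  conv => arg 2; rw [← List.attach_map_subtype_val hS.toFinset.toList]
  rw [List.forall₂_map_left_iff, List.forall₂_same]
  intro p _
  exact hg _ _

/-- Termination of a local solubility test, from a level that decreases in each repetition of
Step (i), does not increase in an iteration, and bounds the number of iterations while it is
constant. -/
theorem halts_of_level {M : Type*} {body : Stage M → List (Stage M) → Prop} (v : M → ℕ)
    (Inv : M → Prop)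
    (hex : ∀ Φ, Inv Φ → (∃ calls, body (.normalise Φ) calls) ∧ ∃ calls, body (.search Φ) calls)
    (hnn : ∀ Φ Ψ, Inv Φ → Calls body (.normalise Φ) (.normalise Ψ) → Inv Ψ ∧ v Ψ < v Φ)
    (hns : ∀ Φ Ψ, Inv Φ → Calls body (.normalise Φ) (.search Ψ) → Inv Ψ)
    (hsn : ∀ Φ Ψ, Inv Φ → Calls body (.search Φ) (.normalise Ψ) → Inv Ψ)
    (hss : ∀ Φ Ψ, Inv Φ → ¬ Calls body (.search Φ) (.search Ψ))
    (hmono : ∀ Φ Ψ, Inv Φ → Iteration body Φ Ψ → v Ψ ≤ v Φ)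
    (hbound : ∀ (m : ℕ) (Ψ : ℕ → M), Inv (Ψ 0) → (∀ i < m, Iteration body (Ψ i) (Ψ (i + 1))) →
      (∀ i ≤ m, v (Ψ i) = v (Ψ 0)) → 2 * m ≤ v (Ψ 0))
    {Φ : M} (hΦ : Inv Φ) : Halts body (.normalise Φ) := by
  have inv_rt : ∀ Φ Ψ, Inv Φ → Relation.ReflTransGen
      (fun A B => Calls body (.normalise A) (.normalise B)) Φ Ψ → Inv Ψ := by
    intro Φ Ψ hΦ h
    induction h with
    | refl => exact hΦ
    | tail _ h ih => exact (hnn _ _ ih h).1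
  have inv_it : ∀ Φ Ψ, Inv Φ → Iteration body Φ Ψ → Inv Ψ := by
    rintro Φ Ψ hΦ ⟨Φ₁, Φ₂, h1, h2, h3⟩
    exact hns _ _ (inv_rt _ _ (hsn _ _ hΦ h1) h2) h3
  -- accessibility for iterations
  have acc_it : ∀ n Φ, Inv Φ → v Φ = n → Acc (fun B A => Inv A ∧ Iteration body A B) Φ := by
    intro n
    induction n using Nat.strong_induction_on with
    | _ n ih =>
      -- On the level set `v = n` chains of iterations have bounded length, which gives
      -- accessibility there. An iteration that leaves the level set lowers `v` and falls under the
      -- outer induction.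
      have key : ∀ Φ, Inv Φ → v Φ = n →
          Acc (fun B A => (Inv A ∧ v A = n) ∧ Iteration body A B ∧ v B = n) Φ := by
        intro Φ hΦ hv
        refine acc_of_bounded_paths (r := fun A B => (Inv A ∧ v A = n) ∧ Iteration body A B ∧ v B = n)
          n Φ fun m f hf hr => ?_
        have hall : ∀ i ≤ m, v (f i) = n := by
          rintro (_ | i) hi
          · rw [hf, hv]
          · exact (hr i (by omega)).2.2
        have := hbound m f (hf ▸ hΦ) (fun i hi => (hr i hi).2.1)
          (fun i hi => by rw [hall i hi, hall 0 (by omega)])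
        rw [hf, hv] at this
        omega
      intro Φ hΦ hv
      have hacc := key Φ hΦ hv
      induction hacc with
      | intro Φ _ ih' =>
        refine ⟨Φ, fun Ψ h => ?_⟩
        have hΨ := inv_it _ _ hΦ h.2
        have hle := hmono _ _ hΦ h.2
        rcases hle.lt_or_eq with hlt | heq
        · exact ih _ (hv ▸ hlt) Ψ hΨ rfl
        · exact ih' Ψ ⟨⟨hΦ, hv⟩, h.2, heq.trans hv⟩ hΨ (heq.trans hv)
  -- Each repetition of Step (i) lowers `v`, so Step (ii) is reached after finitely many of them.
  have halts_norm : ∀ Φ, Inv Φ → (∀ Ψ Φ', Relation.ReflTransGen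
      (fun A B => Calls body (.normalise A) (.normalise B)) Φ Φ' →
      Calls body (.normalise Φ') (.search Ψ) → Halts body (.search Ψ)) →
      Halts body (.normalise Φ) := by
    intro Φ
    induction hn : v Φ using Nat.strong_induction_on generalizing Φ with
    | _ n ih =>
      intro hΦ hs
      refine ⟨_, (hex Φ hΦ).1, ?_⟩
      rintro calls hc (Ψ | Ψ) ht
      · have hstep := hnn _ _ hΦ ⟨calls, hc, ht⟩
        exact ih _ (hn ▸ hstep.2) Ψ rfl hstep.1
          fun Ψ' Φ' h1 h2 => hs Ψ' Φ' (Relation.ReflTransGen.head ⟨calls, hc, ht⟩ h1) h2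
      · exact hs Ψ Φ .refl ⟨calls, hc, ht⟩
  have halts_search : ∀ Φ, Inv Φ → Halts body (.search Φ) := by
    intro Φ hΦ
    have hacc := acc_it _ Φ hΦ rfl
    induction hacc with
    | intro Φ _ ih =>
      refine ⟨_, (hex Φ hΦ).2, ?_⟩
      rintro calls hc (Ψ | Ψ) ht
      · refine halts_norm Ψ (hsn _ _ hΦ ⟨calls, hc, ht⟩) fun Ψ' Φ' h1 h2 => ?_
        have hit : Iteration body Φ Ψ' := ⟨Ψ, Φ', ⟨calls, hc, ht⟩, h1, h2⟩
        exact ih Ψ' ⟨hΦ, hit⟩ (inv_it _ _ hΦ hit)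
      · exact absurd ⟨calls, hc, ht⟩ (hss Φ Ψ hΦ)
  exact halts_norm Φ hΦ fun Ψ Φ' h1 h2 => halts_search Ψ (hns _ _ (inv_rt _ _ hΦ h1) h2)

end Procedures

/-! ### Chain rule and Taylor expansion for polynomials. -/

section Gradients

variable {A : Type*} [CommRing A]

theorem pderiv_aeval {m n : ℕ} (g : Fin n → MvPolynomial (Fin m) A)
    (f : MvPolynomial (Fin n) A) (i : Fin m) :
    pderiv i (aeval g f) = ∑ j, aeval g (pderiv j f) * pderiv i (g j) := by
  induction f using MvPolynomial.induction_on with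
  | C a => simp
  | add p q hp hq => simp only [map_add, hp, hq, add_mul, Finset.sum_add_distrib]
  | mul_X p k hp =>
    simp only [map_mul, aeval_X, Derivation.leibniz, hp, smul_eq_mul, map_add, add_mul,
      Finset.sum_add_distrib, pderiv_X, Finset.mul_sum]
    congr 1
    · rw [Finset.sum_eq_single k]
      · simp
      · intro j _ hj; simp [Pi.single_apply, hj.symm]
      · simp
    · exact Finset.sum_congr rfl fun j _ => by ring

theorem eval_aeval {m n : ℕ} (g : Fin n → MvPolynomial (Fin m) A)
    (f : MvPolynomial (Fin n) A) (p : Fin m → A) :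
    eval p (aeval g f) = eval (fun k => eval p (g k)) f := by
  induction f using MvPolynomial.induction_on with
  | C a => simp
  | add p q hp hq => simp only [map_add, hp, hq]
  | mul_X p k hp => simp only [map_mul, hp, aeval_X, eval_X]

/-- The chain rule. -/
theorem grad_aeval {m n : ℕ} (g : Fin n → MvPolynomial (Fin m) A)
    (f : MvPolynomial (Fin n) A) (p : Fin m → A) (i : Fin m) :
    grad (aeval g f) p i = ∑ j, grad f (fun k => eval p (g k)) j * grad (g j) p i := by
  simp only [grad, pderiv_aeval, map_sum, map_mul, eval_aeval]

theorem eval_linSubst {n : ℕ} (N : Matrix (Fin n) (Fin n) A) (p : Fin n → A) (j : Fin n) :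
    eval p (linSubst N j) = (Matrix.vecMul p N) j := by
  simp [linSubst, Matrix.vecMul, dotProduct, mul_comm]

/-- With this convention points are row vectors multiplied by `N` on the right and gradients are
column vectors multiplied by `N` on the left, so for invertible `N` divisibility of the gradient by
a power of π can be transported both ways. -/
theorem grad_linSubst {n : ℕ} (N : Matrix (Fin n) (Fin n) A) (f : MvPolynomial (Fin n) A)
    (p : Fin n → A) : grad (aeval (linSubst N) f) p = N.mulVec (grad f (Matrix.vecMul p N)) := by
  ext i
  have : (fun k => eval p (linSubst N k)) = Matrix.vecMul p N := funext (eval_linSubst N p)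
  rw [grad_aeval, this]
  refine Finset.sum_congr rfl fun j _ => ?_
  rw [mul_comm]
  congr 1
  simp [grad, linSubst, pderiv_X, Pi.single_apply]

theorem grad_C_mul {n : ℕ} (a : A) (f : MvPolynomial (Fin n) A) (p : Fin n → A) :
    grad (C a * f) p = a • grad f p := by
  ext i; simp [grad]

theorem grad_map {n : ℕ} {B : Type*} [CommRing B] (φ : A →+* B) (f : MvPolynomial (Fin n) A)
    (p : Fin n → A) (i : Fin n) : grad (map φ f) (fun j => φ (p j)) i = φ (grad f p i) := by
  rw [grad, pderiv_map, eval_map, grad, ← eval₂_id, eval₂_comp_left φ]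
  rfl

/-- Taylor's formula modulo `t ^ 2`. -/
theorem sq_dvd_eval_add_sub {n : ℕ} (f : MvPolynomial (Fin n) A) (t : A) (p h : Fin n → A) :
    t ^ 2 ∣ eval (fun i => p i + t * h i) f - eval p f - t * ∑ i, h i * grad f p i := by
  induction f using MvPolynomial.induction_on with
  | C a => simp [grad]
  | add f g hf hg =>
    convert dvd_add hf hg using 1
    simp only [grad, map_add, mul_add, Finset.sum_add_distrib]
    ring
  | mul_X f k hf =>
    obtain ⟨r, hr⟩ := hf
    -- The remainder of `f * X k` consists of the remainder of `f` times the new value of `X k`, and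
    -- the product of the two first order terms.
    refine ⟨r * (p k + t * h k) + h k * ∑ i, h i * grad f p i, ?_⟩
    have : ∑ i, h i * grad (f * X k) p i = p k * ∑ i, h i * grad f p i + h k * eval p f := by
      simp only [grad, pderiv_mul, map_add, map_mul, eval_X, mul_add, Finset.sum_add_distrib,
        Finset.mul_sum, pderiv_X]
      congr 1
      · exact Finset.sum_congr rfl fun j _ => by ring
      · rw [Finset.sum_eq_single k]
        · simp
        · intro j _ hj; simp [Pi.single_apply, hj.symm]
        · simp
    rw [this, map_mul, map_mul, eval_X, eval_X]
    linear_combination (p k + t * h k) * hr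

end Gradients

end GenusOne

/-! ### Singular points modulo powers of π; degree 2: coefficients, substitutions, invariants. -/

namespace GenusOne

/-- `q` is a singular point of `f = 0` modulo `π ^ m`, in the sense that `f` vanishes at `q` modulo
`π ^ (2 * m)` and its gradient vanishes modulo `π ^ m`. -/
def SingMod {n : ℕ} {R : Type*} [CommRing R] (π : R) (m : ℕ) (f : MvPolynomial (Fin n) R)
    (q : Fin n → R) : Prop :=
  π ^ (2 * m) ∣ eval q f ∧ ∀ i, π ^ m ∣ grad f q i

theorem singMod_zero {n : ℕ} {R : Type*} [CommRing R] (π : R) (f : MvPolynomial (Fin n) R)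
    (q : Fin n → R) : SingMod π 0 f q := by
  simp [SingMod]

namespace Quartic

variable {R : Type*} [CommRing R]

theorem map_P (Φ : Quartic R) {A B : Type*} [CommRing A] [Algebra R A] [CommRing B] [Algebra R B]
    (φ : A →ₐ[R] B) (x : Fin 2 → A) : φ (Φ.P x) = Φ.P (fun i => φ (x i)) := by
  simp [P]

theorem map_Q (Φ : Quartic R) {A B : Type*} [CommRing A] [Algebra R A] [CommRing B] [Algebra R B]
    (φ : A →ₐ[R] B) (x : Fin 2 → A) : φ (Φ.Q x) = Φ.Q (fun i => φ (x i)) := by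
  simp [Q]

/-- The defining polynomial. -/
noncomputable def poly (Φ : Quartic R) : MvPolynomial (Fin 3) R := Φ.form X

theorem eval_poly (Φ : Quartic R) (x : Fin 3 → R) : eval x Φ.poly = Φ.form x := by
  simp [poly, form, P, Q, smul_eq_C_mul]

theorem form_X_eq_map (Φ : Quartic R) (F : Type*) [CommRing F] [Algebra R F] :
    Φ.form (X : Fin 3 → MvPolynomial (Fin 3) F) = map (algebraMap R F) Φ.poly := by
  simp [poly, form, P, Q, Algebra.smul_def, IsScalarTower.algebraMap_apply R F (MvPolynomial _ F)]

theorem grad_poly (Φ : Quartic R) (q : Fin 3 → R) : grad Φ.poly q =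
    ![(2 * Φ.l * q 0 + Φ.m * q 1) * q 2
        - (4 * Φ.a * q 0 ^ 3 + 3 * Φ.b * q 0 ^ 2 * q 1 + 2 * Φ.c * q 0 * q 1 ^ 2 + Φ.d * q 1 ^ 3),
      (Φ.m * q 0 + 2 * Φ.n * q 1) * q 2
        - (Φ.b * q 0 ^ 3 + 2 * Φ.c * q 0 ^ 2 * q 1 + 3 * Φ.d * q 0 * q 1 ^ 2 + 4 * Φ.e * q 1 ^ 3),
      2 * q 2 + Φ.P ![q 0, q 1]] := by
  ext i
  fin_cases i <;> simp [grad, poly, form, P, Q, pderiv_X, Pi.single_apply, smul_eq_C_mul] <;> ring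

/-- Setting x₂ = 1 reduces comparisons of binary forms to coefficients of polynomials in one
variable; the default value of `getD` covers the degrees beyond that of the form. -/
theorem coeff_P (Φ : Quartic R) (k : ℕ) :
    (aeval ![(Polynomial.X : Polynomial R), 1] (Φ.P (X : Fin 2 → MvPolynomial (Fin 2) R))).coeff k =
      ([Φ.n, Φ.m, Φ.l].getD k 0) := by
  have : aeval ![(Polynomial.X : Polynomial R), 1] (Φ.P (X : Fin 2 → MvPolynomial (Fin 2) R)) =
      Polynomial.C Φ.l * Polynomial.X ^ 2 + Polynomial.C Φ.m * Polynomial.X + Polynomial.C Φ.n := by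
    rw [map_P]; simp [P, Polynomial.smul_eq_C_mul]
  rw [this]
  rcases k with _ | _ | _ | k <;>
    simp [Polynomial.coeff_C, Polynomial.coeff_X, Polynomial.coeff_X_pow]

theorem coeff_Q (Φ : Quartic R) (k : ℕ) :
    (aeval ![(Polynomial.X : Polynomial R), 1] (Φ.Q (X : Fin 2 → MvPolynomial (Fin 2) R))).coeff k =
      ([Φ.e, Φ.d, Φ.c, Φ.b, Φ.a].getD k 0) := by
  have : aeval ![(Polynomial.X : Polynomial R), 1] (Φ.Q (X : Fin 2 → MvPolynomial (Fin 2) R)) =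
      Polynomial.C Φ.a * Polynomial.X ^ 4 + Polynomial.C Φ.b * Polynomial.X ^ 3 +
      Polynomial.C Φ.c * Polynomial.X ^ 2 + Polynomial.C Φ.d * Polynomial.X + Polynomial.C Φ.e := by
    rw [map_Q]; simp [Q, Polynomial.smul_eq_C_mul]
  rw [this]
  rcases k with _ | _ | _ | _ | _ | k <;>
    simp [Polynomial.coeff_C, Polynomial.coeff_X, Polynomial.coeff_X_pow]

theorem ext_of_forms {Φ Ψ : Quartic R}
    (hP : Φ.P (X : Fin 2 → MvPolynomial (Fin 2) R) = Ψ.P X)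
    (hQ : Φ.Q (X : Fin 2 → MvPolynomial (Fin 2) R) = Ψ.Q X) : Φ = Ψ := by
  have h := fun k => (Φ.coeff_P k).symm.trans ((by rw [hP]) : _ = _) |>.trans (Ψ.coeff_P k)
  have h' := fun k => (Φ.coeff_Q k).symm.trans ((by rw [hQ]) : _ = _) |>.trans (Ψ.coeff_Q k)
  cases Φ; cases Ψ
  simp only [mk.injEq]
  exact ⟨h 2, h 1, h 0, h' 4, h' 3, h' 2, h' 1, h' 0⟩

theorem C_dvd_P {c : R} {Φ : Quartic R} :
    C c ∣ Φ.P (X : Fin 2 → MvPolynomial (Fin 2) R) ↔ c ∣ Φ.l ∧ c ∣ Φ.m ∧ c ∣ Φ.n := by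
  constructor
  · intro h
    have h := map_dvd (aeval ![(Polynomial.X : Polynomial R), 1]) h
    rw [aeval_C, Polynomial.algebraMap_eq, Polynomial.C_dvd_iff_dvd_coeff] at h
    simp only [coeff_P] at h
    exact ⟨h 2, h 1, h 0⟩
  · rintro ⟨⟨l, hl⟩, ⟨m, hm⟩, ⟨n, hn⟩⟩
    refine ⟨(⟨l, m, n, 0, 0, 0, 0, 0⟩ : Quartic R).P X, ?_⟩
    simp [P, hl, hm, hn, smul_eq_C_mul]; ring

theorem C_dvd_Q {c : R} {Φ : Quartic R} :
    C c ∣ Φ.Q (X : Fin 2 → MvPolynomial (Fin 2) R) ↔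
      c ∣ Φ.a ∧ c ∣ Φ.b ∧ c ∣ Φ.c ∧ c ∣ Φ.d ∧ c ∣ Φ.e := by
  constructor
  · intro h
    have h := map_dvd (aeval ![(Polynomial.X : Polynomial R), 1]) h
    rw [aeval_C, Polynomial.algebraMap_eq, Polynomial.C_dvd_iff_dvd_coeff] at h
    simp only [coeff_Q] at h
    exact ⟨h 4, h 3, h 2, h 1, h 0⟩
  · rintro ⟨⟨l, hl⟩, ⟨m, hm⟩, ⟨n, hn⟩, ⟨d, hd⟩, ⟨e, he⟩⟩
    refine ⟨(⟨0, 0, 0, l, m, n, d, e⟩ : Quartic R).Q X, ?_⟩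
    simp [Q, hl, hm, hn, hd, he, smul_eq_C_mul]; ring

/-- The substitution `y ← y + r₀ x₁² + r₁ x₁x₂ + r₂ x₂²`. -/
def shift (r : Fin 3 → R) (Φ : Quartic R) : Quartic R where
  l := Φ.l + 2 * r 0
  m := Φ.m + 2 * r 1
  n := Φ.n + 2 * r 2
  a := Φ.a - r 0 * Φ.l - r 0 ^ 2
  b := Φ.b - r 0 * Φ.m - r 1 * Φ.l - 2 * r 0 * r 1
  c := Φ.c - r 0 * Φ.n - r 1 * Φ.m - r 2 * Φ.l - r 1 ^ 2 - 2 * r 0 * r 2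
  d := Φ.d - r 1 * Φ.n - r 2 * Φ.m - 2 * r 1 * r 2
  e := Φ.e - r 2 * Φ.n - r 2 ^ 2

/-- The substitution `x_j ← ∑ i, N i j * x_i`. -/
def subst (N : Matrix (Fin 2) (Fin 2) R) (Φ : Quartic R) : Quartic R where
  l := Φ.P (N 0)
  m := 2 * Φ.l * N 0 0 * N 1 0 + Φ.m * (N 0 0 * N 1 1 + N 0 1 * N 1 0) + 2 * Φ.n * N 0 1 * N 1 1
  n := Φ.P (N 1)
  a := Φ.Q (N 0)
  b := Φ.a * (4 * N 0 0 ^ 3 * N 1 0) + Φ.b * (3 * N 0 0 ^ 2 * N 1 0 * N 0 1 + N 0 0 ^ 3 * N 1 1)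
    + Φ.c * (2 * N 0 0 * N 1 0 * N 0 1 ^ 2 + 2 * N 0 0 ^ 2 * N 0 1 * N 1 1)
    + Φ.d * (N 1 0 * N 0 1 ^ 3 + 3 * N 0 0 * N 0 1 ^ 2 * N 1 1) + Φ.e * (4 * N 0 1 ^ 3 * N 1 1)
  c := Φ.a * (6 * N 0 0 ^ 2 * N 1 0 ^ 2)
    + Φ.b * (3 * N 0 0 * N 1 0 ^ 2 * N 0 1 + 3 * N 0 0 ^ 2 * N 1 0 * N 1 1)
    + Φ.c * (N 0 0 ^ 2 * N 1 1 ^ 2 + 4 * N 0 0 * N 1 0 * N 0 1 * N 1 1 + N 1 0 ^ 2 * N 0 1 ^ 2)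
    + Φ.d * (3 * N 0 1 * N 1 1 ^ 2 * N 0 0 + 3 * N 0 1 ^ 2 * N 1 1 * N 1 0)
    + Φ.e * (6 * N 0 1 ^ 2 * N 1 1 ^ 2)
  d := Φ.a * (4 * N 1 0 ^ 3 * N 0 0) + Φ.b * (3 * N 1 0 ^ 2 * N 0 0 * N 1 1 + N 1 0 ^ 3 * N 0 1)
    + Φ.c * (2 * N 1 0 * N 0 0 * N 1 1 ^ 2 + 2 * N 1 0 ^ 2 * N 1 1 * N 0 1)
    + Φ.d * (N 0 0 * N 1 1 ^ 3 + 3 * N 1 0 * N 1 1 ^ 2 * N 0 1) + Φ.e * (4 * N 1 1 ^ 3 * N 0 1)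
  e := Φ.Q (N 1)

/-- The substitution `y ← μ⁻¹ y`, with the equation multiplied by `μ²`. -/
def scale (μ : R) (Φ : Quartic R) : Quartic R where
  l := μ * Φ.l
  m := μ * Φ.m
  n := μ * Φ.n
  a := μ ^ 2 * Φ.a
  b := μ ^ 2 * Φ.b
  c := μ ^ 2 * Φ.c
  d := μ ^ 2 * Φ.d
  e := μ ^ 2 * Φ.e

theorem P_shift (r : Fin 3 → R) (Φ : Quartic R) {A : Type*} [CommRing A] [Algebra R A]
    (x : Fin 2 → A) : (Φ.shift r).P x =
      Φ.P x + 2 * (r 0 • x 0 ^ 2 + r 1 • (x 0 * x 1) + r 2 • x 1 ^ 2) := by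
  simp [shift, P, Algebra.smul_def, map_ofNat]; ring

theorem Q_shift (r : Fin 3 → R) (Φ : Quartic R) {A : Type*} [CommRing A] [Algebra R A]
    (x : Fin 2 → A) : (Φ.shift r).Q x =
      Φ.Q x - (r 0 • x 0 ^ 2 + r 1 • (x 0 * x 1) + r 2 • x 1 ^ 2) * Φ.P x
        - (r 0 • x 0 ^ 2 + r 1 • (x 0 * x 1) + r 2 • x 1 ^ 2) ^ 2 := by
  simp [shift, P, Q, Algebra.smul_def, map_ofNat]; ring

theorem P_subst (N : Matrix (Fin 2) (Fin 2) R) (Φ : Quartic R) {A : Type*} [CommRing A]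
    [Algebra R A] (x : Fin 2 → A) :
    (Φ.subst N).P x = Φ.P ![N 0 0 • x 0 + N 1 0 • x 1, N 0 1 • x 0 + N 1 1 • x 1] := by
  simp [subst, P, Algebra.smul_def, map_ofNat]; ring

theorem Q_subst (N : Matrix (Fin 2) (Fin 2) R) (Φ : Quartic R) {A : Type*} [CommRing A]
    [Algebra R A] (x : Fin 2 → A) :
    (Φ.subst N).Q x = Φ.Q ![N 0 0 • x 0 + N 1 0 • x 1, N 0 1 • x 0 + N 1 1 • x 1] := by
  simp [subst, Q, Algebra.smul_def, map_ofNat]; ring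

theorem P_scale (μ : R) (Φ : Quartic R) {A : Type*} [CommRing A] [Algebra R A] (x : Fin 2 → A) :
    (Φ.scale μ).P x = μ • Φ.P x := by
  simp [scale, P, Algebra.smul_def, map_ofNat]; ring

theorem Q_scale (μ : R) (Φ : Quartic R) {A : Type*} [CommRing A] [Algebra R A] (x : Fin 2 → A) :
    (Φ.scale μ).Q x = μ ^ 2 • Φ.Q x := by
  simp [scale, Q, Algebra.smul_def, map_ofNat]; ring

theorem linSubst_two (N : Matrix (Fin 2) (Fin 2) R) :
    linSubst N = ![N 0 0 • X 0 + N 1 0 • X 1, N 0 1 • X 0 + N 1 1 • X 1] := by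
  ext j : 1
  fin_cases j <;> simp [linSubst, smul_eq_C_mul]

/-- The data determine the transformed model, so the relation becomes a composite of three explicit
operations, whose effects on the discriminant and on singular points are computed separately. -/
theorem isTransform_iff {μ : R} {r : Fin 3 → R} {N : Matrix (Fin 2) (Fin 2) R}
    {Φ Φ' : Quartic R} : IsTransform μ r N Φ Φ' ↔ Φ' = ((Φ.shift r).subst N).scale μ := by
  have hP : (((Φ.shift r).subst N).scale μ).P (X : Fin 2 → MvPolynomial (Fin 2) R) =
      C μ * (Φ.P (linSubst N) + 2 * (C (r 0) * linSubst N 0 ^ 2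
        + C (r 1) * (linSubst N 0 * linSubst N 1) + C (r 2) * linSubst N 1 ^ 2)) := by
    rw [P_scale, P_subst, P_shift, linSubst_two, smul_eq_C_mul]
    simp [smul_eq_C_mul]
  have hQ : (((Φ.shift r).subst N).scale μ).Q (X : Fin 2 → MvPolynomial (Fin 2) R) =
      C (μ ^ 2) * (Φ.Q (linSubst N) - (C (r 0) * linSubst N 0 ^ 2
        + C (r 1) * (linSubst N 0 * linSubst N 1) + C (r 2) * linSubst N 1 ^ 2) * Φ.P (linSubst N)
        - (C (r 0) * linSubst N 0 ^ 2
        + C (r 1) * (linSubst N 0 * linSubst N 1) + C (r 2) * linSubst N 1 ^ 2) ^ 2) := by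
    rw [Q_scale, Q_subst, Q_shift, linSubst_two, smul_eq_C_mul]
    simp [smul_eq_C_mul]
  constructor
  · rintro ⟨h1, h2⟩
    exact ext_of_forms (h1.trans hP.symm) (h2.trans hQ.symm)
  · rintro rfl
    exact ⟨hP, hQ⟩

theorem subst_one (Φ : Quartic R) : Φ.subst 1 = Φ := by
  cases Φ; simp [subst, P, Q]

theorem scale_one (Φ : Quartic R) : Φ.scale 1 = Φ := by
  cases Φ; simp [scale]

/-- The coefficients of the binary quartic `P² + 4 Q`. -/
def completed (Φ : Quartic R) : Fin 5 → R :=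
  ![Φ.l ^ 2 + 4 * Φ.a, 2 * Φ.l * Φ.m + 4 * Φ.b, Φ.m ^ 2 + 2 * Φ.l * Φ.n + 4 * Φ.c,
    2 * Φ.m * Φ.n + 4 * Φ.d, Φ.n ^ 2 + 4 * Φ.e]

/-- The invariant of degree 2 of a binary quartic. -/
def invI (g : Fin 5 → R) : R := 12 * g 0 * g 4 - 3 * g 1 * g 3 + g 2 ^ 2

/-- The invariant of degree 3 of a binary quartic. -/
def invJ (g : Fin 5 → R) : R :=
  72 * g 0 * g 2 * g 4 + 9 * g 1 * g 2 * g 3 - 27 * g 0 * g 3 ^ 2 - 27 * g 4 * g 1 ^ 2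
    - 2 * g 2 ^ 3

theorem c₄_jacobian (Φ : Quartic R) : Φ.jacobian.c₄ = invI Φ.completed := by
  simp [jacobian, invI, completed, WeierstrassCurve.c₄, WeierstrassCurve.b₂, WeierstrassCurve.b₄]
  ring

theorem c₆_jacobian (Φ : Quartic R) : 2 * Φ.jacobian.c₆ = invJ Φ.completed := by
  simp [jacobian, invJ, completed, WeierstrassCurve.c₆, WeierstrassCurve.b₂, WeierstrassCurve.b₄,
    WeierstrassCurve.b₆]
  ring

/-- The relation 1728 Δ = c₄³ - c₆², multiplied by 4 because the cubic invariant is 2 c₆. In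
characteristic zero the factor 6912 cancels, so the behaviour of Δ follows from that of the
classical invariants of P² + 4Q. -/
theorem disc_eq (Φ : Quartic R) :
    6912 * Φ.disc = 4 * invI Φ.completed ^ 3 - invJ Φ.completed ^ 2 := by
  rw [← c₄_jacobian, ← c₆_jacobian, disc]
  linear_combination 4 * Φ.jacobian.c_relation

/-- The coefficients of the binary quartic `g` after the substitution given by `N`. -/
def substCoeffs (N : Matrix (Fin 2) (Fin 2) R) (g : Fin 5 → R) : Fin 5 → R :=
  let Φ : Quartic R := (⟨0, 0, 0, g 0, g 1, g 2, g 3, g 4⟩ : Quartic R).subst N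
  ![Φ.a, Φ.b, Φ.c, Φ.d, Φ.e]

theorem invI_substCoeffs (N : Matrix (Fin 2) (Fin 2) R) (g : Fin 5 → R) :
    invI (substCoeffs N g) = N.det ^ 4 * invI g := by
  simp [invI, substCoeffs, subst, Q, Matrix.det_fin_two]; ring

theorem invJ_substCoeffs (N : Matrix (Fin 2) (Fin 2) R) (g : Fin 5 → R) :
    invJ (substCoeffs N g) = N.det ^ 6 * invJ g := by
  simp [invJ, substCoeffs, subst, Q, Matrix.det_fin_two]; ring

theorem completed_subst (N : Matrix (Fin 2) (Fin 2) R) (Φ : Quartic R) :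
    (Φ.subst N).completed = substCoeffs N Φ.completed := by
  ext i
  fin_cases i <;> simp [completed, substCoeffs, subst, P, Q] <;> ring

theorem completed_shift (r : Fin 3 → R) (Φ : Quartic R) :
    (Φ.shift r).completed = Φ.completed := by
  ext i
  fin_cases i <;> simp [completed, shift] <;> ring

theorem disc_scale (μ : R) (Φ : Quartic R) : (Φ.scale μ).disc = μ ^ 12 * Φ.disc := by
  simp [disc, jacobian, scale, WeierstrassCurve.Δ, WeierstrassCurve.b₂, WeierstrassCurve.b₄,
    WeierstrassCurve.b₆, WeierstrassCurve.b₈]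
  ring

/-- Completing the square: P² + 4Q does not see a shift of y. -/
theorem disc_shift [IsDomain R] [CharZero R] (r : Fin 3 → R) (Φ : Quartic R) :
    (Φ.shift r).disc = Φ.disc := by
  apply mul_left_cancel₀ (show (6912 : R) ≠ 0 by norm_num)
  rw [disc_eq, disc_eq, completed_shift]

theorem disc_subst [IsDomain R] [CharZero R] (N : Matrix (Fin 2) (Fin 2) R) (Φ : Quartic R) :
    (Φ.subst N).disc = N.det ^ 12 * Φ.disc := by
  apply mul_left_cancel₀ (show (6912 : R) ≠ 0 by norm_num)
  rw [disc_eq, completed_subst, invI_substCoeffs, invJ_substCoeffs]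
  linear_combination -N.det ^ 12 * Φ.disc_eq

end Quartic

end GenusOne

/-! ### Valuations, and divisibility of Δ by means of singular points in degree 2. -/

namespace GenusOne

section LocalRing

variable {R : Type*} [CommRing R] [IsDomain R] [IsDiscreteValuationRing R] {π : R}

theorem residue_eq_zero_iff (hπ : Irreducible π) {r : R} :
    algebraMap R (IsLocalRing.ResidueField R) r = 0 ↔ π ∣ r := by
  rw [IsLocalRing.ResidueField.algebraMap_eq, IsLocalRing.residue_eq_zero_iff,
    hπ.maximalIdeal_eq, Ideal.mem_span_singleton]

theorem not_dvd_iff_isUnit (hπ : Irreducible π) {r : R} : ¬ π ∣ r ↔ IsUnit r := by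
  rw [← residue_eq_zero_iff hπ, IsLocalRing.ResidueField.algebraMap_eq,
    ← ne_eq, IsLocalRing.residue_ne_zero_iff_isUnit]

theorem exists_lift {n : ℕ} (p : Fin n → IsLocalRing.ResidueField R) :
    ∃ q : Fin n → R, IsLift q p := by
  choose q hq using fun i => IsLocalRing.residue_surjective (p i)
  exact ⟨q, hq⟩

theorem IsLift.exists_eq_add (hπ : Irreducible π) {n : ℕ}
    {p : Fin n → IsLocalRing.ResidueField R} {q q' : Fin n → R} (h : IsLift q p)
    (h' : IsLift q' p) : ∃ d : Fin n → R, q' = fun i => q i + π * d i := by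
  have : ∀ i, π ∣ q' i - q i := fun i => by
    rw [← residue_eq_zero_iff hπ, map_sub, h i, h' i, sub_self]
  choose d hd using this
  exact ⟨d, funext fun i => by rw [← hd i]; ring⟩

/-- Non-regular points are singular points modulo `π`, at each of their lifts. -/
theorem singMod_one_of_lift (hπ : Irreducible π) {n : ℕ} {f : MvPolynomial (Fin n) R}
    {p : Fin n → IsLocalRing.ResidueField R} {q₀ q : Fin n → R}
    (hg : grad (map (algebraMap R (IsLocalRing.ResidueField R)) f) p = 0)
    (h₀ : IsLift q₀ p) (h : IsLift q p) (hf : π ^ 2 ∣ eval q₀ f) : SingMod π 1 f q := by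
  have hgrad : ∀ q : Fin n → R, IsLift q p → ∀ i, π ∣ grad f q i := by
    intro q hq i
    rw [← residue_eq_zero_iff hπ, ← grad_map, show (fun j => algebraMap R _ (q j)) = p from
      funext hq, hg]
    rfl
  refine ⟨?_, fun i => by simpa using hgrad q h i⟩
  obtain ⟨d, rfl⟩ := h₀.exists_eq_add hπ h
  -- By Taylor's formula the value changes, modulo π², by π times a combination of partial
  -- derivatives, which are divisible by π. So vanishing modulo π² at one lift implies it at every
  -- lift.
  have h1 := sq_dvd_eval_add_sub f π q₀ d
  have h2 : π ^ 2 ∣ π * ∑ i, d i * grad f q₀ i := by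
    rw [sq]
    exact mul_dvd_mul_left _ (Finset.dvd_sum fun i _ => (hgrad q₀ h₀ i).mul_left _)
  have := dvd_add (dvd_add h1 h2) hf
  simpa using this

theorem addVal_pow_mul (hπ : Irreducible π) (n : ℕ) (x : R) :
    IsDiscreteValuationRing.addVal R (π ^ n * x) = n + IsDiscreteValuationRing.addVal R x := by
  rw [IsDiscreteValuationRing.addVal_mul, IsDiscreteValuationRing.addVal_pow,
    IsDiscreteValuationRing.addVal_uniformizer hπ]
  simp

theorem le_addVal_of_pow_dvd (hπ : Irreducible π) {n : ℕ} {x : R} (h : π ^ n ∣ x) :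
    (n : ℕ∞) ≤ IsDiscreteValuationRing.addVal R x := by
  obtain ⟨y, rfl⟩ := h
  rw [addVal_pow_mul hπ]
  exact le_self_add

end LocalRing

/-- The discriminant has order two where `a₃` and `a₄` have order one and `a₆` has order two. -/
theorem sq_dvd_delta {R : Type*} [CommRing R] {s : R} {W : WeierstrassCurve R} (h₃ : s ∣ W.a₃)
    (h₄ : s ∣ W.a₄) (h₆ : s ^ 2 ∣ W.a₆) : s ^ 2 ∣ W.Δ := by
  obtain ⟨a1, a2, a3, a4, a6⟩ := W
  obtain ⟨x, rfl⟩ := h₃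
  obtain ⟨y, rfl⟩ := h₄
  obtain ⟨z, rfl⟩ := h₆
  simp only [WeierstrassCurve.Δ, WeierstrassCurve.b₂, WeierstrassCurve.b₄,
    WeierstrassCurve.b₆, WeierstrassCurve.b₈]
  refine ⟨-(a1 ^ 2 + 4 * a2) ^ 2 * (a1 ^ 2 * z + 4 * a2 * z - a1 * x * y + a2 * x ^ 2 - y ^ 2)
    - 8 * s * (2 * y + a1 * x) ^ 3 - 27 * s ^ 2 * (x ^ 2 + 4 * z) ^ 2
    + 9 * (a1 ^ 2 + 4 * a2) * s * (2 * y + a1 * x) * (x ^ 2 + 4 * z), by ring⟩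

/-- The discriminant is homogeneous of weight 12. -/
theorem delta_of_weights {R : Type*} [CommRing R] {s : R} {W W' : WeierstrassCurve R}
    (h1 : W'.a₁ = s * W.a₁) (h2 : W'.a₂ = s ^ 2 * W.a₂) (h3 : W'.a₃ = s ^ 3 * W.a₃)
    (h4 : W'.a₄ = s ^ 4 * W.a₄) (h6 : W'.a₆ = s ^ 6 * W.a₆) : W'.Δ = s ^ 12 * W.Δ := by
  simp only [WeierstrassCurve.Δ, WeierstrassCurve.b₂, WeierstrassCurve.b₄,
    WeierstrassCurve.b₆, WeierstrassCurve.b₈, h1, h2, h3, h4, h6]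
  ring

namespace Quartic

variable {R : Type*} [CommRing R]

/-- The hypotheses describe a singular point modulo π^m at x₁ = y = 0. Each monomial of a₃ and a₄
contains one of n, d, e, and each monomial of a₆ contains e or two factors among n, d. -/
theorem dvd_disc {π : R} {m : ℕ} {Φ : Quartic R} (hn : π ^ m ∣ Φ.n) (hd : π ^ m ∣ Φ.d)
    (he : π ^ (2 * m) ∣ Φ.e) : π ^ (2 * m) ∣ Φ.disc := by
  obtain ⟨l, μ, n, a, b, c, d, e⟩ := Φ
  obtain ⟨n, rfl⟩ := hn
  obtain ⟨d, rfl⟩ := hd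
  obtain ⟨e, rfl⟩ := he
  rw [pow_mul'] at *
  set s := π ^ m
  apply sq_dvd_delta
  · exact ⟨l * d + n * b, by simp only [jacobian]; ring⟩
  · exact ⟨-(l ^ 2 * s * e) - l * n * c - n ^ 2 * s * a - 4 * a * s * e + b * d,
      by simp only [jacobian]; ring⟩
  · exact ⟨-(l ^ 2 * c * e) + l * μ * b * e - l * n * b * d - μ ^ 2 * a * e + μ * n * a * d
      - n ^ 2 * a * c - 4 * a * c * e + a * d ^ 2 + b ^ 2 * e, by simp only [jacobian]; ring⟩

/-- The quadratic form `r₀ x₁² + r₁ x₁x₂ + r₂ x₂²`. -/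
def shiftForm (r : Fin 3 → R) (x y : R) : R := r 0 * x ^ 2 + r 1 * (x * y) + r 2 * y ^ 2

theorem form_shift (r : Fin 3 → R) (Φ : Quartic R) (q : Fin 3 → R) :
    (Φ.shift r).form q = Φ.form ![q 0, q 1, q 2 + shiftForm r (q 0) (q 1)] := by
  simp [form, P, Q, shift, shiftForm]; ring

theorem grad_shift (r : Fin 3 → R) (Φ : Quartic R) (q : Fin 3 → R) :
    let g := grad Φ.poly ![q 0, q 1, q 2 + shiftForm r (q 0) (q 1)]
    grad (Φ.shift r).poly q = ![g 0 + (2 * r 0 * q 0 + r 1 * q 1) * g 2,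
      g 1 + (r 1 * q 0 + 2 * r 2 * q 1) * g 2, g 2] := by
  simp only [grad_poly]
  ext i
  fin_cases i <;> simp [P, shift, shiftForm] <;> ring

theorem form_subst (N : Matrix (Fin 2) (Fin 2) R) (Φ : Quartic R) (q : Fin 3 → R) :
    (Φ.subst N).form q =
      Φ.form ![N 0 0 * q 0 + N 1 0 * q 1, N 0 1 * q 0 + N 1 1 * q 1, q 2] := by
  simp [form, P, Q, subst]; ring

theorem grad_subst (N : Matrix (Fin 2) (Fin 2) R) (Φ : Quartic R) (q : Fin 3 → R) :
    let g := grad Φ.poly ![N 0 0 * q 0 + N 1 0 * q 1, N 0 1 * q 0 + N 1 1 * q 1, q 2]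
    grad (Φ.subst N).poly q = ![N 0 0 * g 0 + N 0 1 * g 1, N 1 0 * g 0 + N 1 1 * g 1, g 2] := by
  simp only [grad_poly]
  ext i
  fin_cases i <;> simp [P, Q, subst] <;> ring

theorem form_scale (μ : R) (Φ : Quartic R) (x y z : R) :
    (Φ.scale μ).form ![x, y, μ * z] = μ ^ 2 * Φ.form ![x, y, z] := by
  simp [form, P, Q, scale]; ring

theorem grad_scale (μ : R) (Φ : Quartic R) (x y z : R) :
    let g := grad Φ.poly ![x, y, z]
    grad (Φ.scale μ).poly ![x, y, μ * z] = ![μ ^ 2 * g 0, μ ^ 2 * g 1, μ * g 2] := by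
  simp only [grad_poly]
  ext i
  fin_cases i <;> simp [P, Q, scale] <;> ring

theorem SingMod_iff {π : R} {m : ℕ} {Φ : Quartic R} {q : Fin 3 → R} :
    SingMod π m Φ.poly q ↔ π ^ (2 * m) ∣ Φ.form q ∧ π ^ m ∣ grad Φ.poly q 0 ∧
      π ^ m ∣ grad Φ.poly q 1 ∧ π ^ m ∣ grad Φ.poly q 2 := by
  simp [SingMod, eval_poly, Fin.forall_fin_succ]

theorem singMod_shift {π : R} {m : ℕ} {r : Fin 3 → R} {Φ : Quartic R} {q : Fin 3 → R} :
    SingMod π m (Φ.shift r).poly q ↔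
      SingMod π m Φ.poly ![q 0, q 1, q 2 + shiftForm r (q 0) (q 1)] := by
  rw [SingMod_iff, SingMod_iff, form_shift, grad_shift]
  simp only [Matrix.cons_val]
  refine and_congr_right fun _ => ⟨fun ⟨h0, h1, h2⟩ => ⟨?_, ?_, h2⟩,
    fun ⟨h0, h1, h2⟩ => ⟨dvd_add h0 (h2.mul_left _), dvd_add h1 (h2.mul_left _), h2⟩⟩
  · exact (dvd_add_left (h2.mul_left _)).1 h0
  · exact (dvd_add_left (h2.mul_left _)).1 h1

theorem dvd_of_dvd_mulVec_two {s a b : R} {N : Matrix (Fin 2) (Fin 2) R} (hN : IsUnit N.det)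
    (h0 : s ∣ N 0 0 * a + N 0 1 * b) (h1 : s ∣ N 1 0 * a + N 1 1 * b) : s ∣ a ∧ s ∣ b := by
  rw [Matrix.det_fin_two] at hN
  rw [← hN.dvd_mul_left, ← hN.dvd_mul_left (b := b)]
  constructor
  · convert dvd_sub (h0.mul_left (N 1 1)) (h1.mul_left (N 0 1)) using 1; ring
  · convert dvd_sub (h1.mul_left (N 0 0)) (h0.mul_left (N 1 0)) using 1; ring

theorem singMod_subst {π : R} {m : ℕ} {N : Matrix (Fin 2) (Fin 2) R} (hN : IsUnit N.det)
    {Φ : Quartic R} {q : Fin 3 → R} (h : SingMod π m (Φ.subst N).poly q) :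
    SingMod π m Φ.poly ![N 0 0 * q 0 + N 1 0 * q 1, N 0 1 * q 0 + N 1 1 * q 1, q 2] := by
  rw [SingMod_iff] at h ⊢
  rw [form_subst, grad_subst] at h
  simp only [Matrix.cons_val] at h
  obtain ⟨h, h0, h1, h2⟩ := h
  obtain ⟨h0, h1⟩ := dvd_of_dvd_mulVec_two hN h0 h1
  exact ⟨h, h0, h1, h2⟩

theorem singMod_scale {π : R} {m : ℕ} {μ : R} (hμ : IsUnit μ) {Φ : Quartic R} {x y z : R}
    (h : SingMod π m (Φ.scale μ).poly ![x, y, μ * z]) : SingMod π m Φ.poly ![x, y, z] := by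
  rw [SingMod_iff, form_scale, grad_scale] at h
  simp only [Matrix.cons_val, hμ.dvd_mul_left, (hμ.pow 2).dvd_mul_left] at h
  exact SingMod_iff.2 h

/-- Here `μ` may be π: singular points survive when a division in Step (i) is undone. -/
theorem scale_singMod {π : R} {m : ℕ} {Φ : Quartic R} {x y z : R} (μ : R)
    (h : SingMod π m Φ.poly ![x, y, z]) : SingMod π m (Φ.scale μ).poly ![x, y, μ * z] := by
  rw [SingMod_iff] at h
  rw [SingMod_iff, form_scale, grad_scale]
  exact ⟨h.1.mul_left _, h.2.1.mul_left _, h.2.2.1.mul_left _, h.2.2.2.mul_left _⟩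

/-- The coefficients after moving a point to `(0 : 1 : 0)`. -/
theorem coeffs_move (N : Matrix (Fin 2) (Fin 2) R) (r : Fin 3 → R) (Φ : Quartic R) :
    let q := ![N 1 0, N 1 1, shiftForm r (N 1 0) (N 1 1)]
    let g := grad Φ.poly q
    ((Φ.shift r).subst N).n = g 2 ∧ ((Φ.shift r).subst N).e = -Φ.form q ∧
    ((Φ.shift r).subst N).d = -(N 0 0 * (g 0 + (2 * r 0 * N 1 0 + r 1 * N 1 1) * g 2)
      + N 0 1 * (g 1 + (r 1 * N 1 0 + 2 * r 2 * N 1 1) * g 2)) := by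
  simp only [grad_poly]
  refine ⟨?_, ?_, ?_⟩ <;> simp [form, P, Q, shift, subst, shiftForm] <;> ring

/-- At a coordinate point the value and the partial derivatives are, up to sign, coefficients of the
model. -/
theorem dvd_coeffs_move {π : R} {m : ℕ} {N : Matrix (Fin 2) (Fin 2) R} {r : Fin 3 → R}
    {Φ : Quartic R}
    (h : SingMod π m Φ.poly ![N 1 0, N 1 1, shiftForm r (N 1 0) (N 1 1)]) :
    π ^ m ∣ ((Φ.shift r).subst N).n ∧ π ^ m ∣ ((Φ.shift r).subst N).d ∧
      π ^ (2 * m) ∣ ((Φ.shift r).subst N).e := by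
  obtain ⟨h1, h2, h3⟩ := coeffs_move N r Φ
  rw [h1, h2, h3]
  rw [SingMod_iff] at h
  refine ⟨h.2.2.2, (dvd_neg).2 (dvd_add (dvd_mul_of_dvd_right ?_ _)
    (dvd_mul_of_dvd_right ?_ _)), (dvd_neg).2 h.1⟩
  · exact dvd_add h.2.1 (h.2.2.2.mul_left _)
  · exact dvd_add h.2.2.1 (h.2.2.2.mul_left _)

theorem dvd_disc_of_singMod [IsDomain R] [CharZero R] {π : R} {m : ℕ} {Φ : Quartic R}
    {q : Fin 3 → R} (hq : IsUnit (q 1)) (h : SingMod π m Φ.poly q) : π ^ (2 * m) ∣ Φ.disc := by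
  obtain ⟨u, hu⟩ := hq
  -- The matrix carries (0 : 1) to (q₀ : q₁), and the shift by q₂/q₁² times x₂² carries y = 0 to y =
  -- q₂. Both exist because q₁ is a unit.
  have hN : (!![1, 0; q 0, q 1] : Matrix (Fin 2) (Fin 2) R).det = u := by
    simp [Matrix.det_fin_two, hu]
  have hr : ![q 0, q 1, shiftForm ![0, 0, ↑u⁻¹ ^ 2 * q 2] (q 0) (q 1)] = q := by
    ext i
    fin_cases i
    · rfl
    · rfl
    · simp only [shiftForm, ← hu]
      simp
      linear_combination (q 2 * (↑u⁻¹ * ↑u) + q 2) * u.inv_mul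
  obtain ⟨h1, h2, h3⟩ := dvd_coeffs_move (N := !![1, 0; q 0, q 1])
    (r := ![0, 0, ↑u⁻¹ ^ 2 * q 2]) (Φ := Φ) (π := π) (m := m) (by simpa [hr] using h)
  have := dvd_disc h1 h2 h3
  rwa [disc_subst, disc_shift, hN, (u.isUnit.pow 12).dvd_mul_left] at this

end Quartic

end GenusOne

/-! ### Degree 2: the steps of the local solubility test. -/

namespace GenusOne

section LocalRing

variable {R : Type*} [CommRing R] [IsDomain R] [IsDiscreteValuationRing R] {π : R}

theorem isUnit_of_residue_eq_mul {x : R} {c : IsLocalRing.ResidueField R} (hπ : Irreducible π)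
    (hc : c ≠ 0) {p : IsLocalRing.ResidueField R} (hp : p ≠ 0)
    (hx : algebraMap R _ x = c * p) : IsUnit x := by
  rw [← not_dvd_iff_isUnit hπ, ← residue_eq_zero_iff hπ, hx]
  exact mul_ne_zero hc hp

end LocalRing

namespace Quartic

variable {R : Type*} [CommRing R]

theorem C_mul_P_eq_iff {π : R} {Φ Ψ : Quartic R} :
    (C π * Φ.P (X : Fin 2 → MvPolynomial (Fin 2) R) = Ψ.P X ∧
      C (π ^ 2) * Φ.Q (X : Fin 2 → MvPolynomial (Fin 2) R) = Ψ.Q X) ↔ Ψ = Φ.scale π := by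
  constructor
  · rintro ⟨h1, h2⟩
    apply ext_of_forms
    · rw [P_scale, ← h1, smul_eq_C_mul]
    · rw [Q_scale, ← h2, smul_eq_C_mul]
  · rintro rfl
    rw [P_scale, Q_scale, smul_eq_C_mul, smul_eq_C_mul]
    exact ⟨rfl, rfl⟩

theorem exists_eq_scale {π : R} {Φ : Quartic R}
    (hP : C π ∣ Φ.P (X : Fin 2 → MvPolynomial (Fin 2) R))
    (hQ : C (π ^ 2) ∣ Φ.Q (X : Fin 2 → MvPolynomial (Fin 2) R)) : ∃ Ψ : Quartic R, Φ = Ψ.scale π := by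
  obtain ⟨l, m, n, a, b, c, d, e⟩ := Φ
  rw [C_dvd_P] at hP
  rw [C_dvd_Q] at hQ
  obtain ⟨⟨l, rfl⟩, ⟨m, rfl⟩, ⟨n, rfl⟩⟩ := hP
  obtain ⟨⟨a, rfl⟩, ⟨b, rfl⟩, ⟨c, rfl⟩, ⟨d, rfl⟩, ⟨e, rfl⟩⟩ := hQ
  exact ⟨⟨l, m, n, a, b, c, d, e⟩, rfl⟩

theorem shift_shift (r s : Fin 3 → R) (Φ : Quartic R) :
    (Φ.shift r).shift s = Φ.shift (r + s) := by
  cases Φ; simp only [shift, Pi.add_apply, mk.injEq]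
  refine ⟨?_, ?_, ?_, ?_, ?_, ?_, ?_, ?_⟩ <;> ring

theorem subst_diag (π : R) (Φ : Quartic R) : Φ.subst !![π, 0; 0, 1] =
    ⟨π ^ 2 * Φ.l, π * Φ.m, Φ.n, π ^ 4 * Φ.a, π ^ 3 * Φ.b, π ^ 2 * Φ.c, π * Φ.d, Φ.e⟩ := by
  simp [subst, P, Q]
  refine ⟨?_, ?_, ?_, ?_, ?_, ?_⟩ <;> ring

theorem isTransform_shift_iff {r : Fin 3 → R} {Φ Ψ : Quartic R} :
    IsTransform 1 r 1 Φ Ψ ↔ Ψ = Φ.shift r := by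
  rw [isTransform_iff, subst_one, scale_one]

variable [IsDomain R] [IsDiscreteValuationRing R] {π : R}

theorem nonRegular_lift (hπ : Irreducible π) {Φ : Quartic R} {affine : Bool}
    {p : Fin 3 → IsLocalRing.ResidueField R} (hp : p ∈ Φ.nonRegular π affine) {q : Fin 3 → R}
    (hq : IsLift q p) : SingMod π 1 Φ.poly q := by
  obtain ⟨-, -, h1, h2, q₀, h3, h4⟩ := hp
  refine singMod_one_of_lift hπ ?_ h3 hq (by rwa [eval_poly])
  rw [← form_X_eq_map]
  by_contra h
  exact h2 ⟨h1, h⟩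

/-- A step of the recursion of the local solubility test. -/
theorem calls_search_iff {Φ : Quartic R} {t : Stage (Quartic R)}
    (h : Calls (isLocallySoluble π) (.search Φ) t) :
    ∃ p ∈ Φ.nonRegular π true, ∃ u : R, algebraMap R _ u = p 0 ∧
      t = .normalise (Φ.subst !![π, 0; u, 1]) := by
  obtain ⟨calls, ⟨-, rfl⟩ | ⟨-, hc⟩, ht⟩ := h
  · simp at ht
  · obtain ⟨p, hp, u, Φ₁, hu, h1, h2, rfl⟩ := hc.exists_of_mem ht
    refine ⟨p, hp, u, hu, ?_⟩
    congr 1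
    have hx : (![C u * X 1 + C π * X 0, X 1] : Fin 2 → MvPolynomial (Fin 2) R) =
        ![π • X 0 + u • X 1, (0 : R) • X 0 + (1 : R) • X 1] := by
      simp [smul_eq_C_mul, add_comm]
    apply ext_of_forms
    · rw [h1, P_subst, hx]; rfl
    · rw [h2, Q_subst, hx]; rfl

/-- The choice of Step (i). -/
def IsGoodShift (π : R) (r : Fin 3 → R) (Φ : Quartic R) : Prop :=
  (∃ r' : Fin 3 → R, C π ∣ (Φ.shift r').P (X : Fin 2 → MvPolynomial (Fin 2) R) ∧
      C π ∣ (Φ.shift r').Q (X : Fin 2 → MvPolynomial (Fin 2) R)) →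
    C π ∣ (Φ.shift r).P (X : Fin 2 → MvPolynomial (Fin 2) R) ∧
      C π ∣ (Φ.shift r).Q (X : Fin 2 → MvPolynomial (Fin 2) R)

theorem exists_isGoodShift (π : R) (Φ : Quartic R) : ∃ r, IsGoodShift π r Φ := by
  by_cases h : ∃ r' : Fin 3 → R, C π ∣ (Φ.shift r').P (X : Fin 2 → MvPolynomial (Fin 2) R) ∧
      C π ∣ (Φ.shift r').Q (X : Fin 2 → MvPolynomial (Fin 2) R)
  · exact ⟨h.choose, fun _ => h.choose_spec⟩
  · exact ⟨0, fun h' => absurd h' h⟩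

theorem isLocallySoluble_normalise_iff {Φ : Quartic R} {calls : List (Stage (Quartic R))} :
    isLocallySoluble π (.normalise Φ) calls ↔ ∃ r, IsGoodShift π r Φ ∧
      ((∃ Ψ₁ : Quartic R, Φ.shift r = Ψ₁.scale π ∧ calls = [.normalise Ψ₁]) ∨
      (¬ (C π ∣ (Φ.shift r).P (X : Fin 2 → MvPolynomial (Fin 2) R) ∧
          C (π ^ 2) ∣ (Φ.shift r).Q (X : Fin 2 → MvPolynomial (Fin 2) R)) ∧
        calls = [.search (Φ.shift r)])) := by
  simp only [isLocallySoluble, isTransform_shift_iff, IsGoodShift, ← and_assoc, C_mul_P_eq_iff]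
  simp only [and_assoc, exists_eq_left]

theorem exists_calls_normalise (π : R) (Φ : Quartic R) :
    ∃ calls, isLocallySoluble π (.normalise Φ) calls := by
  obtain ⟨r, hr⟩ := exists_isGoodShift π Φ
  simp only [isLocallySoluble_normalise_iff]
  by_cases h : C π ∣ (Φ.shift r).P (X : Fin 2 → MvPolynomial (Fin 2) R) ∧
          C (π ^ 2) ∣ (Φ.shift r).Q (X : Fin 2 → MvPolynomial (Fin 2) R)
  · obtain ⟨Ψ, hΨ⟩ := exists_eq_scale h.1 h.2
    exact ⟨_, r, hr, .inl ⟨Ψ, hΨ, rfl⟩⟩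
  · exact ⟨_, r, hr, .inr ⟨h, rfl⟩⟩

theorem exists_calls_search [Finite (IsLocalRing.ResidueField R)] (π : R) (Φ : Quartic R) :
    ∃ calls, isLocallySoluble π (.search Φ) calls := by
  by_cases h : ∃ p : Fin 3 → IsLocalRing.ResidueField R, p 1 = 1 ∧ Φ.IsSmoothAt p
  · exact ⟨[], .inl ⟨h, rfl⟩⟩
  · obtain ⟨calls, hc⟩ := ForEach.exists (Set.toFinite (Φ.nonRegular π true))
      (call := fun (p : Fin 3 → IsLocalRing.ResidueField R) (t : Stage (Quartic R)) =>
            ∃ (u : R) (Φ₁ : Quartic R),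
            algebraMap R (IsLocalRing.ResidueField R) u = p 0 ∧
            Φ₁.P (X : Fin 2 → MvPolynomial (Fin 2) R) = Φ.P ![C u * X 1 + C π * X 0, X 1] ∧
            Φ₁.Q (X : Fin 2 → MvPolynomial (Fin 2) R) = Φ.Q ![C u * X 1 + C π * X 0, X 1] ∧
            t = .normalise Φ₁) (by
        intro p _
        obtain ⟨u, hu⟩ := IsLocalRing.residue_surjective (p 0)
        refine ⟨_, u, Φ.subst !![π, 0; u, 1], hu, ?_, ?_, rfl⟩
        · rw [P_subst]; simp [smul_eq_C_mul, add_comm]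
        · rw [Q_subst]; simp [smul_eq_C_mul, add_comm])
    exact ⟨calls, .inr ⟨h, hc⟩⟩

/-- Modulo π the shifted Q is minus the square of r₀x₁² + r₁x₁x₂ + r₂x₂², which vanishes only if all
rᵢ do. Hence Step (i) has no bad choices once some choice gives P and Q divisible by π and π². -/
theorem dvd_shift_of_dvd (hπ : Irreducible π) {Φ : Quartic R} {r : Fin 3 → R}
    (hP : π ∣ Φ.l ∧ π ∣ Φ.m ∧ π ∣ Φ.n)
    (hQ : π ^ 2 ∣ Φ.a ∧ π ^ 2 ∣ Φ.b ∧ π ^ 2 ∣ Φ.c ∧ π ^ 2 ∣ Φ.d ∧ π ^ 2 ∣ Φ.e)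
    (h : C π ∣ (Φ.shift r).Q (X : Fin 2 → MvPolynomial (Fin 2) R)) :
    (∀ i, π ∣ r i) ∧ C (π ^ 2) ∣ (Φ.shift r).Q (X : Fin 2 → MvPolynomial (Fin 2) R) := by
  obtain ⟨l, m, n, a, b, c, d, e⟩ := Φ
  obtain ⟨⟨l, rfl⟩, ⟨m, rfl⟩, ⟨n, rfl⟩⟩ := hP
  obtain ⟨⟨a, rfl⟩, ⟨b, rfl⟩, ⟨c, rfl⟩, ⟨d, rfl⟩, ⟨e, rfl⟩⟩ := hQ
  have hp := hπ.prime
  rw [C_dvd_Q] at h ⊢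
  simp only [shift] at h ⊢
  obtain ⟨h0, -, h1, -, h2⟩ := h
  have k0 : π ∣ r 0 := by
    refine hp.dvd_of_dvd_pow (n := 2) ?_
    convert dvd_sub (Dvd.intro (π * a - r 0 * l) rfl) h0 using 1
    ring
  have k2 : π ∣ r 2 := by
    refine hp.dvd_of_dvd_pow (n := 2) ?_
    convert dvd_sub (Dvd.intro (π * e - r 2 * n) rfl) h2 using 1
    ring
  obtain ⟨s0, h0'⟩ := k0
  have k1 : π ∣ r 1 := by
    refine hp.dvd_of_dvd_pow (n := 2) ?_
    convert dvd_sub (Dvd.intro (π * c - r 0 * n - r 1 * m - r 2 * l - 2 * s0 * r 2) rfl) h1 using 1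
    rw [h0']
    ring
  obtain ⟨s1, h1'⟩ := k1
  obtain ⟨s2, h2'⟩ := k2
  refine ⟨fun i => ?_, ?_⟩
  · fin_cases i
    exacts [⟨_, h0'⟩, ⟨_, h1'⟩, ⟨_, h2'⟩]
  · rw [h0', h1', h2']
    exact ⟨⟨a - s0 * l - s0 ^ 2, by ring⟩, ⟨b - s0 * m - s1 * l - 2 * s0 * s1, by ring⟩,
      ⟨c - s0 * n - s1 * m - s2 * l - s1 ^ 2 - 2 * s0 * s2, by ring⟩,
      ⟨d - s1 * n - s2 * m - 2 * s1 * s2, by ring⟩, ⟨e - s2 * n - s2 ^ 2, by ring⟩⟩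

/-- After a recursive call, Step (i) divides the equation at least once. -/
theorem isGoodShift_after_call (hπ : Irreducible π) {Φ : Quartic R} {u y : R}
    (h : SingMod π 1 Φ.poly ![u, 1, y]) {r : Fin 3 → R}
    (hr : IsGoodShift π r (Φ.subst !![π, 0; u, 1])) :
    (π ∣ r 0 ∧ π ∣ r 1) ∧
      C π ∣ ((Φ.subst !![π, 0; u, 1]).shift r).P (X : Fin 2 → MvPolynomial (Fin 2) R) ∧
      C (π ^ 2) ∣ ((Φ.subst !![π, 0; u, 1]).shift r).Q (X : Fin 2 → MvPolynomial (Fin 2) R) := by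
  obtain ⟨hn, hd, he⟩ := dvd_coeffs_move (N := !![1, 0; u, 1]) (r := ![0, 0, y]) (Φ := Φ)
    (π := π) (m := 1) (by simpa [shiftForm] using h)
  set Φ₁ := Φ.subst !![π, 0; u, 1] with hΦ₁
  have hPQ : (π ∣ (Φ₁.shift ![0, 0, y]).l ∧ π ∣ (Φ₁.shift ![0, 0, y]).m ∧
      π ∣ (Φ₁.shift ![0, 0, y]).n) ∧ π ^ 2 ∣ (Φ₁.shift ![0, 0, y]).a ∧
      π ^ 2 ∣ (Φ₁.shift ![0, 0, y]).b ∧ π ^ 2 ∣ (Φ₁.shift ![0, 0, y]).c ∧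
      π ^ 2 ∣ (Φ₁.shift ![0, 0, y]).d ∧ π ^ 2 ∣ (Φ₁.shift ![0, 0, y]).e := by
    -- A multiple of x₂² is unaffected by a substitution that fixes x₂. So zooming in splits into a
    -- move of the singular point to x₁ = y = 0 and the substitution x₁ ← π x₁.
    have : Φ₁.shift ![0, 0, y] =
        ((Φ.shift ![0, 0, y]).subst !![1, 0; u, 1]).subst !![π, 0; 0, 1] := by
      simp [hΦ₁, shift, subst, P, Q]
      refine ⟨?_, ?_, ?_, ?_, ?_, ?_⟩ <;> ring
    rw [this]
    generalize (Φ.shift ![0, 0, y]).subst !![1, 0; u, 1] = Ψ at *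
    rw [pow_one] at hn hd
    rw [subst_diag]
    refine ⟨⟨?_, dvd_mul_right _ _, hn⟩, ?_, ?_, dvd_mul_right _ _, ?_, he⟩
    · exact (dvd_pow_self π two_ne_zero).mul_right _
    · exact (pow_dvd_pow π (by norm_num)).mul_right _
    · exact (pow_dvd_pow π (by norm_num)).mul_right _
    · rw [sq]
      exact mul_dvd_mul_left _ hd
  have hgood := hr ⟨![0, 0, y], C_dvd_P.2 hPQ.1, C_dvd_Q.2
    ⟨(dvd_pow_self π two_ne_zero).trans hPQ.2.1, (dvd_pow_self π two_ne_zero).trans hPQ.2.2.1,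
      (dvd_pow_self π two_ne_zero).trans hPQ.2.2.2.1,
      (dvd_pow_self π two_ne_zero).trans hPQ.2.2.2.2.1,
      (dvd_pow_self π two_ne_zero).trans hPQ.2.2.2.2.2⟩⟩
  have hrr : Φ₁.shift r = (Φ₁.shift ![0, 0, y]).shift (r - ![0, 0, y]) := by
    rw [shift_shift, add_sub_cancel]
  obtain ⟨h1, h2⟩ := dvd_shift_of_dvd hπ hPQ.1 hPQ.2 (hrr ▸ hgood.2)
  refine ⟨⟨by simpa using h1 0, by simpa using h1 1⟩, hgood.1, hrr ▸ h2⟩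

/-- Singular points modulo `π ^ m` after an iteration yield singular points modulo `π ^ (m + 1)`
before the iteration. -/
theorem singMod_of_call {m : ℕ} (hπ : Irreducible π) {Φ Ψ : Quartic R} {u x y : R} {r : Fin 3 → R}
    (hr0 : π ∣ r 0) (hr1 : π ∣ r 1) (hΨ : (Φ.subst !![π, 0; u, 1]).shift r = Ψ.scale π)
    (h : SingMod π m Ψ.poly ![x, 1, y]) :
    SingMod π (m + 1) Φ.poly ![π * x + u, 1, π * y + shiftForm r x 1] := by
  have hf := form_scale π Ψ x 1 y
  have hg := grad_scale π Ψ x 1 y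
  rw [← hΨ, form_shift, form_subst] at hf
  rw [← hΨ, grad_shift, grad_subst] at hg
  simp only [Matrix.cons_val, Matrix.of_apply, mul_one, zero_mul, zero_add] at hf hg
  rw [SingMod_iff] at h ⊢
  set g := grad Φ.poly ![π * x + u, 1, π * y + shiftForm r x 1]
  have hg0 := congrFun hg 0
  have hg1 := congrFun hg 1
  have hg2 := congrFun hg 2
  simp only [Matrix.cons_val] at hg0 hg1 hg2
  obtain ⟨h, h0, h1, h2⟩ := h
  have hπ0 := hπ.ne_zero
  have k2 : π ^ (m + 1) ∣ g 2 := by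
    rw [hg2, pow_succ']
    exact mul_dvd_mul_left _ h2
  have k0 : π ^ (m + 1) ∣ g 0 := by
    -- The derivative along x₁ acquired a factor π that has to be cancelled. The contribution (2 r₀
    -- x + r₁) g₂ of the shift allows this because `r 0` and `r 1` are divisible by π.
    have : π * π ^ (m + 1) ∣ π * g 0 := by
      have e : π * g 0 = π ^ 2 * grad Ψ.poly ![x, 1, y] 0 - (2 * r 0 * x + r 1) * g 2 := by
        linear_combination hg0
      rw [e]
      refine dvd_sub ?_ (mul_dvd_mul (dvd_add ((hr0.mul_left 2).mul_right _) hr1) k2)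
      rw [pow_succ', ← mul_assoc, ← sq]
      exact mul_dvd_mul_left _ h0
    exact (mul_dvd_mul_iff_left hπ0).1 this
  refine ⟨?_, k0, ?_, k2⟩
  · rw [hf, show 2 * (m + 1) = 2 + 2 * m by ring, pow_add]
    exact mul_dvd_mul_left _ h
  · have e : g 1 = π ^ 2 * grad Ψ.poly ![x, 1, y] 1 - u * g 0 - (r 1 * x + 2 * r 2) * g 2 := by
      linear_combination hg1
    rw [e]
    refine dvd_sub (dvd_sub ?_ (k0.mul_left _)) (k2.mul_left _)
    rw [pow_succ, mul_comm, sq]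
    exact mul_dvd_mul (dvd_mul_right _ _) h1

end Quartic

end GenusOne

/-! ### Binary quartics of discriminant zero, and Δ ≠ 0 in degree 2. -/

namespace GenusOne

namespace Quartic

section DoubleRoots

variable {L : Type*} [Field L]

/-- `g` has a double root in the projective line. -/
def HasDoubleRoot (g : Fin 5 → L) : Prop :=
  ∃ s t : L, (s ≠ 0 ∨ t ≠ 0) ∧
    4 * g 0 * s ^ 3 + 3 * g 1 * s ^ 2 * t + 2 * g 2 * s * t ^ 2 + g 3 * t ^ 3 = 0 ∧
    g 1 * s ^ 3 + 2 * g 2 * s ^ 2 * t + 3 * g 3 * s * t ^ 2 + 4 * g 4 * t ^ 3 = 0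

theorem HasDoubleRoot.of_subst {N : Matrix (Fin 2) (Fin 2) L} (hN : N.det ≠ 0) {g : Fin 5 → L}
    (h : HasDoubleRoot (substCoeffs N g)) : HasDoubleRoot g := by
  obtain ⟨s, t, hst, h0, h1⟩ := h
  simp only [substCoeffs, subst, Q, Matrix.cons_val, smul_eq_mul] at h0 h1
  rw [Matrix.det_fin_two] at hN
  refine ⟨N 0 0 * s + N 1 0 * t, N 0 1 * s + N 1 1 * t, ?_, ?_, ?_⟩
  · by_contra! h
    have hs : (N 0 0 * N 1 1 - N 0 1 * N 1 0) * s = 0 := by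
      linear_combination N 1 1 * h.1 - N 1 0 * h.2
    have ht : (N 0 0 * N 1 1 - N 0 1 * N 1 0) * t = 0 := by
      linear_combination N 0 0 * h.2 - N 0 1 * h.1
    simp_all
  · apply mul_left_cancel₀ hN
    linear_combination N 1 1 * h0 - N 0 1 * h1
  · apply mul_left_cancel₀ hN
    linear_combination N 0 0 * h1 - N 1 0 * h0

variable [IsAlgClosed L] [CharZero L]

/-- Over an algebraically closed field two roots can be moved to 0 and ∞. Then the invariant is 27
(g₁g₃)²(g₂² - 4g₁g₃), so one of these two roots or a root of the quadratic factor in the middle is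
multiple. A vanishing `g 3` along the way is already a double root. -/
theorem hasDoubleRoot_of_disc_eq_zero (g : Fin 5 → L) (h : 4 * invI g ^ 3 - invJ g ^ 2 = 0) :
    HasDoubleRoot g := by
  have hsub : ∀ (N : Matrix (Fin 2) (Fin 2) L) (g : Fin 5 → L),
      4 * invI g ^ 3 - invJ g ^ 2 = 0 →
      4 * invI (substCoeffs N g) ^ 3 - invJ (substCoeffs N g) ^ 2 = 0 := by
    intro N g h
    rw [invI_substCoeffs, invJ_substCoeffs]
    linear_combination N.det ^ 12 * h
  have key₁ : ∀ g : Fin 5 → L, 4 * invI g ^ 3 - invJ g ^ 2 = 0 → g 4 = 0 → g 0 = 0 →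
      HasDoubleRoot g := by
    intro g h h4 h0
    have h' : 27 * ((g 1 * g 3) ^ 2 * (g 2 ^ 2 - 4 * g 1 * g 3)) = 0 := by
      rw [invI, invJ, h4, h0] at h
      linear_combination h
    rcases mul_eq_zero.1 ((mul_eq_zero.1 h').resolve_left (by norm_num)) with h' | h'
    · rcases mul_eq_zero.1 (pow_eq_zero_iff two_ne_zero |>.1 h') with h' | h'
      · exact ⟨1, 0, by simp, by simp [h0], by simp [h']⟩
      · exact ⟨0, 1, by simp, by simp [h'], by simp [h4]⟩
    · by_cases h1 : g 1 = 0
      · exact ⟨1, 0, by simp, by simp [h0], by simp [h1]⟩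
      -- The double root of g₁s² + g₂st + g₃t².
      · refine ⟨-g 2, 2 * g 1, .inr (by simpa using h1), ?_, ?_⟩
        · rw [h0]
          linear_combination (-2 * g 1 ^ 2) * h'
        · rw [h4]
          linear_combination (3 * g 1 * g 2) * h'
  have key₂ : ∀ g : Fin 5 → L, 4 * invI g ^ 3 - invJ g ^ 2 = 0 → g 4 = 0 → HasDoubleRoot g := by
    intro g h h4
    by_cases h3 : g 3 = 0
    · exact ⟨0, 1, by simp, by simp [h3], by simp [h4]⟩
    · obtain ⟨t, ht⟩ := IsAlgClosed.exists_root
        (Polynomial.C (g 3) * Polynomial.X ^ 3 + Polynomial.C (g 2) * Polynomial.X ^ 2 +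
          Polynomial.C (g 1) * Polynomial.X + Polynomial.C (g 0))
        (by rw [Polynomial.degree_cubic h3]; norm_num)
      simp only [Polynomial.IsRoot, Polynomial.eval_add, Polynomial.eval_mul, Polynomial.eval_C,
        Polynomial.eval_pow, Polynomial.eval_X] at ht
      refine HasDoubleRoot.of_subst (N := !![1, t; 0, 1]) (by simp) (key₁ _ (hsub _ _ h) ?_ ?_)
      · simp [substCoeffs, subst, Q, h4]
      · simp [substCoeffs, subst, Q, h4]
        linear_combination ht
  by_cases h0 : g 0 = 0
  · refine HasDoubleRoot.of_subst (N := !![0, 1; 1, 0]) (by simp) (key₂ _ (hsub _ _ h) ?_)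
    simp [substCoeffs, subst, Q, h0]
  · obtain ⟨s, hs⟩ := IsAlgClosed.exists_root
        (Polynomial.C (g 0) * Polynomial.X ^ 4 + (Polynomial.C (g 1) * Polynomial.X ^ 3 +
          Polynomial.C (g 2) * Polynomial.X ^ 2 + Polynomial.C (g 3) * Polynomial.X +
          Polynomial.C (g 4)))
        (by
          rw [Polynomial.degree_add_eq_left_of_degree_lt]
          · rw [Polynomial.degree_C_mul_X_pow _ h0]; norm_num
          · rw [Polynomial.degree_C_mul_X_pow _ h0]
            exact lt_of_le_of_lt Polynomial.degree_cubic_le (by norm_num))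
    simp only [Polynomial.IsRoot, Polynomial.eval_add, Polynomial.eval_mul, Polynomial.eval_C,
        Polynomial.eval_pow, Polynomial.eval_X] at hs
    refine HasDoubleRoot.of_subst (N := !![1, 0; s, 1]) (by simp) (key₂ _ (hsub _ _ h) ?_)
    simp [substCoeffs, subst, Q]
    linear_combination hs

end DoubleRoots

section

variable {R : Type*} [CommRing R]

/-- Base change. -/
def baseChange (A : Type*) [CommRing A] [Algebra R A] (Φ : Quartic R) : Quartic A :=
  ⟨algebraMap R A Φ.l, algebraMap R A Φ.m, algebraMap R A Φ.n, algebraMap R A Φ.a,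
    algebraMap R A Φ.b, algebraMap R A Φ.c, algebraMap R A Φ.d, algebraMap R A Φ.e⟩

theorem form_baseChange (A : Type*) [CommRing A] [Algebra R A] (Φ : Quartic R) (x : Fin 3 → A) :
    (Φ.baseChange A).form x = Φ.form x := by
  simp [baseChange, form, P, Q, Algebra.smul_def]

theorem poly_baseChange (A : Type*) [CommRing A] [Algebra R A] (Φ : Quartic R) :
    (Φ.baseChange A).poly = Φ.form (X : Fin 3 → MvPolynomial (Fin 3) A) := by
  simp [baseChange, poly, form, P, Q, Algebra.smul_def,
    IsScalarTower.algebraMap_apply R A (MvPolynomial (Fin 3) A)]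

theorem invI_map {A : Type*} [CommRing A] (φ : R →+* A) (g : Fin 5 → R) :
    invI (fun i => φ (g i)) = φ (invI g) := by
  simp [invI, map_ofNat]

theorem invJ_map {A : Type*} [CommRing A] (φ : R →+* A) (g : Fin 5 → R) :
    invJ (fun i => φ (g i)) = φ (invJ g) := by
  simp [invJ, map_ofNat]

/-- A double root (s : t) of P² + 4Q gives the singular point with y = -P(s,t)/2, at which the
derivative along y vanishes as well. -/
theorem disc_ne_zero_of_nonsingular {K : Type*} [Field K] [CharZero K] [Algebra R K]
    {Φ : Quartic R} (h : Φ.Nonsingular K) : Φ.disc ≠ 0 := by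
  intro hdisc
  have h1 := Φ.disc_eq
  rw [hdisc, mul_zero] at h1
  have h2 := congrArg (algebraMap R (AlgebraicClosure K)) h1
  have : CharZero (AlgebraicClosure K) := charZero_of_injective_algebraMap
    (algebraMap K (AlgebraicClosure K)).injective
  obtain ⟨s, t, hst, hs, ht⟩ := hasDoubleRoot_of_disc_eq_zero
    (fun i => algebraMap R (AlgebraicClosure K) (Φ.completed i)) (by
      rw [invI_map, invJ_map, ← map_pow, ← map_pow, ← map_ofNat (algebraMap R _) 4, ← map_mul,
        ← map_sub, ← h1, map_zero])
  have hc : (fun i => algebraMap R (AlgebraicClosure K) (Φ.completed i)) =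
      (Φ.baseChange (AlgebraicClosure K)).completed := by
    ext i
    fin_cases i <;> simp [completed, baseChange, map_ofNat]
  simp only [congrFun hc] at hs ht
  clear hc h1 h2
  have h2' : (2 : AlgebraicClosure K) ≠ 0 := two_ne_zero
  set y := -(Φ.baseChange (AlgebraicClosure K)).P ![s, t] / 2 with hy
  have hy' : 2 * y + (Φ.baseChange (AlgebraicClosure K)).P ![s, t] = 0 := by
    rw [hy]; field_simp; ring
  have hg : grad (Φ.baseChange (AlgebraicClosure K)).poly ![s, t, y] = 0 := by
    rw [grad_poly]
    generalize Φ.baseChange (AlgebraicClosure K) = Ψ at *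
    simp only [P, Matrix.cons_val, smul_eq_mul, completed] at *
    ext i
    fin_cases i
    · simp
      apply mul_left_cancel₀ (show (4 : AlgebraicClosure K) ≠ 0 by norm_num)
      linear_combination 2 * (2 * Ψ.l * s + Ψ.m * t) * hy' - hs
    · simp
      apply mul_left_cancel₀ (show (4 : AlgebraicClosure K) ≠ 0 by norm_num)
      linear_combination 2 * (Ψ.m * s + 2 * Ψ.n * t) * hy' - ht
    · simpa [P] using hy'
  refine (h ![s, t, y] ?_ ?_).2 ?_
  · rintro h
    have := congrFun h 0; have := congrFun h 1
    simp_all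
  · rw [← form_baseChange]
    generalize Φ.baseChange (AlgebraicClosure K) = Ψ at *
    simp only [form, P, Q, Matrix.cons_val, smul_eq_mul, completed] at *
    -- Four times the form is (2y + P)² - (P² + 4Q), and Euler's relation writes 4(P² + 4Q) in terms
    -- of its two partial derivatives; hence the factor 16.
    apply mul_left_cancel₀ (show (16 : AlgebraicClosure K) ≠ 0 by norm_num)
    linear_combination 4 * (2 * y + (Ψ.l * s ^ 2 + Ψ.m * (s * t) + Ψ.n * t ^ 2)) * hy'
      - s * hs - t * ht
  · rw [← poly_baseChange, hg]

end

end Quartic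

end GenusOne

/-! ### Degree 2: the bound for iterations, and termination of both procedures. -/

namespace GenusOne

section LocalRing

variable {R : Type*} [CommRing R] [IsDomain R] [IsDiscreteValuationRing R] {π : R}

/-- The valuation of a non-zero element, as a natural number. -/
noncomputable def natVal (x : R) : ℕ := (IsDiscreteValuationRing.addVal R x).toNat

theorem coe_natVal {x : R} (hx : x ≠ 0) :
    (natVal x : ℕ∞) = IsDiscreteValuationRing.addVal R x :=
  ENat.natCast_toNat (by simpa [IsDiscreteValuationRing.addVal_eq_top_iff])

theorem natVal_pow_mul (hπ : Irreducible π) (n : ℕ) {x : R} (hx : x ≠ 0) :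
    natVal (π ^ n * x) = n + natVal x := by
  have := coe_natVal (mul_ne_zero (pow_ne_zero n hπ.ne_zero) hx)
  rw [addVal_pow_mul hπ, ← coe_natVal hx] at this
  exact_mod_cast this

theorem le_natVal_of_pow_dvd (hπ : Irreducible π) {n : ℕ} {x : R} (hx : x ≠ 0) (h : π ^ n ∣ x) :
    n ≤ natVal x := by
  have := le_addVal_of_pow_dvd hπ h
  rw [← coe_natVal hx] at this
  exact_mod_cast this

end LocalRing

namespace Quartic

variable {R : Type*} [CommRing R] [IsDomain R] [IsDiscreteValuationRing R] [CharZero R] {π : R}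

theorem calls_normalise_normalise {Φ Ψ : Quartic R}
    (h : Calls (isLocallySoluble π) (.normalise Φ) (.normalise Ψ)) :
    ∃ r, IsGoodShift π r Φ ∧ Φ.shift r = Ψ.scale π := by
  obtain ⟨calls, hc, ht⟩ := h
  obtain ⟨r, hr, ⟨Ψ₁, h1, rfl⟩ | ⟨-, rfl⟩⟩ := isLocallySoluble_normalise_iff.1 hc
  · simp only [List.mem_singleton, Stage.normalise.injEq] at ht
    exact ⟨r, hr, ht ▸ h1⟩
  · simp at ht

theorem calls_normalise_search {Φ Ψ : Quartic R}
    (h : Calls (isLocallySoluble π) (.normalise Φ) (.search Ψ)) :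
    ∃ r, IsGoodShift π r Φ ∧ Ψ = Φ.shift r ∧
      ¬ (C π ∣ (Φ.shift r).P (X : Fin 2 → MvPolynomial (Fin 2) R) ∧
          C (π ^ 2) ∣ (Φ.shift r).Q (X : Fin 2 → MvPolynomial (Fin 2) R)) := by
  obtain ⟨calls, hc, ht⟩ := h
  obtain ⟨r, hr, ⟨Ψ₁, h1, rfl⟩ | ⟨h1, rfl⟩⟩ := isLocallySoluble_normalise_iff.1 hc
  · simp at ht
  · simp only [List.mem_singleton, Stage.search.injEq] at ht
    exact ⟨r, hr, ht, h1⟩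

theorem disc_of_calls_normalise_normalise {Φ Ψ : Quartic R}
    (h : Calls (isLocallySoluble π) (.normalise Φ) (.normalise Ψ)) :
    Φ.disc = π ^ 12 * Ψ.disc := by
  obtain ⟨r, -, hr⟩ := calls_normalise_normalise h
  rw [← disc_shift r, hr, disc_scale]

theorem disc_of_calls_normalise_search {Φ Ψ : Quartic R}
    (h : Calls (isLocallySoluble π) (.normalise Φ) (.search Ψ)) : Φ.disc = Ψ.disc := by
  obtain ⟨r, -, rfl, -⟩ := calls_normalise_search h
  rw [disc_shift]

theorem singMod_of_shift_eq_scale {m : ℕ} {Φ Ψ : Quartic R} {r : Fin 3 → R}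
    (h : Φ.shift r = Ψ.scale π) (hs : ∃ x y, SingMod π m Ψ.poly ![x, 1, y]) :
    ∃ x y, SingMod π m Φ.poly ![x, 1, y] := by
  obtain ⟨x, y, hxy⟩ := hs
  have := scale_singMod π hxy
  rw [← h, singMod_shift] at this
  exact ⟨_, _, this⟩

theorem iteration_aux {Φ₁ Φ₂ : Quartic R} (h : Relation.ReflTransGen
      (fun A B => Calls (isLocallySoluble π) (.normalise A) (.normalise B)) Φ₁ Φ₂) :
    (∃ k, Φ₁.disc = π ^ k * Φ₂.disc) ∧
    ∀ m, (∃ x y, SingMod π m Φ₂.poly ![x, 1, y]) → ∃ x y, SingMod π m Φ₁.poly ![x, 1, y] := by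
  induction h with
  | refl => exact ⟨⟨0, by simp⟩, fun m h => h⟩
  | tail _ h ih =>
    obtain ⟨⟨k, hk⟩, ih⟩ := ih
    refine ⟨⟨k + 12, by rw [hk, disc_of_calls_normalise_normalise h]; ring⟩, fun m hm => ih m ?_⟩
    obtain ⟨r, -, hr⟩ := calls_normalise_normalise h
    exact singMod_of_shift_eq_scale hr hm

/-- The substitution multiplies Δ by π^12 and the first pass of Step (i) removes exactly this
factor; further passes can only lower v(Δ). The first pass also raises the order of a singular point
by one, while the further passes keep it. -/
theorem iteration_spec (hπ : Irreducible π) {Φ Ψ : Quartic R}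
    (h : Iteration (isLocallySoluble π) Φ Ψ) :
    (∃ k, Φ.disc = π ^ k * Ψ.disc) ∧
    ∀ m, (∃ x y, SingMod π m Ψ.poly ![x, 1, y]) → ∃ x y, SingMod π (m + 1) Φ.poly ![x, 1, y] := by
  obtain ⟨Φ₁, Φ₂, h1, h2, h3⟩ := h
  obtain ⟨p, hp, u, hu, he⟩ := calls_search_iff h1
  obtain rfl : Φ₁ = Φ.subst !![π, 0; u, 1] := by simpa using he
  obtain ⟨y, hy⟩ := IsLocalRing.residue_surjective (p 2)
  have hp1 : p 1 = 1 := by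
    obtain ⟨i, hi, hj⟩ := hp.1
    fin_cases i
    · exact absurd (hj 1 (by simp)) (hp.2.1 rfl)
    · exact hi
  have hq := nonRegular_lift hπ hp (q := ![u, 1, y]) (by
    intro i
    fin_cases i
    · exact hu
    · simp [hp1]
    · exact hy)
  -- The first pass of Step (i) after a recursive call always divides, so the chain of repetitions
  -- is not empty.
  rcases h2.cases_head with rfl | ⟨Φ₃, h4, h5⟩
  · obtain ⟨r, hr, -, hn⟩ := calls_normalise_search h3
    exact absurd (isGoodShift_after_call hπ hq hr).2 hn
  · obtain ⟨⟨k, hk⟩, haux⟩ := iteration_aux h5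
    constructor
    · refine ⟨k, ?_⟩
      have e1 := disc_of_calls_normalise_normalise h4
      rw [disc_subst, hk, disc_of_calls_normalise_search h3] at e1
      apply mul_left_cancel₀ (pow_ne_zero 12 hπ.ne_zero)
      simpa [Matrix.det_fin_two] using e1
    · rintro m ⟨x, y', hxy⟩
      obtain ⟨r', -, rfl, -⟩ := calls_normalise_search h3
      rw [singMod_shift] at hxy
      obtain ⟨x, y', hxy⟩ := haux m ⟨_, _, hxy⟩
      obtain ⟨r, hr, hr'⟩ := calls_normalise_normalise h4
      obtain ⟨⟨hr0, hr1⟩, -⟩ := isGoodShift_after_call hπ hq hr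
      exact ⟨_, _, singMod_of_call hπ hr0 hr1 hr' hxy⟩

theorem singMod_of_iterations (hπ : Irreducible π) (m : ℕ) (Ψ : ℕ → Quartic R)
    (h : ∀ i < m, Iteration (isLocallySoluble π) (Ψ i) (Ψ (i + 1))) :
    ∃ x y, SingMod π m (Ψ 0).poly ![x, 1, y] := by
  induction m generalizing Ψ with
  | zero => exact ⟨0, 0, singMod_zero _ _ _⟩
  | succ m ih =>
    exact (iteration_spec hπ (h 0 (by omega))).2 m
      (ih (fun i => Ψ (i + 1)) fun i hi => h (i + 1) (by omega))

theorem neverIncreases (hπ : Irreducible π) (Φ : Quartic R) :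
    NeverIncreases (isLocallySoluble π)
      (fun Ψ => IsDiscreteValuationRing.addVal R Ψ.disc) Φ := by
  intro Ψ Ψ' _ h
  obtain ⟨⟨k, hk⟩, -⟩ := iteration_spec hπ h
  dsimp only
  rw [hk, addVal_pow_mul hπ]
  exact le_add_self

theorem pow_dvd_disc_of_iterations (hπ : Irreducible π) (m : ℕ) (Ψ : ℕ → Quartic R)
    (h : ∀ i < m, Iteration (isLocallySoluble π) (Ψ i) (Ψ (i + 1))) :
    π ^ (2 * m) ∣ (Ψ 0).disc := by
  obtain ⟨x, y, hxy⟩ := singMod_of_iterations hπ m Ψ h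
  exact dvd_disc_of_singMod (by simp) hxy

theorem stableIterationsBounded (hπ : Irreducible π) (Φ : Quartic R) :
    StableIterationsBounded (isLocallySoluble π)
      (fun Ψ => IsDiscreteValuationRing.addVal R Ψ.disc) Φ := by
  intro m Ψ _ h _
  have := le_addVal_of_pow_dvd hπ (pow_dvd_disc_of_iterations hπ m Ψ h)
  exact_mod_cast this

theorem halts_isLocallySoluble [Finite (IsLocalRing.ResidueField R)] (hπ : Irreducible π)
    {Φ : Quartic R} (hΦ : Φ.disc ≠ 0) : Halts (isLocallySoluble π) (.normalise Φ) := by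
  refine halts_of_level (fun Ψ => natVal Ψ.disc) (fun Ψ => Ψ.disc ≠ 0)
    (fun Ψ _ => ⟨exists_calls_normalise π Ψ, exists_calls_search π Ψ⟩) ?_ ?_ ?_ ?_ ?_ ?_ hΦ
  · intro Φ Ψ hΦ h
    have e := disc_of_calls_normalise_normalise h
    have hΨ : Ψ.disc ≠ 0 := right_ne_zero_of_mul (e ▸ hΦ)
    refine ⟨hΨ, ?_⟩
    rw [e, natVal_pow_mul hπ _ hΨ]
    omega
  · intro Φ Ψ hΦ h
    rwa [← disc_of_calls_normalise_search h]
  · intro Φ Ψ hΦ h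
    obtain ⟨p, hp, u, hu, he⟩ := calls_search_iff h
    obtain rfl : Ψ = Φ.subst !![π, 0; u, 1] := by simpa using he
    rw [disc_subst]
    exact mul_ne_zero (by simp [Matrix.det_fin_two, hπ.ne_zero]) hΦ
  · intro Φ Ψ _ h
    obtain ⟨p, hp, u, hu, he⟩ := calls_search_iff h
    simp at he
  · intro Φ Ψ hΦ h
    obtain ⟨⟨k, hk⟩, -⟩ := iteration_spec hπ h
    have hΨ : Ψ.disc ≠ 0 := right_ne_zero_of_mul (hk ▸ hΦ)
    rw [hk, natVal_pow_mul hπ _ hΨ]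
    omega
  · intro m Ψ hΨ h _
    exact le_natVal_of_pow_dvd hπ hΨ (pow_dvd_disc_of_iterations hπ m Ψ h)

/-- The data of a recursive call for the Tamagawa distances. -/
def IsTamagawaCall (π : R) (Φ : Quartic R) (p : Fin 3 → IsLocalRing.ResidueField R)
    (t : Quartic R × Bool) : Prop :=
  ∃ (μ : R) (r : Fin 3 → R) (N : Matrix (Fin 2) (Fin 2) R) (Φ₁ : Quartic R)
      (c : IsLocalRing.ResidueField R),
    IsUnit μ ∧ IsUnit N.det ∧ c ≠ 0 ∧ algebraMap R _ (N 1 0) = c * p 0 ∧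
    algebraMap R _ (N 1 1) = c * p 1 ∧
    algebraMap R _ (shiftForm r (N 1 0) (N 1 1)) = c ^ 2 * p 2 ∧
    (((Φ.shift r).subst N).scale μ).subst !![π, 0; 0, 1] = Φ₁.scale π ∧ t = (Φ₁, true)

theorem tamagawaDistances_iff {Φ : Quartic R} {affine : Bool} {calls : List (Quartic R × Bool)} :
    tamagawaDistances π (Φ, affine) calls ↔
      ForEach (Φ.nonRegular π affine) (IsTamagawaCall π Φ) calls := by
  have hx : ∀ Ψ : Quartic R, (Ψ.P (![C π * X 0, X 1] : Fin 2 → MvPolynomial (Fin 2) R) =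
      (Ψ.subst !![π, 0; 0, 1]).P X) ∧
      (Ψ.Q (![C π * X 0, X 1] : Fin 2 → MvPolynomial (Fin 2) R) =
      (Ψ.subst !![π, 0; 0, 1]).Q X) := by
    intro Ψ
    rw [P_subst, Q_subst]
    simp [smul_eq_C_mul]
  rw [tamagawaDistances]
  apply iff_of_eq
  congr 1
  ext p t
  simp only [IsTamagawaCall, isTransform_iff, shiftForm, (hx _).1, (hx _).2]
  constructor
  · rintro ⟨μ, r, N, Φ', Φ₁, c, h1, h2, rfl, h3, h4, h5, h6, h7, h8, h9⟩
    exact ⟨μ, r, N, Φ₁, c, h1, h2, h3, h4, h5, h6, C_mul_P_eq_iff.1 ⟨h7, h8⟩, h9⟩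
  · rintro ⟨μ, r, N, Φ₁, c, h1, h2, h3, h4, h5, h6, h7, h9⟩
    obtain ⟨h7, h8⟩ := C_mul_P_eq_iff.2 h7
    exact ⟨μ, r, N, _, Φ₁, c, h1, h2, rfl, h3, h4, h5, h6, h7, h8, h9⟩

theorem exists_isTamagawaCall (hπ : Irreducible π) {Φ : Quartic R} {affine : Bool}
    {p : Fin 3 → IsLocalRing.ResidueField R} (hp : p ∈ Φ.nonRegular π affine) :
    ∃ t, IsTamagawaCall π Φ p t := by
  obtain ⟨q, hq⟩ := exists_lift p
  obtain ⟨r, N, hN, hN0, hN1, hr⟩ : ∃ (r : Fin 3 → R) (N : Matrix (Fin 2) (Fin 2) R),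
      IsUnit N.det ∧ algebraMap R _ (N 1 0) = p 0 ∧ algebraMap R _ (N 1 1) = p 1 ∧
      shiftForm r (N 1 0) (N 1 1) = q 2 := by
    obtain ⟨i, hi, hj⟩ := hp.1
    fin_cases i
    -- A normalised point has (x₁ : x₂) equal to (1 : 0) or (q₀ : 1); the y-coordinate is carried by
    -- q₂x₁² or q₂x₂² respectively.
    · refine ⟨![q 2, 0, 0], !![0, 1; 1, 0], ?_, ?_, ?_, ?_⟩
      · simp [Matrix.det_fin_two]
      · simpa using hi.symm
      · simpa using (hj 1 (by simp)).symm
      · simp [shiftForm]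
    · refine ⟨![0, 0, q 2], !![1, 0; q 0, 1], ?_, ?_, ?_, ?_⟩
      · simp [Matrix.det_fin_two]
      · simpa using hq 0
      · simpa using hi.symm
      · simp [shiftForm]
  have hsing := nonRegular_lift hπ hp (q := ![N 1 0, N 1 1, shiftForm r (N 1 0) (N 1 1)]) (by
    intro i
    fin_cases i
    · exact hN0
    · exact hN1
    · simpa [hr] using hq 2)
  obtain ⟨hn, hd, he⟩ := dvd_coeffs_move hsing
  rw [pow_one] at hn hd
  obtain ⟨Φ₁, hΦ₁⟩ : ∃ Φ₁ : Quartic R,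
      (((Φ.shift r).subst N).scale 1).subst !![π, 0; 0, 1] = Φ₁.scale π := by
    rw [scale_one, subst_diag]
    apply exists_eq_scale
    · rw [C_dvd_P]
      exact ⟨(dvd_pow_self π two_ne_zero).mul_right _, dvd_mul_right _ _, hn⟩
    · rw [C_dvd_Q]
      refine ⟨(pow_dvd_pow π (by norm_num)).mul_right _, (pow_dvd_pow π (by norm_num)).mul_right _,
        dvd_mul_right _ _, ?_, he⟩
      rw [sq]
      exact mul_dvd_mul_left _ hd
  exact ⟨_, 1, r, N, Φ₁, 1, isUnit_one, hN, one_ne_zero, by rw [hN0, one_mul],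
    by rw [hN1, one_mul], by rw [hr, hq 2, one_pow, one_mul], hΦ₁, rfl⟩

/-- The π^12 from x₁ ← π x₁ cancels the π^12 from the division. So v(Δ) is constant along the calls
and is not a decreasing measure, only a bound for the order of singular points. -/
theorem IsTamagawaCall.disc (hπ : Irreducible π) {Φ : Quartic R}
    {p : Fin 3 → IsLocalRing.ResidueField R} {t : Quartic R × Bool} (h : IsTamagawaCall π Φ p t) :
    t.2 = true ∧ ∃ u, IsUnit u ∧ u * Φ.disc = t.1.disc := by
  obtain ⟨μ, r, N, Φ₁, c, hμ, hN, -, -, -, -, h, rfl⟩ := h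
  refine ⟨rfl, μ ^ 12 * N.det ^ 12, (hμ.pow 12).mul (hN.pow 12), ?_⟩
  have := congrArg Quartic.disc h
  rw [disc_subst, disc_scale, disc_subst, disc_shift, disc_scale] at this
  apply mul_left_cancel₀ (pow_ne_zero 12 hπ.ne_zero)
  simpa [Matrix.det_fin_two, mul_assoc] using this

/-- The x₂-coordinate of the transported point is congruent to `N 1 1 * q 1`. It stays a unit
because the non-regular point lies in the affine piece; this keeps the induction going. -/
theorem IsTamagawaCall.singMod (hπ : Irreducible π) {Φ : Quartic R} {m : ℕ}
    {p : Fin 3 → IsLocalRing.ResidueField R} (hp : p 1 ≠ 0)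
    {t : Quartic R × Bool} (h : IsTamagawaCall π Φ p t)
    (hs : ∃ q : Fin 3 → R, IsUnit (q 1) ∧ SingMod π m t.1.poly q) :
    ∃ q : Fin 3 → R, IsUnit (q 1) ∧ SingMod π (m + 1) Φ.poly q := by
  obtain ⟨μ, r, N, Φ₁, c, hμ, hN, hc, -, hN1, -, h, rfl⟩ := h
  obtain ⟨q, hq, hs⟩ := hs
  have hN1 := isUnit_of_residue_eq_mul hπ hc hp hN1
  have hstep : SingMod π (m + 1) (((Φ.shift r).subst N).scale μ).poly
      ![π * q 0, q 1, π * q 2] := by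
    generalize ((Φ.shift r).subst N).scale μ = Ψ at h
    have hf := form_scale π Φ₁ (q 0) (q 1) (q 2)
    have hg := grad_scale π Φ₁ (q 0) (q 1) (q 2)
    have hqq : ![q 0, q 1, q 2] = q := by
      ext i; fin_cases i <;> rfl
    rw [← h, form_subst, hqq] at hf
    rw [← h, grad_subst, hqq] at hg
    simp only [Matrix.cons_val, Matrix.of_apply, zero_mul, zero_add, add_zero, one_mul] at hf hg
    rw [SingMod_iff] at hs ⊢
    have hg0 := congrFun hg 0
    have hg1 := congrFun hg 1
    have hg2 := congrFun hg 2
    simp only [Matrix.cons_val] at hg0 hg1 hg2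
    obtain ⟨hs, h0, h1, h2⟩ := hs
    refine ⟨?_, ?_, ?_, ?_⟩
    · rw [hf, show 2 * (m + 1) = 2 + 2 * m by ring, pow_add]
      exact mul_dvd_mul_left _ hs
    · rw [sq, mul_assoc] at hg0
      rw [mul_left_cancel₀ hπ.ne_zero hg0, pow_succ']
      exact mul_dvd_mul_left _ h0
    · rw [hg1, pow_succ, mul_comm, sq]
      exact mul_dvd_mul (dvd_mul_right _ _) h1
    · rw [hg2, pow_succ']
      exact mul_dvd_mul_left _ h2
  obtain ⟨ν, hν⟩ := hμ.exists_right_inv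
  have e : π * q 2 = μ * (ν * (π * q 2)) := by rw [← mul_assoc μ, hν, one_mul]
  rw [e] at hstep
  have := singMod_shift.1 (singMod_subst hN (singMod_scale hμ hstep))
  refine ⟨_, ?_, this⟩
  simp only [Matrix.cons_val]
  rw [← not_dvd_iff_isUnit hπ, ← mul_assoc, dvd_add_right (by
    rw [mul_comm (N 0 1)]; exact (dvd_mul_right _ _).mul_right _)]
  exact (not_dvd_iff_isUnit hπ).2 (hN1.mul hq)

theorem halts_tamagawaDistances [Finite (IsLocalRing.ResidueField R)] (hπ : Irreducible π)
    {Φ : Quartic R} (hΦ : Φ.disc ≠ 0) (affine : Bool) :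
    Halts (tamagawaDistances π) (Φ, affine) := by
  have hcall : ∀ (s t : Quartic R × Bool), Calls (tamagawaDistances π) s t →
      ∃ p ∈ s.1.nonRegular π s.2, IsTamagawaCall π s.1 p t := by
    rintro ⟨Φ, a⟩ t ⟨calls, hc, ht⟩
    exact (tamagawaDistances_iff.1 hc).exists_of_mem ht
  have hpres : ∀ (s t : Quartic R × Bool), s.1.disc ≠ 0 → Calls (tamagawaDistances π) s t →
      t.1.disc ≠ 0 := by
    intro s t hs h
    obtain ⟨p, -, hp⟩ := hcall s t h
    obtain ⟨-, u, hu, h⟩ := hp.disc hπ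
    rw [← h]
    exact mul_ne_zero hu.ne_zero hs
  have hacc : ∀ Φ : Quartic R, Φ.disc ≠ 0 →
      Acc (fun t s => Calls (tamagawaDistances π) s t) (Φ, true) := by
    intro Φ hΦ
    refine acc_of_bounded_paths (r := Calls (tamagawaDistances π)) (natVal Φ.disc) _
      fun m f hf hr => ?_
    have hsing : ∀ (m : ℕ) (f : ℕ → Quartic R × Bool), (f 0).2 = true →
        (∀ i < m, Calls (tamagawaDistances π) (f i) (f (i + 1))) →
        ∃ q : Fin 3 → R, IsUnit (q 1) ∧ SingMod π m (f 0).1.poly q := by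
      intro m
      induction m with
      | zero => exact fun f _ _ => ⟨![0, 1, 0], by simp, singMod_zero _ _ _⟩
      | succ m ih =>
        intro f hf hr
        obtain ⟨p, hp, hpc⟩ := hcall _ _ (hr 0 (by omega))
        exact hpc.singMod hπ (hp.2.1 hf) (ih (fun i => f (i + 1)) (hpc.disc hπ).1
          fun i hi => hr (i + 1) (by omega))
    obtain ⟨q, hq, hs⟩ := hsing m f (by rw [hf]) hr
    have := le_natVal_of_pow_dvd hπ (hf ▸ hΦ) (dvd_disc_of_singMod hq hs)
    rw [hf] at this
    dsimp only at this
    omega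
  -- Only the initial call can be projective. All calls that it makes are affine, where paths are
  -- bounded, so one further step suffices.
  refine halts_of_acc (fun s => s.1.disc ≠ 0) ?_ hpres ⟨_, fun t ht => ?_⟩ hΦ
  · rintro ⟨Φ, a⟩ _
    simp only [tamagawaDistances_iff]
    exact ForEach.exists (Set.toFinite _) fun p hp => exists_isTamagawaCall hπ hp
  · obtain ⟨p, -, hp⟩ := hcall (Φ, affine) t ht
    have h1 := (hp.disc hπ).1
    have h2 := hacc t.1 (hpres (Φ, affine) t hΦ ht)
    rwa [← h1] at h2

end Quartic

end GenusOne

/-! ### Degree 3: coefficients, substitutions, discriminant. -/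

namespace GenusOne

namespace Cubic

variable {R : Type*} [CommRing R]

theorem map_form (U : Cubic R) {A B : Type*} [CommRing A] [Algebra R A] [CommRing B] [Algebra R B]
    (φ : A →ₐ[R] B) (x : Fin 3 → A) : φ (U.form x) = U.form (fun i => φ (x i)) := by
  simp [form]

/-- The defining polynomial. -/
noncomputable def poly (U : Cubic R) : MvPolynomial (Fin 3) R := U.form X

theorem aeval_poly (U : Cubic R) {A : Type*} [CommRing A] [Algebra R A] (x : Fin 3 → A) :
    aeval x U.poly = U.form x := by
  rw [poly, map_form]; simp

theorem eval_poly (U : Cubic R) (x : Fin 3 → R) : eval x U.poly = U.form x := by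
  simp [poly, form, smul_eq_C_mul]

theorem form_X_eq_map (U : Cubic R) (F : Type*) [CommRing F] [Algebra R F] :
    U.form (X : Fin 3 → MvPolynomial (Fin 3) F) = map (algebraMap R F) U.poly := by
  simp [poly, form, Algebra.smul_def, IsScalarTower.algebraMap_apply R F (MvPolynomial _ F)]

/-- Kronecker substitution: for x = X, y = X⁴, z = 1 the ten cubic monomials go to distinct powers
of X; the zeros in the list are the exponents that do not occur. -/
theorem coeff_form (U : Cubic R) (k : ℕ) :
    (aeval ![(Polynomial.X : Polynomial R), Polynomial.X ^ 4, 1]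
      (U.form (X : Fin 3 → MvPolynomial (Fin 3) R))).coeff k =
      ([U.c, U.g, U.j, U.a, U.i, U.m, U.h, 0, U.f, U.k, 0, 0, U.b].getD k 0) := by
  have : aeval ![(Polynomial.X : Polynomial R), Polynomial.X ^ 4, 1]
      (U.form (X : Fin 3 → MvPolynomial (Fin 3) R)) =
      Polynomial.C U.b * Polynomial.X ^ 12 + Polynomial.C U.k * Polynomial.X ^ 9 +
      Polynomial.C U.f * Polynomial.X ^ 8 + Polynomial.C U.h * Polynomial.X ^ 6 +
      Polynomial.C U.m * Polynomial.X ^ 5 + Polynomial.C U.i * Polynomial.X ^ 4 +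
      Polynomial.C U.a * Polynomial.X ^ 3 + Polynomial.C U.j * Polynomial.X ^ 2 +
      Polynomial.C U.g * Polynomial.X + Polynomial.C U.c := by
    rw [map_form]; simp [form, Polynomial.smul_eq_C_mul]; ring
  rw [this]
  simp only [Polynomial.coeff_add, Polynomial.coeff_C_mul_X_pow, Polynomial.coeff_C_mul,
    Polynomial.coeff_X, Polynomial.coeff_C]
  rcases k with _ | _ | _ | _ | _ | _ | _ | _ | _ | _ | _ | _ | _ | k <;> simp

theorem ext_of_form {U V : Cubic R}
    (h : U.form (X : Fin 3 → MvPolynomial (Fin 3) R) = V.form X) : U = V := by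
  have h := fun k => (U.coeff_form k).symm.trans ((by rw [h]) : _ = _) |>.trans (V.coeff_form k)
  cases U; cases V
  simp only [mk.injEq]
  exact ⟨h 3, h 12, h 0, h 8, h 1, h 6, h 4, h 2, h 9, h 5⟩

/-- The cubic with all coefficients multiplied by `s`. -/
def smul (s : R) (U : Cubic R) : Cubic R :=
  ⟨s * U.a, s * U.b, s * U.c, s * U.f, s * U.g, s * U.h, s * U.i, s * U.j, s * U.k, s * U.m⟩

theorem form_smul (s : R) (U : Cubic R) {A : Type*} [CommRing A] [Algebra R A] (x : Fin 3 → A) :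
    (U.smul s).form x = s • U.form x := by
  simp [smul, form, mul_smul]

theorem C_mul_form_eq_iff {s : R} {U V : Cubic R} :
    C s * V.form (X : Fin 3 → MvPolynomial (Fin 3) R) = U.form X ↔ U = V.smul s := by
  rw [← smul_eq_C_mul, ← form_smul]
  exact ⟨fun h => (ext_of_form h).symm, fun h => by rw [h]⟩

theorem C_dvd_form {s : R} {U : Cubic R} :
    C s ∣ U.form (X : Fin 3 → MvPolynomial (Fin 3) R) ↔ ∃ V : Cubic R, U = V.smul s := by
  constructor
  · intro h
    have h := map_dvd (aeval ![(Polynomial.X : Polynomial R), Polynomial.X ^ 4, 1]) h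
    rw [aeval_C, Polynomial.algebraMap_eq, Polynomial.C_dvd_iff_dvd_coeff] at h
    simp only [coeff_form] at h
    obtain ⟨a, b, c, f, g, h', i, j, k, m⟩ := U
    obtain ⟨a, ha⟩ := h 3
    obtain ⟨b, hb⟩ := h 12
    obtain ⟨c, hc⟩ := h 0
    obtain ⟨f, hf⟩ := h 8
    obtain ⟨g, hg⟩ := h 1
    obtain ⟨h', hh⟩ := h 6
    obtain ⟨i, hi⟩ := h 4
    obtain ⟨j, hj⟩ := h 2
    obtain ⟨k, hk⟩ := h 9
    obtain ⟨m, hm⟩ := h 5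
    refine ⟨⟨a, b, c, f, g, h', i, j, k, m⟩, ?_⟩
    simp only [smul, mk.injEq]
    exact ⟨ha, hb, hc, hf, hg, hh, hi, hj, hk, hm⟩
  · rintro ⟨V, rfl⟩
    exact ⟨V.form X, (C_mul_form_eq_iff.2 rfl).symm⟩

theorem grad_poly (U : Cubic R) (q : Fin 3 → R) : grad U.poly q =
    ![3 * U.a * q 0 ^ 2 + U.g * q 2 ^ 2 + 2 * U.h * q 0 * q 1 + 2 * U.j * q 2 * q 0
        + U.k * q 1 ^ 2 + U.m * q 1 * q 2,
      3 * U.b * q 1 ^ 2 + 2 * U.f * q 1 * q 2 + U.h * q 0 ^ 2 + U.i * q 2 ^ 2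
        + 2 * U.k * q 0 * q 1 + U.m * q 0 * q 2,
      3 * U.c * q 2 ^ 2 + U.f * q 1 ^ 2 + 2 * U.g * q 2 * q 0 + 2 * U.i * q 1 * q 2
        + U.j * q 0 ^ 2 + U.m * q 0 * q 1] := by
  ext i
  fin_cases i <;> simp [grad, poly, form, pderiv_X, smul_eq_C_mul] <;> ring

/-- The derivative of the form at `p` in the direction of `v`. -/
def polar (U : Cubic R) (p v : Fin 3 → R) : R :=
  v 0 * (3 * U.a * p 0 ^ 2 + U.g * p 2 ^ 2 + 2 * U.h * p 0 * p 1 + 2 * U.j * p 2 * p 0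
        + U.k * p 1 ^ 2 + U.m * p 1 * p 2) +
  v 1 * (3 * U.b * p 1 ^ 2 + 2 * U.f * p 1 * p 2 + U.h * p 0 ^ 2 + U.i * p 2 ^ 2
        + 2 * U.k * p 0 * p 1 + U.m * p 0 * p 2) +
  v 2 * (3 * U.c * p 2 ^ 2 + U.f * p 1 ^ 2 + 2 * U.g * p 2 * p 0 + 2 * U.i * p 1 * p 2
        + U.j * p 0 ^ 2 + U.m * p 0 * p 1)

/-- The symmetric trilinear form of a cubic. -/
def trilinear (U : Cubic R) (p q r : Fin 3 → R) : R :=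
  6 * U.a * p 0 * q 0 * r 0 + 6 * U.b * p 1 * q 1 * r 1 + 6 * U.c * p 2 * q 2 * r 2
  + 2 * U.f * (p 1 * q 1 * r 2 + p 1 * q 2 * r 1 + p 2 * q 1 * r 1)
  + 2 * U.g * (p 2 * q 2 * r 0 + p 2 * q 0 * r 2 + p 0 * q 2 * r 2)
  + 2 * U.h * (p 0 * q 0 * r 1 + p 0 * q 1 * r 0 + p 1 * q 0 * r 0)
  + 2 * U.i * (p 2 * q 2 * r 1 + p 2 * q 1 * r 2 + p 1 * q 2 * r 2)
  + 2 * U.j * (p 0 * q 0 * r 2 + p 0 * q 2 * r 0 + p 2 * q 0 * r 0)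
  + 2 * U.k * (p 1 * q 1 * r 0 + p 1 * q 0 * r 1 + p 0 * q 1 * r 1)
  + U.m * (p 0 * q 1 * r 2 + p 0 * q 2 * r 1 + p 1 * q 0 * r 2 + p 1 * q 2 * r 0
    + p 2 * q 0 * r 1 + p 2 * q 1 * r 0)

/-- The substitution `x_j ← ∑ i, N i j * x_i`. -/
def subst (N : Matrix (Fin 3) (Fin 3) R) (U : Cubic R) : Cubic R where
  a := U.form (N 0)
  b := U.form (N 1)
  c := U.form (N 2)
  f := U.polar (N 1) (N 2)
  g := U.polar (N 2) (N 0)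
  h := U.polar (N 0) (N 1)
  i := U.polar (N 2) (N 1)
  j := U.polar (N 0) (N 2)
  k := U.polar (N 1) (N 0)
  m := U.trilinear (N 0) (N 1) (N 2)

theorem form_subst (N : Matrix (Fin 3) (Fin 3) R) (U : Cubic R) {A : Type*} [CommRing A]
    [Algebra R A] (x : Fin 3 → A) :
    (U.subst N).form x = U.form fun j => N 0 j • x 0 + N 1 j • x 1 + N 2 j • x 2 := by
  simp [subst, form, polar, trilinear, Algebra.smul_def, map_ofNat]; ring

theorem isTransform_iff {N : Matrix (Fin 3) (Fin 3) R} {U V : Cubic R} :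
    IsTransform N U V ↔ V = U.subst N := by
  have h : (U.subst N).form (X : Fin 3 → MvPolynomial (Fin 3) R) = U.form (linSubst N) := by
    rw [form_subst]
    congr 1
    ext j : 1
    simp [linSubst, Fin.sum_univ_three, smul_eq_C_mul]
  rw [IsTransform, ← h]
  exact ⟨ext_of_form, fun h => by rw [h]⟩

theorem poly_subst (N : Matrix (Fin 3) (Fin 3) R) (U : Cubic R) :
    (U.subst N).poly = aeval (linSubst N) U.poly := by
  rw [aeval_poly]
  exact isTransform_iff.2 rfl

theorem poly_smul (s : R) (U : Cubic R) : (U.smul s).poly = C s * U.poly := by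
  rw [poly, form_smul, smul_eq_C_mul, poly]

/-- A singular point modulo π^m at (0 : 0 : 1): each monomial of a₃ and a₄ contains one of g, i, c,
and each monomial of a₆ contains c or two factors among g, i. -/
theorem dvd_disc {π : R} {m : ℕ} {U : Cubic R} (hg : π ^ m ∣ U.g) (hi : π ^ m ∣ U.i)
    (hc : π ^ (2 * m) ∣ U.c) : π ^ (2 * m) ∣ U.disc := by
  obtain ⟨a, b, c, f, g, h, i, j, k, μ⟩ := U
  obtain ⟨g, rfl⟩ := hg
  obtain ⟨i, rfl⟩ := hi
  obtain ⟨c, rfl⟩ := hc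
  rw [pow_mul'] at *
  set s := π ^ m
  apply sq_dvd_delta
  · exact ⟨9 * a * b * (s * c) - a * f * i - b * g * j - (s * c) * h * k
      - f * g * h - i * j * k, by simp only [jacobian]; ring⟩
  · exact ⟨-3 * (a * b * g * i * s + a * (s * c) * f * k + b * (s * c) * h * j)
      + a * f ^ 2 * g + s * a * i ^ 2 * k + s * b * g ^ 2 * h + b * i * j ^ 2
      + (s * c) * f * h ^ 2 + (s * c) * j * k ^ 2 + f * g * j * k
      + f * h * i * j + s * g * h * i * k, by simp only [jacobian]; ring⟩
  · simp only [jacobian]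
    refine ⟨-f * g * h * i * j * k - c * h * i * j * k ^ 2 * s - c * f * j ^ 2 * k ^ 2 + c
      * f * h * j * k * μ - c * f * g * h ^ 2 * k * s - c * f ^ 2 * h ^ 2 * j - b * h * i
      ^ 2 * j ^ 2 - b * g * i * j ^ 2 * k + b * g * h * i * j * μ - b * g ^ 2 * h ^ 2 * i
      * s - b * f * g ^ 2 * h * j + b * c * j ^ 2 * k * μ - b * c * h * j * μ ^ 2 + 2 * b
      * c * h ^ 2 * i * j * s - b * c * g * h * j * k * s + b * c * g * h ^ 2 * μ * s + 2
      * b * c * f * h * j ^ 2 - b * c ^ 2 * h ^ 3 * s ^ 2 - b ^ 2 * c * j ^ 3 - a * g * i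
      ^ 2 * k ^ 2 * s - a * f * i ^ 2 * j * k + a * f * g * i * k * μ - a * f ^ 2 * g * h
      * i - a * f ^ 2 * g ^ 2 * k + a * c * i * k ^ 2 * μ * s - a * c * f * k * μ ^ 2 - a
      * c * f * h * i * k * s + 2 * a * c * f * g * k ^ 2 * s + 2 * a * c * f ^ 2 * j * k
      + a * c * f ^ 2 * h * μ - a * c ^ 2 * k ^ 3 * s ^ 2 + a * b * i ^ 2 * j * μ - a * b
      * g * i * μ ^ 2 + 2 * a * b * g * h * i ^ 2 * s + 2 * a * b * g ^ 2 * i * k * s - a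
      * b * f * g * i * j + a * b * f * g ^ 2 * μ + a * b * c * μ ^ 3 + 3 * a * b * c * i
      * j * k * s - 3 * a * b * c * h * i * μ * s - 3 * a * b * c * g * k * μ * s - 3 * a
      * b * c * f * j * μ + 3 * a * b * c * f * g * h * s + 9 * a * b * c ^ 2 * h * k * s
      ^ 2 - a * b ^ 2 * g ^ 3 * s + 9 * a * b ^ 2 * c * g * j * s - a ^ 2 * c * f ^ 3 - a
      ^ 2 * b * i ^ 3 * s + 9 * a ^ 2 * b * c * f * i * s - 27 * a ^ 2 * b ^ 2 * c ^ 2 * s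
      ^ 2, by ring⟩

/-- The substitution `x ← x + u z`. -/
def translate (u : R) (U : Cubic R) : Cubic R where
  a := U.a
  b := U.b
  c := U.c + U.g * u + U.j * u ^ 2 + U.a * u ^ 3
  f := U.f + U.k * u
  g := U.g + 2 * U.j * u + 3 * U.a * u ^ 2
  h := U.h
  i := U.i + U.m * u + U.h * u ^ 2
  j := U.j + 3 * U.a * u
  k := U.k
  m := U.m + 2 * U.h * u

/-- The substitution that interchanges `x` and `y`. -/
def swap (U : Cubic R) : Cubic R where
  a := U.b
  b := U.a
  c := U.c
  f := U.j
  g := U.i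
  h := U.k
  i := U.g
  j := U.f
  k := U.h
  m := U.m

theorem disc_swap (U : Cubic R) : U.swap.disc = U.disc := by
  rw [disc, disc]
  congr 1
  simp only [jacobian, swap, WeierstrassCurve.mk.injEq]
  refine ⟨trivial, ?_, ?_, ?_, ?_⟩ <;> ring

/-- The Jacobian changes by an explicit change of Weierstrass coordinates with unit 1. Together with
`swap` and the scalings this covers every substitution whose effect on Δ is needed, so invariance
under all of GL₃ can be avoided. -/
theorem disc_translate (u : R) (U : Cubic R) : (U.translate u).disc = U.disc := by
  -- The entries s, r, t are determined in this order by comparing a₁, a₂, a₃.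
  let W : WeierstrassCurve.VariableChange R :=
    ⟨1, -(u * (U.a * U.f + U.j * U.k)) - 2 * U.a * U.k * u ^ 2, U.h * u,
      -2 * U.h * U.j * U.k * u ^ 2 - U.g * U.h * U.k * u - U.f * U.h * U.j * u
      - U.b * U.j ^ 2 * u - U.a * U.k * U.m * u ^ 2 - 2 * U.a * U.i * U.k * u
      - 4 * U.a * U.h * U.k * u ^ 3 - 2 * U.a * U.f * U.h * u ^ 2 + 3 * U.a * U.b * U.g * u⟩
  have h : (U.translate u).jacobian = W • U.jacobian := by
    ext
    · simp [W, jacobian, translate, WeierstrassCurve.variableChange_a₁]; ring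
    · simp [W, jacobian, translate, WeierstrassCurve.variableChange_a₂]; ring
    · simp [W, jacobian, translate, WeierstrassCurve.variableChange_a₃]; ring
    · simp [W, jacobian, translate, WeierstrassCurve.variableChange_a₄]; ring
    · simp [W, jacobian, translate, WeierstrassCurve.variableChange_a₆]; ring
  rw [disc, h, WeierstrassCurve.variableChange_Δ, disc]
  simp [W]

theorem disc_smul (s : R) (U : Cubic R) : (U.smul s).disc = s ^ 12 * U.disc := by
  apply delta_of_weights <;> simp only [jacobian, smul] <;> ring

/-- The substitution `z ← π z`. -/
def scaleZ (s : R) (U : Cubic R) : Cubic R where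
  a := U.a
  b := U.b
  c := s ^ 3 * U.c
  f := s * U.f
  g := s ^ 2 * U.g
  h := U.h
  i := s ^ 2 * U.i
  j := s * U.j
  k := U.k
  m := s * U.m

theorem disc_scaleZ (s : R) (U : Cubic R) : (U.scaleZ s).disc = s ^ 12 * U.disc := by
  apply delta_of_weights <;> simp only [jacobian, scaleZ] <;> ring

end Cubic

end GenusOne

/-! ### Unimodular rows, compactness, and singular points of cubics. -/

namespace GenusOne

section Matrices

variable {R : Type*} [CommRing R]

theorem dvd_of_dvd_mulVec {n : ℕ} {N : Matrix (Fin n) (Fin n) R} (hN : IsUnit N.det) {s : R}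
    {v : Fin n → R} (h : ∀ i, s ∣ N.mulVec v i) (i : Fin n) : s ∣ v i := by
  have : v i = N⁻¹.mulVec (N.mulVec v) i := by
    rw [Matrix.mulVec_mulVec, Matrix.nonsing_inv_mul _ hN, Matrix.one_mulVec]
  rw [this]
  exact (Finset.dvd_sum fun j _ => (h j).mul_left (N⁻¹ i j) : s ∣ ∑ j, N⁻¹ i j * N.mulVec v j)

/-- A vector with a unit coordinate is a row of an invertible matrix. -/
theorem exists_isUnit_det_row {n : ℕ} {q : Fin n → R} {i : Fin n} (hi : IsUnit (q i))
    (k : Fin n) : ∃ N : Matrix (Fin n) (Fin n) R, IsUnit N.det ∧ N k = q := by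
  -- Row `i` of the identity is replaced by `q` and interchanged with row `k`; the determinant is
  -- the unit `q i` up to sign.
  refine ⟨((1 : Matrix (Fin n) (Fin n) R).updateRow i q).submatrix (Equiv.swap i k) id, ?_, ?_⟩
  · rw [Matrix.det_permute, ← Matrix.cramer_transpose_apply, Matrix.transpose_one,
      Matrix.cramer_one]
    exact ((Units.isUnit (Equiv.Perm.sign (Equiv.swap i k))).map (Int.castRingHom R)).mul hi
  · ext j
    simp

/-- A vector with a unit coordinate is moved to a vector of the standard basis by an invertible
matrix. -/
theorem exists_mulVec_eq_single {n : ℕ} {q : Fin n → R} {i : Fin n} (hi : IsUnit (q i))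
    (k : Fin n) : ∃ N : Matrix (Fin n) (Fin n) R, IsUnit N.det ∧ N.mulVec q = Pi.single k 1 := by
  obtain ⟨A, hA, hq⟩ := exists_isUnit_det_row hi k
  have hA' : IsUnit A.transpose.det := by rwa [Matrix.det_transpose]
  refine ⟨A.transpose⁻¹, Matrix.isUnit_nonsing_inv_det _ hA', ?_⟩
  have : A.transpose.mulVec (Pi.single k 1) = q := by
    rw [Matrix.mulVec_single_one, ← hq]; rfl
  rw [← this, Matrix.mulVec_mulVec, Matrix.nonsing_inv_mul _ hA', Matrix.one_mulVec]

theorem row_scalar_ne_zero [IsLocalRing R] {n : ℕ} {N : Matrix (Fin n) (Fin n) R}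
    (hN : IsUnit N.det) {k : Fin n} {c : IsLocalRing.ResidueField R}
    {p : Fin n → IsLocalRing.ResidueField R} (h : ∀ j, algebraMap R _ (N k j) = c * p j) :
    c ≠ 0 := by
  rintro rfl
  have h1 : (N.map (algebraMap R (IsLocalRing.ResidueField R))).det = 0 :=
    Matrix.det_eq_zero_of_row_eq_zero k fun j => by simpa using h j
  have h2 := hN.map (algebraMap R (IsLocalRing.ResidueField R))
  rw [RingHom.map_det, RingHom.mapMatrix_apply, h1] at h2
  exact h2.ne_zero rfl

end Matrices

section Compactness

/-- Over a compact ring, equations that are solvable modulo all powers of `π` are solvable. -/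
theorem exists_eq_zero_of_pow_dvd {R : Type*} [CommRing R] [IsDomain R]
    [IsDiscreteValuationRing R] [TopologicalSpace R] {π : R} (hπ : Irreducible π)
    (hcl : ∀ m : ℕ, IsClosed {x : R | π ^ m ∣ x}) {T : Type*} [TopologicalSpace T] [CompactSpace T]
    {ι : Type*} (f : ι → T → R) (hf : ∀ i, Continuous (f i))
    (h : ∀ m : ℕ, ∃ x, ∀ i, π ^ m ∣ f i x) : ∃ x, ∀ i, f i x = 0 := by
  -- The solution sets modulo π^m form a decreasing sequence of non-empty compact sets, so they have
  -- a common point. There every equation is divisible by all powers of π, hence zero.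
  have key := IsCompact.nonempty_iInter_of_sequence_nonempty_isCompact_isClosed
    (fun m : ℕ => ⋂ i, f i ⁻¹' {x : R | π ^ m ∣ x})
    (fun m => Set.iInter_mono fun i x hx => (pow_dvd_pow π (Nat.le_succ m)).trans hx)
    (fun m => by
      obtain ⟨x, hx⟩ := h m
      exact ⟨x, Set.mem_iInter.2 hx⟩)
    (isClosed_iInter fun i => (hcl 0).preimage (hf i)).isCompact
    (fun m => isClosed_iInter fun i => (hcl m).preimage (hf i))
  obtain ⟨x, hx⟩ := key
  refine ⟨x, fun i => ?_⟩
  simp only [Set.mem_iInter, Set.mem_preimage, Set.mem_ofPred_eq] at hx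
  by_contra h0
  have := fun m => le_natVal_of_pow_dvd hπ h0 (hx m i)
  have := this (natVal (f i x) + 1)
  omega

end Compactness

theorem exists_zero_binary_quadratic {L : Type*} [Field L] [IsAlgClosed L] (a b c : L) :
    ∃ y z : L, (y ≠ 0 ∨ z ≠ 0) ∧ a * y ^ 2 + b * (y * z) + c * z ^ 2 = 0 := by
  by_cases ha : a = 0
  · exact ⟨1, 0, by simp, by simp [ha]⟩
  · obtain ⟨t, ht⟩ := IsAlgClosed.exists_root
      (Polynomial.C a * Polynomial.X ^ 2 + Polynomial.C b * Polynomial.X + Polynomial.C c)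
      (by rw [Polynomial.degree_quadratic ha]; norm_num)
    refine ⟨t, 1, by simp, ?_⟩
    simpa [Polynomial.IsRoot] using ht

namespace Cubic

section

variable {R : Type*} [CommRing R]

theorem vecMul_three (p : Fin 3 → R) (N : Matrix (Fin 3) (Fin 3) R) :
    Matrix.vecMul p N = fun j => N 0 j * p 0 + N 1 j * p 1 + N 2 j * p 2 := by
  ext j
  simp [Matrix.vecMul, dotProduct, Fin.sum_univ_three, mul_comm]

theorem form_eq_of_subst_eq_smul {N : Matrix (Fin 3) (Fin 3) R} {s : R} {U V : Cubic R}
    (h : U.subst N = V.smul s) (q : Fin 3 → R) :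
    U.form (Matrix.vecMul q N) = s * V.form q := by
  have := congrArg (fun W => form W q) h
  simp only [form_subst, form_smul, smul_eq_mul] at this
  rw [vecMul_three, this]

theorem grad_eq_of_subst_eq_smul {N : Matrix (Fin 3) (Fin 3) R} {s : R} {U V : Cubic R}
    (h : U.subst N = V.smul s) (q : Fin 3 → R) :
    N.mulVec (grad U.poly (Matrix.vecMul q N)) = s • grad V.poly q := by
  have := congrArg (fun W => grad (poly W) q) h
  simpa only [poly_subst, poly_smul, grad_linSubst, grad_C_mul] using this

theorem subst_subst (N M : Matrix (Fin 3) (Fin 3) R) (U : Cubic R) :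
    (U.subst N).subst M = U.subst (M * N) := by
  apply ext_of_form
  rw [form_subst, form_subst, form_subst]
  congr 1
  ext j : 1
  simp only [Matrix.mul_apply, Fin.sum_univ_three, add_smul, mul_smul, smul_add]
  simp only [smul_comm (M _ _)]
  abel

theorem smul_one (U : Cubic R) : U.smul 1 = U := by
  cases U; simp [smul]

theorem smul_smul (s t : R) (U : Cubic R) : (U.smul t).smul s = U.smul (s * t) := by
  cases U; simp [smul, mul_assoc]

theorem smul_injective [IsDomain R] {s : R} (hs : s ≠ 0) {U V : Cubic R}
    (h : U.smul s = V.smul s) : U = V := by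
  cases U; cases V
  simpa [smul, hs] using h

theorem subst_diag (s : R) (U : Cubic R) : U.subst !![s, 0, 0; 0, s, 0; 0, 0, 1] =
    ⟨s ^ 3 * U.a, s ^ 3 * U.b, U.c, s ^ 2 * U.f, s * U.g, s ^ 3 * U.h, s * U.i, s ^ 2 * U.j,
      s ^ 3 * U.k, s ^ 2 * U.m⟩ := by
  simp only [subst, form, polar, trilinear, mk.injEq, Matrix.of_apply, Matrix.cons_val_zero,
    Matrix.cons_val_one, Matrix.cons_val, smul_eq_mul]
  refine ⟨?_, ?_, ?_, ?_, ?_, ?_, ?_, ?_, ?_, ?_⟩ <;>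
    first | trivial | ring1 | exact Or.inl (by ring1)

theorem singMod_iff {π : R} {m : ℕ} {U : Cubic R} {q : Fin 3 → R} :
    SingMod π m U.poly q ↔ π ^ (2 * m) ∣ U.form q ∧ ∀ i, π ^ m ∣ grad U.poly q i := by
  rw [SingMod, eval_poly]

/-- The coefficients after moving a point to `(0 : 0 : 1)`. -/
theorem dvd_coeffs_move {π : R} {m : ℕ} {N : Matrix (Fin 3) (Fin 3) R} {U : Cubic R}
    (h : SingMod π m U.poly (N 2)) :
    π ^ m ∣ (U.subst N).g ∧ π ^ m ∣ (U.subst N).i ∧ π ^ (2 * m) ∣ (U.subst N).c := by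
  rw [singMod_iff] at h
  have hp : ∀ v, π ^ m ∣ U.polar (N 2) v := by
    intro v
    have : U.polar (N 2) v = ∑ j, v j * grad U.poly (N 2) j := by
      rw [Fin.sum_univ_three, grad_poly]; rfl
    rw [this]
    exact Finset.dvd_sum fun j _ => (h.2 j).mul_left _
  exact ⟨hp _, hp _, h.1⟩

theorem exists_subst_diag_eq_smul {π : R} {U : Cubic R} (hg : π ∣ U.g) (hi : π ∣ U.i)
    (hc : π ^ 2 ∣ U.c) : ∃ V : Cubic R, U.subst !![π, 0, 0; 0, π, 0; 0, 0, 1] = V.smul (π ^ 2) := by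
  rw [subst_diag]
  obtain ⟨a, b, c, f, g, h, i, j, k, m⟩ := U
  obtain ⟨g, rfl⟩ := hg
  obtain ⟨i, rfl⟩ := hi
  obtain ⟨c, rfl⟩ := hc
  refine ⟨⟨π * a, π * b, c, f, g, π * h, i, j, π * k, m⟩, ?_⟩
  simp only [smul, mk.injEq]
  refine ⟨?_, ?_, ?_, ?_, ?_, ?_, ?_, ?_, ?_, ?_⟩ <;>
    first | trivial | ring1 | exact Or.inl (by ring1)

/-- After the further substitution z ← s z the effect is a translation followed by multiplication of
all three variables by s, that is, of the cubic by s³. Comparison gives s^36 / s^12. -/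
theorem disc_subst_translate [IsDomain R] {s : R} (hs : s ≠ 0) (u v : R) (U : Cubic R) :
    (U.subst !![s, 0, 0; 0, s, 0; u, v, 1]).disc = s ^ 24 * U.disc := by
  have h : (U.subst !![s, 0, 0; 0, s, 0; u, v, 1]).scaleZ s =
      ((U.translate u).swap.translate v).swap.smul (s ^ 3) := by
    simp only [subst, form, polar, trilinear, scaleZ, translate, swap, smul, mk.injEq]
    simp
    refine ⟨?_, ?_, ?_, ?_, ?_, ?_, ?_, ?_, ?_, ?_⟩ <;>
    first | trivial | ring1 | exact Or.inl (by ring1)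
  have := congrArg disc h
  rw [disc_scaleZ, disc_smul, disc_swap, disc_translate, disc_swap, disc_translate] at this
  apply mul_left_cancel₀ (pow_ne_zero 12 hs)
  rw [this]
  ring

theorem dvd_disc_of_singMod [IsDomain R] {π : R} {m : ℕ} {U : Cubic R} {x y : R}
    (h : SingMod π m U.poly ![x, y, 1]) : π ^ (2 * m) ∣ U.disc := by
  obtain ⟨h1, h2, h3⟩ := dvd_coeffs_move (N := !![1, 0, 0; 0, 1, 0; x, y, 1]) h
  have := dvd_disc h1 h2 h3
  rwa [disc_subst_translate one_ne_zero, one_pow, one_mul] at this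

/-- Transport of singular points modulo powers of `π` through a transformation with
`x₁ ← π x₁`, `x₂ ← π x₂`. -/
theorem singMod_of_subst_diag [IsDomain R] {π : R} (hπ : π ≠ 0) {m : ℕ} {s : R} {U V : Cubic R}
    (hs : π ^ 2 ∣ s) (h : U.subst !![π, 0, 0; 0, π, 0; 0, 0, 1] = V.smul s) {q : Fin 3 → R}
    (hq : SingMod π m V.poly q) : SingMod π (m + 1) U.poly ![π * q 0, π * q 1, q 2] := by
  have hf := form_eq_of_subst_eq_smul h q
  have hg := grad_eq_of_subst_eq_smul h q
  have hv : Matrix.vecMul q !![π, 0, 0; 0, π, 0; 0, 0, 1] = ![π * q 0, π * q 1, q 2] := by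
    rw [vecMul_three]
    ext j
    fin_cases j <;> simp
  rw [hv] at hf hg
  rw [singMod_iff] at hq ⊢
  obtain ⟨s, rfl⟩ := hs
  set g := grad U.poly ![π * q 0, π * q 1, q 2]
  -- The derivatives along x and y carry an extra factor π, which uses up one of the two factors π
  -- in the scalar; the other one raises the order of the gradient.
  have hg0 : π * g 0 = π * (π * s * grad V.poly q 0) := by
    have := congrFun hg 0
    simp [Matrix.mulVec, dotProduct, Fin.sum_univ_three] at this
    rw [this]; ring
  have hg1 : π * g 1 = π * (π * s * grad V.poly q 1) := by
    have := congrFun hg 1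
    simp [Matrix.mulVec, dotProduct, Fin.sum_univ_three] at this
    rw [this]; ring
  have hg2 : g 2 = π * (π * s * grad V.poly q 2) := by
    have := congrFun hg 2
    simp [Matrix.mulVec, dotProduct, Fin.sum_univ_three] at this
    rw [this]; ring
  have key : ∀ i, π ^ (m + 1) ∣ π * s * grad V.poly q i := fun i => by
    rw [pow_succ', mul_assoc]
    exact mul_dvd_mul_left _ ((hq.2 i).mul_left _)
  constructor
  · rw [hf, show 2 * (m + 1) = 2 + 2 * m by ring, pow_add, mul_assoc]
    exact mul_dvd_mul_left _ (hq.1.mul_left _)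
  · intro i
    fin_cases i
    · exact mul_left_cancel₀ hπ hg0 ▸ key 0
    · exact mul_left_cancel₀ hπ hg1 ▸ key 1
    · exact hg2 ▸ (key 2).mul_left _

theorem singMod_of_subst {π : R} {m : ℕ} {U : Cubic R} {N : Matrix (Fin 3) (Fin 3) R}
    (hN : IsUnit N.det) {q : Fin 3 → R} (hq : SingMod π m (U.subst N).poly q) :
    SingMod π m U.poly (Matrix.vecMul q N) := by
  have h : U.subst N = (U.subst N).smul 1 := (smul_one _).symm
  have hf := form_eq_of_subst_eq_smul h q
  have hg := grad_eq_of_subst_eq_smul h q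
  rw [singMod_iff] at hq ⊢
  refine ⟨by rw [hf, one_mul]; exact hq.1, dvd_of_dvd_mulVec hN fun i => ?_⟩
  rw [hg, one_smul]
  exact hq.2 i

theorem singMod_normalise {π : R} {m : ℕ} {U : Cubic R} {q : Fin 3 → R} (h2 : IsUnit (q 2))
    (hq : SingMod π m U.poly q) : ∃ x y, SingMod π m U.poly ![x, y, 1] := by
  obtain ⟨w, hw⟩ := h2.exists_right_inv
  refine ⟨q 0 * w, q 1 * w, ?_⟩
  have he : (![q 0 * w, q 1 * w, 1] : Fin 3 → R) = ![q 0 * w, q 1 * w, q 2 * w] := by rw [hw]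
  rw [singMod_iff] at hq ⊢
  rw [he]
  constructor
  · convert hq.1.mul_left (w ^ 3) using 1
    simp [form]; ring
  · intro i
    convert (hq.2 i).mul_left (w ^ 2) using 1
    fin_cases i <;> simp [grad_poly] <;> ring

end

section BaseChange

variable {R : Type*} [CommRing R]

/-- Base change. -/
def baseChange (A : Type*) [CommRing A] [Algebra R A] (U : Cubic R) : Cubic A :=
  ⟨algebraMap R A U.a, algebraMap R A U.b, algebraMap R A U.c, algebraMap R A U.f,
    algebraMap R A U.g, algebraMap R A U.h, algebraMap R A U.i, algebraMap R A U.j,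
    algebraMap R A U.k, algebraMap R A U.m⟩

variable (A : Type*) [CommRing A] [Algebra R A]

theorem form_baseChange (U : Cubic R) (x : Fin 3 → A) : (U.baseChange A).form x = U.form x := by
  simp [baseChange, form, Algebra.smul_def]

theorem poly_baseChange (U : Cubic R) :
    (U.baseChange A).poly = U.form (X : Fin 3 → MvPolynomial (Fin 3) A) := by
  simp [baseChange, poly, form, Algebra.smul_def,
    IsScalarTower.algebraMap_apply R A (MvPolynomial (Fin 3) A)]

theorem baseChange_subst (U : Cubic R) (N : Matrix (Fin 3) (Fin 3) R) :
    (U.subst N).baseChange A = (U.baseChange A).subst (N.map (algebraMap R A)) := by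
  simp [baseChange, subst, form, polar, trilinear, map_ofNat]

theorem baseChange_smul (U : Cubic R) (s : R) :
    (U.smul s).baseChange A = (U.baseChange A).smul (algebraMap R A s) := by
  simp [baseChange, smul]

theorem nonsingular_iff {K : Type*} [Field K] [Algebra R K] {U : Cubic R} :
    U.Nonsingular K ↔ ∀ p : Fin 3 → AlgebraicClosure K, p ≠ 0 →
      (U.baseChange (AlgebraicClosure K)).form p = 0 →
      grad (U.baseChange (AlgebraicClosure K)).poly p ≠ 0 := by
  simp only [Nonsingular, IsSmoothAt, form_baseChange, poly_baseChange]
  exact ⟨fun h p hp hf => (h p hp hf).2, fun h p hp hf => ⟨hf, h p hp hf⟩⟩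

variable {K : Type*} [Field K] [Algebra R K] [FaithfulSMul R K]

theorem algebraMap_algebraicClosure_injective (R : Type*) [CommRing R] (K : Type*) [Field K]
    [Algebra R K] [FaithfulSMul R K] :
    Function.Injective (algebraMap R (AlgebraicClosure K)) := by
  rw [IsScalarTower.algebraMap_eq R K (AlgebraicClosure K)]
  exact (algebraMap K _).injective.comp (FaithfulSMul.algebraMap_injective R K)

/-- Over the fraction field the matrix is invertible, so a singular point of V would be carried to a
singular point of U. This is how smoothness passes along the recursion. -/
theorem nonsingular_of_subst_eq_smul {U V : Cubic R} (hU : U.Nonsingular K)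
    {N : Matrix (Fin 3) (Fin 3) R} (hN : N.det ≠ 0) {s : R} (h : U.subst N = V.smul s) :
    V.Nonsingular K := by
  have hinj := algebraMap_algebraicClosure_injective R K
  rw [nonsingular_iff] at hU ⊢
  intro p hp hf hg
  have h' := congrArg (baseChange (AlgebraicClosure K)) h
  rw [baseChange_subst, baseChange_smul] at h'
  set M := N.map (algebraMap R (AlgebraicClosure K))
  have hM : M.det ≠ 0 := by
    have : M.det = algebraMap R (AlgebraicClosure K) N.det := by
      rw [RingHom.map_det]; rfl
    rw [this]
    exact (map_ne_zero_iff _ hinj).2 hN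
  have h1 := form_eq_of_subst_eq_smul h' p
  have h2 := grad_eq_of_subst_eq_smul h' p
  rw [hf, mul_zero] at h1
  rw [hg, smul_zero] at h2
  refine hU _ (fun h0 => hp ?_) h1 (Matrix.eq_zero_of_mulVec_eq_zero hM h2)
  exact Matrix.eq_zero_of_vecMul_eq_zero hM h0

/-- Once the line is moved to x = 0, the cubic is x times a conic. Over an algebraically closed
field line and conic meet, and all derivatives vanish at a common point. -/
theorem singular_of_contains_line [Nontrivial R] {U : Cubic R} {α β : R} (hb : U.form ![α, 1, 0] = 0)
    (hc : U.form ![β, 0, 1] = 0) (hf : U.polar ![α, 1, 0] ![β, 0, 1] = 0)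
    (hi : U.polar ![β, 0, 1] ![α, 1, 0] = 0) : ¬ U.Nonsingular K := by
  intro hU
  have hU := nonsingular_of_subst_eq_smul hU (N := !![1, 0, 0; α, 1, 0; β, 0, 1])
    (by simp [Matrix.det_fin_three]) (smul_one _).symm
  rw [nonsingular_iff] at hU
  set V := U.subst !![1, 0, 0; α, 1, 0; β, 0, 1] with hV
  have hb' : (V.baseChange (AlgebraicClosure K)).b = 0 := by
    rw [baseChange, ← map_zero (algebraMap R (AlgebraicClosure K)), ← hb]; rfl
  have hc' : (V.baseChange (AlgebraicClosure K)).c = 0 := by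
    rw [baseChange, ← map_zero (algebraMap R (AlgebraicClosure K)), ← hc]; rfl
  have hf' : (V.baseChange (AlgebraicClosure K)).f = 0 := by
    rw [baseChange, ← map_zero (algebraMap R (AlgebraicClosure K)), ← hf]; rfl
  have hi' : (V.baseChange (AlgebraicClosure K)).i = 0 := by
    rw [baseChange, ← map_zero (algebraMap R (AlgebraicClosure K)), ← hi]; rfl
  generalize V.baseChange (AlgebraicClosure K) = W at *
  obtain ⟨y, z, hyz, h⟩ := exists_zero_binary_quadratic W.k W.m W.g
  refine hU ![0, y, z] ?_ ?_ ?_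
  · intro h0
    have := congrFun h0 1
    have := congrFun h0 2
    simp_all
  · simp [form, hb', hc', hf', hi']
  · rw [grad_poly]
    ext j
    fin_cases j
    · simp
      linear_combination h
    · simp [hb', hf', hi']
    · simp [hc', hf', hi']

end BaseChange

end Cubic

end GenusOne

/-! ### Degree 3: the local solubility test. -/

namespace GenusOne

/-- The termination measure in degree 3, and for the Tamagawa algorithm in degree 4: `P m` says that
there is a singular point, line or conic modulo π^m before a step, and `Q m` says it after the step.
-/
theorem sInf_lt_sInf_of_imp {P Q : ℕ → Prop} (hP : ∃ e, ¬ P e) (h0 : P 0)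
    (h : ∀ m, Q m → P (m + 1)) : sInf {e | ¬ Q e} < sInf {e | ¬ P e} := by
  have hs : sInf {e | ¬ P e} ∈ {e | ¬ P e} := Nat.sInf_mem hP
  rcases hn : sInf {e | ¬ P e} with _ | n
  · rw [hn] at hs
    exact absurd h0 hs
  · rw [hn] at hs
    exact Nat.lt_succ_of_le (Nat.sInf_le fun hQ => hs (h n hQ))

namespace Cubic

section

variable {R : Type*} [CommRing R]

theorem smul_subst (N : Matrix (Fin 3) (Fin 3) R) (s : R) (U : Cubic R) :
    (U.smul s).subst N = (U.subst N).smul s := by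
  apply ext_of_form
  rw [form_subst, form_smul, form_smul, form_subst]

theorem subst_one (U : Cubic R) : U.subst 1 = U := by
  apply ext_of_form
  rw [form_subst, Matrix.one_fin_three]
  congr 1
  ext j : 1
  fin_cases j <;> simp

theorem subst_affine (s u v : R) (U : Cubic R) :
    U.subst !![s, 0, 0; 0, s, 0; u, v, 1] =
      (U.subst !![1, 0, 0; 0, 1, 0; u, v, 1]).subst !![s, 0, 0; 0, s, 0; 0, 0, 1] := by
  rw [subst_subst]
  congr 1
  ext i j
  fin_cases i <;> fin_cases j <;> simp [Matrix.mul_apply, Fin.sum_univ_three]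

theorem form_diag (s : R) (U : Cubic R) :
    U.form (![C s * X 0, C s * X 1, X 2] : Fin 3 → MvPolynomial (Fin 3) R) =
      (U.subst !![s, 0, 0; 0, s, 0; 0, 0, 1]).form X := by
  rw [form_subst]
  congr 1
  ext j : 1
  fin_cases j <;> simp [smul_eq_C_mul]

theorem form_diag_left (s : R) (U : Cubic R) :
    U.form (![C s * X 0, X 1, X 2] : Fin 3 → MvPolynomial (Fin 3) R) =
      (U.subst !![s, 0, 0; 0, 1, 0; 0, 0, 1]).form X := by
  rw [form_subst]
  congr 1
  ext j : 1
  fin_cases j <;> simp [smul_eq_C_mul]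

theorem form_shear (a b : R) (U : Cubic R) :
    U.form (![X 0 - C a * X 1 - C b * X 2, X 1, X 2] : Fin 3 → MvPolynomial (Fin 3) R) =
      (U.subst !![1, 0, 0; -a, 1, 0; -b, 0, 1]).form X := by
  rw [form_subst]
  congr 1
  ext j : 1
  fin_cases j <;> simp [smul_eq_C_mul, sub_eq_add_neg]

theorem subst_diag_left (s : R) (U : Cubic R) : U.subst !![s, 0, 0; 0, 1, 0; 0, 0, 1] =
    ⟨s ^ 3 * U.a, U.b, U.c, U.f, s * U.g, s ^ 2 * U.h, U.i, s ^ 2 * U.j, s * U.k, s * U.m⟩ := by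
  simp only [subst, form, polar, trilinear, mk.injEq, Matrix.of_apply, Matrix.cons_val_zero,
    Matrix.cons_val_one, Matrix.cons_val, smul_eq_mul]
  refine ⟨?_, ?_, ?_, ?_, ?_, ?_, ?_, ?_, ?_, ?_⟩ <;> ring

theorem subst_shear (a b : R) (U : Cubic R) :
    let V := U.subst !![1, 0, 0; a, 1, 0; b, 0, 1]
    V.b = U.a * a ^ 3 + U.b + U.h * a ^ 2 + U.k * a ∧
    V.c = U.a * b ^ 3 + U.c + U.g * b + U.j * b ^ 2 ∧
    V.f = b * (3 * U.a * a ^ 2 + 2 * U.h * a + U.k) + U.f + U.j * a ^ 2 + U.m * a ∧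
    V.i = a * (3 * U.a * b ^ 2 + 2 * U.j * b + U.g) + U.i + U.h * b ^ 2 + U.m * b := by
  simp only [subst, form, polar, Matrix.of_apply, Matrix.cons_val_zero,
    Matrix.cons_val_one, Matrix.cons_val, smul_eq_mul]
  refine ⟨?_, ?_, ?_, ?_⟩ <;> ring

/-- The cubic contains the line `x = α y + β z` modulo `π ^ m`. -/
def LineMod (π : R) (m : ℕ) (U : Cubic R) (α β : R) : Prop :=
  let V := U.subst !![1, 0, 0; α, 1, 0; β, 0, 1]
  π ^ m ∣ V.b ∧ π ^ m ∣ V.c ∧ π ^ m ∣ V.f ∧ π ^ m ∣ V.i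

theorem lineMod_iff {π : R} {m : ℕ} {U : Cubic R} {α β : R} : LineMod π m U α β ↔
    π ^ m ∣ U.form ![α, 1, 0] ∧ π ^ m ∣ U.form ![β, 0, 1] ∧
      π ^ m ∣ U.polar ![α, 1, 0] ![β, 0, 1] ∧ π ^ m ∣ U.polar ![β, 0, 1] ![α, 1, 0] :=
  Iff.rfl

/-- Undoing Steps (iii) and (ii): the shear adds a, b to the slopes and x ← π x multiplies them by
π. On the line the equation gains the factor π that Step (ii) had divided out. -/
theorem lineMod_of_subst {π : R} {m : ℕ} {U V : Cubic R}
    (h : U.subst !![π, 0, 0; 0, 1, 0; 0, 0, 1] = V.smul π) {a b α β : R}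
    (hV : LineMod π m (V.subst !![1, 0, 0; a, 1, 0; b, 0, 1]) α β) :
    LineMod π (m + 1) U (π * (α + a)) (π * (β + b)) := by
  have e : (U.subst !![1, 0, 0; π * (α + a), 1, 0; π * (β + b), 0, 1]).subst
        !![π, 0, 0; 0, 1, 0; 0, 0, 1] =
      ((V.subst !![1, 0, 0; a, 1, 0; b, 0, 1]).subst !![1, 0, 0; α, 1, 0; β, 0, 1]).smul π := by
    rw [← smul_subst, ← smul_subst, ← h, subst_subst, subst_subst, subst_subst]
    congr 1
    ext i j
    fin_cases i <;> fin_cases j <;>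
      simp [Matrix.mul_apply, Fin.sum_univ_three, mul_add, mul_comm, add_comm]
  rw [subst_diag_left] at e
  obtain ⟨h1, h2, h3, h4⟩ := hV
  simp only [smul, mk.injEq] at e
  simp only [LineMod, e, pow_succ']
  exact ⟨mul_dvd_mul_left _ h1, mul_dvd_mul_left _ h2, mul_dvd_mul_left _ h3,
    mul_dvd_mul_left _ h4⟩

theorem C_mul_X_pow_injective {F : Type*} [CommRing F] {b f i c b' f' i' c' : F}
    (h : Polynomial.C b * Polynomial.X ^ 3 + Polynomial.C f * Polynomial.X ^ 2 +
      Polynomial.C i * Polynomial.X + Polynomial.C c =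
      Polynomial.C b' * Polynomial.X ^ 3 + Polynomial.C f' * Polynomial.X ^ 2 +
      Polynomial.C i' * Polynomial.X + Polynomial.C c') : b = b' ∧ f = f' ∧ i = i' ∧ c = c' := by
  have h := fun k => congrArg (fun p => Polynomial.coeff p k) h
  have h0 := h 0
  have h1 := h 1
  have h2 := h 2
  have h3 := h 3
  simp [Polynomial.coeff_X, Polynomial.coeff_C, Polynomial.coeff_X_pow] at h0 h1 h2 h3
  exact ⟨h3, h2, h1, h0⟩

end

variable {R : Type*} [CommRing R] [IsDomain R] [IsDiscreteValuationRing R] {π : R}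

theorem nonRegular_lift (hπ : Irreducible π) {U : Cubic R} {affine : Bool}
    {p : Fin 3 → IsLocalRing.ResidueField R} (hp : p ∈ U.nonRegular π affine) {q : Fin 3 → R}
    (hq : IsLift q p) : SingMod π 1 U.poly q := by
  obtain ⟨-, -, h1, h2, q₀, h3, h4⟩ := hp
  refine singMod_one_of_lift hπ ?_ h3 hq (by rwa [eval_poly])
  rw [← form_X_eq_map]
  by_contra h
  exact h2 ⟨h1, h⟩

theorem calls_search_iff {U : Cubic R} {t : Stage (Cubic R)}
    (h : Calls (isLocallySoluble π) (.search U) t) :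
    ∃ p ∈ U.nonRegular π true, ∃ u : Fin 2 → R, IsLift u ![p 0, p 1] ∧
      t = .normalise (U.subst !![π, 0, 0; 0, π, 0; u 0, u 1, 1]) := by
  obtain ⟨calls, ⟨-, rfl⟩ | ⟨-, hc⟩, ht⟩ := h
  · simp at ht
  · obtain ⟨p, hp, u, U₁, hu, h1, rfl⟩ := hc.exists_of_mem ht
    refine ⟨p, hp, u, hu, ?_⟩
    congr 1
    apply ext_of_form
    rw [h1, form_subst]
    congr 1
    ext j : 1
    fin_cases j <;> simp [smul_eq_C_mul, add_comm]

theorem exists_calls_search [Finite (IsLocalRing.ResidueField R)] (π : R) (U : Cubic R) :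
    ∃ calls, isLocallySoluble π (.search U) calls := by
  by_cases h : ∃ p : Fin 3 → IsLocalRing.ResidueField R, p 2 = 1 ∧ U.IsSmoothAt p
  · exact ⟨[], .inl ⟨h, rfl⟩⟩
  · obtain ⟨calls, hc⟩ := ForEach.exists (Set.toFinite (U.nonRegular π true))
      (call := fun (p : Fin 3 → IsLocalRing.ResidueField R) (t : Stage (Cubic R)) =>
        ∃ (u : Fin 2 → R) (U₁ : Cubic R), IsLift u ![p 0, p 1] ∧
            U₁.form (X : Fin 3 → MvPolynomial (Fin 3) R)
              = U.form ![C (u 0) * X 2 + C π * X 0, C (u 1) * X 2 + C π * X 1, X 2] ∧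
            t = .normalise U₁) (by
        intro p _
        obtain ⟨u, hu⟩ := exists_lift ![p 0, p 1]
        refine ⟨_, u, U.subst !![π, 0, 0; 0, π, 0; u 0, u 1, 1], hu, ?_, rfl⟩
        rw [form_subst]
        congr 1
        ext j : 1
        fin_cases j <;> simp [smul_eq_C_mul, add_comm])
    exact ⟨calls, .inr ⟨h, hc⟩⟩

theorem calls_normalise_iff {U : Cubic R} {t : Stage (Cubic R)}
    (h : Calls (isLocallySoluble π) (.normalise U) t) :
    ∃ (r : ℕ) (V : Cubic R), U = V.smul (π ^ r) ∧
      ¬ C π ∣ V.form (X : Fin 3 → MvPolynomial (Fin 3) R) ∧ t = .search V := by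
  obtain ⟨calls, ⟨r, V, h1, h2, rfl⟩, ht⟩ := h
  exact ⟨r, V, C_mul_form_eq_iff.1 h1, h2, by simpa using ht⟩

theorem form_X_ne_zero {K : Type*} [Field K] [Algebra R K] {U : Cubic R}
    (hU : U.Nonsingular K) : U.form (X : Fin 3 → MvPolynomial (Fin 3) R) ≠ 0 := by
  intro h
  rw [nonsingular_iff] at hU
  obtain rfl : U = ⟨0, 0, 0, 0, 0, 0, 0, 0, 0, 0⟩ := ext_of_form (by rw [h]; simp [form])
  refine hU ![1, 0, 0] (fun h => by simpa using congrFun h 0) ?_ ?_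
  · simp [form, baseChange]
  · rw [grad_poly]
    ext j
    fin_cases j <;> simp [baseChange]

/-- Step (i) divides by the exact power of π, which is finite because the form is not zero. -/
theorem exists_calls_normalise (hπ : Irreducible π) {U : Cubic R}
    (hU : U.form (X : Fin 3 → MvPolynomial (Fin 3) R) ≠ 0) :
    ∃ calls, isLocallySoluble π (.normalise U) calls := by
  have hu : ¬ IsUnit (C π : MvPolynomial (Fin 3) R) := fun h =>
    hπ.not_isUnit (by simpa using h.map (eval (0 : Fin 3 → R)))
  obtain ⟨c, hc, hn⟩ := (FiniteMultiplicity.of_not_isUnit hu hU).exists_eq_pow_mul_and_not_dvd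
  rw [← C_pow] at hc
  obtain ⟨V, hV⟩ := C_dvd_form.1 (Dvd.intro _ hc.symm)
  refine ⟨_, _, V, C_mul_form_eq_iff.2 hV, ?_, rfl⟩
  have h0 : (C (π ^ multiplicity (C π) (U.form (X : Fin 3 → MvPolynomial (Fin 3) R))) :
      MvPolynomial (Fin 3) R) ≠ 0 := by
    simpa using fun h => absurd h hπ.ne_zero
  rwa [mul_left_cancel₀ h0 ((C_mul_form_eq_iff.2 hV).trans hc)]

/-- At a singular point modulo π the substitution produces a form divisible by π². As Step (i)
removes every factor π, at least two are removed. -/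
theorem iteration_iff (hπ : Irreducible π) {U V : Cubic R}
    (h : Iteration (isLocallySoluble π) U V) :
    ∃ (u v : R) (r : ℕ), U.subst !![π, 0, 0; 0, π, 0; u, v, 1] = V.smul (π ^ (r + 2)) := by
  obtain ⟨U₁, U₂, h1, h2, h3⟩ := h
  obtain ⟨p, hp, u, hu, he⟩ := calls_search_iff h1
  obtain rfl : U₁ = U.subst !![π, 0, 0; 0, π, 0; u 0, u 1, 1] := by simpa using he
  rcases h2.cases_head with rfl | ⟨U₃, h4, -⟩
  swap
  · obtain ⟨_, _, -, -, h⟩ := calls_normalise_iff h4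
    simp at h
  obtain ⟨r, W, hr, hn, hW⟩ := calls_normalise_iff h3
  obtain rfl : V = W := by simpa using hW
  have hp2 : p 2 = 1 := by
    obtain ⟨i, hi, hj⟩ := hp.1
    fin_cases i
    · exact absurd (hj 2 (by simp)) (hp.2.1 rfl)
    · exact absurd (hj 2 (by simp)) (hp.2.1 rfl)
    · exact hi
  have hs := nonRegular_lift hπ hp (q := ![u 0, u 1, 1]) (by
    intro i
    fin_cases i
    · simpa using hu 0
    · simpa using hu 1
    · simp [hp2])
  obtain ⟨hg, hi, hc⟩ := dvd_coeffs_move (N := !![1, 0, 0; 0, 1, 0; u 0, u 1, 1]) hs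
  rw [pow_one] at hg hi
  obtain ⟨W, hW⟩ := exists_subst_diag_eq_smul hg hi hc
  refine ⟨u 0, u 1, r - 2, ?_⟩
  -- With fewer than two factors removed, V would still be divisible by π. Hence `r - 2` is a
  -- genuine subtraction.
  have hr2 : 2 ≤ r := by
    by_contra hlt
    refine hn (C_dvd_form.2 ⟨W.smul (π ^ (1 - r)), ?_⟩)
    apply smul_injective (pow_ne_zero r hπ.ne_zero)
    have e : π ^ 2 = π ^ r * π * π ^ (1 - r) := by
      rw [mul_assoc, ← pow_succ', ← pow_add]
      congr 1
      omega
    rw [← hr, subst_affine, hW, smul_smul, smul_smul, ← e]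
  rw [hr]
  congr 2
  omega

/-- Zooming in multiplies Δ by π^24, and the division by π^(r+2) divides it by π^(12(r+2)). -/
theorem disc_of_iteration (hπ : Irreducible π) {U V : Cubic R}
    (h : Iteration (isLocallySoluble π) U V) : ∃ k, U.disc = π ^ k * V.disc := by
  obtain ⟨u, v, r, h⟩ := iteration_iff hπ h
  have := congrArg disc h
  rw [disc_subst_translate hπ.ne_zero, disc_smul] at this
  refine ⟨12 * r, mul_left_cancel₀ (pow_ne_zero 24 hπ.ne_zero) (this.trans ?_)⟩
  ring

theorem singMod_of_iteration (hπ : Irreducible π) {U V : Cubic R}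
    (h : Iteration (isLocallySoluble π) U V) {m : ℕ} (hV : ∃ x y, SingMod π m V.poly ![x, y, 1]) :
    ∃ x y, SingMod π (m + 1) U.poly ![x, y, 1] := by
  obtain ⟨u, v, r, h⟩ := iteration_iff hπ h
  obtain ⟨x, y, hV⟩ := hV
  rw [subst_affine] at h
  have := singMod_of_subst (by simp [Matrix.det_fin_three])
    (singMod_of_subst_diag hπ.ne_zero (pow_dvd_pow π (Nat.le_add_left 2 r)) h hV)
  exact singMod_normalise (by simp [vecMul_three]) this

theorem singMod_of_iterations (hπ : Irreducible π) (m : ℕ) (Ψ : ℕ → Cubic R)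
    (h : ∀ i < m, Iteration (isLocallySoluble π) (Ψ i) (Ψ (i + 1))) :
    ∃ x y, SingMod π m (Ψ 0).poly ![x, y, 1] := by
  induction m generalizing Ψ with
  | zero => exact ⟨0, 0, singMod_zero _ _ _⟩
  | succ m ih =>
    exact singMod_of_iteration hπ (h 0 (by omega))
      (ih (fun i => Ψ (i + 1)) fun i hi => h (i + 1) (by omega))

theorem neverIncreases (hπ : Irreducible π) (U : Cubic R) :
    NeverIncreases (isLocallySoluble π)
      (fun V => IsDiscreteValuationRing.addVal R V.disc) U := by
  intro Ψ Ψ' _ h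
  obtain ⟨k, hk⟩ := disc_of_iteration hπ h
  dsimp only
  rw [hk, addVal_pow_mul hπ]
  exact le_add_self

theorem stableIterationsBounded (hπ : Irreducible π) (U : Cubic R) :
    StableIterationsBounded (isLocallySoluble π)
      (fun V => IsDiscreteValuationRing.addVal R V.disc) U := by
  intro m Ψ _ h _
  obtain ⟨x, y, hxy⟩ := singMod_of_iterations hπ m Ψ h
  have := le_addVal_of_pow_dvd hπ (dvd_disc_of_singMod hxy)
  exact_mod_cast this

section Compact

variable [TopologicalSpace R] [IsTopologicalRing R] [CompactSpace R]
  (hcl : ∀ m : ℕ, IsClosed {x : R | π ^ m ∣ x})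
  {K : Type*} [Field K] [Algebra R K] [FaithfulSMul R K]

include hcl in
/-- On a non-singular cubic there are no singular points modulo high powers of `π`. -/
theorem exists_not_singMod (hπ : Irreducible π) {U : Cubic R} (hU : U.Nonsingular K) :
    ∃ e, ¬ ∃ x y, SingMod π e U.poly ![x, y, 1] := by
  by_contra! h
  have hcont : Continuous fun x : R × R => (![x.1, x.2, 1] : Fin 3 → R) :=
    continuous_pi fun i => by fin_cases i <;> simp <;> fun_prop
  -- The index `none` stands for the equation, the indices `some j` for its partial derivatives.
  obtain ⟨⟨x, y⟩, hxy⟩ := exists_eq_zero_of_pow_dvd hπ hcl (T := R × R) (ι := Option (Fin 3))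
    (fun i x => i.elim (eval ![x.1, x.2, 1] U.poly) fun j => grad U.poly ![x.1, x.2, 1] j)
    (by
      rintro (_ | i)
      · exact (MvPolynomial.continuous_eval _).comp hcont
      · exact (MvPolynomial.continuous_eval _).comp hcont)
    (by
      intro m
      obtain ⟨x, y, hxy⟩ := h m
      refine ⟨⟨x, y⟩, ?_⟩
      rintro (_ | i)
      · exact (pow_dvd_pow π (by omega)).trans hxy.1
      · exact hxy.2 i)
  rw [nonsingular_iff] at hU
  have hinj := algebraMap_algebraicClosure_injective R K
  refine hU (fun j => algebraMap R _ (![x, y, 1] j)) (fun h => ?_) ?_ ?_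
  · simpa using congrFun h 2
  · have := hxy none
    simp only [Option.elim, eval_poly] at this
    rw [form_baseChange]
    have e := U.map_form (Algebra.ofId R (AlgebraicClosure K)) ![x, y, 1]
    rw [this, map_zero] at e
    exact e.symm
  · rw [poly_baseChange, form_X_eq_map]
    ext i
    rw [grad_map]
    have := hxy (some i)
    simp only [Option.elim] at this
    rw [this, map_zero]
    rfl

-- By compactness, lines modulo all powers of π would give a line on the cubic over the ring of
-- integers, which is excluded by `singular_of_contains_line`.
include hcl in
theorem exists_not_lineMod (hπ : Irreducible π) {U : Cubic R} (hU : U.Nonsingular K) :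
    ∃ e, ¬ ∃ α β, LineMod π e U α β := by
  by_contra! h
  simp only [lineMod_iff] at h
  have h1 : Continuous fun x : R × R => U.form ![x.1, 1, 0] := by
    simp only [form, smul_eq_mul, Matrix.cons_val]
    fun_prop
  have h2 : Continuous fun x : R × R => U.form ![x.2, 0, 1] := by
    simp only [form, smul_eq_mul, Matrix.cons_val]
    fun_prop
  have h3 : Continuous fun x : R × R => U.polar ![x.1, 1, 0] ![x.2, 0, 1] := by
    simp only [polar, Matrix.cons_val]
    fun_prop
  have h4 : Continuous fun x : R × R => U.polar ![x.2, 0, 1] ![x.1, 1, 0] := by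
    simp only [polar, Matrix.cons_val]
    fun_prop
  obtain ⟨⟨x, y⟩, hxy⟩ := exists_eq_zero_of_pow_dvd hπ hcl
    (![fun x : R × R => U.form ![x.1, 1, 0], fun x : R × R => U.form ![x.2, 0, 1],
      fun x : R × R => U.polar ![x.1, 1, 0] ![x.2, 0, 1],
      fun x : R × R => U.polar ![x.2, 0, 1] ![x.1, 1, 0]])
    (by
      simp only [Fin.forall_fin_succ, Matrix.cons_val_zero, Matrix.cons_val_succ, h1, h2, h3, h4,
        true_and, IsEmpty.forall_iff])
    (by
      intro m
      obtain ⟨x, y, h⟩ := h m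
      refine ⟨⟨x, y⟩, ?_⟩
      simpa only [Fin.forall_fin_succ, Matrix.cons_val_zero, Matrix.cons_val_succ,
        IsEmpty.forall_iff, and_true] using h)
  simp only [Fin.forall_fin_succ, Matrix.cons_val_zero, Matrix.cons_val_succ,
        IsEmpty.forall_iff, and_true] at hxy
  exact singular_of_contains_line hxy.1 hxy.2.1 hxy.2.2.1 hxy.2.2.2 hU

/-- The least `e` such that there are no singular points modulo `π ^ e`. -/
noncomputable def singLevel (π : R) (U : Cubic R) : ℕ :=
  sInf {e | ¬ ∃ x y, SingMod π e U.poly ![x, y, 1]}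

include hcl in
theorem singLevel_lt (hπ : Irreducible π) {U V : Cubic R} (hU : U.Nonsingular K)
    (h : ∀ m, (∃ x y, SingMod π m V.poly ![x, y, 1]) →
      ∃ x y, SingMod π (m + 1) U.poly ![x, y, 1]) : V.singLevel π < U.singLevel π :=
  sInf_lt_sInf_of_imp (exists_not_singMod hcl hπ hU) ⟨0, 0, singMod_zero _ _ _⟩ h

-- The measure is built from `singLevel`, whose finiteness comes from smoothness and compactness, so
-- non-vanishing of the discriminant of a smooth cubic is not needed.
include hcl in
theorem halts_isLocallySoluble [Finite (IsLocalRing.ResidueField R)] (hπ : Irreducible π)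
    {U : Cubic R} (hU : U.Nonsingular K) : Halts (isLocallySoluble π) (.normalise U) := by
  have hlt : ∀ Φ Ψ : Cubic R, Φ.Nonsingular K → Iteration (isLocallySoluble π) Φ Ψ →
      Ψ.singLevel π < Φ.singLevel π := fun Φ Ψ hΦ h =>
    singLevel_lt hcl hπ hΦ fun m hm => singMod_of_iteration hπ h hm
  refine halts_of_level (fun V => 2 * V.singLevel π) (fun V => V.Nonsingular K)
    (fun V hV => ⟨exists_calls_normalise hπ (form_X_ne_zero hV), exists_calls_search π V⟩)
    ?_ ?_ ?_ ?_ (fun Φ Ψ hΦ h => Nat.mul_le_mul_left 2 (hlt Φ Ψ hΦ h).le) ?_ hU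
  · intro Φ Ψ hΦ h
    obtain ⟨r, V, -, -, h⟩ := calls_normalise_iff h
    exact absurd h (by simp)
  · intro Φ Ψ hΦ h
    obtain ⟨r, V, h1, -, h⟩ := calls_normalise_iff h
    rw [Stage.search.inj h]
    exact nonsingular_of_subst_eq_smul hΦ (N := 1) (by simp) ((subst_one Φ).trans h1)
  · intro Φ Ψ hΦ h
    obtain ⟨p, -, u, -, h⟩ := calls_search_iff h
    rw [Stage.normalise.inj h]
    exact nonsingular_of_subst_eq_smul hΦ (by simp [Matrix.det_fin_three, hπ.ne_zero])
      (smul_one _).symm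
  · intro Φ Ψ hΦ h
    obtain ⟨p, -, u, -, h⟩ := calls_search_iff h
    exact absurd h (by simp)
  -- Every iteration lowers the measure, so it is constant only along the chain without iterations.
  · rintro (_ | m) Ψ h0 h hv
    · exact Nat.zero_le _
    · have h1 := hlt _ _ h0 (h 0 (Nat.succ_pos m))
      have h2 : 2 * (Ψ 1).singLevel π = 2 * (Ψ 0).singLevel π := hv 1 (by omega)
      rw [zero_add] at h1
      omega

end Compact

end Cubic

end GenusOne

/-! ### Degree 3: Tamagawa distances and the line subalgorithm. -/

namespace GenusOne

namespace Cubic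

section

variable {R : Type*} [CommRing R] [IsDomain R] [IsDiscreteValuationRing R] {π : R}

/-- The reduction contains the line `x = 0`. -/
def ContainsLine (π : R) (U : Cubic R) : Prop := π ∣ U.b ∧ π ∣ U.f ∧ π ∣ U.i ∧ π ∣ U.c

theorem containsLine_subst (hπ : Irreducible π) {U : Cubic R}
    {ℓ : Fin 3 → IsLocalRing.ResidueField R} (hℓ : linForm ℓ ∣ U.form X)
    {N : Matrix (Fin 3) (Fin 3) R} (hN : ∀ i, i ≠ 0 → ∑ j, algebraMap R _ (N i j) * ℓ j = 0) :
    ContainsLine π (U.subst N) := by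
  -- Restriction to the line spanned by the rows 1 and 2 of N, on which ℓ vanishes.
  let φ : MvPolynomial (Fin 3) (IsLocalRing.ResidueField R) →ₐ[IsLocalRing.ResidueField R]
    Polynomial (IsLocalRing.ResidueField R) :=
    aeval fun j => Polynomial.C (algebraMap R _ (N 1 j)) * Polynomial.X +
      Polynomial.C (algebraMap R _ (N 2 j))
  have h1 : φ (linForm ℓ) = 0 := by
    have e1 := hN 1 (by decide)
    have e2 := hN 2 (by decide)
    rw [Fin.sum_univ_three] at e1 e2
    have e1 := congrArg Polynomial.C e1
    have e2 := congrArg Polynomial.C e2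
    simp only [map_add, map_mul, map_zero] at e1 e2
    simp only [φ, linForm, map_add, map_mul, aeval_C, aeval_X, Fin.sum_univ_three,
      Polynomial.algebraMap_eq]
    linear_combination Polynomial.X * e1 + e2
  have h2 : φ (U.form X) = 0 := by
    obtain ⟨c, hc⟩ := hℓ
    rw [hc, map_mul, h1, zero_mul]
  have h3 : (U.subst N).form
      (![0, Polynomial.X, 1] : Fin 3 → Polynomial (IsLocalRing.ResidueField R)) = 0 := by
    rw [form_subst]
    refine Eq.trans ?_ h2
    have := U.map_form (φ.restrictScalars R) X
    rw [AlgHom.restrictScalars_apply] at this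
    rw [this]
    congr 1
    ext j : 1
    simp [φ, Algebra.smul_def, IsScalarTower.algebraMap_apply R (IsLocalRing.ResidueField R)
        (Polynomial (IsLocalRing.ResidueField R))]
  generalize U.subst N = V at h3
  have h4 : Polynomial.C (algebraMap R (IsLocalRing.ResidueField R) V.b) * Polynomial.X ^ 3 +
      Polynomial.C (algebraMap R _ V.f) * Polynomial.X ^ 2 +
      Polynomial.C (algebraMap R _ V.i) * Polynomial.X + Polynomial.C (algebraMap R _ V.c) =
      Polynomial.C 0 * Polynomial.X ^ 3 + Polynomial.C 0 * Polynomial.X ^ 2 +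
      Polynomial.C 0 * Polynomial.X + Polynomial.C 0 := by
    simp only [map_zero, zero_mul, add_zero]
    rw [← h3]
    simp [form, Algebra.smul_def, IsScalarTower.algebraMap_apply R (IsLocalRing.ResidueField R)
        (Polynomial (IsLocalRing.ResidueField R))]
    ring
  simpa only [residue_eq_zero_iff hπ, ContainsLine] using C_mul_X_pow_injective h4

theorem coeffs_of_divides {V : Cubic R} {a b : R} (h : V.f₃ (X 0) (X 1) = (a • X 0 + b • X 1) *
      V.f₂ (X 0 : MvPolynomial (Fin 2) (IsLocalRing.ResidueField R)) (X 1)) :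
    algebraMap R (IsLocalRing.ResidueField R) V.b = algebraMap R _ (a * V.k) ∧
    algebraMap R (IsLocalRing.ResidueField R) V.f = algebraMap R _ (a * V.m + b * V.k) ∧
    algebraMap R (IsLocalRing.ResidueField R) V.i = algebraMap R _ (a * V.g + b * V.m) ∧
    algebraMap R (IsLocalRing.ResidueField R) V.c = algebraMap R _ (b * V.g) := by
  have h := congrArg (aeval ![(Polynomial.X : Polynomial (IsLocalRing.ResidueField R)), 1]) h
  apply C_mul_X_pow_injective
  simp only [f₂, f₃, Algebra.smul_def, IsScalarTower.algebraMap_apply R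
      (IsLocalRing.ResidueField R) (MvPolynomial (Fin 2) (IsLocalRing.ResidueField R)),
      MvPolynomial.algebraMap_eq, map_add, map_mul, map_pow, aeval_C, aeval_X,
      Polynomial.algebraMap_eq, Matrix.cons_val] at h
  simp only [map_add, map_mul]
  linear_combination h

/-- The move of Step (iii). -/
theorem containsLine_of_divides (hπ : Irreducible π) {U V : Cubic R}
    (hV : U.subst !![π, 0, 0; 0, 1, 0; 0, 0, 1] = V.smul π) {a b : R}
    (h : V.f₃ (X 0) (X 1) = (a • X 0 + b • X 1) *
      V.f₂ (X 0 : MvPolynomial (Fin 2) (IsLocalRing.ResidueField R)) (X 1)) :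
    ContainsLine π (V.subst !![1, 0, 0; -a, 1, 0; -b, 0, 1]) := by
  obtain ⟨h1, h2, h3, h4⟩ := coeffs_of_divides h
  rw [← sub_eq_zero, ← map_sub, residue_eq_zero_iff hπ] at h1 h2 h3 h4
  rw [subst_diag_left] at hV
  simp only [smul, mk.injEq] at hV
  obtain ⟨ha, -, -, -, -, hh, -, hj, -, -⟩ := hV
  -- After Step (ii) the coefficients of x³, x²y and x²z are divisible by π. So V is x f₂ + f₃
  -- modulo π, and the shear replaces f₃ by f₃ - (ay + bz) f₂.
  have ha : V.a = π * (π * U.a) := mul_left_cancel₀ hπ.ne_zero (by rw [← ha]; ring)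
  have hh : V.h = π * U.h := mul_left_cancel₀ hπ.ne_zero (by rw [← hh]; ring)
  have hj : V.j = π * U.j := mul_left_cancel₀ hπ.ne_zero (by rw [← hj]; ring)
  obtain ⟨eb, ec, ef, ei⟩ := subst_shear (-a) (-b) V
  rw [ContainsLine, eb, ec, ef, ei, ha, hh, hj]
  refine ⟨?_, ?_, ?_, ?_⟩
  · convert dvd_add h1 (dvd_mul_right π (-(π * U.a * a ^ 3) + U.h * a ^ 2)) using 1
    ring
  · convert dvd_add h2 (dvd_mul_right π (-b * (3 * (π * U.a) * a ^ 2 - 2 * U.h * a) +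
      U.j * a ^ 2)) using 1
    ring
  · convert dvd_add h3 (dvd_mul_right π (-a * (3 * (π * U.a) * b ^ 2 - 2 * U.j * b) +
      U.h * b ^ 2)) using 1
    ring
  · convert dvd_add h4 (dvd_mul_right π (-(π * U.a * b ^ 3) + U.j * b ^ 2)) using 1
    ring

theorem exists_subst_diag_left {U : Cubic R} (h : ContainsLine π U) :
    ∃ V : Cubic R, U.subst !![π, 0, 0; 0, 1, 0; 0, 0, 1] = V.smul π := by
  rw [subst_diag_left]
  obtain ⟨a, b, c, f, g, h', i, j, k, m⟩ := U
  obtain ⟨⟨b, rfl⟩, ⟨f, rfl⟩, ⟨i, rfl⟩, ⟨c, rfl⟩⟩ := h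
  refine ⟨⟨π ^ 2 * a, b, c, f, g, π * h', i, π * j, k, m⟩, ?_⟩
  simp only [smul, mk.injEq]
  refine ⟨?_, ?_, ?_, ?_, ?_, ?_, ?_, ?_, ?_, ?_⟩ <;> first | trivial | ring1

theorem calls_line {U : Cubic R} {t : Task R} (h : Calls (tamagawaDistances π) (.line U) t) :
    ∃ (V : Cubic R) (a b : R), U.subst !![π, 0, 0; 0, 1, 0; 0, 0, 1] = V.smul π ∧
      V.f₃ (X 0) (X 1) = (a • X 0 + b • X 1) *
        V.f₂ (X 0 : MvPolynomial (Fin 2) (IsLocalRing.ResidueField R)) (X 1) ∧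
      t = .line (V.subst !![1, 0, 0; -a, 1, 0; -b, 0, 1]) := by
  obtain ⟨calls, ⟨V, h1, ⟨a, b, V₁, h2, h3, rfl⟩ | ⟨-, rfl⟩⟩, ht⟩ := h
  · refine ⟨V, a, b, ?_, h2, ?_⟩
    · rwa [form_diag_left, C_mul_form_eq_iff] at h1
    · rw [form_shear] at h3
      rw [← ext_of_form h3]
      simpa using ht
  · simp at ht

theorem exists_calls_line {U : Cubic R} (h : ContainsLine π U) :
    ∃ calls, tamagawaDistances π (.line U) calls := by
  obtain ⟨V, hV⟩ := exists_subst_diag_left h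
  have h1 : C π * V.form (X : Fin 3 → MvPolynomial (Fin 3) R) = U.form ![C π * X 0, X 1, X 2] := by
    rwa [form_diag_left, C_mul_form_eq_iff]
  by_cases hd : ∃ a b : R, V.f₃ (X 0) (X 1) = (a • X 0 + b • X 1) *
        V.f₂ (X 0 : MvPolynomial (Fin 2) (IsLocalRing.ResidueField R)) (X 1)
  · obtain ⟨a, b, hab⟩ := hd
    exact ⟨_, V, h1, .inl ⟨a, b, V.subst !![1, 0, 0; -a, 1, 0; -b, 0, 1], hab,
      (form_shear a b V).symm, rfl⟩⟩
  · exact ⟨_, V, h1, .inr ⟨hd, rfl⟩⟩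

theorem calls_distances {U : Cubic R} {affine : Bool} {t : Task R}
    (h : Calls (tamagawaDistances π) (.distances U affine) t) :
    (∃ ℓ ∈ U.lineComponents affine, ∃ N : Matrix (Fin 3) (Fin 3) R, IsUnit N.det ∧
      (∀ i, i ≠ 0 → ∑ j, algebraMap R _ (N i j) * ℓ j = 0) ∧ t = .line (U.subst N)) ∨
    ∃ p ∈ U.nonRegular π affine, ∃ (N : Matrix (Fin 3) (Fin 3) R) (U₁ : Cubic R)
      (c : IsLocalRing.ResidueField R), IsUnit N.det ∧ (∀ j, algebraMap R _ (N 2 j) = c * p j) ∧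
      (U.subst N).subst !![π, 0, 0; 0, π, 0; 0, 0, 1] = U₁.smul (π ^ 2) ∧
      t = .distances U₁ true := by
  obtain ⟨calls, ⟨c₁, c₂, rfl, h1, h2⟩, ht⟩ := h
  rcases List.mem_append.1 ht with ht | ht
  · obtain ⟨ℓ, hℓ, N, U', hN, hU', h3, rfl⟩ := h1.exists_of_mem ht
    rw [isTransform_iff] at hU'
    exact .inl ⟨ℓ, hℓ, N, hN, h3, by rw [hU']⟩
  · obtain ⟨p, hp, N, U', U₁, c, hN, hU', h3, h4, rfl⟩ := h2.exists_of_mem ht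
    rw [isTransform_iff] at hU'
    rw [form_diag, C_mul_form_eq_iff, hU'] at h4
    exact .inr ⟨p, hp, N, U₁, c, hN, h3, h4, rfl⟩

theorem exists_calls_distances [Finite (IsLocalRing.ResidueField R)] (hπ : Irreducible π)
    (U : Cubic R) (affine : Bool) : ∃ calls, tamagawaDistances π (.distances U affine) calls := by
  obtain ⟨c₁, h1⟩ := ForEach.exists (Set.toFinite (U.lineComponents affine))
      (call := fun (ℓ : Fin 3 → IsLocalRing.ResidueField R) (t : Task R) =>
        ∃ (N : Matrix (Fin 3) (Fin 3) R) (U' : Cubic R),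
            IsUnit N.det ∧ IsTransform N U U' ∧
            (∀ i, i ≠ 0 → ∑ j, algebraMap R _ (N i j) * ℓ j = 0) ∧ t = .line U') (by
    intro ℓ hℓ
    obtain ⟨q, hq⟩ := exists_lift ℓ
    obtain ⟨i, hi, -⟩ := hℓ.1
    have hu : IsUnit (q i) := isUnit_of_residue_eq_mul hπ one_ne_zero one_ne_zero
      (by rw [hq i, hi, one_mul])
    obtain ⟨N, hN, hNq⟩ := exists_mulVec_eq_single hu 0
    refine ⟨_, N, U.subst N, hN, isTransform_iff.2 rfl, fun i hi => ?_, rfl⟩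
    have := congrArg (algebraMap R (IsLocalRing.ResidueField R)) (congrFun hNq i)
    simp only [Matrix.mulVec, dotProduct, map_sum, map_mul] at this
    simp only [hq _] at this
    rw [this, Pi.single_eq_of_ne hi, map_zero])
  obtain ⟨c₂, h2⟩ := ForEach.exists (Set.toFinite (U.nonRegular π affine))
      (call := fun (p : Fin 3 → IsLocalRing.ResidueField R) (t : Task R) =>
        ∃ (N : Matrix (Fin 3) (Fin 3) R) (U' U₁ : Cubic R) (c : IsLocalRing.ResidueField R),
            IsUnit N.det ∧ IsTransform N U U' ∧ (∀ j, algebraMap R _ (N 2 j) = c * p j) ∧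
            C (π ^ 2) * U₁.form (X : Fin 3 → MvPolynomial (Fin 3) R)
              = U'.form ![C π * X 0, C π * X 1, X 2] ∧
            t = .distances U₁ true) (by
    intro p hp
    obtain ⟨q, hq⟩ := exists_lift p
    obtain ⟨i, hi, -⟩ := hp.1
    have hu : IsUnit (q i) := isUnit_of_residue_eq_mul hπ one_ne_zero one_ne_zero
      (by rw [hq i, hi, one_mul])
    obtain ⟨N, hN, hNq⟩ := exists_isUnit_det_row hu 2
    obtain ⟨hg, hi, hc⟩ := dvd_coeffs_move (N := N) (hNq ▸ nonRegular_lift hπ hp hq)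
    rw [pow_one] at hg hi
    obtain ⟨V, hV⟩ := exists_subst_diag_eq_smul hg hi hc
    refine ⟨_, N, U.subst N, V, 1, hN, isTransform_iff.2 rfl, fun j => ?_, ?_, rfl⟩
    · rw [hNq, one_mul, hq j]
    · rwa [form_diag, C_mul_form_eq_iff])
  exact ⟨_, c₁, c₂, rfl, h1, h2⟩

/-- The non-regular point lies in the affine piece, so the z-coordinate of the transported point is
a unit and can be normalised to 1 again. -/
theorem singMod_of_distances (hπ : Irreducible π) {U V : Cubic R}
    {p : Fin 3 → IsLocalRing.ResidueField R} (hp : p 2 ≠ 0) {N : Matrix (Fin 3) (Fin 3) R}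
    {c : IsLocalRing.ResidueField R} (hN : IsUnit N.det)
    (hNp : ∀ j, algebraMap R _ (N 2 j) = c * p j)
    (h : (U.subst N).subst !![π, 0, 0; 0, π, 0; 0, 0, 1] = V.smul (π ^ 2)) {m : ℕ}
    (hV : ∃ x y, SingMod π m V.poly ![x, y, 1]) :
    ∃ x y, SingMod π (m + 1) U.poly ![x, y, 1] := by
  obtain ⟨x, y, hV⟩ := hV
  refine singMod_normalise ?_ (singMod_of_subst hN
    (singMod_of_subst_diag hπ.ne_zero dvd_rfl h hV))
  have hu := isUnit_of_residue_eq_mul hπ (row_scalar_ne_zero hN hNp) hp (hNp 2)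
  rw [← not_dvd_iff_isUnit hπ] at hu ⊢
  simpa [vecMul_three, dvd_add_right (dvd_add (dvd_mul_of_dvd_right (dvd_mul_right π x) (N 0 2))
    (dvd_mul_of_dvd_right (dvd_mul_right π y) (N 1 2)))] using hu

variable (π) in
/-- The inputs of the procedure and its subalgorithm. -/
def Task.Admissible (K : Type*) [Field K] [Algebra R K] : Task R → Prop
  | .distances U _ => U.Nonsingular K
  | .line U => U.Nonsingular K ∧ ContainsLine π U

end

section Compact

variable {R : Type*} [CommRing R] [IsDomain R] [IsDiscreteValuationRing R] {π : R}
  [TopologicalSpace R] [IsTopologicalRing R] [CompactSpace R]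
  (hcl : ∀ m : ℕ, IsClosed {x : R | π ^ m ∣ x})
  {K : Type*} [Field K] [Algebra R K] [FaithfulSMul R K]

theorem Task.Admissible.of_calls (hπ : Irreducible π) {s t : Task R} (hs : s.Admissible π K)
    (h : Calls (tamagawaDistances π) s t) : t.Admissible π K := by
  rcases s with ⟨U, affine⟩ | U
  · obtain ⟨ℓ, hℓ, N, hN, hNℓ, rfl⟩ | ⟨p, hp, N, U₁, c, hN, -, h', rfl⟩ :=
      calls_distances h
    · exact ⟨nonsingular_of_subst_eq_smul hs hN.ne_zero (smul_one _).symm,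
        containsLine_subst hπ hℓ.2.2.1 hNℓ⟩
    · have h1 := nonsingular_of_subst_eq_smul hs hN.ne_zero (smul_one _).symm
      exact nonsingular_of_subst_eq_smul h1 (by simp [Matrix.det_fin_three, hπ.ne_zero]) h'
  · obtain ⟨V, a, b, hV, hd, rfl⟩ := calls_line h
    refine ⟨?_, containsLine_of_divides hπ hV hd⟩
    have h1 := nonsingular_of_subst_eq_smul hs.1
      (by simp [Matrix.det_fin_three, hπ.ne_zero]) hV
    exact nonsingular_of_subst_eq_smul h1 (by simp [Matrix.det_fin_three]) (smul_one _).symm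

-- Each return to Step (ii) lowers the least exponent for which no line is contained in the cubic.
include hcl in
theorem acc_line (hπ : Irreducible π) {U : Cubic R} (hU : (Task.line U).Admissible π K) :
    Acc (fun t s => Calls (tamagawaDistances π) s t) (.line U) := by
  induction hn : sInf {e | ¬ ∃ α β, LineMod π e U α β} using Nat.strong_induction_on
    generalizing U with
  | _ n ih =>
    refine ⟨_, fun t ht => ?_⟩
    have hadm := hU.of_calls hπ ht
    obtain ⟨V, a, b, hV, hd, rfl⟩ := calls_line ht
    refine ih _ ?_ hadm rfl
    rw [← hn]
    refine sInf_lt_sInf_of_imp (exists_not_lineMod hcl hπ hU.1) ⟨0, 0, by simp [LineMod]⟩ ?_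
    rintro m ⟨α, β, h⟩
    exact ⟨_, _, lineMod_of_subst hV h⟩

-- A call for a line never leads back to a call for distances. A call at a non-regular point lowers
-- `singLevel`.
include hcl in
theorem acc_distances (hπ : Irreducible π) {U : Cubic R} (hU : U.Nonsingular K) :
    Acc (fun t s => Calls (tamagawaDistances π) s t) (.distances U true) := by
  induction hn : U.singLevel π using Nat.strong_induction_on
    generalizing U with
  | _ n ih =>
    refine ⟨_, fun t ht => ?_⟩
    have hadm := Task.Admissible.of_calls (s := .distances U true) hπ hU ht
    obtain ⟨ℓ, hℓ, N, hN, hNℓ, rfl⟩ | ⟨p, hp, N, U₁, c, hN, hNp, h, rfl⟩ := calls_distances ht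
    · exact acc_line hcl hπ hadm
    · refine ih _ ?_ hadm rfl
      rw [← hn]
      exact singLevel_lt hcl hπ hU
        fun m hm => singMod_of_distances hπ (hp.2.1 rfl) hN hNp h hm

include hcl in
theorem halts_tamagawaDistances [Finite (IsLocalRing.ResidueField R)] (hπ : Irreducible π)
    {s : Task R} (hs : s.Admissible π K) : Halts (tamagawaDistances π) s := by
  refine halts_of_acc (Task.Admissible π K) ?_ (fun s t hs h => hs.of_calls hπ h) ?_ hs
  · rintro (⟨U, affine⟩ | U) hU
    · exact exists_calls_distances hπ U affine
    · exact exists_calls_line hU.2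
  · rcases s with ⟨U, affine⟩ | U
    · refine ⟨_, fun t ht => ?_⟩
      have hadm := hs.of_calls hπ ht
      obtain ⟨ℓ, hℓ, N, hN, hNℓ, rfl⟩ | ⟨p, hp, N, U₁, c, hN, hNp, h, rfl⟩ := calls_distances ht
      · exact acc_line hcl hπ hadm
      · exact acc_distances hcl hπ hadm
    · exact acc_line hcl hπ hs

theorem containsLine_of_mem (hπ : Irreducible π) {U : Cubic R}
    (h : ![1, 0, 0] ∈ U.lineComponents false) : ContainsLine π U := by
  rw [← subst_one U]
  refine containsLine_subst hπ h.2.2.1 fun i hi => ?_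
  fin_cases i
  · exact absurd rfl hi
  · simp [Fin.sum_univ_three, Matrix.one_apply]
  · simp [Fin.sum_univ_three, Matrix.one_apply]

end Compact

end Cubic

end GenusOne

/-! ### Quadratic forms in four variables and the binary quartic of a pencil. -/

namespace GenusOne

namespace Quadric

section

variable {R : Type*} [CommRing R]

theorem map_form (q : Quadric R) {A B : Type*} [CommRing A] [Algebra R A] [CommRing B] [Algebra R B]
    (φ : A →ₐ[R] B) (x : Fin 4 → A) : φ (q.form x) = q.form (fun i => φ (x i)) := by
  simp [form]

/-- The defining polynomial. -/
noncomputable def poly (q : Quadric R) : MvPolynomial (Fin 4) R := q.form X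

theorem aeval_poly (q : Quadric R) {A : Type*} [CommRing A] [Algebra R A] (x : Fin 4 → A) :
    aeval x q.poly = q.form x := by
  rw [poly, map_form]; simp

theorem eval_poly (q : Quadric R) (x : Fin 4 → R) : eval x q.poly = q.form x := by
  simp [poly, form, smul_eq_C_mul]

theorem form_X_eq_map (q : Quadric R) (F : Type*) [CommRing F] [Algebra R F] :
    q.form (X : Fin 4 → MvPolynomial (Fin 4) F) = map (algebraMap R F) q.poly := by
  simp [poly, form, Algebra.smul_def, IsScalarTower.algebraMap_apply R F (MvPolynomial _ F)]

theorem form_algebraMap (q : Quadric R) (F : Type*) [CommRing F] [Algebra R F] (x : Fin 4 → R) :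
    q.form (fun i => algebraMap R F (x i)) = algebraMap R F (q.form x) :=
  (q.map_form (Algebra.ofId R F) x).symm

theorem form_eq_of_form_X {q r : Quadric R} {F : Type*} [CommRing F] [Algebra R F]
    (h : q.form (X : Fin 4 → MvPolynomial (Fin 4) F) = r.form X) {A : Type*} [CommRing A]
    [Algebra R A] [Algebra F A] [IsScalarTower R F A] (x : Fin 4 → A) : q.form x = r.form x := by
  have := congrArg ((aeval x : MvPolynomial (Fin 4) F →ₐ[F] A).restrictScalars R) h
  rw [map_form, map_form] at this
  simpa using this

theorem ext_of_form {q r : Quadric R} (h : ∀ x : Fin 4 → R, q.form x = r.form x) : q = r := by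
  have h1 := h ![1, 0, 0, 0]
  have h2 := h ![0, 1, 0, 0]
  have h3 := h ![0, 0, 1, 0]
  have h4 := h ![0, 0, 0, 1]
  have h12 := h ![1, 1, 0, 0]
  have h13 := h ![1, 0, 1, 0]
  have h14 := h ![1, 0, 0, 1]
  have h23 := h ![0, 1, 1, 0]
  have h24 := h ![0, 1, 0, 1]
  have h34 := h ![0, 0, 1, 1]
  cases q; cases r
  simp [form] at *
  simp_all

theorem ext_of_form_X {q r : Quadric R}
    (h : q.form (X : Fin 4 → MvPolynomial (Fin 4) R) = r.form X) : q = r :=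
  ext_of_form fun x => form_eq_of_form_X h x

/-- The quadratic form with all coefficients multiplied by `s`. -/
def smul (s : R) (q : Quadric R) : Quadric R :=
  ⟨s * q.c11, s * q.c12, s * q.c13, s * q.c14, s * q.c22, s * q.c23, s * q.c24, s * q.c33,
    s * q.c34, s * q.c44⟩

theorem form_smul (s : R) (q : Quadric R) {A : Type*} [CommRing A] [Algebra R A] (x : Fin 4 → A) :
    (q.smul s).form x = s • q.form x := by
  simp [smul, form, mul_smul]

theorem C_mul_form_eq_iff {s : R} {q r : Quadric R} :
    C s * q.form (X : Fin 4 → MvPolynomial (Fin 4) R) = r.form X ↔ r = q.smul s := by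
  rw [← smul_eq_C_mul, ← form_smul]
  exact ⟨fun h => (ext_of_form_X h).symm, fun h => by rw [h]⟩

/-- The values at the basis vectors and at their pairwise sums determine the coefficients
integrally. This allows divisibility of forms to be treated through values at points over R. -/
theorem exists_eq_smul {s : R} {q : Quadric R} (h : ∀ x : Fin 4 → R, s ∣ q.form x) :
    ∃ r : Quadric R, q = r.smul s := by
  have key : ∀ {a b c : R}, s ∣ a → s ∣ b → s ∣ a + c + b → s ∣ c := by
    intro a b c ha hb hc
    have := dvd_sub (dvd_sub hc ha) hb
    rwa [show a + c + b - a - b = c by ring] at this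
  have h1 := h ![1, 0, 0, 0]
  have h2 := h ![0, 1, 0, 0]
  have h3 := h ![0, 0, 1, 0]
  have h4 := h ![0, 0, 0, 1]
  have h12 := h ![1, 1, 0, 0]
  have h13 := h ![1, 0, 1, 0]
  have h14 := h ![1, 0, 0, 1]
  have h23 := h ![0, 1, 1, 0]
  have h24 := h ![0, 1, 0, 1]
  have h34 := h ![0, 0, 1, 1]
  simp [form] at h1 h2 h3 h4 h12 h13 h14 h23 h24 h34
  obtain ⟨c12, h12⟩ := key h1 h2 h12
  obtain ⟨c13, h13⟩ := key h1 h3 h13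
  obtain ⟨c14, h14⟩ := key h1 h4 h14
  obtain ⟨c23, h23⟩ := key h2 h3 h23
  obtain ⟨c24, h24⟩ := key h2 h4 h24
  obtain ⟨c34, h34⟩ := key h3 h4 h34
  obtain ⟨c11, h1⟩ := h1
  obtain ⟨c22, h2⟩ := h2
  obtain ⟨c33, h3⟩ := h3
  obtain ⟨c44, h4⟩ := h4
  refine ⟨⟨c11, c12, c13, c14, c22, c23, c24, c33, c34, c44⟩, ?_⟩
  cases q
  simp_all [smul]

theorem grad_poly (q : Quadric R) (p : Fin 4 → R) : grad q.poly p =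
    ![2 * q.c11 * p 0 + q.c12 * p 1 + q.c13 * p 2 + q.c14 * p 3,
      q.c12 * p 0 + 2 * q.c22 * p 1 + q.c23 * p 2 + q.c24 * p 3,
      q.c13 * p 0 + q.c23 * p 1 + 2 * q.c33 * p 2 + q.c34 * p 3,
      q.c14 * p 0 + q.c24 * p 1 + q.c34 * p 2 + 2 * q.c44 * p 3] := by
  ext i
  fin_cases i <;> simp [grad, poly, form, pderiv_X, smul_eq_C_mul] <;> ring

/-- The symmetric bilinear form of a quadratic form. -/
def polar (q : Quadric R) (u v : Fin 4 → R) : R :=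
  v 0 * (2 * q.c11 * u 0 + q.c12 * u 1 + q.c13 * u 2 + q.c14 * u 3) +
  v 1 * (q.c12 * u 0 + 2 * q.c22 * u 1 + q.c23 * u 2 + q.c24 * u 3) +
  v 2 * (q.c13 * u 0 + q.c23 * u 1 + 2 * q.c33 * u 2 + q.c34 * u 3) +
  v 3 * (q.c14 * u 0 + q.c24 * u 1 + q.c34 * u 2 + 2 * q.c44 * u 3)

theorem polar_eq (q : Quadric R) (u v : Fin 4 → R) :
    q.polar u v = ∑ k, v k * grad q.poly u k := by
  rw [Fin.sum_univ_four, grad_poly]; rfl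

theorem polar_comm (q : Quadric R) (u v : Fin 4 → R) : q.polar u v = q.polar v u := by
  simp only [polar]; ring

/-- The substitution `x_j ← ∑ i, N i j * x_i`. -/
def subst (N : Matrix (Fin 4) (Fin 4) R) (q : Quadric R) : Quadric R where
  c11 := q.form (N 0)
  c12 := q.polar (N 0) (N 1)
  c13 := q.polar (N 0) (N 2)
  c14 := q.polar (N 0) (N 3)
  c22 := q.form (N 1)
  c23 := q.polar (N 1) (N 2)
  c24 := q.polar (N 1) (N 3)
  c33 := q.form (N 2)
  c34 := q.polar (N 2) (N 3)
  c44 := q.form (N 3)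

theorem form_subst (N : Matrix (Fin 4) (Fin 4) R) (q : Quadric R) {A : Type*} [CommRing A]
    [Algebra R A] (x : Fin 4 → A) :
    (q.subst N).form x = q.form fun j => N 0 j • x 0 + N 1 j • x 1 + N 2 j • x 2 + N 3 j • x 3 := by
  simp [subst, form, polar, Algebra.smul_def, map_ofNat]; ring

theorem vecMul_four (p : Fin 4 → R) (N : Matrix (Fin 4) (Fin 4) R) :
    Matrix.vecMul p N = fun j => N 0 j * p 0 + N 1 j * p 1 + N 2 j * p 2 + N 3 j * p 3 := by
  ext j
  simp [Matrix.vecMul, dotProduct, Fin.sum_univ_four, mul_comm]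

theorem form_subst_eq (N : Matrix (Fin 4) (Fin 4) R) (q : Quadric R) (x : Fin 4 → R) :
    (q.subst N).form x = q.form (Matrix.vecMul x N) := by
  rw [form_subst, vecMul_four]; rfl

theorem form_linSubst (N : Matrix (Fin 4) (Fin 4) R) (q : Quadric R) :
    (q.subst N).form (X : Fin 4 → MvPolynomial (Fin 4) R) = q.form (linSubst N) := by
  rw [form_subst]
  congr 1
  ext j : 1
  simp [linSubst, Fin.sum_univ_four, smul_eq_C_mul]

theorem grad_subst (N : Matrix (Fin 4) (Fin 4) R) (q : Quadric R) (p : Fin 4 → R) :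
    grad (q.subst N).poly p = N.mulVec (grad q.poly (Matrix.vecMul p N)) := by
  rw [poly, form_linSubst, ← aeval_poly, grad_linSubst]

/-- The linear combination `s q + t r`, with coefficients in an algebra. -/
def lin {A : Type*} [CommRing A] [Algebra R A] (s t : A) (q r : Quadric R) : Quadric A where
  c11 := q.c11 • s + r.c11 • t
  c12 := q.c12 • s + r.c12 • t
  c13 := q.c13 • s + r.c13 • t
  c14 := q.c14 • s + r.c14 • t
  c22 := q.c22 • s + r.c22 • t
  c23 := q.c23 • s + r.c23 • t
  c24 := q.c24 • s + r.c24 • t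
  c33 := q.c33 • s + r.c33 • t
  c34 := q.c34 • s + r.c34 • t
  c44 := q.c44 • s + r.c44 • t

theorem form_lin (s t : R) (q r : Quadric R) {A : Type*} [CommRing A] [Algebra R A]
    (x : Fin 4 → A) : (lin s t q r).form x = s • q.form x + t • r.form x := by
  simp [lin, form, Algebra.smul_def]; ring

theorem pencil_eq (q r : Quadric R) : pencil q r = lin Polynomial.X 1 q r := by
  simp [pencil, lin, Polynomial.smul_eq_C_mul]

variable {A B : Type*} [CommRing A] [Algebra R A] [CommRing B] [Algebra R B]

theorem map_pf_lin (φ : A →ₐ[R] B) (s t : A) (q r : Quadric R) :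
    φ (lin s t q r).pf = (lin (φ s) (φ t) q r).pf := by
  simp [lin, pf]

theorem map_rd_lin (φ : A →ₐ[R] B) (s t : A) (q r : Quadric R) :
    φ (lin s t q r).rd = (lin (φ s) (φ t) q r).rd := by
  simp [lin, rd, map_ofNat]

theorem pf_lin_mul (c s t : A) (q r : Quadric R) :
    (lin (c * s) (c * t) q r).pf = c ^ 2 * (lin s t q r).pf := by
  simp only [lin, pf, Algebra.smul_def]; ring

theorem rd_lin_mul (c s t : A) (q r : Quadric R) :
    (lin (c * s) (c * t) q r).rd = c ^ 4 * (lin s t q r).rd := by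
  have h : lin (c * s) (c * t) q r = (lin s t q r).smul c := by
    simp only [lin, smul, mul_smul_comm, mul_add]
  rw [h]
  simp only [smul, rd]
  ring

theorem natDegree_pf_pencil (q r : Quadric R) : (pencil q r).pf.natDegree < 3 := by
  refine Nat.lt_succ_of_le ?_
  simp only [pencil, pf]
  compute_degree

theorem natDegree_rd_pencil (q r : Quadric R) : (pencil q r).rd.natDegree < 5 := by
  refine Nat.lt_succ_of_le ?_
  simp only [pencil, rd]
  compute_degree

end

end Quadric

namespace QuadricPair

section

variable {R : Type*} [CommRing R]

theorem pf_pencil (Φ : QuadricPair R) : (Quadric.pencil (Φ.Q 0) (Φ.Q 1)).pf =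
    Φ.doubling.P ![(Polynomial.X : Polynomial R), 1] := by
  refine (Polynomial.as_sum_range_C_mul_X_pow' _ (Quadric.natDegree_pf_pencil _ _)).trans ?_
  simp [Finset.sum_range_succ, doubling, Quartic.P, Polynomial.smul_eq_C_mul]
  ring

theorem rd_pencil (Φ : QuadricPair R) : (Quadric.pencil (Φ.Q 0) (Φ.Q 1)).rd =
    Φ.doubling.Q ![(Polynomial.X : Polynomial R), 1] := by
  refine (Polynomial.as_sum_range_C_mul_X_pow' _ (Quadric.natDegree_rd_pencil _ _)).trans ?_
  simp [Finset.sum_range_succ, doubling, Quartic.Q, Polynomial.smul_eq_C_mul]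
  ring

theorem pf_lin_one (Φ : QuadricPair R) {A : Type*} [CommRing A] [Algebra R A] (s : A) :
    (Quadric.lin s 1 (Φ.Q 0) (Φ.Q 1)).pf = Φ.doubling.P ![s, 1] := by
  have := congrArg (Polynomial.aeval s) Φ.pf_pencil
  rw [Quadric.pencil_eq, Quadric.map_pf_lin, Quartic.map_P] at this
  simp only [Polynomial.aeval_X, map_one] at this
  rw [this]
  simp [Quartic.P]

theorem rd_lin_one (Φ : QuadricPair R) {A : Type*} [CommRing A] [Algebra R A] (s : A) :
    (Quadric.lin s 1 (Φ.Q 0) (Φ.Q 1)).rd = Φ.doubling.Q ![s, 1] := by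
  have := congrArg (Polynomial.aeval s) Φ.rd_pencil
  rw [Quadric.pencil_eq, Quadric.map_rd_lin, Quartic.map_Q] at this
  simp only [Polynomial.aeval_X, map_one] at this
  rw [this]
  simp [Quartic.Q]

section Laurent

variable {A : Type*} [CommRing A] [Algebra R A]

/-- The doubling is defined by coefficients with the second parameter equal to 1. Homogeneity
recovers the general case: over Laurent polynomials the second parameter may be taken to be the
invertible variable T and divided out, and then T is specialised to t. -/
theorem pf_lin (Φ : QuadricPair R) (s t : A) :
    (Quadric.lin s t (Φ.Q 0) (Φ.Q 1)).pf = Φ.doubling.P ![s, t] := by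
  have key : (Quadric.lin (Polynomial.C s) Polynomial.X (Φ.Q 0) (Φ.Q 1)).pf =
      Φ.doubling.P ![Polynomial.C s, Polynomial.X] := by
    apply Polynomial.toLaurent_injective
    let τ : Polynomial A →ₐ[R] LaurentPolynomial A := Polynomial.toLaurentAlg.restrictScalars R
    let T : LaurentPolynomial A := LaurentPolynomial.T 1
    change τ _ = τ _
    rw [Quadric.map_pf_lin, Quartic.map_P]
    have h1 : τ (Polynomial.C s) = T * (LaurentPolynomial.T (-1) * LaurentPolynomial.C s) := by
      rw [← mul_assoc, ← LaurentPolynomial.T_add]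
      simp [τ]
    have h2 : τ Polynomial.X = T * 1 := by simp [τ, T]
    have h3 : (fun i => τ (![Polynomial.C s, Polynomial.X] i)) =
        ![τ (Polynomial.C s), τ Polynomial.X] := by
      ext i : 1
      fin_cases i <;> rfl
    rw [h3, h1, h2, Quadric.pf_lin_mul, pf_lin_one]
    simp only [Quartic.P, Matrix.cons_val_zero, Matrix.cons_val_one, Algebra.smul_def]
    ring
  have := congrArg ((Polynomial.aeval t : Polynomial A →ₐ[A] A).restrictScalars R) key
  rw [Quadric.map_pf_lin, Quartic.map_P] at this
  simp only [AlgHom.restrictScalars_apply, Polynomial.aeval_C, Polynomial.aeval_X,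
    Algebra.algebraMap_self, RingHom.id_apply] at this
  rw [this]
  simp [Quartic.P]

theorem rd_lin (Φ : QuadricPair R) (s t : A) :
    (Quadric.lin s t (Φ.Q 0) (Φ.Q 1)).rd = Φ.doubling.Q ![s, t] := by
  have key : (Quadric.lin (Polynomial.C s) Polynomial.X (Φ.Q 0) (Φ.Q 1)).rd =
      Φ.doubling.Q ![Polynomial.C s, Polynomial.X] := by
    apply Polynomial.toLaurent_injective
    let τ : Polynomial A →ₐ[R] LaurentPolynomial A := Polynomial.toLaurentAlg.restrictScalars R
    let T : LaurentPolynomial A := LaurentPolynomial.T 1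
    change τ _ = τ _
    rw [Quadric.map_rd_lin, Quartic.map_Q]
    have h1 : τ (Polynomial.C s) = T * (LaurentPolynomial.T (-1) * LaurentPolynomial.C s) := by
      rw [← mul_assoc, ← LaurentPolynomial.T_add]
      simp [τ]
    have h2 : τ Polynomial.X = T * 1 := by simp [τ, T]
    have h3 : (fun i => τ (![Polynomial.C s, Polynomial.X] i)) =
        ![τ (Polynomial.C s), τ Polynomial.X] := by
      ext i : 1
      fin_cases i <;> rfl
    rw [h3, h1, h2, Quadric.rd_lin_mul, rd_lin_one]
    simp only [Quartic.Q, Matrix.cons_val_zero, Matrix.cons_val_one, Algebra.smul_def]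
    ring
  have := congrArg ((Polynomial.aeval t : Polynomial A →ₐ[A] A).restrictScalars R) key
  rw [Quadric.map_rd_lin, Quartic.map_Q] at this
  simp only [AlgHom.restrictScalars_apply, Polynomial.aeval_C, Polynomial.aeval_X,
    Algebra.algebraMap_self, RingHom.id_apply] at this
  rw [this]
  simp [Quartic.Q]

end Laurent

/-- The combinations of the two forms given by the rows of `M`. -/
def comb (M : Matrix (Fin 2) (Fin 2) R) (Φ : QuadricPair R) : QuadricPair R :=
  ⟨fun i => Quadric.lin (M i 0) (M i 1) (Φ.Q 0) (Φ.Q 1)⟩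

/-- The substitution `x_j ← ∑ i, N i j * x_i`. -/
def subst (N : Matrix (Fin 4) (Fin 4) R) (Φ : QuadricPair R) : QuadricPair R :=
  ⟨fun i => (Φ.Q i).subst N⟩

/-- The values of the two forms at a point. -/
def val (Φ : QuadricPair R) (x : Fin 4 → R) : Fin 2 → R := fun i => (Φ.Q i).form x

/-- The `k`-th partial derivatives of the two forms at a point. -/
noncomputable def jac (Φ : QuadricPair R) (x : Fin 4 → R) (k : Fin 4) : Fin 2 → R :=
  fun i => grad (Φ.Q i).poly x k

theorem comb_Q (M : Matrix (Fin 2) (Fin 2) R) (Φ : QuadricPair R) (i : Fin 2) :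
    (Φ.comb M).Q i = Quadric.lin (M i 0) (M i 1) (Φ.Q 0) (Φ.Q 1) := rfl

theorem subst_Q (N : Matrix (Fin 4) (Fin 4) R) (Φ : QuadricPair R) (i : Fin 2) :
    (Φ.subst N).Q i = (Φ.Q i).subst N := rfl

attribute [irreducible] comb subst

theorem form_comb (M : Matrix (Fin 2) (Fin 2) R) (Φ : QuadricPair R) {A : Type*} [CommRing A]
    [Algebra R A] (x : Fin 4 → A) (i : Fin 2) :
    ((Φ.comb M).Q i).form x = ∑ j, M i j • (Φ.Q j).form x := by
  rw [comb_Q, Quadric.form_lin, Fin.sum_univ_two]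

theorem val_comb (M : Matrix (Fin 2) (Fin 2) R) (Φ : QuadricPair R) (x : Fin 4 → R) :
    (Φ.comb M).val x = M.mulVec (Φ.val x) := by
  ext i
  simp [val, form_comb, Matrix.mulVec, dotProduct]

theorem val_subst (N : Matrix (Fin 4) (Fin 4) R) (Φ : QuadricPair R) (x : Fin 4 → R) :
    (Φ.subst N).val x = Φ.val (Matrix.vecMul x N) :=
  funext fun i => by rw [val, val, subst_Q, Quadric.form_subst_eq]

theorem jac_comb (M : Matrix (Fin 2) (Fin 2) R) (Φ : QuadricPair R) (x : Fin 4 → R) (k : Fin 4) :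
    (Φ.comb M).jac x k = M.mulVec (Φ.jac x k) := by
  ext i
  have : ((Φ.comb M).Q i).poly = C (M i 0) * (Φ.Q 0).poly + C (M i 1) * (Φ.Q 1).poly := by
    rw [Quadric.poly, form_comb, Fin.sum_univ_two, smul_eq_C_mul, smul_eq_C_mul]; rfl
  simp [jac, this, grad, Matrix.mulVec, dotProduct, Fin.sum_univ_two]

theorem jac_subst (N : Matrix (Fin 4) (Fin 4) R) (Φ : QuadricPair R) (x : Fin 4 → R) (k : Fin 4) :
    (Φ.subst N).jac x k = ∑ j, N k j • Φ.jac (Matrix.vecMul x N) j := by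
  ext i
  simp [jac, subst_Q, Quadric.grad_subst, Matrix.mulVec, dotProduct]

theorem ext_of_val {Φ Ψ : QuadricPair R} (h : ∀ x, Φ.val x = Ψ.val x) : Φ = Ψ := by
  obtain ⟨Q⟩ := Φ
  obtain ⟨Q'⟩ := Ψ
  congr 1
  funext i
  apply Quadric.ext_of_form
  intro x
  have := congrFun (h x) i
  simp only [val] at this
  exact this

theorem comb_comb (M M' : Matrix (Fin 2) (Fin 2) R) (Φ : QuadricPair R) :
    (Φ.comb M).comb M' = Φ.comb (M' * M) :=
  ext_of_val fun x => by rw [val_comb, val_comb, val_comb, Matrix.mulVec_mulVec]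

theorem subst_subst (N N' : Matrix (Fin 4) (Fin 4) R) (Φ : QuadricPair R) :
    (Φ.subst N).subst N' = Φ.subst (N' * N) :=
  ext_of_val fun x => by rw [val_subst, val_subst, val_subst, Matrix.vecMul_vecMul]

theorem comb_one (Φ : QuadricPair R) : Φ.comb 1 = Φ :=
  ext_of_val fun x => by rw [val_comb, Matrix.one_mulVec]

theorem subst_one (Φ : QuadricPair R) : Φ.subst 1 = Φ :=
  ext_of_val fun x => by rw [val_subst, Matrix.vecMul_one]

theorem isTransform_iff {M : Matrix (Fin 2) (Fin 2) R} {N : Matrix (Fin 4) (Fin 4) R}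
    {Φ Φ' : QuadricPair R} : IsTransform M N Φ Φ' ↔ Φ' = (Φ.comb M).subst N := by
  have h : ∀ i, (((Φ.comb M).subst N).Q i).form (X : Fin 4 → MvPolynomial (Fin 4) R) =
      ∑ j, C (M i j) * (Φ.Q j).form (linSubst N) := by
    intro i
    rw [subst_Q, Quadric.form_linSubst, form_comb]
    simp only [smul_eq_C_mul]
  constructor
  · intro h'
    generalize (Φ.comb M).subst N = Ψ at h ⊢
    refine ext_of_val fun x => funext fun i => ?_
    rw [val, val, Quadric.ext_of_form_X ((h' i).trans (h i).symm)]
  · intro h'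
    rw [h']
    exact h

theorem isTransform_one_left {N : Matrix (Fin 4) (Fin 4) R} {Φ Φ' : QuadricPair R} :
    IsTransform 1 N Φ Φ' ↔ Φ' = Φ.subst N := by
  rw [isTransform_iff, comb_one]

theorem isTransform_one_right {M : Matrix (Fin 2) (Fin 2) R} {Φ Φ' : QuadricPair R} :
    IsTransform M 1 Φ Φ' ↔ Φ' = Φ.comb M := by
  rw [isTransform_iff, subst_one]

theorem lin_comb (M : Matrix (Fin 2) (Fin 2) R) (Φ : QuadricPair R) {A : Type*} [CommRing A]
    [Algebra R A] (s t : A) :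
    Quadric.lin s t ((Φ.comb M).Q 0) ((Φ.comb M).Q 1) =
      Quadric.lin (M 0 0 • s + M 1 0 • t) (M 0 1 • s + M 1 1 • t) (Φ.Q 0) (Φ.Q 1) := by
  simp only [comb_Q, Quadric.lin, Quadric.mk.injEq, Algebra.smul_def, map_add, map_mul,
    Algebra.algebraMap_self, RingHom.id_apply]
  refine ⟨?_, ?_, ?_, ?_, ?_, ?_, ?_, ?_, ?_, ?_⟩ <;> ring

/-- Changing the basis of the pencil is a substitution of its two parameters. -/
theorem doubling_comb (M : Matrix (Fin 2) (Fin 2) R) (Φ : QuadricPair R) :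
    (Φ.comb M).doubling = Φ.doubling.subst M := by
  have hx : (X : Fin 2 → MvPolynomial (Fin 2) R) = ![X 0, X 1] := by
    ext i : 1
    fin_cases i <;> rfl
  apply Quartic.ext_of_forms
  · rw [Quartic.P_subst, ← pf_lin, hx, ← pf_lin, lin_comb]
    rfl
  · rw [Quartic.Q_subst, ← rd_lin, hx, ← rd_lin, lin_comb]
    rfl

theorem disc_comb [IsDomain R] [CharZero R] (M : Matrix (Fin 2) (Fin 2) R) (Φ : QuadricPair R) :
    (Φ.comb M).disc = M.det ^ 12 * Φ.disc := by
  rw [disc, doubling_comb, Quartic.disc_subst, disc]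

end

end QuadricPair

namespace Quadric

variable {R : Type*} [CommRing R]

/-- The matrix of second partial derivatives. -/
def hessian (q : Quadric R) : Matrix (Fin 4) (Fin 4) R :=
  !![2 * q.c11, q.c12, q.c13, q.c14; q.c12, 2 * q.c22, q.c23, q.c24;
      q.c13, q.c23, 2 * q.c33, q.c34; q.c14, q.c24, q.c34, 2 * q.c44]

theorem grad_poly_eq (q : Quadric R) (p : Fin 4 → R) : grad q.poly p = q.hessian.mulVec p := by
  rw [grad_poly]
  ext i
  fin_cases i <;> simp [hessian, Matrix.mulVec, dotProduct, Fin.sum_univ_four]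

theorem polar_self (q : Quadric R) (u : Fin 4 → R) : q.polar u u = 2 * q.form u := by
  simp only [polar, form, smul_eq_mul]; ring

theorem hessian_subst (N : Matrix (Fin 4) (Fin 4) R) (q : Quadric R) :
    (q.subst N).hessian = N * q.hessian * N.transpose := by
  have h : ∀ i j, (N * q.hessian * N.transpose) i j = q.polar (N j) (N i) := by
    intro i j
    rw [polar_eq, grad_poly_eq, Matrix.mul_assoc, Matrix.mul_apply]
    rfl
  ext i j
  rw [h]
  fin_cases i <;> fin_cases j <;>
    first
    | exact (q.polar_self _).symm
    | exact q.polar_comm _ _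
    | rfl

end Quadric

end GenusOne

/-! ### The discriminant of a quadric intersection, and Δ ≠ 0 in degree 4. -/

namespace GenusOne

namespace Quartic

variable {R : Type*} [CommRing R]

theorem completed_polynomial (Φ : Quartic R) :
    Φ.P ![(Polynomial.X : Polynomial R), 1] ^ 2 + 4 * Φ.Q ![Polynomial.X, 1] =
      ∑ i : Fin 5, Polynomial.C (Φ.completed i) * Polynomial.X ^ (4 - i : ℕ) := by
  simp [Fin.sum_univ_succ, P, Q, completed, Polynomial.smul_eq_C_mul, map_ofNat]
  ring

theorem completed_eq_of_polynomial {Φ Ψ : Quartic R} {s : R}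
    (h : Φ.P ![(Polynomial.X : Polynomial R), 1] ^ 2 + 4 * Φ.Q ![Polynomial.X, 1] =
      Polynomial.C s * (Ψ.P ![(Polynomial.X : Polynomial R), 1] ^ 2 +
        4 * Ψ.Q ![Polynomial.X, 1])) : Φ.completed = fun i => s * Ψ.completed i := by
  rw [completed_polynomial, completed_polynomial] at h
  have h := fun k => congrArg (fun p => Polynomial.coeff p k) h
  ext i
  have := h (4 - i)
  simp only [Polynomial.coeff_C_mul, Polynomial.finsetSum_coeff, Polynomial.coeff_X_pow,
    Fin.sum_univ_succ] at this
  fin_cases i <;> simpa using this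

theorem invI_mul (s : R) (g : Fin 5 → R) : invI (fun i => s * g i) = s ^ 2 * invI g := by
  simp only [invI]; ring

theorem invJ_mul (s : R) (g : Fin 5 → R) : invJ (fun i => s * g i) = s ^ 3 * invJ g := by
  simp only [invJ]; ring

theorem completed_baseChange (A : Type*) [CommRing A] [Algebra R A] (Φ : Quartic R) :
    (Φ.baseChange A).completed = fun i => algebraMap R A (Φ.completed i) := by
  ext i
  fin_cases i <;> simp [completed, baseChange, map_ofNat]

theorem P_baseChange (A : Type*) [CommRing A] [Algebra R A] (Φ : Quartic R) {B : Type*}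
    [CommRing B] [Algebra R B] [Algebra A B] [IsScalarTower R A B] (x : Fin 2 → B) :
    (Φ.baseChange A).P x = Φ.P x := by
  simp [baseChange, P]

theorem Q_baseChange (A : Type*) [CommRing A] [Algebra R A] (Φ : Quartic R) {B : Type*}
    [CommRing B] [Algebra R B] [Algebra A B] [IsScalarTower R A B] (x : Fin 2 → B) :
    (Φ.baseChange A).Q x = Φ.Q x := by
  simp [baseChange, Q]

end Quartic

namespace Quadric

variable {R : Type*} [CommRing R]

/-- Base change. -/
def baseChange (A : Type*) [CommRing A] [Algebra R A] (q : Quadric R) : Quadric A :=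
  ⟨algebraMap R A q.c11, algebraMap R A q.c12, algebraMap R A q.c13, algebraMap R A q.c14,
    algebraMap R A q.c22, algebraMap R A q.c23, algebraMap R A q.c24, algebraMap R A q.c33,
    algebraMap R A q.c34, algebraMap R A q.c44⟩

variable (A : Type*) [CommRing A] [Algebra R A]

theorem form_baseChange (q : Quadric R) {B : Type*} [CommRing B] [Algebra R B] [Algebra A B]
    [IsScalarTower R A B] (x : Fin 4 → B) : (q.baseChange A).form x = q.form x := by
  simp [baseChange, form]

theorem poly_baseChange (q : Quadric R) :
    (q.baseChange A).poly = q.form (X : Fin 4 → MvPolynomial (Fin 4) A) := by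
  rw [poly, form_baseChange]

theorem lin_baseChange {B : Type*} [CommRing B] [Algebra R B] [Algebra A B] [IsScalarTower R A B]
    (s t : B) (q r : Quadric R) :
    lin s t (q.baseChange A) (r.baseChange A) = lin s t q r := by
  simp [baseChange, lin]

variable {A}

theorem lin_subst (N : Matrix (Fin 4) (Fin 4) R) (s t : A) (q r : Quadric R) :
    lin s t (q.subst N) (r.subst N) = (lin s t q r).subst (N.map (algebraMap R A)) := by
  simp only [lin, subst, form, polar, mk.injEq, Algebra.smul_def, Matrix.map_apply, map_add,
    map_mul, map_pow, map_ofNat, Algebra.algebraMap_self, RingHom.id_apply]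
  refine ⟨?_, ?_, ?_, ?_, ?_, ?_, ?_, ?_, ?_, ?_⟩ <;> ring

theorem det_hessian_subst (N : Matrix (Fin 4) (Fin 4) R) (q : Quadric R) :
    (q.subst N).pf ^ 2 + 4 * (q.subst N).rd = N.det ^ 2 * (q.pf ^ 2 + 4 * q.rd) := by
  rw [← det_hessian, ← det_hessian]
  have := congrArg Matrix.det (hessian_subst N q)
  rw [Matrix.det_mul, Matrix.det_mul, Matrix.det_transpose] at this
  exact this.trans (by rw [hessian]; ring)

end Quadric

namespace QuadricPair

variable {R : Type*} [CommRing R]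

/-- The quartic P² + 4Q of the doubling is the determinant of the Hessian of the pencil, and the
Hessian H becomes N H Nᵀ. -/
theorem completed_subst (N : Matrix (Fin 4) (Fin 4) R) (Φ : QuadricPair R) :
    (Φ.subst N).doubling.completed = fun i => N.det ^ 2 * Φ.doubling.completed i := by
  apply Quartic.completed_eq_of_polynomial
  rw [← pf_lin, ← rd_lin, ← pf_lin, ← rd_lin, subst_Q, subst_Q, Quadric.lin_subst,
    Quadric.det_hessian_subst]
  congr 1
  rw [Polynomial.algebraMap_eq, map_pow, RingHom.map_det]
  rfl

theorem disc_subst [IsDomain R] [CharZero R] (N : Matrix (Fin 4) (Fin 4) R) (Φ : QuadricPair R) :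
    (Φ.subst N).disc = N.det ^ 12 * Φ.disc := by
  apply mul_left_cancel₀ (show (6912 : R) ≠ 0 by norm_num)
  rw [disc, Quartic.disc_eq, completed_subst, Quartic.invI_mul, Quartic.invJ_mul, disc]
  linear_combination -N.det ^ 12 * Φ.doubling.disc_eq

/-- Base change. -/
def baseChange (A : Type*) [CommRing A] [Algebra R A] (Φ : QuadricPair R) : QuadricPair A :=
  ⟨fun i => (Φ.Q i).baseChange A⟩

theorem baseChange_Q (A : Type*) [CommRing A] [Algebra R A] (Φ : QuadricPair R) (i : Fin 2) :
    (Φ.baseChange A).Q i = (Φ.Q i).baseChange A := rfl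

attribute [irreducible] baseChange

theorem doubling_baseChange (A : Type*) [CommRing A] [Algebra R A] (Φ : QuadricPair R) :
    (Φ.baseChange A).doubling = Φ.doubling.baseChange A := by
  have hx : (X : Fin 2 → MvPolynomial (Fin 2) A) = ![X 0, X 1] := by
    ext i : 1
    fin_cases i <;> rfl
  apply Quartic.ext_of_forms
  · rw [Quartic.P_baseChange, hx, ← pf_lin, ← pf_lin, baseChange_Q, baseChange_Q,
      Quadric.lin_baseChange]
  · rw [Quartic.Q_baseChange, hx, ← rd_lin, ← rd_lin, baseChange_Q, baseChange_Q,
      Quadric.lin_baseChange]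

theorem isSmoothAt_iff {F : Type*} [Field F] [Algebra R F] {Φ : QuadricPair R} {p : Fin 4 → F} :
    Φ.IsSmoothAt p ↔ (Φ.baseChange F).val p = 0 ∧
      ∀ c : Fin 2 → F, (∀ k, c ⬝ᵥ (Φ.baseChange F).jac p k = 0) → c = 0 := by
  rw [IsSmoothAt, Fintype.linearIndependent_iff]
  refine and_congr ?_ (forall_congr' fun c => ?_)
  · simp only [funext_iff, val, baseChange_Q, Quadric.form_baseChange, Pi.zero_apply]
  · simp only [funext_iff, dotProduct, jac, baseChange_Q, Quadric.poly_baseChange, Pi.zero_apply,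
      Finset.sum_apply, Pi.smul_apply, smul_eq_mul]

/-- There is a point where the two forms vanish and their gradients are linearly dependent. -/
def HasSingularPoint {F : Type*} [Field F] (Φ : QuadricPair F) : Prop :=
  ∃ v : Fin 4 → F, v ≠ 0 ∧ Φ.val v = 0 ∧ ∃ c : Fin 2 → F, c ≠ 0 ∧ ∀ k, c ⬝ᵥ Φ.jac v k = 0

theorem not_hasSingularPoint {F : Type*} [Field F] [Algebra R F] {Φ : QuadricPair R}
    (h : Φ.Nonsingular F) : ¬ (Φ.baseChange (AlgebraicClosure F)).HasSingularPoint := by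
  rintro ⟨v, hv, h1, c, hc, h2⟩
  have := h v hv (fun i => by
    have := congrFun h1 i
    rwa [val, baseChange_Q, Quadric.form_baseChange] at this)
  exact hc ((isSmoothAt_iff.1 this).2 c h2)

section Field

variable {L : Type*} [Field L]

theorem HasSingularPoint.of_comb {M : Matrix (Fin 2) (Fin 2) L} (hM : M.det ≠ 0)
    {Φ : QuadricPair L} (h : (Φ.comb M).HasSingularPoint) : Φ.HasSingularPoint := by
  obtain ⟨v, hv, h1, c, hc, h2⟩ := h
  rw [val_comb] at h1
  refine ⟨v, hv, Matrix.eq_zero_of_mulVec_eq_zero hM h1, Matrix.vecMul c M,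
    fun h => hc (Matrix.eq_zero_of_vecMul_eq_zero hM h), fun k => ?_⟩
  rw [← Matrix.dotProduct_mulVec, ← jac_comb, h2]

theorem HasSingularPoint.of_subst {N : Matrix (Fin 4) (Fin 4) L} (hN : N.det ≠ 0)
    {Φ : QuadricPair L} (h : (Φ.subst N).HasSingularPoint) : Φ.HasSingularPoint := by
  obtain ⟨v, hv, h1, c, hc, h2⟩ := h
  rw [val_subst] at h1
  refine ⟨Matrix.vecMul v N, fun h => hv (Matrix.eq_zero_of_vecMul_eq_zero hN h), h1, c, hc,
    fun k => ?_⟩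
  have : N.mulVec (fun k => c ⬝ᵥ Φ.jac (Matrix.vecMul v N) k) = 0 := by
    ext i
    have := h2 i
    rw [jac_subst, dotProduct_sum] at this
    refine Eq.trans ?_ this
    simp only [Matrix.mulVec, dotProduct, Fin.sum_univ_two, Pi.smul_apply, smul_eq_mul]
    exact Finset.sum_congr rfl fun _ _ => by ring
  exact congrFun (Matrix.eq_zero_of_mulVec_eq_zero hN this) k

/-- If x₁ does not occur in r, then the part of the determinant of t q + r that is linear in t is
q₁₁ times the discriminant of the ternary form r. -/
theorem coeff_one_rd {q r : Quadric L} (h11 : r.c11 = 0) (h12 : r.c12 = 0) (h13 : r.c13 = 0)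
    (h14 : r.c14 = 0) : (Quadric.pencil q r).rd.coeff 1 = q.c11 * (4 * r.c22 * r.c33 * r.c44 +
      r.c23 * r.c24 * r.c34 - r.c22 * r.c34 ^ 2 - r.c33 * r.c24 ^ 2 - r.c44 * r.c23 ^ 2) := by
  have : ∀ p : Polynomial L, p.coeff 1 = (Polynomial.derivative p).eval 0 := fun p => by
    rw [← Polynomial.coeff_zero_eq_eval_zero, Polynomial.coeff_derivative]; simp
  rw [this]
  simp [Quadric.pencil, Quadric.rd, h11, h12, h13, h14, mul_pow, Polynomial.derivative_mul,
    Polynomial.derivative_pow]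
  ring

variable [IsAlgClosed L] [CharZero L]

/-- The quadric Q₂ is a cone, and its vertex may be moved to (1 : 0 : 0 : 0). As the determinant of
t Q₁ + Q₂ vanishes doubly at t = 0, either Q₁ passes through the vertex or Q₂ is singular along a
line, which meets Q₁. In both cases a singular point of Q₂ lies on Q₁. -/
theorem hasSingularPoint_of_coeffs {Φ : QuadricPair L} (h4 : Φ.doubling.completed 4 = 0)
    (h3 : Φ.doubling.completed 3 = 0) : Φ.HasSingularPoint := by
  have h2' : (2 : L) ≠ 0 := two_ne_zero
  have h4' : (4 : L) ≠ 0 := by norm_num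
  have e : ∀ Φ : QuadricPair L, Φ.doubling.n = (Φ.Q 1).pf ∧ Φ.doubling.e = (Φ.Q 1).rd := by
    intro Φ
    have h1 := Φ.pf_lin (0 : L) 1
    have h2 := Φ.rd_lin (0 : L) 1
    simp [Quadric.lin, Quartic.P, Quartic.Q] at h1 h2
    exact ⟨h1.symm, h2.symm⟩
  have hdet : (Φ.Q 1).hessian.det = 0 := by
    rw [Quadric.hessian, Quadric.det_hessian, ← (e Φ).1, ← (e Φ).2]
    exact h4
  obtain ⟨v, hv, hv'⟩ := Matrix.exists_mulVec_eq_zero_iff.2 hdet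
  obtain ⟨i, hi⟩ := Function.ne_iff.1 hv
  obtain ⟨N, hN, rfl⟩ := exists_isUnit_det_row (isUnit_iff_ne_zero.2 hi) 0
  refine HasSingularPoint.of_subst hN.ne_zero ?_
  have h3 : (Φ.subst N).doubling.completed 3 = 0 := by
    simp only [completed_subst, h3, mul_zero]
  have hpol : ∀ u, (Φ.Q 1).polar (N 0) u = 0 := by
    intro u
    rw [Quadric.polar_eq, Quadric.grad_poly_eq, hv']
    simp
  have h11 : ((Φ.subst N).Q 1).c11 = 0 := by
    have := hpol (N 0)
    rw [Quadric.polar_self] at this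
    rw [subst_Q]
    exact (mul_eq_zero.1 this).resolve_left h2'
  have h12 : ((Φ.subst N).Q 1).c12 = 0 := by rw [subst_Q]; exact hpol _
  have h13 : ((Φ.subst N).Q 1).c13 = 0 := by rw [subst_Q]; exact hpol _
  have h14 : ((Φ.subst N).Q 1).c14 = 0 := by rw [subst_Q]; exact hpol _
  generalize Φ.subst N = Ψ at *
  have hn : Ψ.doubling.n = 0 := by rw [(e Ψ).1, Quadric.pf, h12, h13, h14]; ring
  have hd : Ψ.doubling.d = 0 := by
    have : 2 * Ψ.doubling.m * Ψ.doubling.n + 4 * Ψ.doubling.d = 0 := h3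
    rw [hn, mul_zero, zero_add] at this
    exact (mul_eq_zero.1 this).resolve_left h4'
  have hd := (coeff_one_rd (q := Ψ.Q 0) h11 h12 h13 h14).symm.trans hd
  have hfin : ∀ v : Fin 4 → L, v ≠ 0 → (Ψ.Q 0).form v = 0 → grad (Ψ.Q 1).poly v = 0 →
      Ψ.HasSingularPoint := by
    intro v hv h0 h1
    refine ⟨v, hv, ?_, ![0, 1], fun h => by simpa using congrFun h 1, fun k => ?_⟩
    · ext i
      fin_cases i
      · exact h0
      · have := (Ψ.Q 1).polar_self v
        rw [Quadric.polar_eq, h1] at this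
        simpa [val] using this
    · simp [dotProduct, jac, h1]
  rcases mul_eq_zero.1 hd with hd | hd
  · refine hfin ![1, 0, 0, 0] (fun h => by simpa using congrFun h 0) ?_ ?_
    · simp [Quadric.form, hd]
    · rw [Quadric.grad_poly]
      ext k
      fin_cases k <;> simp [h11, h12, h13, h14]
  · obtain ⟨w, hw, hw'⟩ := Matrix.exists_mulVec_eq_zero_iff.2 (show
      Matrix.det !![2 * (Ψ.Q 1).c22, (Ψ.Q 1).c23, (Ψ.Q 1).c24;
        (Ψ.Q 1).c23, 2 * (Ψ.Q 1).c33, (Ψ.Q 1).c34;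
        (Ψ.Q 1).c24, (Ψ.Q 1).c34, 2 * (Ψ.Q 1).c44] = 0 by
      simp [Matrix.det_fin_three]
      linear_combination 2 * hd)
    -- The restriction of Q₁ to the singular line of Q₂, spanned by the vertex and w.
    obtain ⟨y, z, hyz, hq⟩ := exists_zero_binary_quadratic (Ψ.Q 0).c11
      ((Ψ.Q 0).c12 * w 0 + (Ψ.Q 0).c13 * w 1 + (Ψ.Q 0).c14 * w 2)
      ((Ψ.Q 0).form ![0, w 0, w 1, w 2])
    have e0 := congrFun hw' 0
    have e1 := congrFun hw' 1
    have e2 := congrFun hw' 2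
    simp [Matrix.mulVec, dotProduct, Fin.sum_univ_three] at e0 e1 e2
    refine hfin ![y, z * w 0, z * w 1, z * w 2] (fun h => ?_) ?_ ?_
    · have hy : y = 0 := by simpa using congrFun h 0
      have hz : z ≠ 0 := hyz.resolve_left (not_not.2 hy)
      refine hw (funext fun i => ?_)
      have := congrFun h i.succ
      fin_cases i <;> simpa [hz] using this
    · simp [Quadric.form] at hq ⊢
      linear_combination hq
    · rw [Quadric.grad_poly]
      ext k
      fin_cases k
      · simp [h11, h12, h13, h14]
      · simp [h12]
        linear_combination z * e0
      · simp [h13]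
        linear_combination z * e1
      · simp [h14]
        linear_combination z * e2

/-- A change of basis of the pencil with second row (s, t) moves the double root to Q₂; Euler's
relation and the directional derivative along (u, v) then give the last two coefficients. -/
theorem hasSingularPoint_of_hasDoubleRoot {Φ : QuadricPair L}
    (h : Quartic.HasDoubleRoot Φ.doubling.completed) : Φ.HasSingularPoint := by
  obtain ⟨s, t, hst, h0, h1⟩ := h
  obtain ⟨u, v, huv⟩ : ∃ u v : L, u * t - v * s ≠ 0 := by
    rcases hst with h | h
    · exact ⟨0, 1, by simpa using h⟩
    · exact ⟨1, 0, by simpa using h⟩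
  have hM : (!![u, v; s, t] : Matrix (Fin 2) (Fin 2) L).det ≠ 0 := by
    simpa [Matrix.det_fin_two] using huv
  refine HasSingularPoint.of_comb hM (hasSingularPoint_of_coeffs ?_ ?_)
  · rw [doubling_comb, Quartic.completed_subst]
    simp [Quartic.substCoeffs, Quartic.subst, Quartic.Q]
    linear_combination (s * h0 + t * h1) / 4
  · rw [doubling_comb, Quartic.completed_subst]
    simp [Quartic.substCoeffs, Quartic.subst, Quartic.Q]
    linear_combination u * h0 + v * h1

end Field

theorem disc_ne_zero_of_nonsingular {K : Type*} [Field K] [CharZero K] [Algebra R K]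
    {Φ : QuadricPair R} (h : Φ.Nonsingular K) : Φ.disc ≠ 0 := by
  intro hdisc
  have : CharZero (AlgebraicClosure K) := charZero_of_injective_algebraMap
    (algebraMap K (AlgebraicClosure K)).injective
  have h1 := Φ.doubling.disc_eq
  rw [← disc, hdisc, mul_zero] at h1
  refine not_hasSingularPoint h (hasSingularPoint_of_hasDoubleRoot
    (Quartic.hasDoubleRoot_of_disc_eq_zero _ ?_))
  rw [doubling_baseChange, Quartic.completed_baseChange, Quartic.invI_map, Quartic.invJ_map,
    ← map_pow, ← map_pow, ← map_ofNat (algebraMap R _) 4, ← map_mul, ← map_sub, ← h1, map_zero]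

end QuadricPair

end GenusOne

/-! ### Degree 4: singular points modulo π^m make Δ divisible by π^(2m). -/

namespace GenusOne

section

variable {R : Type*} [CommRing R]

theorem Quadric.subst_diagonal (v : Fin 4 → R) (q : Quadric R) :
    q.subst (Matrix.diagonal v) = ⟨v 0 ^ 2 * q.c11, v 0 * v 1 * q.c12, v 0 * v 2 * q.c13,
      v 0 * v 3 * q.c14, v 1 ^ 2 * q.c22, v 1 * v 2 * q.c23, v 1 * v 3 * q.c24, v 2 ^ 2 * q.c33,
      v 2 * v 3 * q.c34, v 3 ^ 2 * q.c44⟩ := by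
  simp [Quadric.subst, Quadric.form, Quadric.polar, Matrix.diagonal]
  refine ⟨?_, ?_, ?_, ?_, ?_, ?_, ?_, ?_, ?_, ?_⟩ <;> ring

theorem Quadric.pf_subst_diagonal (v : Fin 4 → R) (q : Quadric R) :
    (q.subst (Matrix.diagonal v)).pf = (v 0 * v 1 * v 2 * v 3) * q.pf := by
  rw [subst_diagonal]; simp only [pf]; ring

theorem Quadric.rd_subst_diagonal (v : Fin 4 → R) (q : Quadric R) :
    (q.subst (Matrix.diagonal v)).rd = (v 0 * v 1 * v 2 * v 3) ^ 2 * q.rd := by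
  rw [subst_diagonal]; simp only [rd]; ring

namespace QuadricPair

/-- For diagonal substitutions both forms of the doubling scale exactly, without a shift of y. So
divisibility of the individual coefficients n, d, e can be compared, not only that of P² + 4Q. -/
theorem doubling_subst_diagonal (v : Fin 4 → R) (Φ : QuadricPair R) :
    (Φ.subst (Matrix.diagonal v)).doubling = Φ.doubling.scale (v 0 * v 1 * v 2 * v 3) := by
  have hx : (X : Fin 2 → MvPolynomial (Fin 2) R) = ![X 0, X 1] := by
    ext i : 1
    fin_cases i <;> rfl
  have hd : (Matrix.diagonal v).map (algebraMap R (MvPolynomial (Fin 2) R)) =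
      Matrix.diagonal fun i => algebraMap R (MvPolynomial (Fin 2) R) (v i) :=
    Matrix.diagonal_map (map_zero _)
  apply Quartic.ext_of_forms
  · rw [Quartic.P_scale, hx, ← pf_lin, ← pf_lin, subst_Q, subst_Q, Quadric.lin_subst, hd,
      Quadric.pf_subst_diagonal, Algebra.smul_def]
    simp only [map_mul]
  · rw [Quartic.Q_scale, hx, ← rd_lin, ← rd_lin, subst_Q, subst_Q, Quadric.lin_subst, hd,
      Quadric.rd_subst_diagonal, Algebra.smul_def]
    simp only [map_mul, map_pow]

/-- The pair is given modulo `π ^ m` near the point `q`, in terms of a matrix whose determinant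
is divisible by `π ^ m`. -/
def SingMod (π : R) (m : ℕ) (Φ : QuadricPair R) (q : Fin 4 → R) : Prop :=
  ∃ B : Matrix (Fin 2) (Fin 2) R, π ^ m ∣ B.det ∧ (∃ w, Φ.val q = π ^ m • B.mulVec w) ∧
    ∀ k, ∃ w, Φ.jac q k = B.mulVec w

theorem singMod_zero (π : R) (Φ : QuadricPair R) (q : Fin 4 → R) : SingMod π 0 Φ q :=
  ⟨1, by simp, ⟨Φ.val q, by simp⟩, fun k => ⟨Φ.jac q k, by simp⟩⟩

theorem SingMod.of_comb {π : R} {m : ℕ} {Φ : QuadricPair R} {q : Fin 4 → R}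
    {M : Matrix (Fin 2) (Fin 2) R} (hM : IsUnit M.det) (h : SingMod π m (Φ.comb M) q) :
    SingMod π m Φ q := by
  obtain ⟨B, h1, ⟨w, h2⟩, h3⟩ := h
  refine ⟨M⁻¹ * B, ?_, ⟨w, ?_⟩, fun k => ?_⟩
  · rw [Matrix.det_mul]
    exact h1.mul_left _
  · rw [← Matrix.mulVec_mulVec, ← Matrix.mulVec_smul, ← h2, val_comb, Matrix.mulVec_mulVec,
      Matrix.nonsing_inv_mul _ hM, Matrix.one_mulVec]
  · obtain ⟨w, hw⟩ := h3 k
    exact ⟨w, by rw [← Matrix.mulVec_mulVec, ← hw, jac_comb, Matrix.mulVec_mulVec,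
      Matrix.nonsing_inv_mul _ hM, Matrix.one_mulVec]⟩

theorem SingMod.of_subst {π : R} {m : ℕ} {Φ : QuadricPair R} {q : Fin 4 → R}
    {N : Matrix (Fin 4) (Fin 4) R} (hN : IsUnit N.det) (h : SingMod π m (Φ.subst N) q) :
    SingMod π m Φ (Matrix.vecMul q N) := by
  obtain ⟨B, h1, ⟨w, h2⟩, h3⟩ := h
  refine ⟨B, h1, ⟨w, by rw [← val_subst, h2]⟩, fun k => ?_⟩
  choose w hw using h3
  refine ⟨∑ j, N⁻¹ k j • w j, ?_⟩
  rw [Matrix.mulVec_sum]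
  simp only [Matrix.mulVec_smul, ← hw, jac_subst, Finset.smul_sum, smul_smul]
  rw [Finset.sum_comm]
  simp only [← Finset.sum_smul]
  have : ∀ l, ∑ j, N⁻¹ k j * N j l = (1 : Matrix (Fin 4) (Fin 4) R) k l := fun l => by
    rw [← Matrix.nonsing_inv_mul _ hN]; rfl
  simp [this, Matrix.one_apply]

/-- The new matrix is A B. The values gain the factor π of π A. The first three partial derivatives
gain the same factor, which cancels the π of the substitution, and the fourth has a factor π to
spare. -/
theorem SingMod.of_diagonal [IsDomain R] {π : R} (hπ : π ≠ 0) {m : ℕ} {Φ Ψ : QuadricPair R}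
    {A : Matrix (Fin 2) (Fin 2) R} (hA : π ∣ A.det)
    (h : Φ.subst (Matrix.diagonal ![π, π, π, 1]) = Ψ.comb (π • A)) {q : Fin 4 → R}
    (hq : SingMod π m Ψ q) : SingMod π (m + 1) Φ (Matrix.vecMul q (Matrix.diagonal ![π, π, π, 1])) := by
  obtain ⟨B, h1, ⟨w, h2⟩, h3⟩ := hq
  refine ⟨A * B, ?_, ⟨w, ?_⟩, fun k => ?_⟩
  · rw [Matrix.det_mul, pow_succ']
    exact mul_dvd_mul hA h1
  · rw [← val_subst, h, val_comb, h2, Matrix.smul_mulVec, Matrix.mulVec_smul,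
      Matrix.mulVec_mulVec, smul_smul, pow_succ']
  · obtain ⟨w, hw⟩ := h3 k
    have key : (![π, π, π, 1] : Fin 4 → R) k •
        Φ.jac (Matrix.vecMul q (Matrix.diagonal ![π, π, π, 1])) k = π • (A * B).mulVec w := by
      have := jac_subst (Matrix.diagonal ![π, π, π, 1]) Φ q k
      rw [h, jac_comb, hw, Finset.sum_eq_single k (fun j _ hj => by
        rw [Matrix.diagonal_apply_ne' _ hj, zero_smul]) (by simp), Matrix.diagonal_apply_eq] at this
      rw [← this, Matrix.smul_mulVec, Matrix.mulVec_mulVec]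
    have hcancel : ∀ {u v : Fin 2 → R}, π • u = π • v → u = v := fun h =>
      smul_right_injective _ hπ h
    fin_cases k
    · exact ⟨w, hcancel key⟩
    · exact ⟨w, hcancel key⟩
    · exact ⟨w, hcancel key⟩
    · exact ⟨π • w, by rw [Matrix.mulVec_smul, ← key]; simp⟩

end QuadricPair

/-- A weak form of elementary divisors: after common factors π are taken out of B, some entry is a
unit or the remaining exponent is at most 1. In the first case a row of the adjugate is a primitive
combination of rows killed by the determinant. -/
theorem exists_isUnit_pow_dvd_vecMul [IsDomain R] [IsDiscreteValuationRing R] {π : R}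
    (hπ : Irreducible π) (m : ℕ) (B : Matrix (Fin 2) (Fin 2) R) (h : π ^ m ∣ B.det) :
    ∃ (j : ℕ) (c : Fin 2 → R), 2 * j ≤ m ∧ (∃ i, IsUnit (c i)) ∧ (∀ i k, π ^ j ∣ B i k) ∧
      ∀ k, π ^ (m - j) ∣ Matrix.vecMul c B k := by
  induction m using Nat.strong_induction_on generalizing B with
  | _ m ih =>
    by_cases hB : ∀ i k, π ∣ B i k
    · rcases Nat.lt_or_ge m 2 with hm | hm
      · refine ⟨0, ![1, 0], by omega, ⟨0, by simp⟩, by simp, fun k => ?_⟩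
        simp only [Matrix.vecMul, dotProduct, Fin.sum_univ_two, Matrix.cons_val_zero,
          Matrix.cons_val_one, one_mul, zero_mul, add_zero, Nat.sub_zero]
        exact (pow_dvd_pow π (by omega : m ≤ 1)).trans ((pow_one π).symm ▸ hB 0 k)
      · choose B' hB' using hB
        have hBB : B = π • Matrix.of B' := by
          ext i k
          simp [hB' i k]
        have hdet : π ^ (m - 2) ∣ (Matrix.of B').det := by
          rw [hBB, Matrix.det_smul, Fintype.card_fin] at h
          refine (mul_dvd_mul_iff_left (pow_ne_zero 2 hπ.ne_zero)).1 ?_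
          rwa [← pow_add, Nat.add_sub_cancel' hm]
        obtain ⟨j, c, h1, h2, h3, h4⟩ := ih (m - 2) (by omega) _ hdet
        refine ⟨j + 1, c, by omega, h2, fun i k => ?_, fun k => ?_⟩
        · rw [hB' i k, pow_succ']
          exact mul_dvd_mul_left _ (h3 i k)
        · rw [hBB, Matrix.vecMul_smul, Pi.smul_apply, smul_eq_mul,
            show m - (j + 1) = m - 2 - j + 1 by omega, pow_succ']
          exact mul_dvd_mul_left _ (h4 k)
    · push Not at hB
      obtain ⟨i, k, hik⟩ := hB
      rw [not_dvd_iff_isUnit hπ] at hik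
      have key : ∀ a, (∃ b, IsUnit (B.adjugate a b)) → ∃ (j : ℕ) (c : Fin 2 → R), 2 * j ≤ m ∧
          (∃ i, IsUnit (c i)) ∧ (∀ i k, π ^ j ∣ B i k) ∧
          ∀ k, π ^ (m - j) ∣ Matrix.vecMul c B k := by
        intro a ha
        -- Since adj(B) B = det B, a row of the adjugate that contains a unit can serve as `c`.
        refine ⟨0, B.adjugate a, by omega, ha, by simp, fun k => ?_⟩
        have : Matrix.vecMul (B.adjugate a) B k = (B.adjugate * B) a k := rfl
        rw [this, Matrix.adjugate_mul, Matrix.smul_apply, smul_eq_mul]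
        exact h.mul_right _
      rw [Matrix.adjugate_fin_two] at key
      fin_cases i <;> fin_cases k
      · exact key 1 ⟨1, by simpa using hik⟩
      · exact key 0 ⟨1, by simpa using hik⟩
      · exact key 1 ⟨0, by simpa using hik⟩
      · exact key 0 ⟨0, by simpa using hik⟩

namespace QuadricPair

/-- The pair after scaling the last coordinate. -/
theorem exists_eq_subst_diagonal {Φ : QuadricPair R} {s : R} (h1 : ∀ i, s ∣ (Φ.Q i).c14)
    (h2 : ∀ i, s ∣ (Φ.Q i).c24) (h3 : ∀ i, s ∣ (Φ.Q i).c34) (h4 : ∀ i, s ^ 2 ∣ (Φ.Q i).c44) :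
    ∃ Ψ : QuadricPair R, Φ = Ψ.subst (Matrix.diagonal ![1, 1, 1, s]) := by
  choose a ha using h1
  choose b hb using h2
  choose c hc using h3
  choose d hd using h4
  refine ⟨⟨fun i => ⟨(Φ.Q i).c11, (Φ.Q i).c12, (Φ.Q i).c13, a i, (Φ.Q i).c22, (Φ.Q i).c23, b i,
    (Φ.Q i).c33, c i, d i⟩⟩, ?_⟩
  obtain ⟨Q⟩ := Φ
  apply ext_of_val
  intro x
  ext i
  rw [val, val, subst_Q, Quadric.subst_diagonal]
  simp only [Matrix.cons_val, one_mul, one_pow, ← ha, ← hb, ← hc, ← hd]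

/-- Taking s out of x₄ accounts for s^12. If Q₁ is multiplied by r, then r s can be taken out of x₄;
comparing the doublings obtained in these two ways shows that r divides n and d and that r² divides
e, and the estimate for binary quartics gives the remaining r². -/
theorem dvd_disc [IsDomain R] [CharZero R] {Φ : QuadricPair R} {s r : R} {k : ℕ} {π : R}
    (hs : s ≠ 0) (hr : r = π ^ k) (hπ : r ≠ 0)
    (h1 : ∀ i, s ∣ (Φ.Q i).c14) (h2 : ∀ i, s ∣ (Φ.Q i).c24) (h3 : ∀ i, s ∣ (Φ.Q i).c34)
    (h4 : s ^ 2 * r ∣ (Φ.Q 0).c44) (h1' : s * r ∣ (Φ.Q 1).c14) (h2' : s * r ∣ (Φ.Q 1).c24)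
    (h3' : s * r ∣ (Φ.Q 1).c34) (h4' : s ^ 2 * r ^ 2 ∣ (Φ.Q 1).c44) :
    s ^ 12 * r ^ 2 ∣ Φ.disc := by
  obtain ⟨Ψ, hΨ⟩ := exists_eq_subst_diagonal h1 h2 h3 (fun i => by
    fin_cases i
    · exact (dvd_mul_right _ _).trans h4
    · exact (dvd_mul_right _ _).trans h4')
  obtain ⟨Ψ', hΨ'⟩ := exists_eq_subst_diagonal (Φ := Φ.comb (Matrix.diagonal ![r, 1]))
      (s := s * r) (by
    intro i
    rw [comb_Q]
    fin_cases i
    · simpa [Quadric.lin] using mul_dvd_mul_right (h1 0) r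
    · simpa [Quadric.lin] using h1') (by
    intro i
    rw [comb_Q]
    fin_cases i
    · simpa [Quadric.lin] using mul_dvd_mul_right (h2 0) r
    · simpa [Quadric.lin] using h2') (by
    intro i
    rw [comb_Q]
    fin_cases i
    · simpa [Quadric.lin] using mul_dvd_mul_right (h3 0) r
    · simpa [Quadric.lin] using h3') (by
    intro i
    rw [comb_Q]
    fin_cases i
    · have := mul_dvd_mul_right h4 r
      rw [show s ^ 2 * r * r = (s * r) ^ 2 by ring] at this
      simpa [Quadric.lin] using this
    · simpa [Quadric.lin, mul_pow] using h4')
  have e := congrArg doubling hΨ'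
  rw [doubling_comb, hΨ, doubling_subst_diagonal, doubling_subst_diagonal] at e
  have hn : s * Ψ.doubling.n = s * r * Ψ'.doubling.n := by
    simpa [Quartic.subst, Quartic.scale, Quartic.P] using congrArg Quartic.n e
  have hd : s ^ 2 * Ψ.doubling.d * r = (s * r) ^ 2 * Ψ'.doubling.d := by
    simpa [Quartic.subst, Quartic.scale, Quartic.P] using congrArg Quartic.d e
  have he : s ^ 2 * Ψ.doubling.e = (s * r) ^ 2 * Ψ'.doubling.e := by
    simpa [Quartic.subst, Quartic.scale, Quartic.Q] using congrArg Quartic.e e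
  have hn : r ∣ Ψ.doubling.n := ⟨Ψ'.doubling.n, mul_left_cancel₀ hs (by rw [hn]; ring)⟩
  have hd : r ∣ Ψ.doubling.d := ⟨Ψ'.doubling.d, mul_left_cancel₀ (pow_ne_zero 2 hs)
    (mul_right_cancel₀ hπ (by rw [hd]; ring))⟩
  have he : r ^ 2 ∣ Ψ.doubling.e :=
    ⟨Ψ'.doubling.e, mul_left_cancel₀ (pow_ne_zero 2 hs) (by rw [he]; ring)⟩
  rw [hr] at hn hd he
  rw [← pow_mul, mul_comm k] at he
  have := Quartic.dvd_disc hn hd he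
  rw [hΨ, disc, doubling_subst_diagonal, Quartic.disc_scale]
  simp only [Matrix.cons_val, one_mul]
  refine mul_dvd_mul_left _ ?_
  rwa [hr, ← pow_mul, mul_comm k]

/-- The point is made the last row of N and the primitive combination of the equations the last row
of M. Then the coefficients involving x₄ lie in the image of M B, so they are divisible by π^j in
both equations and by π^(m-j) in the second. -/
theorem dvd_disc_of_singMod [IsDomain R] [IsDiscreteValuationRing R] [CharZero R] {π : R}
    (hπ : Irreducible π) {m : ℕ} {Φ : QuadricPair R} {q : Fin 4 → R} (hq : IsUnit (q 3))
    (h : SingMod π m Φ q) : π ^ (2 * m) ∣ Φ.disc := by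
  obtain ⟨B, h1, ⟨w, h2⟩, h3⟩ := h
  obtain ⟨j, c, hj, ⟨i, hc⟩, h4, h5⟩ := exists_isUnit_pow_dvd_vecMul hπ m B h1
  obtain ⟨M, hM, rfl⟩ := exists_isUnit_det_row hc 1
  obtain ⟨N, hN, rfl⟩ := exists_isUnit_det_row hq 3
  have hw : ∀ i w, π ^ j ∣ M.mulVec (B.mulVec w) i := fun i w =>
    (Finset.dvd_sum fun a _ => (Finset.dvd_sum fun b _ => (h4 a b).mul_right (w b) :
      π ^ j ∣ ∑ b, B a b * w b).mul_left (M i a) : π ^ j ∣ ∑ a, M i a * ∑ b, B a b * w b)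
  have hw' : ∀ w, π ^ (m - j) ∣ M.mulVec (B.mulVec w) 1 := fun w => by
    rw [Matrix.mulVec_mulVec]
    exact (Finset.dvd_sum fun a _ => (h5 a).mul_right (w a) :
      π ^ (m - j) ∣ ∑ a, Matrix.vecMul (M 1) B a * w a)
  have hv : ∀ i, ((((Φ.comb M).subst N).Q i).c44) = π ^ m * M.mulVec (B.mulVec w) i := by
    intro i
    have := congrFun (val_comb M Φ (N 3)) i
    rw [h2, Matrix.mulVec_smul] at this
    rw [subst_Q]
    exact this
  have hg : ∀ k, ∃ w, ∀ i, ((Φ.comb M).Q i).polar (N 3) (N k) = M.mulVec (B.mulVec w) i := by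
    intro k
    choose W hW using h3
    refine ⟨∑ l, N k l • W l, fun i => ?_⟩
    rw [Quadric.polar_eq, Matrix.mulVec_sum, Matrix.mulVec_sum, Finset.sum_apply]
    refine Finset.sum_congr rfl fun l _ => ?_
    rw [Matrix.mulVec_smul, ← hW, Matrix.mulVec_smul, ← jac_comb]
    rfl
  have e14 : ∀ i, (((Φ.comb M).subst N).Q i).c14 = ((Φ.comb M).Q i).polar (N 3) (N 0) := by
    intro i; rw [subst_Q, Quadric.polar_comm]; rfl
  have e24 : ∀ i, (((Φ.comb M).subst N).Q i).c24 = ((Φ.comb M).Q i).polar (N 3) (N 1) := by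
    intro i; rw [subst_Q, Quadric.polar_comm]; rfl
  have e34 : ∀ i, (((Φ.comb M).subst N).Q i).c34 = ((Φ.comb M).Q i).polar (N 3) (N 2) := by
    intro i; rw [subst_Q, Quadric.polar_comm]; rfl
  have hg1 : ∀ k i, π ^ j ∣ ((Φ.comb M).Q i).polar (N 3) (N k) := by
    intro k i
    obtain ⟨w, hw1⟩ := hg k
    rw [hw1]
    exact hw i w
  have hg2 : ∀ k, π ^ j * π ^ (m - 2 * j) ∣ ((Φ.comb M).Q 1).polar (N 3) (N k) := by
    intro k
    obtain ⟨w, hw1⟩ := hg k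
    rw [hw1, ← pow_add, show j + (m - 2 * j) = m - j by omega]
    exact hw' w
  -- The resulting exponent is 12 j + 2 (m - 2 j), which is at least 2 m.
  have key := dvd_disc (Φ := (Φ.comb M).subst N) (s := π ^ j) (r := π ^ (m - 2 * j)) (π := π)
    (pow_ne_zero _ hπ.ne_zero) rfl (pow_ne_zero _ hπ.ne_zero) (fun i => e14 i ▸ hg1 0 i)
    (fun i => e24 i ▸ hg1 1 i) (fun i => e34 i ▸ hg1 2 i)
    (by
      rw [hv, ← pow_mul, ← pow_add, show j * 2 + (m - 2 * j) = m by omega]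
      exact dvd_mul_right _ _)
    (e14 1 ▸ hg2 0) (e24 1 ▸ hg2 1) (e34 1 ▸ hg2 2)
    (by
      rw [hv]
      refine dvd_trans ?_ (mul_dvd_mul_left _ (hw' w))
      rw [← pow_mul, ← pow_mul, ← pow_add, ← pow_add]
      exact pow_dvd_pow _ (by omega))
  rw [disc_subst, disc_comb] at key
  have hu := ((hN.pow 12).mul (hM.pow 12))
  rw [← mul_assoc] at key
  refine dvd_trans ?_ ((IsUnit.dvd_mul_left hu).1 key)
  rw [← pow_mul, ← pow_mul, ← pow_add]
  exact pow_dvd_pow _ (by omega)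

end QuadricPair

end

end GenusOne

/-! ### Degree 4: the steps of the local solubility test and the bound for iterations. -/

namespace GenusOne

namespace Quadric

section

variable {R : Type*} [CommRing R]

theorem form_subst_diagonal (v : Fin 4 → R) (q : Quadric R) {A : Type*} [CommRing A] [Algebra R A]
    (x : Fin 4 → A) : (q.subst (Matrix.diagonal v)).form x = q.form fun i => v i • x i := by
  rw [form_subst]
  congr 1
  ext j : 1
  fin_cases j <;> simp [Matrix.diagonal]

theorem form_scale_three (s : R) (q : Quadric R) :
    q.form (![C s * X 0, C s * X 1, C s * X 2, X 3] : Fin 4 → MvPolynomial (Fin 4) R) =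
      (q.subst (Matrix.diagonal ![s, s, s, 1])).form X := by
  rw [form_subst_diagonal]
  congr 1
  ext j : 1
  fin_cases j <;> simp [smul_eq_C_mul]

theorem form_scale_two (s : R) (q : Quadric R) :
    q.form (![C s * X 0, C s * X 1, X 2, X 3] : Fin 4 → MvPolynomial (Fin 4) R) =
      (q.subst (Matrix.diagonal ![s, s, 1, 1])).form X := by
  rw [form_subst_diagonal]
  congr 1
  ext j : 1
  fin_cases j <;> simp [smul_eq_C_mul]

theorem form_scale_one (s : R) (q : Quadric R) :
    q.form (![C s * X 0, X 1, X 2, X 3] : Fin 4 → MvPolynomial (Fin 4) R) =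
      (q.subst (Matrix.diagonal ![s, 1, 1, 1])).form X := by
  rw [form_subst_diagonal]
  congr 1
  ext j : 1
  fin_cases j <;> simp [smul_eq_C_mul]

theorem sq_dvd_form_subst {s : R} {q : Quadric R} (h : s ^ 2 ∣ q.c44) (h1 : s ∣ q.c14)
    (h2 : s ∣ q.c24) (h3 : s ∣ q.c34) (x : Fin 4 → R) :
    s ^ 2 ∣ (q.subst (Matrix.diagonal ![s, s, s, 1])).form x := by
  rw [subst_diagonal]
  obtain ⟨d, hd⟩ := h
  obtain ⟨a, ha⟩ := h1
  obtain ⟨b, hb⟩ := h2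
  obtain ⟨c, hc⟩ := h3
  simp only [form, Matrix.cons_val, ha, hb, hc, hd, smul_eq_mul]
  exact ⟨q.c11 * x 0 ^ 2 + q.c12 * (x 0 * x 1) + q.c13 * (x 0 * x 2) + a * (x 0 * x 3) +
    q.c22 * x 1 ^ 2 + q.c23 * (x 1 * x 2) + b * (x 1 * x 3) + q.c33 * x 2 ^ 2 +
    c * (x 2 * x 3) + d * x 3 ^ 2, by ring⟩

theorem dvd_form_subst {s : R} {q : Quadric R} (h : s ∣ q.c44) (x : Fin 4 → R) :
    s ∣ (q.subst (Matrix.diagonal ![s, s, s, 1])).form x := by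
  rw [subst_diagonal]
  obtain ⟨d, hd⟩ := h
  simp only [form, Matrix.cons_val, hd, smul_eq_mul]
  exact ⟨s * q.c11 * x 0 ^ 2 + s * q.c12 * (x 0 * x 1) + s * q.c13 * (x 0 * x 2) +
    q.c14 * (x 0 * x 3) + s * q.c22 * x 1 ^ 2 + s * q.c23 * (x 1 * x 2) + q.c24 * (x 1 * x 3) +
    s * q.c33 * x 2 ^ 2 + q.c34 * (x 2 * x 3) + d * x 3 ^ 2, by ring⟩

end

variable {R : Type*} [CommRing R] [IsDomain R] [IsDiscreteValuationRing R] {π : R}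

theorem dvd_form_of_form_X_eq_zero (hπ : Irreducible π) {q : Quadric R}
    (h : q.form (X : Fin 4 → MvPolynomial (Fin 4) (IsLocalRing.ResidueField R)) = 0)
    (x : Fin 4 → R) : π ∣ q.form x := by
  rw [← residue_eq_zero_iff hπ, ← form_algebraMap]
  have := q.map_form ((aeval fun i => algebraMap R (IsLocalRing.ResidueField R) (x i) :
    MvPolynomial (Fin 4) _ →ₐ[IsLocalRing.ResidueField R] _).restrictScalars R) X
  rw [h, map_zero] at this
  simpa using this.symm

theorem form_eq_zero_of_dvd (hπ : Irreducible π) {q : Quadric R}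
    (h : ∀ x : Fin 4 → R, π ∣ q.form x) {A : Type*} [CommRing A] [Algebra R A]
    [Algebra (IsLocalRing.ResidueField R) A] [IsScalarTower R (IsLocalRing.ResidueField R) A]
    (x : Fin 4 → A) : q.form x = 0 := by
  obtain ⟨r, rfl⟩ := exists_eq_smul h
  rw [form_smul, ← algebraMap_smul (IsLocalRing.ResidueField R) π,
    (residue_eq_zero_iff hπ).2 dvd_rfl, zero_smul]

end Quadric

namespace QuadricPair

section

variable {R : Type*} [CommRing R]

theorem form_lin_eq (c : Fin 2 → R) (Φ : QuadricPair R) (x : Fin 4 → R) :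
    (Quadric.lin (c 0) (c 1) (Φ.Q 0) (Φ.Q 1)).form x = c ⬝ᵥ Φ.val x := by
  rw [Quadric.form_lin]
  simp [dotProduct, val]

theorem lin_subst_Q (c : Fin 2 → R) (N : Matrix (Fin 4) (Fin 4) R) (Φ : QuadricPair R) :
    Quadric.lin (c 0) (c 1) ((Φ.subst N).Q 0) ((Φ.subst N).Q 1) =
      (Quadric.lin (c 0) (c 1) (Φ.Q 0) (Φ.Q 1)).subst N := by
  rw [subst_Q, subst_Q, Quadric.lin_subst]
  rfl

end

variable {R : Type*} [CommRing R] [IsDomain R] [IsDiscreteValuationRing R] {π : R}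

/-- The equations are linearly independent modulo `π`. -/
def Indep (π : R) (Φ : QuadricPair R) : Prop :=
  ∀ c : Fin 2 → R, (∀ x, π ∣ c ⬝ᵥ Φ.val x) → ∀ i, π ∣ c i

/-- Independence over the residue field is rephrased by values over R, in which form it can be
played off against divisibility of values. -/
theorem linearIndependent_iff_indep (hπ : Irreducible π) {Φ : QuadricPair R} :
    LinearIndependent (IsLocalRing.ResidueField R) (fun i => (Φ.Q i).form
      (X : Fin 4 → MvPolynomial (Fin 4) (IsLocalRing.ResidueField R))) ↔ Indep π Φ := by
  have key : ∀ c : Fin 2 → R, (Quadric.lin (c 0) (c 1) (Φ.Q 0) (Φ.Q 1)).form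
      (X : Fin 4 → MvPolynomial (Fin 4) (IsLocalRing.ResidueField R)) =
      ∑ i, algebraMap R (IsLocalRing.ResidueField R) (c i) • (Φ.Q i).form X := fun c => by
    rw [Quadric.form_lin, Fin.sum_univ_two, algebraMap_smul, algebraMap_smul]
  rw [Fintype.linearIndependent_iff]
  constructor
  · intro h c hc i
    rw [← residue_eq_zero_iff hπ]
    refine h (fun i => algebraMap R _ (c i)) ?_ i
    rw [← key]
    exact Quadric.form_eq_zero_of_dvd hπ (fun x => by rw [form_lin_eq]; exact hc x) _
  · intro h c hc i
    obtain ⟨d, hd⟩ := exists_lift c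
    rw [← hd i, residue_eq_zero_iff hπ]
    refine h d (fun x => ?_) i
    rw [← form_lin_eq]
    refine Quadric.dvd_form_of_form_X_eq_zero hπ ?_ x
    rw [key, ← hc]
    exact Finset.sum_congr rfl fun i _ => by rw [hd i]

theorem Indep.exists_eq_smul {Φ : QuadricPair R} (h : Indep π Φ) {A : Matrix (Fin 2) (Fin 2) R}
    (hA : ∀ x i, π ∣ A.mulVec (Φ.val x) i) : ∃ A' : Matrix (Fin 2) (Fin 2) R, A = π • A' := by
  have : ∀ i j, π ∣ A i j := fun i => h (A i) fun x => hA x i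
  choose A' hA' using this
  exact ⟨Matrix.of A', by ext i j; simp [hA' i j]⟩

/-- If the pair is divisible by `π`, and some combination is divisible by `π ^ 2`, then it is given
by a matrix whose determinant is divisible by `π ^ 3`. -/
theorem Indep.exists_eq_smul_dvd_det (hπ : Irreducible π) {Φ : QuadricPair R} (h : Indep π Φ)
    {A : Matrix (Fin 2) (Fin 2) R} (hA : ∀ x i, π ∣ (Φ.comb A).val x i) {c : Fin 2 → R}
    (hc : ¬ ∀ i, π ∣ c i) (hcA : ∀ x, π ^ 2 ∣ c ⬝ᵥ (Φ.comb A).val x) :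
    ∃ A' : Matrix (Fin 2) (Fin 2) R, A = π • A' ∧ π ∣ A'.det := by
  simp only [val_comb] at hA hcA
  obtain ⟨A', rfl⟩ := h.exists_eq_smul hA
  refine ⟨A', rfl, ?_⟩
  -- After cancelling π, the row c A' annihilates the independent equations modulo π, so it vanishes
  -- modulo π. As c does not, A' is singular modulo π.
  have h1 : ∀ j, π ∣ Matrix.vecMul c A' j := h _ fun x => by
    have := hcA x
    rw [Matrix.smul_mulVec, dotProduct_smul, Matrix.dotProduct_mulVec, smul_eq_mul, pow_two] at this
    exact (mul_dvd_mul_iff_left hπ.ne_zero).1 this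
  push Not at hc
  obtain ⟨i, hi⟩ := hc
  refine (hπ.prime.dvd_or_dvd ?_).resolve_right hi
  have : Matrix.vecMul (Matrix.vecMul c A') A'.adjugate i = A'.det * c i := by
    rw [Matrix.vecMul_vecMul, Matrix.mul_adjugate, Matrix.vecMul_smul, Matrix.vecMul_one]; rfl
  rw [← this]
  exact (Finset.dvd_sum fun j _ => (h1 j).mul_right _ :
    π ∣ ∑ j, Matrix.vecMul c A' j * A'.adjugate j i)

theorem nonRegular_lift (hπ : Irreducible π) {Φ : QuadricPair R} {affine : Bool}
    {p : Fin 4 → IsLocalRing.ResidueField R} (hp : p ∈ Φ.nonRegular π affine) {q : Fin 4 → R}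
    (hq : IsLift q p) : (∀ i, π ∣ (Φ.Q i).form q) ∧ ∃ c : Fin 2 → R, (¬ ∀ i, π ∣ c i) ∧
      π ^ 2 ∣ (Quadric.lin (c 0) (c 1) (Φ.Q 0) (Φ.Q 1)).form q ∧
      ∀ v, π ∣ (Quadric.lin (c 0) (c 1) (Φ.Q 0) (Φ.Q 1)).polar q v := by
  obtain ⟨-, -, h1, c, hc, h2, q₀, h3, h4⟩ := hp
  constructor
  · intro i
    rw [← residue_eq_zero_iff hπ, ← Quadric.form_algebraMap, ← h1 i]
    congr 1
    exact funext hq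
  · refine ⟨c, hc, ?_⟩
    have hs := singMod_one_of_lift hπ (f := (Quadric.lin (c 0) (c 1) (Φ.Q 0) (Φ.Q 1)).poly)
      (p := p) (q₀ := q₀) (q := q) ?_ h3 hq ?_
    · rw [GenusOne.SingMod, Quadric.eval_poly] at hs
      refine ⟨hs.1, fun v => ?_⟩
      rw [Quadric.polar_eq]
      exact Finset.dvd_sum fun k _ => (by simpa using hs.2 k : π ∣ _).mul_left _
    · rw [← Quadric.form_X_eq_map, Quadric.form_lin, ← h2, Fin.sum_univ_two]
      ext i
      simp [grad, Algebra.smul_def, IsScalarTower.algebraMap_apply R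
        (IsLocalRing.ResidueField R) (MvPolynomial (Fin 4) (IsLocalRing.ResidueField R))]
    · rw [Quadric.eval_poly, form_lin_eq]
      exact h4

/-- The model after a move to a non-regular point. -/
theorem dvd_of_nonRegular (hπ : Irreducible π) {Φ : QuadricPair R} {affine : Bool}
    {p : Fin 4 → IsLocalRing.ResidueField R} (hp : p ∈ Φ.nonRegular π affine)
    {N : Matrix (Fin 4) (Fin 4) R} (hq : IsLift (N 3) p) :
    (∀ x i, π ∣ ((Φ.subst N).subst (Matrix.diagonal ![π, π, π, 1])).val x i) ∧
      ∃ c : Fin 2 → R, (¬ ∀ i, π ∣ c i) ∧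
        ∀ x, π ^ 2 ∣ c ⬝ᵥ ((Φ.subst N).subst (Matrix.diagonal ![π, π, π, 1])).val x := by
  obtain ⟨h1, c, hc, h2, h3⟩ := nonRegular_lift hπ hp hq
  refine ⟨fun x i => ?_, c, hc, fun x => ?_⟩
  · rw [val, subst_Q, subst_Q]
    exact Quadric.dvd_form_subst (h1 i) x
  · rw [← form_lin_eq, lin_subst_Q, lin_subst_Q]
    refine Quadric.sq_dvd_form_subst h2 ?_ ?_ ?_ x
    · have := h3 (N 0)
      rwa [Quadric.polar_comm] at this
    · have := h3 (N 1)
      rwa [Quadric.polar_comm] at this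
    · have := h3 (N 2)
      rwa [Quadric.polar_comm] at this

/-- The translation that moves the point `(0 : 0 : 0 : 1)` to `(u : 1)`. -/
def translation (u : Fin 3 → R) : Matrix (Fin 4) (Fin 4) R :=
  !![1, 0, 0, 0; 0, 1, 0, 0; 0, 0, 1, 0; u 0, u 1, u 2, 1]

theorem det_translation (u : Fin 3 → R) : (translation u).det = 1 := by
  simp [translation, Matrix.det_succ_row_zero, Fin.sum_univ_succ, Fin.succAbove]

theorem det_diagonal_three : (Matrix.diagonal ![π, π, π, 1]).det = π ^ 3 := by
  rw [Matrix.det_diagonal, Fin.prod_univ_four]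
  simp only [Matrix.cons_val]
  ring

theorem calls_search {Φ : QuadricPair R} {t : Stage (QuadricPair R)}
    (h : Calls (isLocallySoluble π) (.search Φ) t) :
    ∃ p ∈ Φ.nonRegular π true, ∃ u : Fin 3 → R, IsLift u ![p 0, p 1, p 2] ∧
      t = .normalise ((Φ.subst (translation u)).subst (Matrix.diagonal ![π, π, π, 1])) := by
  obtain ⟨calls, ⟨-, rfl⟩ | ⟨-, hc⟩, ht⟩ := h
  · simp at ht
  · obtain ⟨p, hp, u, Φ₁, hu, h1, rfl⟩ := hc.exists_of_mem ht
    refine ⟨p, hp, u, hu, ?_⟩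
    congr 1
    apply ext_of_val
    intro x
    ext i
    have h2 : (((Φ.subst (translation u)).subst (Matrix.diagonal ![π, π, π, 1])).Q i).form
        (X : Fin 4 → MvPolynomial (Fin 4) R) = (Φ₁.Q i).form X := by
      rw [subst_Q, subst_Q, Quadric.form_subst_diagonal, Quadric.form_subst, h1]
      congr 1
      ext j : 1
      fin_cases j <;> simp [smul_eq_C_mul, translation, add_comm]
    exact (Quadric.form_eq_of_form_X h2 x).symm

theorem exists_calls_search [Finite (IsLocalRing.ResidueField R)] (π : R) (Φ : QuadricPair R) :
    ∃ calls, isLocallySoluble π (.search Φ) calls := by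
  by_cases h : ∃ p : Fin 4 → IsLocalRing.ResidueField R, p 3 = 1 ∧ Φ.IsSmoothAt p
  · exact ⟨[], .inl ⟨h, rfl⟩⟩
  · obtain ⟨calls, hc⟩ := ForEach.exists (Set.toFinite (Φ.nonRegular π true))
      (call := fun (p : Fin 4 → IsLocalRing.ResidueField R) (t : Stage (QuadricPair R)) =>
        ∃ (u : Fin 3 → R) (Φ₁ : QuadricPair R), IsLift u ![p 0, p 1, p 2] ∧
            (∀ i, (Φ₁.Q i).form (X : Fin 4 → MvPolynomial (Fin 4) R)
              = (Φ.Q i).form ![C (u 0) * X 3 + C π * X 0, C (u 1) * X 3 + C π * X 1,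
                  C (u 2) * X 3 + C π * X 2, X 3]) ∧
            t = .normalise Φ₁) (by
        intro p _
        obtain ⟨u, hu⟩ := exists_lift ![p 0, p 1, p 2]
        refine ⟨_, u, (Φ.subst (translation u)).subst (Matrix.diagonal ![π, π, π, 1]), hu,
          fun i => ?_, rfl⟩
        rw [subst_Q, subst_Q, Quadric.form_subst_diagonal, Quadric.form_subst]
        congr 1
        ext j : 1
        fin_cases j <;> simp [smul_eq_C_mul, translation, add_comm])
    exact ⟨calls, .inr ⟨h, hc⟩⟩

theorem det_diagonal_one : (Matrix.diagonal ![π, 1, 1, 1]).det = π := by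
  rw [Matrix.det_diagonal, Fin.prod_univ_four]
  simp

theorem calls_normalise (hπ : Irreducible π) {Φ : QuadricPair R} {t : Stage (QuadricPair R)}
    (h : Calls (isLocallySoluble π) (.normalise Φ) t) :
    ∃ (A : Matrix (Fin 2) (Fin 2) R) (Ψ : QuadricPair R), A.det ≠ 0 ∧ Φ = Ψ.comb A ∧
      Indep π Ψ ∧ (t = .search Ψ ∨ ∃ (N : Matrix (Fin 4) (Fin 4) R) (Ψ₁ : QuadricPair R),
        IsUnit N.det ∧ (Ψ.subst N).subst (Matrix.diagonal ![π, 1, 1, 1]) = Ψ₁.comb (π • 1) ∧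
        t = .normalise Ψ₁) := by
  obtain ⟨calls, ⟨A, Ψ, h1, h2, h3, h4⟩, ht⟩ := h
  rw [isTransform_one_right] at h2
  rw [linearIndependent_iff_indep hπ] at h3
  refine ⟨A, Ψ, h1, h2, h3, ?_⟩
  rcases h4 with ⟨-, rfl⟩ | ⟨-, N, Ψ', Ψ₁, hN, -, hΨ', -, h5, rfl⟩
  · exact .inl (by simpa using ht)
  · refine .inr ⟨N, Ψ₁, hN, ?_, by simpa using ht⟩
    rw [isTransform_one_left] at hΨ'
    apply ext_of_val
    intro x
    ext i
    have := h5 i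
    rw [Quadric.form_scale_one, Quadric.C_mul_form_eq_iff, hΨ'] at this
    rw [val_comb, Matrix.smul_mulVec, Matrix.one_mulVec, val, subst_Q, this, Quadric.form_smul]
    rfl

variable [CharZero R]

theorem disc_of_calls_normalise_search (hπ : Irreducible π) {Φ Ψ : QuadricPair R}
    (h : Calls (isLocallySoluble π) (.normalise Φ) (.search Ψ)) : Ψ.disc ∣ Φ.disc := by
  obtain ⟨A, Ψ', -, rfl, -, h | ⟨N, Ψ₁, -, -, h⟩⟩ := calls_normalise hπ h
  · rw [Stage.search.inj h, disc_comb]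
    exact dvd_mul_left _ _
  · simp at h

/-- The substitution x₁ ← π x₁ contributes π^12, and the division of both equations by π removes
π^24. -/
theorem disc_eq_of_common_factor (hπ : Irreducible π) {Ψ Ψ₁ : QuadricPair R}
    {N : Matrix (Fin 4) (Fin 4) R} (hN : IsUnit N.det)
    (h : (Ψ.subst N).subst (Matrix.diagonal ![π, 1, 1, 1]) = Ψ₁.comb (π • 1)) :
    π ^ 12 * Ψ₁.disc ∣ Ψ.disc := by
  have := congrArg disc h
  rw [disc_subst, disc_subst, disc_comb, det_diagonal_one, Matrix.det_smul, Matrix.det_one,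
    Fintype.card_fin] at this
  have h1 : π ^ 12 * Ψ₁.disc = N.det ^ 12 * Ψ.disc :=
    mul_left_cancel₀ (pow_ne_zero 12 hπ.ne_zero) (by rw [this]; ring)
  rw [h1]
  exact (IsUnit.mul_left_dvd (hN.pow 12)).2 dvd_rfl

theorem disc_of_calls_normalise_normalise (hπ : Irreducible π) {Φ Ψ : QuadricPair R}
    (h : Calls (isLocallySoluble π) (.normalise Φ) (.normalise Ψ)) : π ^ 12 * Ψ.disc ∣ Φ.disc := by
  obtain ⟨A, Ψ', -, rfl, -, h | ⟨N, Ψ₁, hN, h', h⟩⟩ := calls_normalise hπ h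
  · simp at h
  · rw [Stage.normalise.inj h, disc_comb]
    exact (disc_eq_of_common_factor hπ hN h').mul_left _

theorem disc_of_normalise_chain (hπ : Irreducible π) {Φ Ψ : QuadricPair R}
    (h : Relation.ReflTransGen (fun A B => Calls (isLocallySoluble π) (.normalise A) (.normalise B))
      Φ Ψ) : Ψ.disc ∣ Φ.disc := by
  induction h with
  | refl => exact dvd_rfl
  | tail _ h ih =>
    exact ((dvd_mul_left _ _).trans (disc_of_calls_normalise_normalise hπ h)).trans ih

/-- An iteration without repetitions of Step (i). -/
def SimpleIteration (π : R) (Φ Ψ : QuadricPair R) : Prop :=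
  ∃ (u : Fin 3 → R) (A : Matrix (Fin 2) (Fin 2) R),
    (Φ.subst (translation u)).subst (Matrix.diagonal ![π, π, π, 1]) = Ψ.comb (π • A) ∧ π ∣ A.det

/-- The substitution multiplies Δ by π^36. The passage to independent equations has determinant π²
det A, divisible by π³, and so removes at least π^36. -/
theorem SimpleIteration.disc_dvd (hπ : Irreducible π) {Φ Ψ : QuadricPair R}
    (h : SimpleIteration π Φ Ψ) : Ψ.disc ∣ Φ.disc := by
  obtain ⟨u, A, h, d, hd⟩ := h
  have := congrArg disc h
  rw [disc_subst, disc_subst, disc_comb, det_diagonal_three, det_translation, Matrix.det_smul,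
    Fintype.card_fin, hd] at this
  refine ⟨d ^ 12, mul_left_cancel₀ (pow_ne_zero 36 hπ.ne_zero) ?_⟩
  linear_combination this

theorem SimpleIteration.singMod (hπ : Irreducible π) {Φ Ψ : QuadricPair R}
    (h : SimpleIteration π Φ Ψ) {m : ℕ} (hΨ : ∃ q, IsUnit (q 3) ∧ SingMod π m Ψ q) :
    ∃ q, IsUnit (q 3) ∧ SingMod π (m + 1) Φ q := by
  obtain ⟨u, A, h, hA⟩ := h
  obtain ⟨q, hq, hΨ⟩ := hΨ
  refine ⟨_, ?_, (hΨ.of_diagonal hπ.ne_zero hA h).of_subst (by rw [det_translation]; exact isUnit_one)⟩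
  rw [Matrix.vecMul_vecMul, Quadric.vecMul_four]
  simpa [translation, Matrix.diagonal_mul] using hq

/-- The first passage to independent equations in Step (i) always gives a simple iteration. Every
division by a common linear factor after it costs a factor π^12 of Δ. -/
theorem iteration_cases (hπ : Irreducible π) {Φ Ψ : QuadricPair R}
    (h : Iteration (isLocallySoluble π) Φ Ψ) :
    SimpleIteration π Φ Ψ ∨ π ^ 12 * Ψ.disc ∣ Φ.disc := by
  obtain ⟨Φ₁, Φ₂, h1, h2, h3⟩ := h
  obtain ⟨p, hp, u, hu, he⟩ := calls_search h1
  have he := Stage.normalise.inj he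
  have hp3 : p 3 = 1 := by
    obtain ⟨i, hi, hj⟩ := hp.1
    by_cases h3 : i = 3
    · exact h3 ▸ hi
    · exact absurd (hj 3 (by omega)) (hp.2.1 rfl)
  have hlift : IsLift (translation u 3) p := by
    intro i
    fin_cases i
    · exact hu 0
    · exact hu 1
    · exact hu 2
    · simp [translation, hp3]
  obtain ⟨hd1, c, hc, hd2⟩ := dvd_of_nonRegular hπ hp hlift
  rw [← he] at hd1 hd2
  have key : ∀ (A : Matrix (Fin 2) (Fin 2) R) (Ψ : QuadricPair R), Φ₁ = Ψ.comb A → Indep π Ψ →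
      SimpleIteration π Φ Ψ := by
    intro A Ψ hA hi
    obtain ⟨A', hA', hdet⟩ := hi.exists_eq_smul_dvd_det hπ (A := A) (hA ▸ hd1) hc (hA ▸ hd2)
    exact ⟨u, A', by rw [← he, hA, hA'], hdet⟩
  rcases h2.cases_head with rfl | ⟨Φ₃, h4, h5⟩
  · obtain ⟨A, Ψ', -, h6, hi, h | ⟨N, Ψ₁, -, -, h⟩⟩ := calls_normalise hπ h3
    · rw [Stage.search.inj h]
      exact .inl (key A Ψ' h6 hi)
    · simp at h
  · right
    have h6 := (disc_of_calls_normalise_search hπ h3).trans (disc_of_normalise_chain hπ h5)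
    obtain ⟨A, Ψ', -, h7, hi, h | ⟨N, Ψ₁, hN, h8, h⟩⟩ := calls_normalise hπ h4
    · simp at h
    · rw [Stage.normalise.inj h] at h6
      exact ((mul_dvd_mul_left _ h6).trans (disc_eq_of_common_factor hπ hN h8)).trans
        ((key A Ψ' h7 hi).disc_dvd hπ)

theorem disc_dvd_of_iteration (hπ : Irreducible π) {Φ Ψ : QuadricPair R}
    (h : Iteration (isLocallySoluble π) Φ Ψ) : Ψ.disc ∣ Φ.disc :=
  (iteration_cases hπ h).elim (fun h => h.disc_dvd hπ) fun h => (dvd_mul_left _ _).trans h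

theorem singMod_of_iterations (hπ : Irreducible π) (m : ℕ) (Ψ : ℕ → QuadricPair R)
    (h : ∀ i < m, SimpleIteration π (Ψ i) (Ψ (i + 1))) :
    ∃ q, IsUnit (q 3) ∧ SingMod π m (Ψ 0) q := by
  induction m generalizing Ψ with
  | zero => exact ⟨1, isUnit_one, singMod_zero _ _ _⟩
  | succ m ih =>
    exact (h 0 (by omega)).singMod hπ
      (ih (fun i => Ψ (i + 1)) fun i hi => h (i + 1) (by omega))

theorem neverIncreases (hπ : Irreducible π) (Φ : QuadricPair R) :
    NeverIncreases (isLocallySoluble π)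
      (fun Ψ => IsDiscreteValuationRing.addVal R Ψ.disc) Φ := fun Ψ Ψ' _ h =>
  IsDiscreteValuationRing.addVal_le_iff_dvd.2 (disc_dvd_of_iteration hπ h)

theorem two_mul_le_of_iterations (hπ : Irreducible π) (m : ℕ) (Ψ : ℕ → QuadricPair R)
    (h : ∀ i < m, Iteration (isLocallySoluble π) (Ψ i) (Ψ (i + 1)))
    (hv : ∀ i ≤ m, IsDiscreteValuationRing.addVal R (Ψ i).disc =
      IsDiscreteValuationRing.addVal R (Ψ 0).disc) :
    2 * (m : ℕ∞) ≤ IsDiscreteValuationRing.addVal R (Ψ 0).disc := by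
  -- The valuation of zero is `⊤`, where the bound is trivial; otherwise constancy of the valuation
  -- excludes the drop by 12.
  by_cases h0 : (Ψ 0).disc = 0
  · rw [h0, IsDiscreteValuationRing.addVal_zero]
    exact le_top
  obtain ⟨q, hq, hs⟩ := singMod_of_iterations hπ m Ψ fun i hi => by
    refine (iteration_cases hπ (h i hi)).resolve_right fun hd => ?_
    have h1 := IsDiscreteValuationRing.addVal_le_iff_dvd.2 hd
    rw [addVal_pow_mul hπ, hv i (by omega), hv (i + 1) (by omega), ← coe_natVal h0] at h1
    norm_cast at h1
    omega
  have := le_addVal_of_pow_dvd hπ (dvd_disc_of_singMod hπ hq hs)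
  exact_mod_cast this

theorem stableIterationsBounded (hπ : Irreducible π) (Φ : QuadricPair R) :
    StableIterationsBounded (isLocallySoluble π)
      (fun Ψ => IsDiscreteValuationRing.addVal R Ψ.disc) Φ :=
  fun m Ψ _ h hv => two_mul_le_of_iterations hπ m Ψ h hv

end QuadricPair

end GenusOne

/-! ### Degree 4: Step (i) is never stuck; termination of the local solubility test. -/

namespace GenusOne

theorem linForm_linSubst {A : Type*} [CommRing A] {n : ℕ} (N : Matrix (Fin n) (Fin n) A)
    (ℓ : Fin n → A) : aeval (linSubst N) (linForm ℓ) = linForm (N.mulVec ℓ) := by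
  simp only [linForm, map_sum, map_mul, aeval_X, linSubst, Matrix.mulVec, dotProduct,
    Finset.mul_sum, Finset.sum_mul, algHom_C, algebraMap_eq]
  rw [Finset.sum_comm]
  exact Finset.sum_congr rfl fun i _ => Finset.sum_congr rfl fun j _ => by ring

theorem Quadric.form_X_subst {R : Type*} [CommRing R] (N : Matrix (Fin 4) (Fin 4) R) (q : Quadric R)
    (F : Type*) [CommRing F] [Algebra R F] :
    (q.subst N).form (X : Fin 4 → MvPolynomial (Fin 4) F) =
      aeval (linSubst (N.map (algebraMap R F))) (q.form (X : Fin 4 → MvPolynomial (Fin 4) F)) := by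
  have := q.map_form ((aeval (linSubst (N.map (algebraMap R F))) :
    MvPolynomial (Fin 4) F →ₐ[F] MvPolynomial (Fin 4) F).restrictScalars R) X
  rw [AlgHom.restrictScalars_apply] at this
  rw [form_subst, this]
  congr 1
  ext j : 1
  rw [AlgHom.restrictScalars_apply, aeval_X]
  simp [linSubst, Fin.sum_univ_four, Algebra.smul_def,
    IsScalarTower.algebraMap_apply R F (MvPolynomial (Fin 4) F)]

section

variable {R : Type*} [CommRing R] [IsDomain R] [IsDiscreteValuationRing R] {π : R}

theorem natVal_le_of_dvd {x y : R} (hx : x ≠ 0) (h : y ∣ x) : natVal y ≤ natVal x := by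
  have hy : y ≠ 0 := fun h0 => hx (zero_dvd_iff.1 (h0 ▸ h))
  have := IsDiscreteValuationRing.addVal_le_iff_dvd.2 h
  rw [← coe_natVal hx, ← coe_natVal hy] at this
  exact_mod_cast this

theorem natVal_lt_of_dvd (hπ : Irreducible π) {x y : R} (hx : x ≠ 0) (h : π ^ 12 * y ∣ x) :
    natVal y < natVal x := by
  obtain ⟨z, rfl⟩ := h
  have hy : y * z ≠ 0 := fun h => hx (by rw [mul_assoc, h, mul_zero])
  have h1 := natVal_pow_mul hπ 12 hy
  rw [mul_assoc, h1]
  have := (natVal_le_of_dvd hy (dvd_mul_right y z))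
  omega

end

namespace QuadricPair

variable {R : Type*} [CommRing R] [IsDomain R] [IsDiscreteValuationRing R] {π : R} [CharZero R]

/-- As long as the equations are dependent modulo π, some primitive combination can be divided by π.
This lowers v(Δ) by 12, so it happens finitely often. -/
theorem exists_indep (hπ : Irreducible π) {Φ : QuadricPair R} (hΦ : Φ.disc ≠ 0) :
    ∃ (A : Matrix (Fin 2) (Fin 2) R) (Ψ : QuadricPair R), A.det ≠ 0 ∧ Φ = Ψ.comb A ∧
      Indep π Ψ := by
  induction hn : natVal Φ.disc using Nat.strong_induction_on generalizing Φ with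
  | _ n ih =>
    by_cases hi : Indep π Φ
    · exact ⟨1, Φ, by simp, (comb_one Φ).symm, hi⟩
    · simp only [Indep, not_forall] at hi
      obtain ⟨c, hc, i, hi⟩ := hi
      rw [not_dvd_iff_isUnit hπ] at hi
      obtain ⟨M, hM, rfl⟩ := exists_isUnit_det_row hi 0
      obtain ⟨r, hr⟩ := Quadric.exists_eq_smul (fun x => by
        have := hc x
        rwa [← form_lin_eq] at this)
      obtain ⟨Ψ, h0, h1⟩ : ∃ Ψ : QuadricPair R, Ψ.Q 0 = r ∧ Ψ.Q 1 = (Φ.comb M).Q 1 :=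
        ⟨⟨![r, (Φ.comb M).Q 1]⟩, rfl, rfl⟩
      have hΨ : Φ.comb M = Ψ.comb (Matrix.diagonal ![π, 1]) := by
        apply ext_of_val
        intro x
        have hv := val_comb (Matrix.diagonal ![π, 1]) Ψ x
        rw [hv]
        ext i
        rw [Matrix.mulVec_diagonal]
        fin_cases i
        · change ((Φ.comb M).Q 0).form x = π * (Ψ.Q 0).form x
          rw [comb_Q, hr, Quadric.form_smul, h0, smul_eq_mul]
        · change ((Φ.comb M).Q 1).form x = 1 * (Ψ.Q 1).form x
          rw [h1, one_mul]
      have hd := congrArg disc hΨ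
      rw [disc_comb, disc_comb, Matrix.det_diagonal, Fin.prod_univ_two] at hd
      simp only [Matrix.cons_val_zero, Matrix.cons_val_one, mul_one] at hd
      have hd' : π ^ 12 * Ψ.disc ∣ Φ.disc := by
        rw [← hd]
        exact (IsUnit.mul_left_dvd (hM.pow 12)).2 dvd_rfl
      have h0 : Ψ.disc ≠ 0 := fun h => by
        rw [h, mul_zero] at hd'
        exact hΦ (zero_dvd_iff.1 hd')
      obtain ⟨A, Ψ', hA, hΨ', hi'⟩ := ih _ (hn ▸ natVal_lt_of_dvd hπ hΦ hd') h0 rfl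
      refine ⟨M⁻¹ * (Matrix.diagonal ![π, 1] * A), Ψ', ?_, ?_, hi'⟩
      · rw [Matrix.det_mul, Matrix.det_mul, Matrix.det_diagonal, Fin.prod_univ_two]
        refine mul_ne_zero (Matrix.isUnit_nonsing_inv_det _ hM).ne_zero (mul_ne_zero ?_ hA)
        simpa using hπ.ne_zero
      · rw [← comb_comb, ← comb_comb, ← hΨ', ← hΨ, comb_comb, Matrix.nonsing_inv_mul _ hM,
          comb_one]

theorem exists_affine_mulVec {ℓ : Fin 4 → R} {j : Fin 4} (hj : j ≠ 3) (hu : IsUnit (ℓ j)) :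
    ∃ N : Matrix (Fin 4) (Fin 4) R, IsUnit N.det ∧ (∀ i, N i 3 = if i = 3 then 1 else 0) ∧
      N.mulVec ℓ = ![1, 0, 0, 0] := by
  obtain ⟨j', hj'⟩ : ∃ j' : Fin 3, ![ℓ 0, ℓ 1, ℓ 2] j' = ℓ j := by
    fin_cases j
    · exact ⟨0, rfl⟩
    · exact ⟨1, rfl⟩
    · exact ⟨2, rfl⟩
    · exact absurd rfl hj
  obtain ⟨M, hM, hMℓ⟩ := exists_mulVec_eq_single (q := ![ℓ 0, ℓ 1, ℓ 2]) (i := j')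
    (by rwa [hj']) 0
  have h0 := congrFun hMℓ 0
  have h1 := congrFun hMℓ 1
  have h2 := congrFun hMℓ 2
  simp [Matrix.mulVec, dotProduct, Fin.sum_univ_three] at h0 h1 h2
  -- M moves the linear part of ℓ to x₁, and the multiple -ℓ₃ of its first row in the last row
  -- removes the constant term. The last column keeps the change of coordinates affine.
  refine ⟨!![M 0 0, M 0 1, M 0 2, 0; M 1 0, M 1 1, M 1 2, 0; M 2 0, M 2 1, M 2 2, 0;
    -ℓ 3 * M 0 0, -ℓ 3 * M 0 1, -ℓ 3 * M 0 2, 1], ?_, ?_, ?_⟩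
  · convert hM using 1
    rw [Matrix.det_fin_three]
    simp [Matrix.det_succ_row_zero, Fin.sum_univ_succ, Fin.succAbove]
    ring
  · intro i
    fin_cases i <;> simp
  · ext i
    fin_cases i <;> simp [Matrix.mulVec, dotProduct, Fin.sum_univ_four]
    · exact h0
    · exact h1
    · exact h2
    · linear_combination -ℓ 3 * h0

theorem exists_calls_normalise (hπ : Irreducible π) {Φ : QuadricPair R} (hΦ : Φ.disc ≠ 0) :
    ∃ calls, isLocallySoluble π (.normalise Φ) calls := by
  obtain ⟨A, Ψ, hA, hΨ, hi⟩ := exists_indep hπ hΦ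
  by_cases hf : Ψ.HasCommonFactor
  · have hf' := hf
    obtain ⟨ℓ, ⟨j, hj, hℓj⟩, hℓ⟩ := hf
    obtain ⟨m, hm⟩ := exists_lift ℓ
    have hu : IsUnit (m j) := isUnit_of_residue_eq_mul hπ one_ne_zero hℓj (by rw [hm j, one_mul])
    obtain ⟨N, hN, hN3, hNm⟩ := exists_affine_mulVec hj hu
    have hX : ∀ i, (X 0 : MvPolynomial (Fin 4) (IsLocalRing.ResidueField R)) ∣
        ((Ψ.subst N).Q i).form X := by
      intro i
      have h1 := map_dvd (aeval (linSubst (N.map (algebraMap R (IsLocalRing.ResidueField R))))) (hℓ i)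
      rw [linForm_linSubst, ← Quadric.form_X_subst] at h1
      have h2 : (N.map (algebraMap R (IsLocalRing.ResidueField R))).mulVec ℓ = ![1, 0, 0, 0] := by
        have h3 := fun i => congrArg (algebraMap R (IsLocalRing.ResidueField R)) (congrFun hNm i)
        ext i
        have := h3 i
        simp only [Matrix.mulVec, dotProduct, map_sum, map_mul, hm _] at this ⊢
        rw [Matrix.map] at *
        refine this.trans ?_
        fin_cases i <;> simp
      rw [h2] at h1
      rw [subst_Q]
      simpa [linForm, Fin.sum_univ_four] using h1
    have hdvd : ∀ i (x : Fin 4 → R), π ∣ (((Ψ.subst N).subst (Matrix.diagonal ![π, 1, 1, 1])).Q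
        i).form x := by
      intro i x
      rw [subst_Q, Quadric.form_subst_diagonal, ← residue_eq_zero_iff hπ,
        ← Quadric.form_algebraMap]
      obtain ⟨c, hc⟩ := hX i
      have := ((Ψ.subst N).Q i).map_form ((aeval fun j => algebraMap R (IsLocalRing.ResidueField R)
        (![π, 1, 1, 1] j • x j) : MvPolynomial (Fin 4) _ →ₐ[IsLocalRing.ResidueField R]
        _).restrictScalars R) X
      rw [hc, map_mul] at this
      simp only [AlgHom.restrictScalars_apply, aeval_X, Matrix.cons_val_zero, smul_eq_mul, map_mul,
        (residue_eq_zero_iff hπ).2 (dvd_refl π), zero_mul] at this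
      rw [this]
      simp only [smul_eq_mul, map_mul]
    choose Q hQ using fun i => Quadric.exists_eq_smul (hdvd i)
    refine ⟨_, A, Ψ, hA, isTransform_one_right.2 hΨ, (linearIndependent_iff_indep hπ).2 hi,
      .inr ⟨hf', N, Ψ.subst N, ⟨Q⟩, hN, hN3, isTransform_one_left.2 rfl, hX, fun i => ?_, rfl⟩⟩
    rw [Quadric.form_scale_one, Quadric.C_mul_form_eq_iff, ← hQ]
    exact (subst_Q _ _ _).symm
  · exact ⟨_, A, Ψ, hA, isTransform_one_right.2 hΨ, (linearIndependent_iff_indep hπ).2 hi,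
      .inl ⟨hf, rfl⟩⟩

theorem halts_isLocallySoluble [Finite (IsLocalRing.ResidueField R)] (hπ : Irreducible π)
    {Φ : QuadricPair R} (hΦ : Φ.disc ≠ 0) : Halts (isLocallySoluble π) (.normalise Φ) := by
  have hne : ∀ {x y : R}, x ≠ 0 → y ∣ x → y ≠ 0 := fun hx h h0 => hx (zero_dvd_iff.1 (h0 ▸ h))
  refine halts_of_level (fun Φ => natVal Φ.disc) (fun Φ => Φ.disc ≠ 0)
    (fun Φ hΦ => ⟨exists_calls_normalise hπ hΦ, exists_calls_search π Φ⟩) ?_ ?_ ?_ ?_ ?_ ?_ hΦ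
  · intro Φ Ψ hΦ h
    have := disc_of_calls_normalise_normalise hπ h
    exact ⟨hne hΦ ((dvd_mul_left _ _).trans this), natVal_lt_of_dvd hπ hΦ this⟩
  · exact fun Φ Ψ hΦ h => hne hΦ (disc_of_calls_normalise_search hπ h)
  · intro Φ Ψ hΦ h
    obtain ⟨p, -, u, -, h⟩ := calls_search h
    rw [Stage.normalise.inj h, disc_subst, disc_subst, det_translation, det_diagonal_three]
    exact mul_ne_zero (pow_ne_zero _ (pow_ne_zero _ hπ.ne_zero))
      (mul_ne_zero (pow_ne_zero _ one_ne_zero) hΦ)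
  · intro Φ Ψ hΦ h
    obtain ⟨p, -, u, -, h⟩ := calls_search h
    exact absurd h (by simp)
  · exact fun Φ Ψ hΦ h => natVal_le_of_dvd hΦ (disc_dvd_of_iteration hπ h)
  · intro m Ψ h0 h hv
    have hi : ∀ i ≤ m, (Ψ i).disc ≠ 0 := by
      intro i
      induction i with
      | zero => exact fun _ => h0
      | succ i ih => exact fun hi => hne (ih (by omega)) (disc_dvd_of_iteration hπ (h i (by omega)))
    have := two_mul_le_of_iterations hπ m Ψ h fun i hm => by
      rw [← coe_natVal (hi i hm), ← coe_natVal h0, hv i hm]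
    rw [← coe_natVal h0] at this
    exact_mod_cast this

end QuadricPair

end GenusOne

/-! ### Degree 4: recursive calls for Tamagawa distances, and planes that contain conics. -/

namespace GenusOne

namespace Quadric

variable {R : Type*} [CommRing R]

theorem dvd_form_sub_form (q : Quadric R) {s : R} {x : Fin 4 → R} (h : s ∣ x 0) :
    s ∣ q.form x - q.form ![0, x 1, x 2, x 3] := by
  obtain ⟨a, ha⟩ := h
  simp only [form, smul_eq_mul, Matrix.cons_val, ha]
  exact ⟨q.c11 * s * a ^ 2 + q.c12 * (a * x 1) + q.c13 * (a * x 2) + q.c14 * (a * x 3), by ring⟩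

/-- The substitution `x₁ ← x₁ + α₀ x₂ + α₁ x₃ + α₂ x₄`. -/
def shear (α : Fin 3 → R) : Matrix (Fin 4) (Fin 4) R :=
  !![1, 0, 0, 0; α 0, 1, 0, 0; α 1, 0, 1, 0; α 2, 0, 0, 1]

theorem det_shear (α : Fin 3 → R) : (shear α).det = 1 := by
  simp [shear, Matrix.det_succ_row_zero, Fin.sum_univ_succ, Fin.succAbove]

theorem vecMul_shear (α : Fin 3 → R) (x : Fin 4 → R) : Matrix.vecMul x (shear α) =
    ![x 0 + α 0 * x 1 + α 1 * x 2 + α 2 * x 3, x 1, x 2, x 3] := by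
  rw [vecMul_four]
  ext j
  fin_cases j <;> simp [shear]

theorem form_shear (a : Fin 3 → R) (q : Quadric R) :
    q.form (![X 0 - C (a 0) * X 1 - C (a 1) * X 2 - C (a 2) * X 3, X 1, X 2, X 3] :
      Fin 4 → MvPolynomial (Fin 4) R) = (q.subst (shear (-a))).form X := by
  rw [form_subst]
  congr 1
  ext j : 1
  fin_cases j <;> simp [smul_eq_C_mul, shear, sub_eq_add_neg]

variable [IsDomain R] [IsDiscreteValuationRing R] {π : R}

theorem form_zero_eq_zero_of_dvd (hπ : Irreducible π) {q : Quadric R}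
    (h : ∀ x : Fin 4 → R, π ∣ x 0 → π ∣ q.form x) {A : Type*} [CommRing A] [Algebra R A]
    [Algebra (IsLocalRing.ResidueField R) A] [IsScalarTower R (IsLocalRing.ResidueField R) A]
    (x : Fin 3 → A) : q.form ![0, x 0, x 1, x 2] = 0 := by
  have := form_eq_zero_of_dvd hπ (q := q.subst (Matrix.diagonal ![0, 1, 1, 1]))
    (fun x => by
      rw [form_subst_diagonal]
      exact h _ (by simp)) ![0, x 0, x 1, x 2]
  rw [form_subst_diagonal] at this
  refine Eq.trans ?_ this
  congr 1
  ext j : 1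
  fin_cases j <;> simp

end Quadric

namespace QuadricPair

variable {R : Type*} [CommRing R] [IsDomain R] [IsDiscreteValuationRing R] {π : R}

theorem calls_distances {Φ : QuadricPair R} {affine : Bool} {t : Task R}
    (h : Calls (tamagawaDistances π) (.distances Φ affine) t) :
    (∃ W ∈ Φ.lineComponents affine, ∃ N : Matrix (Fin 4) (Fin 4) R, IsUnit N.det ∧
      (fun j => algebraMap R _ (N 2 j)) ∈ W ∧ (fun j => algebraMap R _ (N 3 j)) ∈ W ∧
      t = .line (Φ.subst N)) ∨
    (∃ ℓ ∈ Φ.conicComponents affine, ∃ N : Matrix (Fin 4) (Fin 4) R, IsUnit N.det ∧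
      (∀ i, i ≠ 0 → ∑ j, algebraMap R _ (N i j) * ℓ j = 0) ∧ t = .conic (Φ.subst N)) ∨
    ∃ p ∈ Φ.nonRegular π affine, ∃ (M : Matrix (Fin 2) (Fin 2) R) (N : Matrix (Fin 4) (Fin 4) R)
      (Φ₁ : QuadricPair R) (c : IsLocalRing.ResidueField R), IsUnit M.det ∧ IsUnit N.det ∧
      (∀ j, algebraMap R _ (N 3 j) = c * p j) ∧
      ((Φ.comb M).subst N).subst (Matrix.diagonal ![π, π, π, 1]) =
        Φ₁.comb (π • Matrix.diagonal ![π, 1]) ∧ t = .distances Φ₁ true := by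
  obtain ⟨calls, ⟨c₁, c₂, c₃, rfl, h1, h2, h3⟩, ht⟩ := h
  rw [List.mem_append, List.mem_append] at ht
  rcases ht with (ht | ht) | ht
  · obtain ⟨W, hW, N, Φ', hN, hΦ', h4, h5, rfl⟩ := h1.exists_of_mem ht
    rw [isTransform_one_left] at hΦ'
    exact .inl ⟨W, hW, N, hN, h4, h5, by rw [hΦ']⟩
  · obtain ⟨ℓ, hℓ, N, Φ', hN, hΦ', h4, rfl⟩ := h2.exists_of_mem ht
    rw [isTransform_one_left] at hΦ'
    exact .inr (.inl ⟨ℓ, hℓ, N, hN, h4, by rw [hΦ']⟩)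
  · obtain ⟨p, hp, M, N, Φ', Φ₁, c, hM, hN, hΦ', h4, -, -, h5, h6, rfl⟩ := h3.exists_of_mem ht
    rw [isTransform_iff] at hΦ'
    refine .inr (.inr ⟨p, hp, M, N, Φ₁, c, hM, hN, h4, ?_, rfl⟩)
    rw [Quadric.form_scale_three, Quadric.C_mul_form_eq_iff] at h5 h6
    rw [← hΦ']
    apply ext_of_val
    intro x
    have hv := val_comb (π • Matrix.diagonal ![π, 1]) Φ₁ x
    rw [hv, Matrix.smul_mulVec]
    ext i
    rw [Pi.smul_apply, Matrix.mulVec_diagonal, val, subst_Q]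
    fin_cases i
    · change (Quadric.subst _ (Φ'.Q 0)).form x = π • (π * (Φ₁.Q 0).form x)
      rw [h5, Quadric.form_smul, smul_eq_mul, smul_eq_mul]
      ring
    · change (Quadric.subst _ (Φ'.Q 1)).form x = π • (1 * (Φ₁.Q 1).form x)
      rw [h6, Quadric.form_smul, one_mul]

/-- The divisions by π² and π amount to the matrix π diag(π, 1), to which `SingMod.of_diagonal`
applies. The x₄-coordinate remains a unit because the point lies in the affine piece. -/
theorem singMod_of_distances (hπ : Irreducible π) {Φ Φ₁ : QuadricPair R}
    {p : Fin 4 → IsLocalRing.ResidueField R} (hp : p 3 ≠ 0) {M : Matrix (Fin 2) (Fin 2) R}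
    {N : Matrix (Fin 4) (Fin 4) R} {c : IsLocalRing.ResidueField R} (hM : IsUnit M.det)
    (hN : IsUnit N.det) (hNp : ∀ j, algebraMap R _ (N 3 j) = c * p j)
    (h : ((Φ.comb M).subst N).subst (Matrix.diagonal ![π, π, π, 1]) =
        Φ₁.comb (π • Matrix.diagonal ![π, 1])) {m : ℕ}
    (hΦ₁ : ∃ q, IsUnit (q 3) ∧ SingMod π m Φ₁ q) :
    ∃ q, IsUnit (q 3) ∧ SingMod π (m + 1) Φ q := by
  obtain ⟨q, hq, hs⟩ := hΦ₁
  refine ⟨_, ?_, ((hs.of_diagonal hπ.ne_zero (by simp [Matrix.det_fin_two]) h).of_subst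
    hN).of_comb hM⟩
  have hu := isUnit_of_residue_eq_mul hπ (row_scalar_ne_zero hN hNp) hp (hNp 3)
  rw [Quadric.vecMul_four]
  simp only [Matrix.vecMul_diagonal, Matrix.cons_val, mul_one]
  rw [← not_dvd_iff_isUnit hπ, dvd_add_right ⟨N 0 3 * q 0 + N 1 3 * q 1 + N 2 3 * q 2, by ring⟩,
    not_dvd_iff_isUnit hπ]
  exact hu.mul hq

theorem disc_of_distances [CharZero R] (hπ : Irreducible π) {Φ Φ₁ : QuadricPair R}
    {M : Matrix (Fin 2) (Fin 2) R} {N : Matrix (Fin 4) (Fin 4) R} (hM : IsUnit M.det)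
    (hN : IsUnit N.det) (h : ((Φ.comb M).subst N).subst (Matrix.diagonal ![π, π, π, 1]) =
        Φ₁.comb (π • Matrix.diagonal ![π, 1])) (hΦ : Φ.disc ≠ 0) : Φ₁.disc ≠ 0 := by
  intro h0
  have := congrArg disc h
  rw [disc_subst, disc_subst, disc_comb, disc_comb, h0, mul_zero, det_diagonal_three] at this
  exact mul_ne_zero (pow_ne_zero _ (pow_ne_zero _ hπ.ne_zero))
    (mul_ne_zero (pow_ne_zero _ hN.ne_zero) (mul_ne_zero (pow_ne_zero _ hM.ne_zero) hΦ)) this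

/-- A lift of the point becomes the last row of N, and the combination of the equations that is
singular at it becomes the first row of M. -/
theorem exists_distances_call (hπ : Irreducible π) {Φ : QuadricPair R} {affine : Bool}
    {p : Fin 4 → IsLocalRing.ResidueField R} (hp : p ∈ Φ.nonRegular π affine) :
    ∃ (t : Task R) (M : Matrix (Fin 2) (Fin 2) R) (N : Matrix (Fin 4) (Fin 4) R)
      (Φ' Φ₁ : QuadricPair R) (c : IsLocalRing.ResidueField R),
      IsUnit M.det ∧ IsUnit N.det ∧ IsTransform M N Φ Φ' ∧
      (∀ j, algebraMap R _ (N 3 j) = c * p j) ∧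
      grad ((Φ'.Q 0).form (X : Fin 4 → MvPolynomial (Fin 4) (IsLocalRing.ResidueField R)))
        ![0, 0, 0, 1] = 0 ∧
      π ^ 2 ∣ (Φ'.Q 0).form (![0, 0, 0, 1] : Fin 4 → R) ∧
      C (π ^ 2) * (Φ₁.Q 0).form (X : Fin 4 → MvPolynomial (Fin 4) R)
        = (Φ'.Q 0).form ![C π * X 0, C π * X 1, C π * X 2, X 3] ∧
      C π * (Φ₁.Q 1).form (X : Fin 4 → MvPolynomial (Fin 4) R)
        = (Φ'.Q 1).form ![C π * X 0, C π * X 1, C π * X 2, X 3] ∧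
      t = .distances Φ₁ true := by
  obtain ⟨q, hq⟩ := exists_lift p
  obtain ⟨i, hi, -⟩ := hp.1
  have hu : IsUnit (q i) := isUnit_of_residue_eq_mul hπ one_ne_zero one_ne_zero
    (by rw [hq i, hi, one_mul])
  obtain ⟨N, hN, rfl⟩ := exists_isUnit_det_row hu 3
  obtain ⟨hv, c, hc, hf, hg⟩ := nonRegular_lift hπ hp hq
  push Not at hc
  obtain ⟨j, hj⟩ := hc
  rw [not_dvd_iff_isUnit hπ] at hj
  obtain ⟨M, hM, rfl⟩ := exists_isUnit_det_row hj 0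
  have e3 : ∀ r : Quadric R, (r.subst N).form ![0, 0, 0, 1] = r.form (N 3) := by
    intro r
    rw [Quadric.form_subst_eq, Quadric.vecMul_four]
    simp
  have e0 : ((Φ.comb M).subst N).Q 0 =
      (Quadric.lin (M 0 0) (M 0 1) (Φ.Q 0) (Φ.Q 1)).subst N := by rw [subst_Q, comb_Q]
  have hg' : ∀ v, π ∣ (Quadric.lin (M 0 0) (M 0 1) (Φ.Q 0) (Φ.Q 1)).polar v (N 3) := fun v => by
    rw [Quadric.polar_comm]; exact hg v
  obtain ⟨r₀, h0⟩ := Quadric.exists_eq_smul (Quadric.sq_dvd_form_subst (s := π)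
    (q := ((Φ.comb M).subst N).Q 0) (e0 ▸ hf) (e0 ▸ hg' (N 0)) (e0 ▸ hg' (N 1)) (e0 ▸ hg' (N 2)))
  obtain ⟨r₁, h1⟩ := Quadric.exists_eq_smul (Quadric.dvd_form_subst (s := π)
    (q := ((Φ.comb M).subst N).Q 1) (by
      rw [subst_Q, comb_Q]
      change π ∣ (Quadric.lin (M 1 0) (M 1 1) (Φ.Q 0) (Φ.Q 1)).form (N 3)
      rw [form_lin_eq]
      exact Finset.dvd_sum fun i _ => (hv i).mul_left _))
  refine ⟨_, M, N, (Φ.comb M).subst N, ⟨![r₀, r₁]⟩, 1, hM, hN, isTransform_iff.2 rfl,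
    fun j => by rw [one_mul, hq j], ?_, ?_, ?_, ?_, rfl⟩
  · rw [Quadric.form_X_eq_map]
    ext k
    have e : (![0, 0, 0, 1] : Fin 4 → IsLocalRing.ResidueField R) =
        fun j => algebraMap R _ ((![0, 0, 0, 1] : Fin 4 → R) j) := by
      ext j
      fin_cases j <;> simp
    have e2 : Matrix.vecMul ![0, 0, 0, 1] N = N 3 := by
      rw [Quadric.vecMul_four]; simp
    rw [e, grad_map, Pi.zero_apply, residue_eq_zero_iff hπ, e0, Quadric.grad_subst, e2]
    have := hg (N k)
    rwa [Quadric.polar_eq] at this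
  · rw [e0, e3]
    exact hf
  · rw [Quadric.form_scale_three, Quadric.C_mul_form_eq_iff, h0]
    rfl
  · rw [Quadric.form_scale_three, Quadric.C_mul_form_eq_iff, h1]
    rfl

/-- In the plane `x₁ = 0`, the reductions of the two equations are linearly dependent. -/
def DependentOnPlane (π : R) (Φ : QuadricPair R) : Prop :=
  ∃ c : Fin 2 → R, (¬ ∀ i, π ∣ c i) ∧ ∀ x : Fin 4 → R, π ∣ x 0 → π ∣ c ⬝ᵥ Φ.val x

theorem dvd_form_iff (hπ : Irreducible π) (q : Quadric R) (x : Fin 4 → R) :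
    π ∣ q.form x ↔ q.form (fun i => algebraMap R (IsLocalRing.ResidueField R) (x i)) = 0 := by
  rw [Quadric.form_algebraMap, residue_eq_zero_iff hπ]

theorem DependentOnPlane.of_residue (hπ : Irreducible π) {Φ : QuadricPair R}
    {c : Fin 2 → IsLocalRing.ResidueField R} (hc : c ≠ 0)
    (h : ∑ i, C (c i) * Φ.conicPart i
      (X : Fin 3 → MvPolynomial (Fin 3) (IsLocalRing.ResidueField R)) = 0) :
    DependentOnPlane π Φ := by
  obtain ⟨d, hd⟩ := exists_lift c
  refine ⟨d, fun h0 => hc (funext fun i => ?_), fun x hx => ?_⟩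
  · rw [← hd i, (residue_eq_zero_iff hπ).2 (h0 i)]
    rfl
  · rw [← form_lin_eq, dvd_form_iff hπ, Quadric.form_lin]
    have h1 := congrArg (aeval fun i : Fin 3 => algebraMap R (IsLocalRing.ResidueField R)
      (x i.succ)) h
    have h2 : ∀ i, aeval (fun i : Fin 3 => algebraMap R (IsLocalRing.ResidueField R)
        (x i.succ)) (Φ.conicPart i
          (X : Fin 3 → MvPolynomial (Fin 3) (IsLocalRing.ResidueField R))) =
        (Φ.Q i).form (fun i => algebraMap R (IsLocalRing.ResidueField R) (x i)) := by
      intro i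
      have := (Φ.Q i).map_form ((aeval fun i : Fin 3 => algebraMap R (IsLocalRing.ResidueField R)
        (x i.succ) : MvPolynomial (Fin 3) _ →ₐ[IsLocalRing.ResidueField R]
        IsLocalRing.ResidueField R).restrictScalars R) ![0, X 0, X 1, X 2]
      refine this.trans ?_
      congr 1
      ext j : 1
      fin_cases j
      · simpa using ((residue_eq_zero_iff hπ).2 hx).symm
      all_goals simp
    simp only [map_sum, map_add, map_mul, h2, map_zero, algHom_C, Fin.sum_univ_two, Algebra.algebraMap_self,
      RingHom.id_apply, ← hd _] at h1
    simpa only [Algebra.smul_def] using h1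

/-- The plane may be moved to x₁ = 0 by other coordinates than those in which the conic was found;
the two systems differ by a transformation that preserves this plane modulo π. -/
theorem DependentOnPlane.of_subst (hπ : Irreducible π) {Φ : QuadricPair R}
    {N N₀ : Matrix (Fin 4) (Fin 4) R} (hN₀ : IsUnit N₀.det) {ℓ : Fin 4 → IsLocalRing.ResidueField R}
    (hℓ : ℓ ≠ 0) (h₀ : ∀ i, i ≠ 0 → ∑ j, algebraMap R _ (N₀ i j) * ℓ j = 0)
    (h : ∀ i, i ≠ 0 → ∑ j, algebraMap R _ (N i j) * ℓ j = 0)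
    (hΦ : DependentOnPlane π (Φ.subst N₀)) : DependentOnPlane π (Φ.subst N) := by
  obtain ⟨m, hm⟩ := exists_lift ℓ
  have key : ∀ N : Matrix (Fin 4) (Fin 4) R,
      (∀ i, i ≠ 0 → ∑ j, algebraMap R (IsLocalRing.ResidueField R) (N i j) * ℓ j = 0) →
      ∀ i, i ≠ 0 → π ∣ N.mulVec m i := by
    intro N h i hi
    rw [← residue_eq_zero_iff hπ, ← h i hi]
    simp only [Matrix.mulVec, dotProduct, map_sum, map_mul, hm _]
  have h0 : ¬ π ∣ N₀.mulVec m 0 := by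
    intro h0
    refine hℓ (funext fun j => ?_)
    rw [← hm j, Pi.zero_apply, residue_eq_zero_iff hπ]
    refine dvd_of_dvd_mulVec hN₀ (fun i => ?_) j
    by_cases hi : i = 0
    · rwa [hi]
    · exact key N₀ h₀ i hi
  -- Modulo π the vectors N ℓ and N₀ ℓ are multiples of the first basis vector, the second one by a
  -- unit, so the first column of the quotient is zero below its top entry.
  have hT : ∀ i, i ≠ 0 → π ∣ (N * N₀⁻¹) i 0 := by
    intro i hi
    have e : N.mulVec m i = ∑ j, (N * N₀⁻¹) i j * N₀.mulVec m j := by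
      have : N.mulVec m = (N * N₀⁻¹).mulVec (N₀.mulVec m) := by
        rw [Matrix.mulVec_mulVec, Matrix.mul_assoc, Matrix.nonsing_inv_mul _ hN₀, Matrix.mul_one]
      rw [this]; rfl
    have h1 := key N h i hi
    rw [e, Fin.sum_univ_four, add_assoc, add_assoc, dvd_add_left] at h1
    · exact (hπ.prime.dvd_or_dvd h1).resolve_right h0
    · exact dvd_add ((key N₀ h₀ 1 (by decide)).mul_left _)
        (dvd_add ((key N₀ h₀ 2 (by decide)).mul_left _) ((key N₀ h₀ 3 (by decide)).mul_left _))
  obtain ⟨c, hc, h2⟩ := hΦ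
  refine ⟨c, hc, fun x hx => ?_⟩
  have e : Φ.subst N = (Φ.subst N₀).subst (N * N₀⁻¹) := by
    rw [subst_subst, Matrix.mul_assoc, Matrix.nonsing_inv_mul _ hN₀, Matrix.mul_one]
  rw [e, val_subst]
  refine h2 _ ?_
  rw [Quadric.vecMul_four]
  exact dvd_add (dvd_add (dvd_add (hx.mul_left _) ((hT 1 (by decide)).mul_right _))
    ((hT 2 (by decide)).mul_right _)) ((hT 3 (by decide)).mul_right _)

theorem isHomogeneous_conicPart (Φ : QuadricPair R) (i : Fin 2) (F : Type*) [CommRing F]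
    [Algebra R F] : (Φ.conicPart i (X : Fin 3 → MvPolynomial (Fin 3) F)).IsHomogeneous 2 := by
  have h : ∀ (r : R) (a b : Fin 3),
      (r • (X a * X b : MvPolynomial (Fin 3) F)).IsHomogeneous 2 := by
    intro r a b
    rw [Algebra.smul_def, IsScalarTower.algebraMap_apply R F (MvPolynomial (Fin 3) F),
      algebraMap_eq]
    exact ((isHomogeneous_X F a).mul (isHomogeneous_X F b)).C_mul _
  simp only [conicPart, Quadric.form, Matrix.cons_val, zero_mul, smul_zero, ne_eq,
    OfNat.ofNat_ne_zero, not_false_eq_true, zero_pow, zero_add, pow_two]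
  exact ((((((h _ _ _).add (h _ _ _)).add (h _ _ _)).add (h _ _ _)).add (h _ _ _)).add (h _ _ _))

/-- For reasons of degree the restrictions of both equations to the plane are constant multiples of
the equation of the conic. -/
theorem dependentOnPlane_of_hasConic (hπ : Irreducible π) {Φ : QuadricPair R} (h : Φ.HasConic) :
    DependentOnPlane π Φ := by
  obtain ⟨q, hq, hirr, hdvd, -⟩ := h
  have hq0 : q ≠ 0 := by
    rintro rfl
    exact hirr.ne_zero (map_zero _)
  have hconst : ∀ i, ∃ a : IsLocalRing.ResidueField R,
      Φ.conicPart i (X : Fin 3 → MvPolynomial (Fin 3) (IsLocalRing.ResidueField R)) = C a * q := by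
    intro i
    obtain ⟨r, hr⟩ := hdvd i
    by_cases hr0 : r = 0
    · exact ⟨0, by rw [hr, hr0]; simp⟩
    · have h1 := totalDegree_mul_of_isDomain hq0 hr0
      rw [← hr, (isHomogeneous_conicPart Φ i _).totalDegree (by
        rw [hr]; exact mul_ne_zero hq0 hr0), hq.totalDegree hq0] at h1
      have h2 : r.totalDegree = 0 := by omega
      rw [totalDegree_eq_zero_iff_eq_C] at h2
      exact ⟨_, by rw [hr, mul_comm, h2]⟩
  choose a ha using hconst
  by_cases h0 : a = 0
  · refine .of_residue hπ (c := 1) one_ne_zero ?_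
    simp [ha, h0]
  · refine .of_residue hπ (c := ![a 1, -a 0]) (fun h => h0 ?_) ?_
    · ext i
      fin_cases i
      · simpa using congrFun h 1
      · simpa using congrFun h 0
    · simp only [ha, Fin.sum_univ_two, Matrix.cons_val_zero, Matrix.cons_val_one, map_neg]
      ring

end QuadricPair

end GenusOne

/-! ### Degree 4: the conic subalgorithm. -/

namespace GenusOne

theorem Quadric.smul_one {R : Type*} [CommRing R] (q : Quadric R) : q.smul 1 = q := by
  cases q; simp [Quadric.smul]

namespace QuadricPair

variable {R : Type*} [CommRing R]

theorem comb_diagonal_iff {Φ Ψ : QuadricPair R} {s t : R} : Φ = Ψ.comb (Matrix.diagonal ![s, t]) ↔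
    Φ.Q 0 = (Ψ.Q 0).smul s ∧ Φ.Q 1 = (Ψ.Q 1).smul t := by
  have h0 : (Ψ.comb (Matrix.diagonal ![s, t])).Q 0 = (Ψ.Q 0).smul s := by
    apply Quadric.ext_of_form
    intro x
    rw [form_comb, Quadric.form_smul]
    simp
  have h1 : (Ψ.comb (Matrix.diagonal ![s, t])).Q 1 = (Ψ.Q 1).smul t := by
    apply Quadric.ext_of_form
    intro x
    rw [form_comb, Quadric.form_smul]
    simp
  constructor
  · rintro rfl
    exact ⟨h0, h1⟩
  · rintro ⟨e0, e1⟩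
    apply ext_of_val
    intro x
    ext i
    fin_cases i
    · change (Φ.Q 0).form x = _
      rw [e0, ← h0]; rfl
    · change (Φ.Q 1).form x = _
      rw [e1, ← h1]; rfl

/-- After the substitution `x₁ = α₀ x₂ + α₁ x₃ + α₂ x₄`, the pair is given by a matrix whose
determinant is divisible by `π ^ m`. -/
def ConicMod (π : R) (m : ℕ) (Φ : QuadricPair R) : Prop :=
  ∃ (α : Fin 3 → R) (B : Matrix (Fin 2) (Fin 2) R), π ^ m ∣ B.det ∧
    ∀ x : Fin 4 → R, x 0 = 0 → ∃ w, (Φ.subst (Quadric.shear α)).val x = B.mulVec w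

theorem conicMod_zero (π : R) (Φ : QuadricPair R) : ConicMod π 0 Φ :=
  ⟨0, 1, by simp, fun _ _ => ⟨_, (Matrix.one_mulVec _).symm⟩⟩

/-- Undoing Steps (iii) and (ii) replaces α by π (α + a) and multiplies B on the left by M⁻¹ diag(π,
1), whose determinant supplies the additional factor π. -/
theorem ConicMod.step {π : R} {m : ℕ} {Φ Ψ : QuadricPair R} {M : Matrix (Fin 2) (Fin 2) R}
    (hM : IsUnit M.det) (h : (Φ.comb M).subst (Matrix.diagonal ![π, 1, 1, 1]) =
      Ψ.comb (Matrix.diagonal ![π, 1])) {a : Fin 3 → R}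
    (hΨ : ConicMod π m (Ψ.subst (Quadric.shear a))) : ConicMod π (m + 1) Φ := by
  obtain ⟨α, B, hB, hw⟩ := hΨ
  refine ⟨fun i => π * (α i + a i), M⁻¹ * (Matrix.diagonal ![π, 1] * B), ?_, fun x hx => ?_⟩
  · rw [Matrix.det_mul, Matrix.det_mul, Matrix.det_diagonal, Fin.prod_univ_two, pow_succ']
    exact (mul_dvd_mul (by simp) hB).mul_left _
  · obtain ⟨w, hw⟩ := hw x hx
    refine ⟨w, ?_⟩
    have h1 : Matrix.vecMul x (Quadric.shear fun i => π * (α i + a i)) =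
        Matrix.vecMul (Matrix.vecMul (Matrix.vecMul x (Quadric.shear α)) (Quadric.shear a))
          (Matrix.diagonal ![π, 1, 1, 1]) := by
      simp only [Quadric.vecMul_shear, hx]
      ext j
      rw [Matrix.vecMul_diagonal]
      fin_cases j <;> simp
      ring
    have h2 := congrArg (fun Θ => Θ.val
      (Matrix.vecMul (Matrix.vecMul x (Quadric.shear α)) (Quadric.shear a))) h
    rw [val_subst, val_subst] at hw
    rw [val_subst, val_comb, val_comb, hw, ← h1] at h2
    rw [val_subst, ← Matrix.mulVec_mulVec, ← Matrix.mulVec_mulVec, ← h2, Matrix.mulVec_mulVec,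
      Matrix.nonsing_inv_mul _ hM, Matrix.one_mulVec]

/-- With r = π^k, both equations become divisible by r when Q₁ is multiplied by r and x₁ by r.
Comparing the doublings gives r ∣ n, r ∣ d and r² ∣ e. -/
theorem pow_dvd_disc_of_plane [IsDomain R] [CharZero R] {π : R} {k : ℕ} (hπ : π ≠ 0)
    {Φ : QuadricPair R} (h : ∀ x : Fin 4 → R, x 0 = 0 → π ^ k ∣ (Φ.Q 1).form x) :
    π ^ (2 * k) ∣ Φ.disc := by
  set r := π ^ k with hr
  have hr0 : r ≠ 0 := pow_ne_zero k hπ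
  have hdvd : ∀ i (x : Fin 4 → R), r ∣ (((Φ.comb (Matrix.diagonal ![r, 1])).subst
      (Matrix.diagonal ![r, 1, 1, 1])).Q i).form x := by
    obtain ⟨e0, e1⟩ := comb_diagonal_iff.1 (Eq.refl (Φ.comb (Matrix.diagonal ![r, 1])))
    intro i x
    rw [subst_Q, Quadric.form_subst_diagonal]
    fin_cases i
    · change r ∣ ((Φ.comb (Matrix.diagonal ![r, 1])).Q 0).form _
      rw [e0, Quadric.form_smul]
      exact dvd_mul_right _ _
    · change r ∣ ((Φ.comb (Matrix.diagonal ![r, 1])).Q 1).form _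
      rw [e1, Quadric.form_smul, one_smul]
      have h1 := (Φ.Q 1).dvd_form_sub_form (s := r)
        (x := fun i => (![r, 1, 1, 1] : Fin 4 → R) i • x i) (by simp)
      exact (dvd_iff_dvd_of_dvd_sub h1).2 (h _ rfl)
  choose Q hQ using fun i => Quadric.exists_eq_smul (hdvd i)
  have e : (Φ.comb (Matrix.diagonal ![r, 1])).subst (Matrix.diagonal ![r, 1, 1, 1]) =
      (QuadricPair.mk Q).comb (Matrix.diagonal ![r, r]) :=
    comb_diagonal_iff.2 ⟨hQ 0, hQ 1⟩
  have e := congrArg doubling e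
  rw [doubling_subst_diagonal, doubling_comb, doubling_comb] at e
  generalize (QuadricPair.mk Q).doubling = Ψ at e
  have hn : r * Φ.doubling.n = r ^ 2 * Ψ.n := by
    have := congrArg Quartic.n e
    simp [Quartic.subst, Quartic.scale, Quartic.P] at this
    rw [this]; ring
  have hd : r ^ 2 * (Φ.doubling.d * r) = r ^ 4 * Ψ.d := by
    have := congrArg Quartic.d e
    simp [Quartic.subst, Quartic.scale, Quartic.P] at this
    rw [this]; ring
  have he : r ^ 2 * Φ.doubling.e = r ^ 4 * Ψ.e := by
    have := congrArg Quartic.e e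
    simp [Quartic.subst, Quartic.scale, Quartic.Q] at this
    rw [this]; ring
  refine Quartic.dvd_disc ?_ ?_ ?_
  · exact ⟨Ψ.n, mul_left_cancel₀ hr0 (by rw [hn, ← hr]; ring)⟩
  · exact ⟨Ψ.d, mul_left_cancel₀ (pow_ne_zero 3 hr0) (by rw [← hr]; linear_combination hd)⟩
  · exact ⟨Ψ.e, mul_left_cancel₀ (pow_ne_zero 2 hr0)
      (by rw [pow_mul', ← hr]; linear_combination he)⟩

variable [IsDomain R] [IsDiscreteValuationRing R] {π : R}

/-- Some primitive combination of the equations vanishes modulo π^(m-j) on the sheared plane, where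
2 j ≤ m. So 2 (m - j) ≥ m. -/
theorem pow_dvd_disc_of_conicMod [CharZero R] (hπ : Irreducible π) {m : ℕ} {Φ : QuadricPair R}
    (h : ConicMod π m Φ) : π ^ m ∣ Φ.disc := by
  obtain ⟨α, B, hB, hw⟩ := h
  obtain ⟨j, c, hj, ⟨i, hc⟩, -, h5⟩ := exists_isUnit_pow_dvd_vecMul hπ m B hB
  obtain ⟨M, hM, rfl⟩ := exists_isUnit_det_row hc 1
  have key := pow_dvd_disc_of_plane (k := m - j) (Φ := (Φ.subst (Quadric.shear α)).comb M)
    hπ.ne_zero (fun x hx => by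
      obtain ⟨w, hw⟩ := hw x hx
      have h1 := congrFun (val_comb M (Φ.subst (Quadric.shear α)) x) 1
      rw [hw, Matrix.mulVec_mulVec] at h1
      change π ^ (m - j) ∣ ((Φ.subst (Quadric.shear α)).comb M).val x 1
      rw [h1]
      exact (Finset.dvd_sum fun a _ => (h5 a).mul_right (w a) :
        π ^ (m - j) ∣ ∑ a, Matrix.vecMul (M 1) B a * w a))
  rw [disc_comb, disc_subst, Quadric.det_shear, one_pow, one_mul] at key
  exact (pow_dvd_pow π (by omega)).trans ((IsUnit.dvd_mul_left (hM.pow 12)).1 key)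

variable (π) in
/-- The condition of Step (iii) in the subalgorithm for conics. -/
def InIdeal (Ψ : QuadricPair R) (a : Fin 3 → R) (b : R) : Prop :=
  Ψ.conicPart 0 (X : Fin 3 → MvPolynomial (Fin 3) (IsLocalRing.ResidueField R))
    = (∑ j, a j • X j) * Ψ.linearPart 0 X + b • Ψ.conicPart 1 X

theorem InIdeal.dvd (hπ : Irreducible π) {Ψ : QuadricPair R} {a : Fin 3 → R} {b : R}
    (h : Ψ.InIdeal a b) (y : Fin 3 → R) :
    π ∣ Ψ.conicPart 0 y - ((∑ j, a j * y j) * Ψ.linearPart 0 y + b * Ψ.conicPart 1 y) := by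
  obtain ⟨φ, hφ⟩ : ∃ φ : MvPolynomial (Fin 3) (IsLocalRing.ResidueField R) →ₐ[R]
      IsLocalRing.ResidueField R, ∀ j, φ (X j) = algebraMap R _ (y j) :=
    ⟨(aeval fun j => algebraMap R (IsLocalRing.ResidueField R) (y j)).restrictScalars R, by simp⟩
  have h1 : ∀ i, φ (Ψ.conicPart i X) = algebraMap R _ (Ψ.conicPart i y) := by
    intro i
    rw [conicPart, conicPart, Quadric.map_form, ← Quadric.form_algebraMap]
    congr 1
    ext j : 1
    fin_cases j <;> simp [hφ]
  have h := congrArg φ h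
  rw [h1] at h
  rw [← residue_eq_zero_iff hπ, map_sub, sub_eq_zero, h]
  simp only [map_add, map_mul, map_smul, map_sum, h1, linearPart, hφ, Algebra.smul_def,
    AlgHom.commutes,
    Algebra.algebraMap_self, RingHom.id_apply]

/-- After Step (ii) the equations are ℓ₁x₁ + q₁ and q₂ modulo π. If q₁ is in the ideal of ℓ₁ and q₂,
then after the shear the combination Q₁ - b Q₂ reduces to ℓ₁x₁, so Step (ii) can be carried out
again. -/
theorem dependentOnPlane_step (hπ : Irreducible π) {Φ Ψ : QuadricPair R}
    (h : Φ.subst (Matrix.diagonal ![π, 1, 1, 1]) = Ψ.comb (Matrix.diagonal ![π, 1]))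
    {a : Fin 3 → R} {b : R} (hab : Ψ.InIdeal a b) :
    DependentOnPlane π (Ψ.subst (Quadric.shear (-a))) := by
  obtain ⟨e0, e1⟩ := comb_diagonal_iff.1 h
  rw [subst_Q, Quadric.subst_diagonal] at e0 e1
  simp only [Quadric.smul, Quadric.mk.injEq, Matrix.cons_val, one_mul, mul_one] at e0 e1
  have h11 : (Ψ.Q 0).c11 = π * (Φ.Q 0).c11 := mul_left_cancel₀ hπ.ne_zero (by rw [← e0.1]; ring)
  refine ⟨![1, -b], fun h0 => hπ.not_isUnit (isUnit_of_dvd_one (h0 0)), fun x hx => ?_⟩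
  have h1 := hab.dvd hπ ![x 1, x 2, x 3]
  rw [val_subst, Quadric.vecMul_shear]
  obtain ⟨x0, hx0⟩ := hx
  obtain ⟨d, hd⟩ := h1
  simp only [dotProduct, Fin.sum_univ_two, val, Matrix.cons_val_zero, Matrix.cons_val_one]
  simp only [conicPart, linearPart, Quadric.form, Fin.sum_univ_three, Matrix.cons_val, smul_eq_mul,
    Pi.neg_apply] at hd ⊢
  rw [← e1.1, ← e1.2.1, ← e1.2.2.1, ← e1.2.2.2.1, h11, hx0]
  refine ⟨d + x0 * ((Ψ.Q 0).c12 * x 1 + (Ψ.Q 0).c13 * x 2 + (Ψ.Q 0).c14 * x 3) +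
    (Φ.Q 0).c11 * (π * x0 - (a 0 * x 1 + a 1 * x 2 + a 2 * x 3)) ^ 2 -
    b * (((Φ.Q 1).c12 * x 1 + (Φ.Q 1).c13 * x 2 + (Φ.Q 1).c14 * x 3) *
      (π * x0 - (a 0 * x 1 + a 1 * x 2 + a 2 * x 3)) +
      π * (Φ.Q 1).c11 * (π * x0 - (a 0 * x 1 + a 1 * x 2 + a 2 * x 3)) ^ 2), ?_⟩
  linear_combination hd

theorem calls_conic {Φ : QuadricPair R} {t : Task R}
    (h : Calls (tamagawaDistances π) (.conic Φ) t) :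
    ∃ (M : Matrix (Fin 2) (Fin 2) R) (Ψ : QuadricPair R) (a : Fin 3 → R) (b : R), IsUnit M.det ∧
      (Φ.comb M).subst (Matrix.diagonal ![π, 1, 1, 1]) = Ψ.comb (Matrix.diagonal ![π, 1]) ∧
      Ψ.InIdeal a b ∧ t = .conic (Ψ.subst (Quadric.shear (-a))) := by
  obtain ⟨calls, ⟨M, Φ', Ψ, hM, hΦ', -, h1, h2, ⟨a, b, Ψ₁, h3, h4, rfl⟩ | ⟨-, rfl⟩⟩, ht⟩ := h
  · rw [isTransform_one_right] at hΦ'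
    rw [Quadric.form_scale_one, Quadric.C_mul_form_eq_iff] at h1
    rw [Quadric.form_scale_one] at h2
    refine ⟨M, Ψ, a, b, hM, ?_, h3, ?_⟩
    · rw [comb_diagonal_iff, subst_Q, subst_Q, ← hΦ', Quadric.smul_one]
      exact ⟨h1, (Quadric.ext_of_form_X h2).symm⟩
    · have : Ψ₁ = Ψ.subst (Quadric.shear (-a)) := by
        apply ext_of_val
        intro x
        ext i
        rw [val, val, subst_Q]
        refine Quadric.form_eq_of_form_X (F := R) ?_ x
        rw [h4, Quadric.form_shear]
      rw [← this]
      simpa using ht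
  · simp at ht

theorem exists_calls_conic (hπ : Irreducible π) {Φ : QuadricPair R} (h : DependentOnPlane π Φ) :
    ∃ calls, tamagawaDistances π (.conic Φ) calls := by
  obtain ⟨c, hc, h⟩ := h
  push Not at hc
  obtain ⟨i, hi⟩ := hc
  rw [not_dvd_iff_isUnit hπ] at hi
  obtain ⟨M, hM, rfl⟩ := exists_isUnit_det_row hi 0
  have h0 : ∀ x : Fin 4 → R, π ∣ x 0 → π ∣ ((Φ.comb M).Q 0).form x := fun x hx => by
    rw [comb_Q, form_lin_eq]
    exact h x hx
  obtain ⟨r, hr⟩ := Quadric.exists_eq_smul (q := ((Φ.comb M).Q 0).subst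
    (Matrix.diagonal ![π, 1, 1, 1])) (s := π) (fun x => by
      rw [Quadric.form_subst_diagonal]
      exact h0 _ (by simp))
  let Ψ : QuadricPair R := ⟨![r, ((Φ.comb M).Q 1).subst (Matrix.diagonal ![π, 1, 1, 1])]⟩
  have h1 : C π * (Ψ.Q 0).form (X : Fin 4 → MvPolynomial (Fin 4) R) =
      ((Φ.comb M).Q 0).form ![C π * X 0, X 1, X 2, X 3] := by
    rw [Quadric.form_scale_one, Quadric.C_mul_form_eq_iff, hr]
    rfl
  have h2 : (Ψ.Q 1).form (X : Fin 4 → MvPolynomial (Fin 4) R) =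
      ((Φ.comb M).Q 1).form ![C π * X 0, X 1, X 2, X 3] := by
    rw [Quadric.form_scale_one]
    rfl
  have h3 : (Φ.comb M).conicPart 0
      (X : Fin 3 → MvPolynomial (Fin 3) (IsLocalRing.ResidueField R)) = 0 :=
    Quadric.form_zero_eq_zero_of_dvd hπ h0 _
  by_cases hd : ∃ (a : Fin 3 → R) (b : R), Ψ.InIdeal a b
  · obtain ⟨a, b, hab⟩ := hd
    refine ⟨_, M, _, Ψ, hM, isTransform_one_right.2 rfl, h3, h1, h2, .inl ⟨a, b,
      Ψ.subst (Quadric.shear (-a)), hab, fun i => ?_, rfl⟩⟩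
    rw [subst_Q, Quadric.form_shear]
  · exact ⟨_, M, _, Ψ, hM, isTransform_one_right.2 rfl, h3, h1, h2, .inr ⟨hd, rfl⟩⟩

variable [CharZero R]

theorem disc_of_conic (hπ : Irreducible π) {Φ Ψ : QuadricPair R} {M : Matrix (Fin 2) (Fin 2) R}
    (hM : IsUnit M.det) (h : (Φ.comb M).subst (Matrix.diagonal ![π, 1, 1, 1]) =
      Ψ.comb (Matrix.diagonal ![π, 1])) {a : Fin 3 → R} (hΦ : Φ.disc ≠ 0) :
    (Ψ.subst (Quadric.shear a)).disc ≠ 0 := by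
  intro h0
  rw [disc_subst, Quadric.det_shear, one_pow, one_mul] at h0
  have := congrArg disc h
  rw [disc_subst, disc_comb, disc_comb, h0, mul_zero, det_diagonal_one] at this
  exact mul_ne_zero (pow_ne_zero _ hπ.ne_zero) (mul_ne_zero (pow_ne_zero _ hM.ne_zero) hΦ) this

variable (π) in
/-- The least `m` for which there is no conic modulo `π ^ m` in the given plane. -/
noncomputable def conicLevel (Φ : QuadricPair R) : ℕ := sInf {e | ¬ ConicMod π e Φ}

variable (π) in
/-- The least `m` for which there is no singular point modulo `π ^ m`. -/
noncomputable def singLevel (Φ : QuadricPair R) : ℕ :=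
  sInf {e | ¬ ∃ q : Fin 4 → R, IsUnit (q 3) ∧ SingMod π e Φ q}

theorem conicLevel_lt (hπ : Irreducible π) {Φ Ψ : QuadricPair R} (hΦ : Φ.disc ≠ 0)
    (h : ∀ m, ConicMod π m Ψ → ConicMod π (m + 1) Φ) : Ψ.conicLevel π < Φ.conicLevel π := by
  refine sInf_lt_sInf_of_imp ⟨natVal Φ.disc + 1, fun hc => ?_⟩ (conicMod_zero π Φ) h
  have := le_natVal_of_pow_dvd hπ hΦ (pow_dvd_disc_of_conicMod hπ hc)
  omega

theorem singLevel_lt (hπ : Irreducible π) {Φ Ψ : QuadricPair R} (hΦ : Φ.disc ≠ 0)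
    (h : ∀ m, (∃ q : Fin 4 → R, IsUnit (q 3) ∧ SingMod π m Ψ q) →
      ∃ q : Fin 4 → R, IsUnit (q 3) ∧ SingMod π (m + 1) Φ q) : Ψ.singLevel π < Φ.singLevel π := by
  refine sInf_lt_sInf_of_imp ⟨natVal Φ.disc + 1, ?_⟩ ⟨1, isUnit_one, singMod_zero _ _ _⟩ h
  rintro ⟨q, hq, hs⟩
  have := le_natVal_of_pow_dvd hπ hΦ (dvd_disc_of_singMod hπ hq hs)
  omega

theorem acc_conic (hπ : Irreducible π) {Φ : QuadricPair R} (hΦ : Φ.disc ≠ 0) :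
    Acc (fun t s => Calls (tamagawaDistances π) s t) (.conic Φ) := by
  induction hn : Φ.conicLevel π using Nat.strong_induction_on generalizing Φ with
  | _ n ih =>
    refine ⟨_, fun t ht => ?_⟩
    obtain ⟨M, Ψ, a, b, hM, h, -, rfl⟩ := calls_conic ht
    exact ih _ (hn ▸ conicLevel_lt hπ hΦ fun m hm => hm.step hM h) (disc_of_conic hπ hM h hΦ) rfl

end QuadricPair

end GenusOne

/-! ### Degree 4: lines modulo π^m and the line subalgorithm. -/

namespace GenusOne

namespace Quadric

section

variable {R : Type*} [CommRing R]

/-- The substitution `x₁ ← x₁ + a₀ x₃ + b₀ x₄`, `x₂ ← x₂ + a₁ x₃ + b₁ x₄`. -/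
def shearLine (a b : Fin 2 → R) : Matrix (Fin 4) (Fin 4) R :=
  !![1, 0, 0, 0; 0, 1, 0, 0; a 0, a 1, 1, 0; b 0, b 1, 0, 1]

theorem det_shearLine (a b : Fin 2 → R) : (shearLine a b).det = 1 := by
  simp [shearLine, Matrix.det_succ_row_zero, Fin.sum_univ_succ, Fin.succAbove]

theorem vecMul_shearLine (a b : Fin 2 → R) (x : Fin 4 → R) : Matrix.vecMul x (shearLine a b) =
    ![x 0 + a 0 * x 2 + b 0 * x 3, x 1 + a 1 * x 2 + b 1 * x 3, x 2, x 3] := by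
  rw [vecMul_four]
  ext j
  fin_cases j <;> simp [shearLine]

theorem form_shearLine (a b : Fin 2 → R) (q : Quadric R) :
    q.form (![X 0 - C (a 0) * X 2 - C (b 0) * X 3, X 1 - C (a 1) * X 2 - C (b 1) * X 3, X 2, X 3] :
      Fin 4 → MvPolynomial (Fin 4) R) = (q.subst (shearLine (-a) (-b))).form X := by
  rw [form_subst]
  congr 1
  ext j : 1
  fin_cases j <;> simp [smul_eq_C_mul, shearLine, sub_eq_add_neg]

/-- If the form vanishes modulo s on a line, then with ρ = c₁₃c₂₄ the polynomial y² + pf y - rd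
splits modulo s as (y + ρ)(y - ρ + pf). -/
theorem dvd_rd_shift {q : Quadric R} {s : R} (h1 : s ∣ q.c33) (h2 : s ∣ q.c34) (h3 : s ∣ q.c44) :
    s ∣ q.rd + (q.c13 * q.c24) * q.pf - (q.c13 * q.c24) ^ 2 := by
  obtain ⟨x, hx⟩ := h1
  obtain ⟨y, hy⟩ := h2
  obtain ⟨z, hz⟩ := h3
  simp only [rd, pf, hx, hy, hz]
  exact ⟨4 * q.c11 * q.c22 * s * x * z - q.c11 * q.c22 * s * y ^ 2 + q.c11 * q.c23 * q.c24 * y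
    - q.c11 * q.c23 ^ 2 * z - q.c11 * q.c24 ^ 2 * x + q.c12 * q.c13 * q.c23 * z
    - q.c12 * q.c13 * q.c24 * y - q.c12 * q.c14 * q.c23 * y + q.c12 * q.c14 * q.c24 * x
    - q.c12 ^ 2 * s * x * z + q.c13 * q.c14 * q.c22 * y - q.c13 ^ 2 * q.c22 * z
    - q.c14 ^ 2 * q.c22 * x + q.c13 * q.c24 * q.c12 * y, by ring⟩

end

end Quadric

namespace Quartic

variable {R : Type*} [CommRing R]

/-- Every monomial of a₃ and a₄ contains a coefficient of Q, and every monomial of a₆ contains at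
least two. -/
theorem dvd_disc_of_dvd_Q {Φ : Quartic R} {s : R} (ha : s ∣ Φ.a) (hb : s ∣ Φ.b) (hc : s ∣ Φ.c)
    (hd : s ∣ Φ.d) (he : s ∣ Φ.e) : s ^ 2 ∣ Φ.disc := by
  obtain ⟨l, m, n, a, b, c, d, e⟩ := Φ
  obtain ⟨a, rfl⟩ := ha
  obtain ⟨b, rfl⟩ := hb
  obtain ⟨c, rfl⟩ := hc
  obtain ⟨d, rfl⟩ := hd
  obtain ⟨e, rfl⟩ := he
  apply sq_dvd_delta
  · exact ⟨l * d + n * b, by simp only [jacobian]; ring⟩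
  · exact ⟨-(l ^ 2 * e) - l * n * c - n ^ 2 * a - 4 * a * s * e + b * s * d,
      by simp only [jacobian]; ring⟩
  · exact ⟨-(l ^ 2 * c * e) + l * m * b * e - l * n * b * d - m ^ 2 * a * e + m * n * a * d
      - n ^ 2 * a * c - 4 * a * s * c * e + a * s * d ^ 2 + b ^ 2 * s * e,
      by simp only [jacobian]; ring⟩

end Quartic

namespace QuadricPair

section

variable {R : Type*} [CommRing R]

theorem sq_dvd_disc_of_line [IsDomain R] [CharZero R] {Φ : QuadricPair R} {s : R}
    (h1 : ∀ i, s ∣ (Φ.Q i).c33) (h2 : ∀ i, s ∣ (Φ.Q i).c34) (h3 : ∀ i, s ∣ (Φ.Q i).c44) :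
    s ^ 2 ∣ Φ.disc := by
  -- The coefficients of -c₁₃c₂₄ for the pencil; by `Quadric.dvd_rd_shift`, shifting y by this form
  -- makes the right-hand side divisible by s.
  let r : Fin 3 → R := ![-((Φ.Q 0).c13 * (Φ.Q 0).c24),
    -((Φ.Q 0).c13 * (Φ.Q 1).c24 + (Φ.Q 1).c13 * (Φ.Q 0).c24), -((Φ.Q 1).c13 * (Φ.Q 1).c24)]
  have hlin : ∀ {a b : R}, s ∣ a → s ∣ b →
      Polynomial.C s ∣ Polynomial.C a * Polynomial.X + Polynomial.C b := fun ha hb =>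
    dvd_add ((map_dvd Polynomial.C ha).mul_right _) (map_dvd Polynomial.C hb)
  have key : Polynomial.C s ∣ (Φ.doubling.shift r).Q ![(Polynomial.X : Polynomial R), 1] := by
    have := Quadric.dvd_rd_shift (q := Quadric.pencil (Φ.Q 0) (Φ.Q 1)) (hlin (h1 0) (h1 1))
      (hlin (h2 0) (h2 1)) (hlin (h3 0) (h3 1))
    rw [rd_pencil, pf_pencil] at this
    rw [Quartic.Q_shift]
    convert this using 1
    simp [r, Quadric.pencil, Polynomial.smul_eq_C_mul]
    ring
  rw [Polynomial.C_dvd_iff_dvd_coeff] at key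
  rw [disc, ← Quartic.disc_shift r]
  generalize Φ.doubling.shift r = Ψ at key
  have k0 := key 0
  have k1 := key 1
  have k2 := key 2
  have k3 := key 3
  have k4 := key 4
  simp [Quartic.Q, Polynomial.coeff_X_pow, Polynomial.coeff_X, Polynomial.coeff_one]
    at k0 k1 k2 k3 k4
  exact Quartic.dvd_disc_of_dvd_Q k4 k3 k2 k1 k0

/-- The pair contains a line near `x₁ = x₂ = 0` modulo `π ^ m`. -/
def LineMod (π : R) (m : ℕ) (Φ : QuadricPair R) : Prop :=
  ∃ a b : Fin 2 → R, ∀ x : Fin 4 → R, x 0 = 0 → x 1 = 0 →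
    ∀ i, π ^ m ∣ (Φ.subst (Quadric.shearLine a b)).val x i

theorem lineMod_zero (π : R) (Φ : QuadricPair R) : LineMod π 0 Φ :=
  ⟨0, 0, by simp⟩

/-- As for cubics, the slopes change to π times their sheared values, and the equations regain the
factor π that was divided out. -/
theorem LineMod.step {π : R} {m : ℕ} {Φ Ψ : QuadricPair R}
    (h : Φ.subst (Matrix.diagonal ![π, π, 1, 1]) = Ψ.comb (π • 1)) {a b : Fin 2 → R}
    (hΨ : LineMod π m (Ψ.subst (Quadric.shearLine a b))) : LineMod π (m + 1) Φ := by
  obtain ⟨α, β, hw⟩ := hΨ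
  refine ⟨fun i => π * (α i + a i), fun i => π * (β i + b i), fun x h0 h1 i => ?_⟩
  have e : Matrix.vecMul x (Quadric.shearLine (fun i => π * (α i + a i))
      fun i => π * (β i + b i)) =
      Matrix.vecMul (Matrix.vecMul (Matrix.vecMul x (Quadric.shearLine α β))
        (Quadric.shearLine a b)) (Matrix.diagonal ![π, π, 1, 1]) := by
    simp only [Quadric.vecMul_shearLine, h0, h1]
    ext j
    rw [Matrix.vecMul_diagonal]
    fin_cases j <;> simp <;> ring
  have h2 := congrArg (fun Θ => Θ.val (Matrix.vecMul (Matrix.vecMul x (Quadric.shearLine α β))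
    (Quadric.shearLine a b))) h
  have hw := hw x h0 h1 i
  rw [val_subst, val_subst] at hw
  rw [val_subst, val_comb, ← e, Matrix.smul_mulVec, Matrix.one_mulVec] at h2
  rw [val_subst, h2, Pi.smul_apply, smul_eq_mul, pow_succ']
  exact mul_dvd_mul_left _ hw

theorem pow_dvd_disc_of_lineMod [IsDomain R] [CharZero R] {π : R} {m : ℕ} {Φ : QuadricPair R}
    (h : LineMod π m Φ) : π ^ (2 * m) ∣ Φ.disc := by
  obtain ⟨a, b, h⟩ := h
  have e := disc_subst (Quadric.shearLine a b) Φ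
  rw [Quadric.det_shearLine, one_pow, one_mul] at e
  rw [← e, pow_mul']
  generalize Φ.subst (Quadric.shearLine a b) = V at h
  have e33 : ∀ i, π ^ m ∣ (V.Q i).c33 := fun i => by
    simpa [val, Quadric.form] using h ![0, 0, 1, 0] rfl rfl i
  have e44 : ∀ i, π ^ m ∣ (V.Q i).c44 := fun i => by
    simpa [val, Quadric.form] using h ![0, 0, 0, 1] rfl rfl i
  refine sq_dvd_disc_of_line e33 (fun i => ?_) e44
  have := h ![0, 0, 1, 1] rfl rfl i
  simp [val, Quadric.form] at this
  rwa [dvd_add_left (e44 i), dvd_add_right (e33 i)] at this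

end

variable {R : Type*} [CommRing R] [IsDomain R] [IsDiscreteValuationRing R] {π : R}

/-- The forms `Q_i(0, 0, s, t)` vanish modulo `π`, and `g(s, t)` does not. -/
def ContainsLine (π : R) (Φ : QuadricPair R) : Prop :=
  (∀ x : Fin 4 → R, π ∣ x 0 → π ∣ x 1 → ∀ i, π ∣ Φ.val x i) ∧ Φ.lineG ≠ 0

theorem lineG_congr (hπ : Irreducible π) {Φ Ψ : QuadricPair R}
    (h13 : ∀ i, π ∣ (Φ.Q i).c13 - (Ψ.Q i).c13) (h14 : ∀ i, π ∣ (Φ.Q i).c14 - (Ψ.Q i).c14)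
    (h23 : ∀ i, π ∣ (Φ.Q i).c23 - (Ψ.Q i).c23) (h24 : ∀ i, π ∣ (Φ.Q i).c24 - (Ψ.Q i).c24) :
    Φ.lineG = Ψ.lineG := by
  simp only [← residue_eq_zero_iff hπ, map_sub, sub_eq_zero] at h13 h14 h23 h24
  simp only [lineG, lineMatrix, Algebra.smul_def, IsScalarTower.algebraMap_apply R
    (IsLocalRing.ResidueField R) (MvPolynomial (Fin 2) (IsLocalRing.ResidueField R)), h13, h14,
    h23, h24]

/-- The linear step of the subalgorithm for lines, on the level of coefficients. -/
theorem coeffs_of_scale (hπ : Irreducible π) {Φ Ψ : QuadricPair R}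
    (h : Φ.subst (Matrix.diagonal ![π, π, 1, 1]) = Ψ.comb (π • 1)) (i : Fin 2) :
    (Ψ.Q i).c11 = π * (Φ.Q i).c11 ∧ (Ψ.Q i).c12 = π * (Φ.Q i).c12 ∧
      (Ψ.Q i).c22 = π * (Φ.Q i).c22 ∧ (Ψ.Q i).c13 = (Φ.Q i).c13 ∧ (Ψ.Q i).c14 = (Φ.Q i).c14 ∧
      (Ψ.Q i).c23 = (Φ.Q i).c23 ∧ (Ψ.Q i).c24 = (Φ.Q i).c24 := by
  have hd : (π • 1 : Matrix (Fin 2) (Fin 2) R) = Matrix.diagonal ![π, π] := by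
    ext i j
    fin_cases i <;> fin_cases j <;> simp
  rw [hd, comb_diagonal_iff] at h
  have h : (Φ.subst (Matrix.diagonal ![π, π, 1, 1])).Q i = (Ψ.Q i).smul π := by
    fin_cases i
    · exact h.1
    · exact h.2
  rw [subst_Q, Quadric.subst_diagonal] at h
  simp only [Quadric.smul, Quadric.mk.injEq, Matrix.cons_val, mul_one] at h
  obtain ⟨e11, e12, e13, e14, e22, e23, e24, -, -, -⟩ := h
  have hc : ∀ {x y : R}, π * x = π * y → y = x := fun h => (mul_left_cancel₀ hπ.ne_zero h).symm
  exact ⟨hc (by rw [← e11]; ring), hc (by rw [← e12]; ring), hc (by rw [← e22]; ring), hc e13,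
    hc e14, hc e23, hc e24⟩

/-- The condition of Step (iv) in the subalgorithm for lines. -/
def Divides (Ψ : QuadricPair R) (a b : Fin 2 → R) : Prop :=
  ∀ i, Ψ.lineF i = (a i • X 0 + b i • X 1) * Ψ.lineG

/-- Multiplication by L recovers the forms on the line, since L adj(L) = g; then g ≠ 0 is cancelled.
-/
theorem Divides.form_eq {Ψ : QuadricPair R} {a b : Fin 2 → R} (h : Ψ.Divides a b)
    (hg : Ψ.lineG ≠ 0) (i : Fin 2) : (Ψ.Q i).form
      (![0, 0, X 0, X 1] : Fin 4 → MvPolynomial (Fin 2) (IsLocalRing.ResidueField R)) =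
      ∑ j, Ψ.lineMatrix (X 0) (X 1) i j * (a j • X 0 + b j • X 1) := by
  apply mul_left_cancel₀ hg
  have h1 : (Ψ.lineMatrix (X 0) (X 1)).mulVec Ψ.lineF i = Ψ.lineG * (Ψ.Q i).form
      (![0, 0, X 0, X 1] : Fin 4 → MvPolynomial (Fin 2) (IsLocalRing.ResidueField R)) := by
    rw [lineF, Matrix.mulVec_mulVec, Matrix.mul_adjugate, Matrix.smul_mulVec, Matrix.one_mulVec,
      lineG]
    rfl
  rw [← h1, Matrix.mulVec, dotProduct, Finset.mul_sum]
  refine Finset.sum_congr rfl fun j _ => ?_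
  rw [h j]
  ring

/-- After Step (ii) the terms quadratic in x₁, x₂ vanish modulo π, and what remains is L (x₁, x₂) +
q. Since q is L applied to linear forms, the shear by these forms removes q. -/
theorem containsLine_step (hπ : Irreducible π) {Φ Ψ : QuadricPair R} (hΦ : Φ.lineG ≠ 0)
    (h : Φ.subst (Matrix.diagonal ![π, π, 1, 1]) = Ψ.comb (π • 1)) {a b : Fin 2 → R}
    (hab : Ψ.Divides a b) : ContainsLine π (Ψ.subst (Quadric.shearLine (-a) (-b))) := by
  have hc := coeffs_of_scale hπ h
  have hg : Ψ.lineG ≠ 0 := by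
    rw [lineG_congr hπ (Ψ := Φ)]
    · exact hΦ
    all_goals simp [hc]
  constructor
  · intro x hx0 hx1 i
    rw [val_subst, Quadric.vecMul_shearLine, val]
    obtain ⟨φ, hφ⟩ : ∃ φ : MvPolynomial (Fin 2) (IsLocalRing.ResidueField R) →ₐ[R]
        IsLocalRing.ResidueField R, ∀ j, φ (X j) = algebraMap R _ ((![x 2, x 3] : Fin 2 → R) j) :=
      ⟨(aeval fun j => algebraMap R (IsLocalRing.ResidueField R)
        ((![x 2, x 3] : Fin 2 → R) j)).restrictScalars R, by simp⟩
    have e := congrArg φ (hab.form_eq hg i)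
    rw [Quadric.map_form] at e
    have e1 : (fun j => φ ((![0, 0, X 0, X 1] :
        Fin 4 → MvPolynomial (Fin 2) (IsLocalRing.ResidueField R)) j)) =
        fun j => algebraMap R _ ((![0, 0, x 2, x 3] : Fin 4 → R) j) := by
      ext j
      fin_cases j <;> simp [hφ]
    rw [e1, Quadric.form_algebraMap] at e
    have e2 : ∀ j, φ (Ψ.lineMatrix (X 0) (X 1) i j) =
        algebraMap R _ (Ψ.lineMatrix (x 2) (x 3) i j) := by
      intro j
      fin_cases i <;> fin_cases j <;>
        simp only [lineMatrix, Matrix.of_apply, Matrix.cons_val', Matrix.cons_val, Fin.zero_eta,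
          Fin.mk_one, map_add, map_smul, hφ] <;>
        simp [Algebra.smul_def]
    simp only [map_sum, map_mul, map_add, map_smul, e2, hφ] at e
    have e3 : π ∣ (Ψ.Q i).form ![0, 0, x 2, x 3] -
        ∑ j, Ψ.lineMatrix (x 2) (x 3) i j * (a j * x 2 + b j * x 3) := by
      rw [← residue_eq_zero_iff hπ, map_sub, e]
      simp [Algebra.smul_def]
    obtain ⟨h11, h12, h22, -⟩ := hc i
    obtain ⟨y0, hy0⟩ := hx0
    obtain ⟨y1, hy1⟩ := hx1
    obtain ⟨d, hd⟩ := e3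
    have hL : ∀ u v : R, ∑ j, Ψ.lineMatrix (x 2) (x 3) i j * (![u, v] : Fin 2 → R) j =
        ((Ψ.Q i).c13 * x 2 + (Ψ.Q i).c14 * x 3) * u +
        ((Ψ.Q i).c23 * x 2 + (Ψ.Q i).c24 * x 3) * v := by
      intro u v
      fin_cases i <;> simp [lineMatrix, Fin.sum_univ_two]
    have hL' := hL (a 0 * x 2 + b 0 * x 3) (a 1 * x 2 + b 1 * x 3)
    simp only [Fin.sum_univ_two, Matrix.cons_val_zero, Matrix.cons_val_one] at hL'
    rw [Fin.sum_univ_two, hL'] at hd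
    simp only [Quadric.form, Matrix.cons_val, smul_eq_mul, Pi.neg_apply, h11, h12, h22] at hd ⊢
    rw [hy0, hy1]
    refine ⟨d + (Φ.Q i).c11 * (π * y0 - a 0 * x 2 - b 0 * x 3) ^ 2 +
      (Φ.Q i).c12 * ((π * y0 - a 0 * x 2 - b 0 * x 3) * (π * y1 - a 1 * x 2 - b 1 * x 3)) +
      (Φ.Q i).c22 * (π * y1 - a 1 * x 2 - b 1 * x 3) ^ 2 +
      ((Ψ.Q i).c13 * x 2 + (Ψ.Q i).c14 * x 3) * y0 +
      ((Ψ.Q i).c23 * x 2 + (Ψ.Q i).c24 * x 3) * y1, ?_⟩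
    linear_combination hd
  -- The shear changes the entries of L only by multiples of c₁₁, c₁₂, c₂₂, which vanish modulo π.
  · rw [lineG_congr hπ (Ψ := Ψ)]
    · exact hg
    all_goals
      intro i
      obtain ⟨h11, h12, h22, -⟩ := hc i
      rw [subst_Q]
      simp [Quadric.subst, Quadric.polar, Quadric.shearLine, h11, h12, h22]
    · exact ⟨2 * (Φ.Q i).c11 * (-a 0) + (Φ.Q i).c12 * (-a 1), by ring⟩
    · exact ⟨2 * (Φ.Q i).c11 * (-b 0) + (Φ.Q i).c12 * (-b 1), by ring⟩
    · exact ⟨(Φ.Q i).c12 * (-a 0) + 2 * (Φ.Q i).c22 * (-a 1), by ring⟩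
    · exact ⟨(Φ.Q i).c12 * (-b 0) + 2 * (Φ.Q i).c22 * (-b 1), by ring⟩

end QuadricPair

end GenusOne

/-! ### Binary forms over a field: the linear algebra behind Step (v). -/

namespace GenusOne

section

variable {F : Type*} [Field F]

/-- The zero of the binary linear form with coefficients `h`. -/
def binaryZero (h : Fin 2 → F) : Fin 2 → F := ![h 1, -h 0]

theorem eval_linForm_binaryZero (h : Fin 2 → F) : eval (binaryZero h) (linForm h) = 0 := by
  simp [linForm, binaryZero, Fin.sum_univ_two]
  ring

theorem binary_ne_zero {h : Fin 2 → F} (hh : h ≠ 0) : h 0 ≠ 0 ∨ h 1 ≠ 0 := by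
  by_contra! h'
  exact hh (by ext i; fin_cases i; exacts [h'.1, h'.2])

theorem linForm_ne_zero {h : Fin 2 → F} (hh : h ≠ 0) : linForm h ≠ 0 := by
  intro h0
  have e : ∀ x y : F, h 0 * x + h 1 * y = 0 := fun x y => by
    simpa [linForm, Fin.sum_univ_two] using congrArg (eval ![x, y]) h0
  rcases binary_ne_zero hh with h1 | h1
  · exact h1 (by simpa using e 1 0)
  · exact h1 (by simpa using e 0 1)

theorem linear_eq_mul_linForm {h : Fin 2 → F} (hh : h ≠ 0) {a b : F}
    (h0 : eval (binaryZero h) (C a * X 0 + C b * X 1) = 0) :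
    ∃ d, (C a * X 0 + C b * X 1 : MvPolynomial (Fin 2) F) = C d * linForm h := by
  simp [binaryZero] at h0
  obtain ⟨d, h1, h2⟩ : ∃ d, a = d * h 0 ∧ b = d * h 1 := by
    rcases binary_ne_zero hh with h' | h'
    · exact ⟨a / h 0, by field_simp, by field_simp; linear_combination -h0⟩
    · exact ⟨b / h 1, by field_simp; linear_combination h0, by field_simp⟩
  refine ⟨d, ?_⟩
  simp only [linForm, Fin.sum_univ_two, h1, h2, C_mul]
  ring

theorem quadratic_eq_mul_linForm {h : Fin 2 → F} (hh : h ≠ 0) {a b c : F}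
    (h0 : eval (binaryZero h) (C a * X 0 ^ 2 + C b * (X 0 * X 1) + C c * X 1 ^ 2) = 0) :
    ∃ d e, (C a * X 0 ^ 2 + C b * (X 0 * X 1) + C c * X 1 ^ 2 : MvPolynomial (Fin 2) F) =
      (C d * X 0 + C e * X 1) * linForm h := by
  simp [binaryZero] at h0
  obtain ⟨d, e, h1, h2, h3⟩ : ∃ d e, a = d * h 0 ∧ b = d * h 1 + e * h 0 ∧ c = e * h 1 := by
    rcases binary_ne_zero hh with h' | h'
    · exact ⟨a / h 0, b / h 0 - a * h 1 / h 0 ^ 2, by field_simp, by field_simp; ring,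
        by field_simp; linear_combination h0⟩
    · exact ⟨b / h 1 - c * h 0 / h 1 ^ 2, c / h 1, by field_simp; linear_combination h0,
        by field_simp; ring, by field_simp⟩
  refine ⟨d, e, ?_⟩
  simp only [linForm, Fin.sum_univ_two, h1, h2, h3, C_mul, C_add]
  ring

/-- If the curve `L (x₁, x₂) + q = 0`, whose coordinates are binary forms, is contained in the
plane `ℓ`, then either it is a line, or a combination of its equations vanishes on the plane. -/
theorem dependent_or_divides {L : Matrix (Fin 2) (Fin 2) (MvPolynomial (Fin 2) F)}
    {q : Fin 2 → MvPolynomial (Fin 2) F} {α β : Matrix (Fin 2) (Fin 2) F} {u v w : Fin 2 → F}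
    (hL : ∀ i j, L i j = C (α i j) * X 0 + C (β i j) * X 1)
    (hq : ∀ i, q i = C (u i) * X 0 ^ 2 + C (v i) * (X 0 * X 1) + C (w i) * X 1 ^ 2)
    (hg : L.det ≠ 0) {h : Fin 2 → F} (hh : h ≠ 0) (hd : linForm h ∣ L.det) {ℓ : Fin 4 → F}
    (hℓ : ℓ ≠ 0) (hrel : ∑ i, C (ℓ (Fin.castLE (by omega) i)) * L.adjugate.mulVec q i =
      L.det * (C (ℓ 2) * X 0 + C (ℓ 3) * X 1)) :
    (∃ (c : Fin 2 → F) (r : MvPolynomial (Fin 2) F), c ≠ 0 ∧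
      (∀ j : Fin 2, ∑ i, C (c i) * L i j = r * C (ℓ (Fin.castLE (by omega) j))) ∧
      ∑ i, C (c i) * q i = r * (C (ℓ 2) * X 0 + C (ℓ 3) * X 1)) ∨
    ∃ a b : Fin 2 → F, ∀ i,
      L.adjugate.mulVec q i = (C (a i) * X 0 + C (b i) * X 1) * L.det := by
  obtain ⟨g', hg'⟩ := hd
  have hgz : eval (binaryZero h) L.det = 0 := by
    rw [hg', map_mul, eval_linForm_binaryZero, zero_mul]
  have hh0 := linForm_ne_zero hh
  have hdet : L.det = L 0 0 * L 1 1 - L 0 1 * L 1 0 := Matrix.det_fin_two L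
  set g := L.det with hgdef
  have hf : L.adjugate.mulVec q = ![L 1 1 * q 0 - L 0 1 * q 1, -(L 1 0 * q 0) + L 0 0 * q 1] := by
    rw [Matrix.adjugate_fin_two]
    ext i : 1
    fin_cases i <;> simp [Matrix.mulVec, dotProduct, Fin.sum_univ_two] <;> ring
  rw [hf] at hrel ⊢
  have h0 : Fin.castLE (by omega : 2 ≤ 4) 0 = 0 := rfl
  have h1 : Fin.castLE (by omega : 2 ≤ 4) 1 = 1 := rfl
  simp only [Fin.sum_univ_two, Matrix.cons_val_zero, Matrix.cons_val_one, Fin.forall_fin_two,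
    h0, h1] at hrel ⊢
  set m : MvPolynomial (Fin 2) F := C (ℓ 2) * X 0 + C (ℓ 3) * X 1 with hm
  -- the covector `(ℓ₀, ℓ₁) adj L`
  have hC0 : C (ℓ 0) * L 1 1 - C (ℓ 1) * L 1 0 =
      C (ℓ 0 * α 1 1 - ℓ 1 * α 1 0) * X 0 + C (ℓ 0 * β 1 1 - ℓ 1 * β 1 0) * X 1 := by
    simp only [hL, C_mul, C_sub]
    ring
  have hC1 : C (ℓ 1) * L 0 0 - C (ℓ 0) * L 0 1 =
      C (ℓ 1 * α 0 0 - ℓ 0 * α 0 1) * X 0 + C (ℓ 1 * β 0 0 - ℓ 0 * β 0 1) * X 1 := by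
    simp only [hL, C_mul, C_sub]
    ring
  set D0 := C (ℓ 0) * L 1 1 - C (ℓ 1) * L 1 0 with hD0
  set D1 := C (ℓ 1) * L 0 0 - C (ℓ 0) * L 0 1 with hD1
  have k0 : D0 * L 0 0 + D1 * L 1 0 = g * C (ℓ 0) := by rw [hdet, hD0, hD1]; ring
  have k1 : D0 * L 0 1 + D1 * L 1 1 = g * C (ℓ 1) := by rw [hdet, hD0, hD1]; ring
  have k2 : D0 * q 0 + D1 * q 1 = g * m := by rw [← hrel, hD0, hD1]; ring
  -- If the covector D vanishes at the zero of h, then it is h times a constant covector c.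
  -- Cancelling h in D L = g (ℓ₀, ℓ₁) and D q = g m shows that the combination c of the equations is
  -- a multiple of the plane ℓ.
  by_cases hz : eval (binaryZero h) D0 = 0 ∧ eval (binaryZero h) D1 = 0
  · left
    obtain ⟨c0, e0⟩ := linear_eq_mul_linForm hh (hC0 ▸ hz.1)
    obtain ⟨c1, e1⟩ := linear_eq_mul_linForm hh (hC1 ▸ hz.2)
    rw [← hC0] at e0
    rw [← hC1] at e1
    refine ⟨![c0, c1], g', fun hc => hℓ ?_, ⟨?_, ?_⟩, ?_⟩
    · have hc0 : c0 = 0 := congrFun hc 0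
      have hc1 : c1 = 0 := congrFun hc 1
      rw [hc0, C_0, zero_mul] at e0
      rw [hc1, C_0, zero_mul] at e1
      simp only [e0, e1, zero_mul, add_zero, zero_eq_mul, hg, false_or] at k0 k1 k2
      have k2' : ∀ x y : F, ℓ 2 * x + ℓ 3 * y = 0 := fun x y => by
        simpa [hm] using congrArg (eval ![x, y]) k2
      ext i
      fin_cases i
      · simpa using k0
      · simpa using k1
      · simpa using k2' 1 0
      · simpa using k2' 0 1
    all_goals
      apply mul_left_cancel₀ hh0
      simp only [Matrix.cons_val_zero, Matrix.cons_val_one]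
    · linear_combination k0 - e0 * L 0 0 - e1 * L 1 0 + C (ℓ 0) * hg'
    · linear_combination k1 - e0 * L 0 1 - e1 * L 1 1 + C (ℓ 1) * hg'
    · linear_combination k2 - e0 * q 0 - e1 * q 1 + m * hg'
  -- Otherwise let c be the non-zero value of D at the zero of h. As g vanishes there, so do c L and
  -- c q, and h can be divided out of both.
  · generalize hc0 : eval (binaryZero h) D0 = c0 at hz
    generalize hc1 : eval (binaryZero h) D1 = c1 at hz
    have z0 := congrArg (eval (binaryZero h)) k0
    have z1 := congrArg (eval (binaryZero h)) k1
    have z2 := congrArg (eval (binaryZero h)) k2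
    simp only [map_add, map_mul, hgz, zero_mul, hc0, hc1] at z0 z1 z2
    have hj : ∀ j, C c0 * L 0 j + C c1 * L 1 j = C (c0 * α 0 j + c1 * α 1 j) * X 0 +
        C (c0 * β 0 j + c1 * β 1 j) * X 1 := fun j => by
      simp only [hL, C_mul, C_add]
      ring
    have hr : C c0 * q 0 + C c1 * q 1 = C (c0 * u 0 + c1 * u 1) * X 0 ^ 2 +
        C (c0 * v 0 + c1 * v 1) * (X 0 * X 1) + C (c0 * w 0 + c1 * w 1) * X 1 ^ 2 := by
      simp only [hq, C_mul, C_add]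
      ring
    obtain ⟨w0, e0⟩ := linear_eq_mul_linForm hh (by rw [← hj 0]; simpa using z0)
    obtain ⟨w1, e1⟩ := linear_eq_mul_linForm hh (by rw [← hj 1]; simpa using z1)
    obtain ⟨r0, r1, e2⟩ := quadratic_eq_mul_linForm hh (by rw [← hr]; simpa using z2)
    rw [← hj] at e0 e1
    rw [← hr] at e2
    have e3 : C w0 * (L 1 1 * q 0 - L 0 1 * q 1) + C w1 * (-(L 1 0 * q 0) + L 0 0 * q 1) =
        g * (C r0 * X 0 + C r1 * X 1) := by
      apply mul_left_cancel₀ hh0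
      linear_combination -(L 1 1 * q 0 - L 0 1 * q 1) * e0
        - (-(L 1 0 * q 0) + L 0 0 * q 1) * e1 + g * e2
        - (C c0 * q 0 + C c1 * q 1) * hdet
    -- Dividing h out of c L and c q gives the second relation `e3` for adj(L) q, besides that of ℓ.
    -- If the two are proportional, c is a combination as required. If not, Cramer's rule expresses
    -- both components of adj(L) q as g times linear forms.
    by_cases hdet0 : w0 * ℓ 1 - w1 * ℓ 0 = 0
    · left
      have hℓ01 : ℓ 0 ≠ 0 ∨ ℓ 1 ≠ 0 := by
        by_contra! h'
        apply hz
        rw [← hc0, ← hc1, hD0, hD1, h'.1, h'.2]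
        simp
      obtain ⟨κ, hk0, hk1⟩ : ∃ κ, w0 = κ * ℓ 0 ∧ w1 = κ * ℓ 1 := by
        rcases hℓ01 with h' | h'
        · exact ⟨w0 / ℓ 0, by field_simp, by field_simp; linear_combination -hdet0⟩
        · exact ⟨w1 / ℓ 1, by field_simp; linear_combination hdet0, by field_simp⟩
      have e4 : (C r0 * X 0 + C r1 * X 1 : MvPolynomial (Fin 2) F) = C κ * m := by
        apply mul_left_cancel₀ hg
        rw [← e3, hk0, hk1, C_mul, C_mul]
        linear_combination C κ * hrel
      refine ⟨![c0, c1], C κ * linForm h, fun hc => hz ⟨congrFun hc 0, congrFun hc 1⟩,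
        ⟨?_, ?_⟩, ?_⟩
      · simp only [Matrix.cons_val_zero, Matrix.cons_val_one, e0, hk0, C_mul]
        ring
      · simp only [Matrix.cons_val_zero, Matrix.cons_val_one, e1, hk1, C_mul]
        ring
      · simp only [Matrix.cons_val_zero, Matrix.cons_val_one, e2, e4]
        ring
    · right
      set δ := w0 * ℓ 1 - w1 * ℓ 0 with hδ
      have hδ' : (C δ⁻¹ * C δ : MvPolynomial (Fin 2) F) = 1 := by
        rw [← C_mul, inv_mul_cancel₀ hdet0, C_1]
      have hδ'' : (C δ : MvPolynomial (Fin 2) F) = C w0 * C (ℓ 1) - C w1 * C (ℓ 0) := by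
        rw [hδ, C_sub, C_mul, C_mul]
      refine ⟨![δ⁻¹ * (r0 * ℓ 1 - w1 * ℓ 2), δ⁻¹ * (w0 * ℓ 2 - r0 * ℓ 0)],
        ![δ⁻¹ * (r1 * ℓ 1 - w1 * ℓ 3), δ⁻¹ * (w0 * ℓ 3 - r1 * ℓ 0)], ?_, ?_⟩
      · simp only [Matrix.cons_val_zero, Matrix.cons_val_one, C_mul, C_sub]
        linear_combination -(L 1 1 * q 0 - L 0 1 * q 1) * hδ' + C δ⁻¹ * C (ℓ 1) * e3
          - C δ⁻¹ * C w1 * hrel + C δ⁻¹ * (L 1 1 * q 0 - L 0 1 * q 1) * hδ''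
          + C δ⁻¹ * C w1 * g * hm
      · simp only [Matrix.cons_val_zero, Matrix.cons_val_one, C_mul, C_sub]
        linear_combination -(-(L 1 0 * q 0) + L 0 0 * q 1) * hδ' - C δ⁻¹ * C (ℓ 0) * e3
          + C δ⁻¹ * C w0 * hrel + C δ⁻¹ * (-(L 1 0 * q 0) + L 0 0 * q 1) * hδ''
          - C δ⁻¹ * C w0 * g * hm

/-- Four binary cubic forms with a common zero are linearly dependent. -/
theorem exists_relation_of_common_zero {p : Fin 4 → MvPolynomial (Fin 2) F}
    {k : Matrix (Fin 4) (Fin 4) F}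
    (hp : ∀ i, p i = ∑ j : Fin 4, C (k i j) * (X 0 ^ (3 - j : ℕ) * X 1 ^ (j : ℕ)))
    {h : Fin 2 → F} (hh : h ≠ 0) (h0 : ∀ i, linForm h ∣ p i) :
    ∃ ℓ : Fin 4 → F, ℓ ≠ 0 ∧ ∑ i, C (ℓ i) * p i = 0 := by
  -- The cubic monomials at the common zero form a non-zero vector in the kernel of the coefficient
  -- matrix. So this square matrix also has a left kernel, which is a relation between the forms.
  let v : Fin 4 → F := fun j => binaryZero h 0 ^ (3 - j : ℕ) * binaryZero h 1 ^ (j : ℕ)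
  have hv : v ≠ 0 := by
    intro h'
    have v0 := congrFun h' 0
    have v3 := congrFun h' 3
    simp [v, binaryZero] at v0 v3
    rcases binary_ne_zero hh with h1 | h1
    exacts [h1 v3, h1 v0]
  have hk : k.mulVec v = 0 := by
    ext i
    obtain ⟨r, hr⟩ := h0 i
    have := congrArg (eval (binaryZero h)) hr
    rw [map_mul, eval_linForm_binaryZero, zero_mul, hp, map_sum] at this
    simpa [Matrix.mulVec, dotProduct, v] using this
  obtain ⟨ℓ, hℓ, hℓk⟩ := Matrix.exists_vecMul_eq_zero_iff.mpr
    (Matrix.exists_mulVec_eq_zero_iff.mp ⟨v, hv, hk⟩)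
  refine ⟨ℓ, hℓ, ?_⟩
  simp only [hp, Finset.mul_sum]
  rw [Finset.sum_comm]
  refine Finset.sum_eq_zero fun j _ => ?_
  have := congrFun hℓk j
  simp only [Matrix.vecMul, dotProduct, Pi.zero_apply] at this
  simp only [← mul_assoc, ← Finset.sum_mul, ← C_mul, ← map_sum, this, C_0, zero_mul]

end

end GenusOne

/-! ### Degree 4: Step (v), and the recursive calls of the line subalgorithm. -/

namespace GenusOne

section

variable {F : Type*} [Field F]

/-- The binary cubic form with coefficients `k`. -/
noncomputable def binaryCubic (k : Fin 4 → F) : MvPolynomial (Fin 2) F :=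
  ∑ j : Fin 4, C (k j) * (X 0 ^ (3 - j : ℕ) * X 1 ^ (j : ℕ))

theorem binaryCubic_sub (k k' : Fin 4 → F) :
    binaryCubic k - binaryCubic k' = binaryCubic (k - k') := by
  simp [binaryCubic, sub_mul, Finset.sum_sub_distrib]

theorem exists_mul_eq_binaryCubic (a b u v w : F) : ∃ k, (C a * X 0 + C b * X 1) *
    (C u * X 0 ^ 2 + C v * (X 0 * X 1) + C w * X 1 ^ 2) = binaryCubic k := by
  refine ⟨![a * u, a * v + b * u, a * w + b * v, b * w], ?_⟩
  simp [binaryCubic, Fin.sum_univ_succ]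
  ring

theorem exists_sub_eq_binaryCubic {p q : MvPolynomial (Fin 2) F} (hp : ∃ k, p = binaryCubic k)
    (hq : ∃ k, q = binaryCubic k) : ∃ k, p - q = binaryCubic k := by
  obtain ⟨k, rfl⟩ := hp
  obtain ⟨k', rfl⟩ := hq
  exact ⟨_, binaryCubic_sub k k'⟩

/-- The forms f₁, f₂, g s, g t are four binary cubics with a common zero, hence linearly dependent:
the curve that they parametrise lies in a plane. -/
theorem exists_conic_relation {L : Matrix (Fin 2) (Fin 2) (MvPolynomial (Fin 2) F)}
    {q : Fin 2 → MvPolynomial (Fin 2) F} {α β : Matrix (Fin 2) (Fin 2) F} {u v w : Fin 2 → F}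
    (hL : ∀ i j, L i j = C (α i j) * X 0 + C (β i j) * X 1)
    (hq : ∀ i, q i = C (u i) * X 0 ^ 2 + C (v i) * (X 0 * X 1) + C (w i) * X 1 ^ 2)
    {h : Fin 2 → F} (hh : h ≠ 0) (hd : linForm h ∣ L.det)
    (hf : ∀ i, linForm h ∣ L.adjugate.mulVec q i) :
    ∃ ℓ : Fin 4 → F, ℓ ≠ 0 ∧ C (ℓ 0) * L.adjugate.mulVec q 0 + C (ℓ 1) * L.adjugate.mulVec q 1 =
      L.det * (C (ℓ 2) * X 0 + C (ℓ 3) * X 1) := by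
  have hLq : ∀ i j i', ∃ k, L i j * q i' = binaryCubic k := fun i j i' => by
    rw [hL, hq]
    exact exists_mul_eq_binaryCubic _ _ _ _ _
  have hLL : ∀ i j i' j' (l : Fin 2), ∃ k, L i j * (L i' j' * X l) = binaryCubic k := by
    intro i j i' j' l
    rw [hL, hL i']
    fin_cases l
    · obtain ⟨k, hk⟩ := exists_mul_eq_binaryCubic (α i j) (β i j) (α i' j') (β i' j') 0
      exact ⟨k, by simp only [← hk, C_0, Fin.zero_eta, Fin.mk_one]; ring⟩
    · obtain ⟨k, hk⟩ := exists_mul_eq_binaryCubic (α i j) (β i j) 0 (α i' j') (β i' j')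
      exact ⟨k, by simp only [← hk, C_0, Fin.zero_eta, Fin.mk_one]; ring⟩
  have hfe : L.adjugate.mulVec q =
      ![L 1 1 * q 0 - L 0 1 * q 1, L 0 0 * q 1 - L 1 0 * q 0] := by
    rw [Matrix.adjugate_fin_two]
    ext i : 1
    fin_cases i <;> simp [Matrix.mulVec, dotProduct, Fin.sum_univ_two] <;> ring
  have hge : ∀ l, L.det * X l = L 0 0 * (L 1 1 * X l) - L 0 1 * (L 1 0 * X l) := fun l => by
    rw [Matrix.det_fin_two]
    ring
  have key : ∀ i : Fin 4, ∃ k, (![L.adjugate.mulVec q 0, L.adjugate.mulVec q 1, L.det * X 0,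
      L.det * X 1] : Fin 4 → MvPolynomial (Fin 2) F) i = binaryCubic k := by
    rw [hge, hge, hfe]
    intro i
    fin_cases i
    exacts [exists_sub_eq_binaryCubic (hLq ..) (hLq ..), exists_sub_eq_binaryCubic (hLq ..) (hLq ..),
      exists_sub_eq_binaryCubic (hLL ..) (hLL ..), exists_sub_eq_binaryCubic (hLL ..) (hLL ..)]
  choose k hk using key
  obtain ⟨ℓ, hℓ, hr⟩ := exists_relation_of_common_zero (k := k) hk hh (fun i => by
    fin_cases i
    exacts [hf 0, hf 1, hd.mul_right _, hd.mul_right _])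
  refine ⟨![ℓ 0, ℓ 1, -ℓ 2, -ℓ 3], fun h0 => hℓ ?_, ?_⟩
  · have e0 := congrFun h0 0
    have e1 := congrFun h0 1
    have e2 := congrFun h0 2
    have e3 := congrFun h0 3
    simp at e0 e1 e2 e3
    ext i
    fin_cases i <;> assumption
  · simp [Fin.sum_univ_succ] at hr ⊢
    linear_combination hr

end

namespace QuadricPair

variable {R : Type*} [CommRing R] [IsDomain R] [IsDiscreteValuationRing R] {π : R}

local notation "κ" => IsLocalRing.ResidueField R
local notation "red" => algebraMap R (IsLocalRing.ResidueField R)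

/-- The coefficients `a_{i, j + 1, 3}`. -/
def coeffThree (Ψ : QuadricPair R) : Matrix (Fin 2) (Fin 2) R :=
  Matrix.of fun i => ![(Ψ.Q i).c13, (Ψ.Q i).c23]

/-- The coefficients `a_{i, j + 1, 4}`. -/
def coeffFour (Ψ : QuadricPair R) : Matrix (Fin 2) (Fin 2) R :=
  Matrix.of fun i => ![(Ψ.Q i).c14, (Ψ.Q i).c24]

theorem lineMatrix_apply (Ψ : QuadricPair R) (i j : Fin 2) :
    Ψ.lineMatrix (X 0 : MvPolynomial (Fin 2) κ) (X 1) i j =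
      C (red (Ψ.coeffThree i j)) * X 0 + C (red (Ψ.coeffFour i j)) * X 1 := by
  fin_cases i <;> fin_cases j <;>
    simp [lineMatrix, coeffThree, coeffFour, Algebra.smul_def, MvPolynomial.algebraMap_apply]

theorem form_line (q : Quadric R) :
    q.form (![0, 0, X 0, X 1] : Fin 4 → MvPolynomial (Fin 2) κ) =
      C (red q.c33) * X 0 ^ 2 + C (red q.c34) * (X 0 * X 1) + C (red q.c44) * X 1 ^ 2 := by
  simp [Quadric.form, Algebra.smul_def, MvPolynomial.algebraMap_apply]

/-- The relation that defines the plane in Step (v) of the subalgorithm for lines. -/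
theorem relation_iff (Ψ : QuadricPair R) (ℓ : Fin 4 → R) :
    -(ℓ 0 • Ψ.lineF 0) - ℓ 1 • Ψ.lineF 1 + ℓ 2 • (Ψ.lineG * X 0) + ℓ 3 • (Ψ.lineG * X 1) = 0 ↔
      C (red (ℓ 0)) * Ψ.lineF 0 + C (red (ℓ 1)) * Ψ.lineF 1 =
        Ψ.lineG * (C (red (ℓ 2)) * X 0 + C (red (ℓ 3)) * X 1) := by
  simp only [Algebra.smul_def, MvPolynomial.algebraMap_apply]
  constructor <;> intro h <;> linear_combination -h

/-- The alternatives in Step (v) of the subalgorithm for lines. -/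
theorem exists_relation (hπ : Irreducible π) (Ψ : QuadricPair R) {h : Fin 2 → κ} (hh : h ≠ 0)
    (hg : linForm h ∣ Ψ.lineG) (hf : ∀ i, linForm h ∣ Ψ.lineF i) :
    ∃ (ℓ : Fin 4 → R) (N : Matrix (Fin 4) (Fin 4) R),
      -(ℓ 0 • Ψ.lineF 0) - ℓ 1 • Ψ.lineF 1 + ℓ 2 • (Ψ.lineG * X 0) + ℓ 3 • (Ψ.lineG * X 1) = 0 ∧
      IsUnit N.det ∧ N.mulVec ℓ = ![1, 0, 0, 0] := by
  obtain ⟨ℓ, hℓ, hr⟩ := exists_conic_relation (lineMatrix_apply Ψ) (fun i => form_line (Ψ.Q i))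
    hh hg hf
  obtain ⟨m, hm⟩ := exists_lift ℓ
  obtain ⟨i, hi⟩ := Function.ne_iff.mp hℓ
  have hu : IsUnit (m i) := by
    rw [← not_dvd_iff_isUnit hπ, ← residue_eq_zero_iff hπ, hm]
    exact hi
  obtain ⟨N, hN, e⟩ := exists_mulVec_eq_single hu 0
  refine ⟨m, N, ?_, hN, ?_⟩
  · rw [relation_iff, hm, hm, hm, hm]
    exact hr
  · rw [e]
    ext j
    fin_cases j <;> simp

/-- This makes the first division of the conic subalgorithm possible. Modulo π the equations are L
(x₁, x₂) + q, so `dependent_or_divides` applies; its second alternative would have been caught by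
Step (iv). -/
theorem dependentOnPlane_of_relation (hπ : Irreducible π) {Ψ : QuadricPair R}
    (hΨ : ∀ i, π ∣ (Ψ.Q i).c11 ∧ π ∣ (Ψ.Q i).c12 ∧ π ∣ (Ψ.Q i).c22) (hg : Ψ.lineG ≠ 0)
    (hnd : ¬ ∃ a b, Ψ.Divides a b) {h : Fin 2 → κ} (hh : h ≠ 0) (hhg : linForm h ∣ Ψ.lineG)
    {ℓ : Fin 4 → R} {N : Matrix (Fin 4) (Fin 4) R}
    (hr : -(ℓ 0 • Ψ.lineF 0) - ℓ 1 • Ψ.lineF 1 + ℓ 2 • (Ψ.lineG * X 0)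
      + ℓ 3 • (Ψ.lineG * X 1) = 0) (hNℓ : N.mulVec ℓ = ![1, 0, 0, 0]) :
    DependentOnPlane π (Ψ.subst N) := by
  have hℓ : (fun i => red (ℓ i)) ≠ 0 := by
    intro h0
    have := congrArg red (congrFun hNℓ 0)
    simp only [Matrix.mulVec, dotProduct, map_sum, map_mul, Matrix.cons_val_zero, map_one] at this
    rw [Finset.sum_eq_zero fun i _ => ?_] at this
    · exact zero_ne_one this
    · rw [show red (ℓ i) = 0 from congrFun h0 i, mul_zero]
  rw [relation_iff] at hr
  rcases dependent_or_divides (lineMatrix_apply Ψ) (fun i => form_line (Ψ.Q i)) hg hh hhg hℓ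
    (by rw [Fin.sum_univ_two]; exact hr) with ⟨c, r, hc, h1, h2⟩ | ⟨a, b, hab⟩
  · obtain ⟨d, hd⟩ := exists_lift c
    refine ⟨d, fun h0 => hc (funext fun i => ?_), fun x hx => ?_⟩
    · rw [← hd i, (residue_eq_zero_iff hπ).2 (h0 i)]
      rfl
    · rw [val_subst]
      set y := Matrix.vecMul x N with hy
      have hyℓ : y ⬝ᵥ ℓ = x 0 := by
        rw [hy, ← Matrix.dotProduct_mulVec, hNℓ]
        simp [dotProduct, Fin.sum_univ_succ]
      rw [← residue_eq_zero_iff hπ] at hx ⊢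
      rw [← hyℓ] at hx
      have e1 := fun j => congrArg (eval ![red (y 2), red (y 3)]) (h1 j)
      have e2 := congrArg (eval ![red (y 2), red (y 3)]) h2
      have e10 := e1 0
      have e11 := e1 1
      simp only [lineMatrix_apply, Fin.sum_univ_two, coeffThree, coeffFour, Matrix.of_apply,
        map_add, map_mul, eval_C, eval_X, Matrix.cons_val_zero, Matrix.cons_val_one] at e10 e11
      simp only [form_line, Fin.sum_univ_two, map_add, map_mul, map_pow, eval_C, eval_X,
        Matrix.cons_val_zero, Matrix.cons_val_one] at e2
      have h0 : Fin.castLE (by omega : 2 ≤ 4) 0 = 0 := rfl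
      have h1 : Fin.castLE (by omega : 2 ≤ 4) 1 = 1 := rfl
      rw [h0] at e10
      rw [h1] at e11
      have z : ∀ i, red (Ψ.Q i).c11 = 0 ∧ red (Ψ.Q i).c12 = 0 ∧ red (Ψ.Q i).c22 = 0 := fun i => by
        simpa only [residue_eq_zero_iff hπ] using hΨ i
      simp only [dotProduct, Fin.sum_univ_succ, Finset.univ_unique, Fin.default_eq_zero,
        Finset.sum_singleton, Finset.univ_eq_empty, Finset.sum_empty, add_zero, map_add,
        map_mul] at hx
      simp only [dotProduct, val, Quadric.form, smul_eq_mul, Fin.sum_univ_two, map_add, map_mul,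
        map_pow, hd _, z]
      change red (y 0) * red (ℓ 0) + (red (y 1) * red (ℓ 1) + (red (y 2) * red (ℓ 2) +
        red (y 3) * red (ℓ 3))) = 0 at hx
      linear_combination red (y 0) * e10 + red (y 1) * e11 + e2 +
        eval ![red (y 2), red (y 3)] r * hx
  · obtain ⟨a', ha⟩ := exists_lift a
    obtain ⟨b', hb⟩ := exists_lift b
    refine absurd ⟨a', b', fun i => ?_⟩ hnd
    simp only [Algebra.smul_def, MvPolynomial.algebraMap_apply, ha _, hb _]
    exact hab i

/-- The recursive calls of the subalgorithm for lines. -/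
theorem calls_line (hπ : Irreducible π) {Φ : QuadricPair R} {t : Task R} (hΦ : Φ.lineG ≠ 0)
    (h : Calls (tamagawaDistances π) (.line Φ) t) :
    ∃ Ψ : QuadricPair R, Φ.subst (Matrix.diagonal ![π, π, 1, 1]) = Ψ.comb (π • 1) ∧
      ((∃ a b, Ψ.Divides a b ∧ t = .line (Ψ.subst (Quadric.shearLine (-a) (-b)))) ∨
        ∃ N : Matrix (Fin 4) (Fin 4) R, IsUnit N.det ∧ DependentOnPlane π (Ψ.subst N) ∧
          t = .conic (Ψ.subst N)) := by
  obtain ⟨calls, ⟨Ψ, h1, h2⟩, ht⟩ := h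
  have hs : Φ.subst (Matrix.diagonal ![π, π, 1, 1]) = Ψ.comb (π • 1) := by
    have hd : (π • 1 : Matrix (Fin 2) (Fin 2) R) = Matrix.diagonal ![π, π] := by
      ext i j
      fin_cases i <;> fin_cases j <;> simp
    simp only [Quadric.form_scale_two, Quadric.C_mul_form_eq_iff] at h1
    rw [hd, comb_diagonal_iff, subst_Q, subst_Q]
    exact ⟨h1 0, h1 1⟩
  refine ⟨Ψ, hs, ?_⟩
  have hc := coeffs_of_scale hπ hs
  have hg : Ψ.lineG ≠ 0 := by
    rw [lineG_congr hπ (Ψ := Φ)]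
    · exact hΦ
    all_goals simp [hc]
  rcases h2 with ⟨a, b, Ψ₁, hab, h3, rfl⟩ | ⟨hnd, ⟨h, hh, hhg, -⟩, ℓ, N, Ψ₁, hr, hN, hNℓ, h4, rfl⟩ |
    ⟨-, -, rfl⟩
  · left
    refine ⟨a, b, hab, ?_⟩
    have : Ψ₁ = Ψ.subst (Quadric.shearLine (-a) (-b)) := by
      apply ext_of_val
      intro x
      ext i
      rw [val, val, subst_Q]
      refine Quadric.form_eq_of_form_X (F := R) ?_ x
      rw [h3, Quadric.form_shearLine]
    rw [← this]
    simpa using ht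
  · right
    rw [isTransform_one_left] at h4
    refine ⟨N, hN, dependentOnPlane_of_relation hπ (fun i => ?_) hg hnd hh hhg hr hNℓ, ?_⟩
    · obtain ⟨h11, h12, h22, -⟩ := hc i
      exact ⟨⟨_, h11⟩, ⟨_, h12⟩, ⟨_, h22⟩⟩
    · rw [← h4]
      simpa using ht
  · simp at ht

theorem exists_calls_line (hπ : Irreducible π) {Φ : QuadricPair R} (h : ContainsLine π Φ) :
    ∃ calls, tamagawaDistances π (.line Φ) calls := by
  have hr : ∀ i, ∃ r : Quadric R, (Φ.Q i).subst (Matrix.diagonal ![π, π, 1, 1]) =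
      r.smul π := fun i => Quadric.exists_eq_smul fun x => by
      rw [Quadric.form_subst_diagonal]
      exact h.1 _ (by simp) (by simp) i
  choose r hr using hr
  let Ψ : QuadricPair R := ⟨r⟩
  have h1 : ∀ i, C π * (Ψ.Q i).form (X : Fin 4 → MvPolynomial (Fin 4) R) =
      (Φ.Q i).form ![C π * X 0, C π * X 1, X 2, X 3] := fun i => by
    rw [Quadric.form_scale_two, Quadric.C_mul_form_eq_iff, hr]
  by_cases hab : ∃ a b, Ψ.Divides a b
  · obtain ⟨a, b, hab⟩ := hab
    refine ⟨_, Ψ, h1, .inl ⟨a, b, Ψ.subst (Quadric.shearLine (-a) (-b)), hab, fun i => ?_, rfl⟩⟩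
    rw [Quadric.form_shearLine, subst_Q]
  · by_cases hf : ∃ h : Fin 2 → κ, h ≠ 0 ∧ linForm h ∣ Ψ.lineG ∧ ∀ i, linForm h ∣ Ψ.lineF i
    · obtain ⟨h, hh, hg, hf'⟩ := hf
      obtain ⟨ℓ, N, hr, hN, hNℓ⟩ := exists_relation hπ Ψ hh hg hf'
      exact ⟨_, Ψ, h1, .inr (.inl ⟨hab, ⟨h, hh, hg, hf'⟩, ℓ, N, Ψ.subst N, hr, hN, hNℓ,
        isTransform_one_left.2 rfl, rfl⟩)⟩
    · exact ⟨_, Ψ, h1, .inr (.inr ⟨hab, hf, rfl⟩)⟩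

end QuadricPair

end GenusOne

/-! ### Degree 4: the choice of coordinates in which a line is x₁ = x₂ = 0. -/

namespace GenusOne

/-- If the rows `i ∈ {2, 3}` of two invertible matrices span the same line modulo `π`, then the
quotient of these matrices is block triangular modulo `π`. -/
theorem dvd_mul_inv_of_mem {R : Type*} [CommRing R] [IsDomain R] [IsDiscreteValuationRing R]
    {π : R} (hπ : Irreducible π)
    {W : Submodule (IsLocalRing.ResidueField R) (Fin 4 → IsLocalRing.ResidueField R)}
    (hW : Module.finrank (IsLocalRing.ResidueField R) W = 2) {N₀ N : Matrix (Fin 4) (Fin 4) R}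
    (hN₀ : IsUnit N₀.det) (h₀2 : (fun j => algebraMap R _ (N₀ 2 j)) ∈ W)
    (h₀3 : (fun j => algebraMap R _ (N₀ 3 j)) ∈ W) {i : Fin 4}
    (hi : (fun j => algebraMap R _ (N i j)) ∈ W) :
    π ∣ (N * N₀⁻¹) i 0 ∧ π ∣ (N * N₀⁻¹) i 1 := by
  have hdet : (N₀.map (algebraMap R (IsLocalRing.ResidueField R))).det ≠ 0 := by
    rw [← RingHom.mapMatrix_apply, ← RingHom.map_det]
    exact (hN₀.map _).ne_zero
  have hli : LinearIndependent (IsLocalRing.ResidueField R)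
      ![fun j => algebraMap R (IsLocalRing.ResidueField R) (N₀ 2 j),
        fun j => algebraMap R (IsLocalRing.ResidueField R) (N₀ 3 j)] := by
    have := (Matrix.linearIndependent_rows_of_det_ne_zero hdet).comp ![2, 3] (by decide)
    have e : ![fun j => algebraMap R (IsLocalRing.ResidueField R) (N₀ 2 j),
        fun j => algebraMap R (IsLocalRing.ResidueField R) (N₀ 3 j)] =
        (N₀.map (algebraMap R (IsLocalRing.ResidueField R))).row ∘ ![2, 3] := by
      ext k : 1
      fin_cases k <;> rfl
    rw [e]
    exact this
  have hspan : Submodule.span (IsLocalRing.ResidueField R) (Set.range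
      ![fun j => algebraMap R (IsLocalRing.ResidueField R) (N₀ 2 j),
        fun j => algebraMap R (IsLocalRing.ResidueField R) (N₀ 3 j)]) = W := by
    refine Submodule.eq_of_le_of_finrank_eq ?_ ?_
    · rw [Submodule.span_le]
      rintro _ ⟨k, rfl⟩
      fin_cases k
      exacts [h₀2, h₀3]
    · rw [finrank_span_eq_card hli, hW]
      rfl
  rw [← hspan, Matrix.range_cons_cons_empty, Submodule.mem_span_pair] at hi
  obtain ⟨a, b, hab⟩ := hi
  obtain ⟨a, rfl⟩ := IsLocalRing.residue_surjective a
  obtain ⟨b, rfl⟩ := IsLocalRing.residue_surjective b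
  have hd : ∀ j, π ∣ N i j - (a * N₀ 2 j + b * N₀ 3 j) := fun j => by
    rw [← residue_eq_zero_iff hπ, map_sub, map_add, map_mul, map_mul, sub_eq_zero]
    exact (congrFun hab j).symm
  choose d hd using hd
  have e : ∀ j, (N * N₀⁻¹) i j =
      a * (1 : Matrix (Fin 4) (Fin 4) R) 2 j + b * (1 : Matrix (Fin 4) (Fin 4) R) 3 j +
        π * ∑ k, d k * N₀⁻¹ k j := by
    intro j
    rw [← Matrix.mul_nonsing_inv _ hN₀]
    simp only [Matrix.mul_apply, Finset.mul_sum]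
    rw [← Finset.sum_add_distrib, ← Finset.sum_add_distrib]
    refine Finset.sum_congr rfl fun k _ => ?_
    linear_combination N₀⁻¹ k j * hd k
  rw [e, e]
  exact ⟨⟨∑ k, d k * N₀⁻¹ k 0, by simp⟩, ⟨∑ k, d k * N₀⁻¹ k 1, by simp⟩⟩

namespace QuadricPair

variable {R : Type*} [CommRing R] [IsDomain R] [IsDiscreteValuationRing R] {π : R}

local notation "κ" => IsLocalRing.ResidueField R
local notation "red" => algebraMap R (IsLocalRing.ResidueField R)

theorem containsLine_coeff (hπ : Irreducible π) {Φ : QuadricPair R}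
    (h : ∀ x : Fin 4 → R, π ∣ x 0 → π ∣ x 1 → ∀ i, π ∣ Φ.val x i) (i : Fin 2) :
    red (Φ.Q i).c33 = 0 ∧ red (Φ.Q i).c34 = 0 ∧ red (Φ.Q i).c44 = 0 := by
  simp only [residue_eq_zero_iff hπ]
  have h3 : π ∣ (Φ.Q i).c33 := by
    simpa [val, Quadric.form] using h ![0, 0, 1, 0] (dvd_zero _) (dvd_zero _) i
  have h4 : π ∣ (Φ.Q i).c44 := by
    simpa [val, Quadric.form] using h ![0, 0, 0, 1] (dvd_zero _) (dvd_zero _) i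
  have := h ![0, 0, 1, 1] (dvd_zero _) (dvd_zero _) i
  simp [val, Quadric.form] at this
  rw [dvd_add_left h4, dvd_add_right h3] at this
  exact ⟨h3, this, h4⟩

/-- A transformation that preserves the line acts on L by a substitution in s, t and a constant 2×2
block on the right. So g becomes its image under the substitution times the determinant of the
block. -/
theorem lineG_subst_eq_zero (hπ : Irreducible π) {Φ : QuadricPair R}
    (h : ∀ x : Fin 4 → R, π ∣ x 0 → π ∣ x 1 → ∀ i, π ∣ Φ.val x i)
    {T : Matrix (Fin 4) (Fin 4) R} (h2 : π ∣ T 2 0 ∧ π ∣ T 2 1) (h3 : π ∣ T 3 0 ∧ π ∣ T 3 1)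
    (hg : Φ.lineG = 0) : (Φ.subst T).lineG = 0 := by
  simp only [← residue_eq_zero_iff hπ] at h2 h3
  let y : Fin 2 → MvPolynomial (Fin 2) κ := ![C (red (T 2 2)) * X 0 + C (red (T 3 2)) * X 1,
    C (red (T 2 3)) * X 0 + C (red (T 3 3)) * X 1]
  obtain ⟨φ, hφ⟩ : ∃ φ : MvPolynomial (Fin 2) κ →ₐ[κ] MvPolynomial (Fin 2) κ,
      ∀ j, φ (X j) = y j := ⟨aeval y, by simp⟩
  have hφC : ∀ c : κ, φ (C c) = C c := fun c => φ.commutes c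
  have h0 : Fin.castLE (by omega : 2 ≤ 4) 0 = 0 := rfl
  have h1 : Fin.castLE (by omega : 2 ≤ 4) 1 = 1 := rfl
  have key : ∀ i j : Fin 2, (Φ.subst T).lineMatrix (X 0 : MvPolynomial (Fin 2) κ) (X 1) i j =
      φ (Φ.lineMatrix (X 0) (X 1) i 0) * C (red (T (Fin.castLE (by omega) j) 0)) +
      φ (Φ.lineMatrix (X 0) (X 1) i 1) * C (red (T (Fin.castLE (by omega) j) 1)) := by
    intro i j
    obtain ⟨z1, z2, z3⟩ := containsLine_coeff hπ h i
    simp only [lineMatrix_apply, coeffThree, coeffFour, Matrix.of_apply, subst_Q, Quadric.subst,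
      Quadric.polar, map_add, map_mul, hφ, hφC, y]
    fin_cases j <;> simp only [h2, h3, z1, z2, z3, h0, h1, Fin.zero_eta, Fin.mk_one,
      Matrix.cons_val_zero, Matrix.cons_val_one, map_add, map_mul, map_zero, mul_zero, zero_mul,
      add_zero, zero_add] <;> ring
  have hdet : (Φ.subst T).lineG =
      φ Φ.lineG * (C (red (T 0 0 * T 1 1 - T 0 1 * T 1 0))) := by
    simp only [lineG, Matrix.det_fin_two, key, map_sub, map_mul]
    rw [h0, h1]
    ring
  rw [hdet, hg, map_zero, zero_mul]

theorem ContainsLine.subst (hπ : Irreducible π) {Φ : QuadricPair R} (h : ContainsLine π Φ)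
    {T S : Matrix (Fin 4) (Fin 4) R} (hST : S * T = 1) (h2 : π ∣ T 2 0 ∧ π ∣ T 2 1)
    (h3 : π ∣ T 3 0 ∧ π ∣ T 3 1) (h2' : π ∣ S 2 0 ∧ π ∣ S 2 1) (h3' : π ∣ S 3 0 ∧ π ∣ S 3 1) :
    ContainsLine π (Φ.subst T) := by
  have h1 : ∀ x : Fin 4 → R, π ∣ x 0 → π ∣ x 1 → ∀ i, π ∣ (Φ.subst T).val x i := by
    intro x h0 h1 i
    rw [val_subst]
    refine h.1 _ ?_ ?_ i <;> rw [Quadric.vecMul_four]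
    · exact dvd_add (dvd_add (dvd_add (h0.mul_left _) (h1.mul_left _)) (h2.1.mul_right _))
        (h3.1.mul_right _)
    · exact dvd_add (dvd_add (dvd_add (h0.mul_left _) (h1.mul_left _)) (h2.2.mul_right _))
        (h3.2.mul_right _)
  refine ⟨h1, fun hg => h.2 ?_⟩
  -- Applied to the inverse transformation S, since the previous lemma transports only the vanishing
  -- of g.
  have := lineG_subst_eq_zero hπ h1 h2' h3' hg
  rwa [subst_subst, hST, subst_one] at this

end QuadricPair

end GenusOne

/-! ### Degree 4: termination of the Tamagawa distance algorithm and its subalgorithms. -/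

namespace GenusOne

namespace QuadricPair

variable {R : Type*} [CommRing R] [IsDomain R] [IsDiscreteValuationRing R] {π : R}

local notation "κ" => IsLocalRing.ResidueField R
local notation "red" => algebraMap R (IsLocalRing.ResidueField R)

/-- At a point of the line the derivatives along the line vanish and the other two form the matrix
L. So g = 0 would make the gradients dependent at every point of the line, against the existence of
a smooth one. -/
theorem containsLine_of_hasLine (hπ : Irreducible π) {Φ : QuadricPair R} (h : Φ.HasLine) :
    ContainsLine π Φ := by
  obtain ⟨h1, p, hp0, hp1, hp⟩ := h
  have hline : ∀ x : Fin 4 → R, π ∣ x 0 → π ∣ x 1 → ∀ i, π ∣ Φ.val x i := by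
    intro x h0 h0' i
    rw [← residue_eq_zero_iff hπ] at h0 h0' ⊢
    have key : ∀ r : R, algebraMap R (AlgebraicClosure κ) r =
        algebraMap κ (AlgebraicClosure κ) (red r) := fun r =>
      IsScalarTower.algebraMap_apply R κ (AlgebraicClosure κ) r
    have := h1 (fun j => algebraMap R (AlgebraicClosure κ) (x j)) (by rw [key, h0, map_zero])
      (by rw [key, h0', map_zero]) i
    rw [Quadric.form_algebraMap, key] at this
    exact (map_eq_zero _).1 this
  refine ⟨hline, fun hg => ?_⟩
  obtain ⟨hv, hc⟩ := isSmoothAt_iff.1 hp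
  have key : ∀ r : R, algebraMap R (AlgebraicClosure κ) r =
      algebraMap κ (AlgebraicClosure κ) (red r) := fun r =>
    IsScalarTower.algebraMap_apply R κ (AlgebraicClosure κ) r
  let L : Matrix (Fin 2) (Fin 2) (AlgebraicClosure κ) := Matrix.of fun i j =>
    aeval ![p 2, p 3] (Φ.lineMatrix (X 0 : MvPolynomial (Fin 2) κ) (X 1) i j)
  have hL : L.det = 0 := by
    have : L = (aeval ![p 2, p 3] : MvPolynomial (Fin 2) κ →ₐ[κ] AlgebraicClosure κ).mapMatrix
        (Φ.lineMatrix (X 0 : MvPolynomial (Fin 2) κ) (X 1)) := rfl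
    rw [this, ← AlgHom.map_det]
    change aeval _ Φ.lineG = 0
    rw [hg, map_zero]
  obtain ⟨c, hc0, hcL⟩ := Matrix.exists_vecMul_eq_zero_iff.2 hL
  refine hc0 (hc c fun k => ?_)
  have e0 := congrFun hcL 0
  have e1 := congrFun hcL 1
  have z : ∀ i, algebraMap R (AlgebraicClosure κ) (Φ.Q i).c33 = 0 ∧
      algebraMap R (AlgebraicClosure κ) (Φ.Q i).c34 = 0 ∧
      algebraMap R (AlgebraicClosure κ) (Φ.Q i).c44 = 0 := fun i => by
    obtain ⟨z1, z2, z3⟩ := containsLine_coeff hπ hline i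
    simp only [key, z1, z2, z3, map_zero, and_self]
  have hk : ∀ (j : Fin 2) (a b : R), aeval ![p 2, p 3] (C (red a) * X 0 + C (red b) * X 1 :
      MvPolynomial (Fin 2) κ) = algebraMap R (AlgebraicClosure κ) a * p 2 +
        algebraMap R (AlgebraicClosure κ) b * p 3 := fun j a b => by
    rw [key, key]
    simp
  simp only [L, Matrix.vecMul, dotProduct, Fin.sum_univ_two, Matrix.of_apply, lineMatrix_apply,
    hk 0, coeffThree, coeffFour, Matrix.cons_val_zero, Matrix.cons_val_one,
    Pi.zero_apply] at e0 e1
  simp only [dotProduct, jac, Fin.sum_univ_two, Quadric.grad_poly, baseChange_Q,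
    Quadric.baseChange, hp0, hp1, z, mul_zero, zero_mul, add_zero, zero_add]
  fin_cases k
  · exact e0
  · exact e1
  · simp
  · simp

theorem containsLine_of_mem (hπ : Irreducible π) {Φ : QuadricPair R} {affine : Bool}
    {W : Submodule κ (Fin 4 → κ)} (hW : W ∈ Φ.lineComponents affine)
    {N : Matrix (Fin 4) (Fin 4) R} (hN : IsUnit N.det) (h2 : (fun j => red (N 2 j)) ∈ W)
    (h3 : (fun j => red (N 3 j)) ∈ W) : ContainsLine π (Φ.subst N) := by
  obtain ⟨hr, -, N₀, Φ', hN₀, hΦ', h₀2, h₀3, hl⟩ := hW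
  rw [isTransform_one_left] at hΦ'
  have hc := containsLine_of_hasLine hπ hl
  rw [hΦ'] at hc
  have e : Φ.subst N = (Φ.subst N₀).subst (N * N₀⁻¹) := by
    rw [subst_subst, Matrix.mul_assoc, Matrix.nonsing_inv_mul _ hN₀, Matrix.mul_one]
  rw [e]
  refine hc.subst hπ (S := N₀ * N⁻¹) ?_ (dvd_mul_inv_of_mem hπ hr hN₀ h₀2 h₀3 h2)
    (dvd_mul_inv_of_mem hπ hr hN₀ h₀2 h₀3 h3) (dvd_mul_inv_of_mem hπ hr hN h2 h3 h₀2)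
    (dvd_mul_inv_of_mem hπ hr hN h2 h3 h₀3)
  rw [Matrix.mul_assoc, ← Matrix.mul_assoc N⁻¹, Matrix.nonsing_inv_mul _ hN, Matrix.one_mul,
    Matrix.mul_nonsing_inv _ hN₀]

theorem dependentOnPlane_of_mem (hπ : Irreducible π) {Φ : QuadricPair R} {affine : Bool}
    {ℓ : Fin 4 → κ} (hℓ : ℓ ∈ Φ.conicComponents affine) {N : Matrix (Fin 4) (Fin 4) R}
    (h : ∀ i, i ≠ 0 → ∑ j, red (N i j) * ℓ j = 0) : DependentOnPlane π (Φ.subst N) := by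
  obtain ⟨hn, -, N₀, Φ', hN₀, hΦ', h₀, hc⟩ := hℓ
  rw [isTransform_one_left] at hΦ'
  refine .of_subst hπ hN₀ ?_ h₀ h (hΦ' ▸ dependentOnPlane_of_hasConic hπ hc)
  obtain ⟨i, hi, -⟩ := hn
  exact fun h0 => one_ne_zero (hi.symm.trans (congrFun h0 i))

variable [CharZero R]

theorem disc_of_line (hπ : Irreducible π) {Φ Ψ : QuadricPair R}
    (h : Φ.subst (Matrix.diagonal ![π, π, 1, 1]) = Ψ.comb (π • 1))
    {N : Matrix (Fin 4) (Fin 4) R} (hN : IsUnit N.det) (hΦ : Φ.disc ≠ 0) :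
    (Ψ.subst N).disc ≠ 0 := by
  intro h0
  rw [disc_subst, mul_eq_zero_iff_left (pow_ne_zero _ hN.ne_zero)] at h0
  have := congrArg disc h
  rw [disc_subst, disc_comb, h0, mul_zero, Matrix.det_diagonal, Fin.prod_univ_four] at this
  refine mul_ne_zero (pow_ne_zero _ ?_) hΦ this
  simpa using hπ.ne_zero

variable (π) in
/-- The least `m` for which the pair contains no line modulo `π ^ m`. -/
noncomputable def lineLevel (Φ : QuadricPair R) : ℕ := sInf {e | ¬ LineMod π e Φ}

theorem lineLevel_lt (hπ : Irreducible π) {Φ Ψ : QuadricPair R} (hΦ : Φ.disc ≠ 0)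
    (h : ∀ m, LineMod π m Ψ → LineMod π (m + 1) Φ) : Ψ.lineLevel π < Φ.lineLevel π := by
  refine sInf_lt_sInf_of_imp ⟨natVal Φ.disc + 1, fun hc => ?_⟩ (lineMod_zero π Φ) h
  have := le_natVal_of_pow_dvd hπ hΦ (pow_dvd_disc_of_lineMod hc)
  omega

/-- Returning to a line lowers `lineLevel`; once Step (v) passes to a conic, the subalgorithm never
comes back to lines. -/
theorem acc_line (hπ : Irreducible π) {Φ : QuadricPair R} (hΦ : Φ.disc ≠ 0)
    (hg : ContainsLine π Φ) : Acc (fun t s => Calls (tamagawaDistances π) s t) (.line Φ) := by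
  induction hn : Φ.lineLevel π using Nat.strong_induction_on generalizing Φ with
  | _ n ih =>
    refine ⟨_, fun t ht => ?_⟩
    obtain ⟨Ψ, h, ⟨a, b, hab, rfl⟩ | ⟨N, hN, -, rfl⟩⟩ := calls_line hπ hg.2 ht
    · refine ih _ (hn ▸ lineLevel_lt hπ hΦ fun m hm => hm.step h)
        (disc_of_line hπ h ?_ hΦ) (containsLine_step hπ hg.2 h hab) rfl
      rw [Quadric.det_shearLine]
      exact isUnit_one
    · exact acc_conic hπ (disc_of_line hπ h hN hΦ)

/-- The states that are reached by the procedure from models with nonzero discriminant. -/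
def Task.Admissible (π : R) : Task R → Prop
  | .distances Φ _ => Φ.disc ≠ 0
  | .line Φ => Φ.disc ≠ 0 ∧ ContainsLine π Φ
  | .conic Φ => Φ.disc ≠ 0 ∧ DependentOnPlane π Φ

theorem disc_subst_ne_zero {Φ : QuadricPair R} (hΦ : Φ.disc ≠ 0) {N : Matrix (Fin 4) (Fin 4) R}
    (hN : IsUnit N.det) : (Φ.subst N).disc ≠ 0 := by
  rw [disc_subst]
  exact mul_ne_zero (pow_ne_zero _ hN.ne_zero) hΦ

theorem Task.Admissible.of_calls (hπ : Irreducible π) {s t : Task R} (hs : s.Admissible π)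
    (ht : Calls (tamagawaDistances π) s t) : t.Admissible π := by
  rcases s with ⟨Φ, affine⟩ | Φ | Φ
  · obtain ⟨W, hW, N, hN, h2, h3, rfl⟩ | ⟨ℓ, hℓ, N, hN, hNℓ, rfl⟩ |
      ⟨p, hp, M, N, Φ₁, c, hM, hN, hNp, h, rfl⟩ := calls_distances ht
    · exact ⟨disc_subst_ne_zero hs hN, containsLine_of_mem hπ hW hN h2 h3⟩
    · exact ⟨disc_subst_ne_zero hs hN, dependentOnPlane_of_mem hπ hℓ hNℓ⟩
    · exact disc_of_distances hπ hM hN h hs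
  · obtain ⟨hΦ, hg⟩ := hs
    obtain ⟨Ψ, h, ⟨a, b, hab, rfl⟩ | ⟨N, hN, hd, rfl⟩⟩ := calls_line hπ hg.2 ht
    · refine ⟨disc_of_line hπ h ?_ hΦ, containsLine_step hπ hg.2 h hab⟩
      rw [Quadric.det_shearLine]
      exact isUnit_one
    · exact ⟨disc_of_line hπ h hN hΦ, hd⟩
  · obtain ⟨hΦ, -⟩ := hs
    obtain ⟨M, Ψ, a, b, hM, h, hab, rfl⟩ := calls_conic ht
    exact ⟨disc_of_conic hπ hM h hΦ, dependentOnPlane_step hπ h hab⟩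

theorem acc_distances (hπ : Irreducible π) {Φ : QuadricPair R} (hΦ : Φ.disc ≠ 0) :
    Acc (fun t s => Calls (tamagawaDistances π) s t) (.distances Φ true) := by
  induction hn : Φ.singLevel π using Nat.strong_induction_on generalizing Φ with
  | _ n ih =>
    refine ⟨_, fun t ht => ?_⟩
    have hadm := Task.Admissible.of_calls (s := .distances Φ true) hπ hΦ ht
    obtain ⟨W, hW, N, hN, h2, h3, rfl⟩ | ⟨ℓ, hℓ, N, hN, hNℓ, rfl⟩ |
      ⟨p, hp, M, N, Φ₁, c, hM, hN, hNp, h, rfl⟩ := calls_distances ht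
    · exact acc_line hπ hadm.1 hadm.2
    · exact acc_conic hπ hadm.1
    · refine ih _ (hn ▸ singLevel_lt hπ hΦ fun m hm => ?_) hadm rfl
      exact singMod_of_distances hπ (hp.2.1 rfl) hM hN hNp h hm

theorem exists_calls_distances [Finite κ] (hπ : Irreducible π) (Φ : QuadricPair R)
    (affine : Bool) : ∃ calls, tamagawaDistances π (.distances Φ affine) calls := by
  -- Subspaces are among the subsets of a finite set, so there are finitely many lines to loop over.
  have : Finite (Submodule κ (Fin 4 → κ)) := Finite.of_injective _ SetLike.coe_injective
  obtain ⟨c₁, h1⟩ := ForEach.exists (Set.toFinite (Φ.lineComponents affine))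
      (call := fun (W : Submodule κ (Fin 4 → κ)) (t : Task R) =>
        ∃ (N : Matrix (Fin 4) (Fin 4) R) (Φ' : QuadricPair R),
            IsUnit N.det ∧ IsTransform 1 N Φ Φ' ∧
            (fun j => red (N 2 j)) ∈ W ∧ (fun j => red (N 3 j)) ∈ W ∧ t = .line Φ') (by
    rintro W ⟨-, -, N, Φ', hN, hΦ', h2, h3, -⟩
    exact ⟨_, N, Φ', hN, hΦ', h2, h3, rfl⟩)
  obtain ⟨c₂, h2⟩ := ForEach.exists (Set.toFinite (Φ.conicComponents affine))
      (call := fun (ℓ : Fin 4 → κ) (t : Task R) =>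
        ∃ (N : Matrix (Fin 4) (Fin 4) R) (Φ' : QuadricPair R),
            IsUnit N.det ∧ IsTransform 1 N Φ Φ' ∧
            (∀ i, i ≠ 0 → ∑ j, red (N i j) * ℓ j = 0) ∧ t = .conic Φ') (by
    rintro ℓ ⟨-, -, N, Φ', hN, hΦ', h, -⟩
    exact ⟨_, N, Φ', hN, hΦ', h, rfl⟩)
  obtain ⟨c₃, h3⟩ := ForEach.exists (Set.toFinite (Φ.nonRegular π affine))
    fun p hp => exists_distances_call hπ hp
  exact ⟨_, c₁, c₂, c₃, rfl, h1, h2, h3⟩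

theorem halts_tamagawaDistances [Finite κ] (hπ : Irreducible π) {s : Task R}
    (hs : s.Admissible π) : Halts (tamagawaDistances π) s := by
  refine halts_of_acc (Task.Admissible π) ?_ (fun s t hs h => hs.of_calls hπ h) ?_ hs
  · rintro (⟨Φ, affine⟩ | Φ | Φ) hΦ
    · exact exists_calls_distances hπ Φ affine
    · exact exists_calls_line hπ hΦ.2
    · exact exists_calls_conic hπ hΦ.2
  · rcases s with ⟨Φ, affine⟩ | Φ | Φ
    · refine ⟨_, fun t ht => ?_⟩
      have hadm := hs.of_calls hπ ht
      obtain ⟨W, hW, N, hN, h2, h3, rfl⟩ | ⟨ℓ, hℓ, N, hN, hNℓ, rfl⟩ |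
        ⟨p, hp, M, N, Φ₁, c, hM, hN, hNp, h, rfl⟩ := calls_distances ht
      · exact acc_line hπ hadm.1 hadm.2
      · exact acc_conic hπ hadm.1
      · exact acc_distances hπ hadm
    · exact acc_line hπ hs.1 hs.2
    · exact acc_conic hπ hs.1

end QuadricPair

end GenusOne

/-! ### Conclusion over the ring of integers of a local field. -/

namespace GenusOne

/-- The ideal is the image of the compact ring under multiplication by π^m, hence compact, hence
closed in a Hausdorff space. This is the input for the compactness argument in degree 3. -/
theorem isClosed_setOf_pow_dvd {R : Type*} [CommRing R] [TopologicalSpace R] [IsTopologicalRing R]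
    [CompactSpace R] [T2Space R] (π : R) (m : ℕ) : IsClosed {x : R | π ^ m ∣ x} := by
  have e : {x : R | π ^ m ∣ x} = Set.range fun x : R => π ^ m * x := by
    ext x
    exact exists_congr fun _ => eq_comm
  rw [e]
  exact (isCompact_range (continuous_const.mul continuous_id)).isClosed

end GenusOne

open scoped ValuativeRel in
theorem mainTheorem12 (K : Type*) [Field K] [CharZero K] [ValuativeRel K] [TopologicalSpace K]
    [IsNonarchimedeanLocalField K] (π : 𝒪[K]) (hπ : Irreducible π) :
    -- models of degree 2
    (∀ Φ : GenusOne.Quartic 𝒪[K], Φ.Nonsingular K →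
      GenusOne.Halts (GenusOne.Quartic.isLocallySoluble π) (.normalise Φ) ∧
      GenusOne.NeverIncreases (GenusOne.Quartic.isLocallySoluble π)
        (fun Ψ => IsDiscreteValuationRing.addVal 𝒪[K] Ψ.disc) Φ ∧
      GenusOne.StableIterationsBounded (GenusOne.Quartic.isLocallySoluble π)
        (fun Ψ => IsDiscreteValuationRing.addVal 𝒪[K] Ψ.disc) Φ ∧
      ∀ affine : Bool, GenusOne.Halts (GenusOne.Quartic.tamagawaDistances π) (Φ, affine)) ∧
    -- models of degree 3
    (∀ U : GenusOne.Cubic 𝒪[K], U.Nonsingular K →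
      GenusOne.Halts (GenusOne.Cubic.isLocallySoluble π) (.normalise U) ∧
      GenusOne.NeverIncreases (GenusOne.Cubic.isLocallySoluble π)
        (fun V => IsDiscreteValuationRing.addVal 𝒪[K] V.disc) U ∧
      GenusOne.StableIterationsBounded (GenusOne.Cubic.isLocallySoluble π)
        (fun V => IsDiscreteValuationRing.addVal 𝒪[K] V.disc) U ∧
      (∀ affine : Bool,
        GenusOne.Halts (GenusOne.Cubic.tamagawaDistances π) (.distances U affine)) ∧
      (![1, 0, 0] ∈ U.lineComponents false →
        GenusOne.Halts (GenusOne.Cubic.tamagawaDistances π) (.line U))) ∧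
    -- models of degree 4
    (∀ Φ : GenusOne.QuadricPair 𝒪[K], Φ.Nonsingular K →
      GenusOne.Halts (GenusOne.QuadricPair.isLocallySoluble π) (.normalise Φ) ∧
      GenusOne.NeverIncreases (GenusOne.QuadricPair.isLocallySoluble π)
        (fun Ψ => IsDiscreteValuationRing.addVal 𝒪[K] Ψ.disc) Φ ∧
      GenusOne.StableIterationsBounded (GenusOne.QuadricPair.isLocallySoluble π)
        (fun Ψ => IsDiscreteValuationRing.addVal 𝒪[K] Ψ.disc) Φ ∧
      (∀ affine : Bool,
        GenusOne.Halts (GenusOne.QuadricPair.tamagawaDistances π) (.distances Φ affine)) ∧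
      (Φ.HasLine → GenusOne.Halts (GenusOne.QuadricPair.tamagawaDistances π) (.line Φ)) ∧
      (Φ.HasConic → GenusOne.Halts (GenusOne.QuadricPair.tamagawaDistances π) (.conic Φ))) := by
  -- The Hausdorff property is needed to see that the powers of the maximal ideal are closed.
  have : T2Space K := by
    let := IsTopologicalAddGroup.rightUniformSpace K
    have := isUniformAddGroup_of_addCommGroup (G := K)
    infer_instance
  have : T2Space 𝒪[K] := inferInstanceAs (T2Space ((ValuativeRel.valuation K).integer : Set K))
  have hcl := GenusOne.isClosed_setOf_pow_dvd π
  refine ⟨fun Φ h => ?_, fun U h => ?_, fun Φ h => ?_⟩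
  · have hΦ := GenusOne.Quartic.disc_ne_zero_of_nonsingular h
    exact ⟨GenusOne.Quartic.halts_isLocallySoluble hπ hΦ, GenusOne.Quartic.neverIncreases hπ Φ,
      GenusOne.Quartic.stableIterationsBounded hπ Φ,
      GenusOne.Quartic.halts_tamagawaDistances hπ hΦ⟩
  · exact ⟨GenusOne.Cubic.halts_isLocallySoluble hcl hπ h, GenusOne.Cubic.neverIncreases hπ U,
      GenusOne.Cubic.stableIterationsBounded hπ U,
      fun affine => GenusOne.Cubic.halts_tamagawaDistances hcl hπ (s := .distances U affine) h,
      fun hl => GenusOne.Cubic.halts_tamagawaDistances hcl hπ (s := .line U)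
        ⟨h, GenusOne.Cubic.containsLine_of_mem hπ hl⟩⟩
  · have hΦ := GenusOne.QuadricPair.disc_ne_zero_of_nonsingular h
    exact ⟨GenusOne.QuadricPair.halts_isLocallySoluble hπ hΦ,
      GenusOne.QuadricPair.neverIncreases hπ Φ, GenusOne.QuadricPair.stableIterationsBounded hπ Φ,
      fun affine => GenusOne.QuadricPair.halts_tamagawaDistances hπ (s := .distances Φ affine) hΦ,
      fun hl => GenusOne.QuadricPair.halts_tamagawaDistances hπ (s := .line Φ)
        ⟨hΦ, GenusOne.QuadricPair.containsLine_of_hasLine hπ hl⟩,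
      fun hc => GenusOne.QuadricPair.halts_tamagawaDistances hπ (s := .conic Φ)
        ⟨hΦ, GenusOne.QuadricPair.dependentOnPlane_of_hasConic hπ hc⟩⟩
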